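/- Let $n\ge 1$ be an integer and $\lambda>0$. Write $\mathbb R^{n+1}_+=\mathbb R^n\times(0,\infty)$, $x=(x',x_{n+1})$, and $dm_\lambda(x)=x_{n+1}^{2\lambda}\,dx$; all $L_2$-spaces are complex. **Riesz transforms.** $R_l=\partial_l\Delta^{-1/2}$, with $\Delta=-\sum_j\partial_j^2$, denotes the $l$-th classical Riesz transform on $L_2(\mathbb R^{n+1},dx)$. For $f\in C_c^\infty(\mathbb R_+^{n+1})$ put $$(\mathcal F\otimes U_\lambda)f(\xi)=(2\pi)^{-n/2}\int_{\mathbb R^{n+1}_+}f(y)\,e^{-i\langle y',\xi'\rangle}\,\phi_\lambda(y_{n+1}\xi_{n+1})\,dm_\lambda(y),\qquad \phi_\lambda(s)=s^{\frac12-\lambda}J_{\lambda-\frac12}(s),$$ where $J_\nu$ is the Bessel function of the first kind. This map extends to a unitary operator on $L_2(\mathbb R^{n+1}_+,m_\lambda)$. With $\Delta_\lambda=(\mathcal F\otimes U_\lambda)^{-1}M_{|\xi|^2}(\mathcal F\otimes U_\lambda)$, a self-adjoint extension of $-\sum_{j=1}^{n+1}\partial_j^2-\frac{2\lambda}{x_{n+1}}\partial_{n+1}$,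 the operator $\partial_k\Delta_\lambda^{-1/2}$ (distributional derivative in $\mathbb R^{n+1}_+$, defined on the domain of $\Delta_\lambda^{-1/2}$) extends to a bounded operator $R_{\lambda,k}$ on $L_2(\mathbb R^{n+1}_+,m_\lambda)$, for $1\le k\le n+1$: the $k$-th Bessel–Riesz transform. **Other operators.** $M_g$ is multiplication by $g$, $[A,B]=AB-BA$, and $E:L_2(\mathbb R^{n+1}_+,dx)\to L_2(\mathbb R^{n+1},dx)$ is extension by zero, with adjoint $E^*$ (restriction); $E^*f$ also denotes the restriction to $\mathbb R_+^{n+1}$ of a function $f$ on $\mathbb R^{n+1}$. For $f\in C_c^\infty(\mathbb R^{n+1})$ set $$T_l=M_{x_{n+1}^{-\lambda}}E^*[R_l,M_f]E\,M_{x_{n+1}^{\lambda}},\qquad 1\le l\le n+1,$$ a bounded operator on $L_2(\mathbb R_+^{n+1},m_\lambda)$, where $M_{x_{n+1}^{\lambda}}:L_2(\mathbb R^{n+1}_+,m_\lambda)\to L_2(\mathbb R^{n+1}_+,dx)$ and $M_{x_{n+1}^{-\lambda}}$ is its inverse. **Schur multipliers.** A bounded operator $T$ on $L_2(\mathbb R_+^{n+1},m_\lambda)$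 has integral kernel $K$ if $K$ is measurable and, for every $g$, $(Tg)(x)=\int K(x,y)g(y)\,dm_\lambda(y)$ for a.e. $x$, with absolute convergence. For a bounded function $M$ on $\mathbb R^{n+1}_+\times\mathbb R^{n+1}_+$, $\mathfrak S_M$ sends an operator $T$ with integral kernel $K$ to the bounded operator with integral kernel $M\cdot K$ (its domain consists of those $T$ for which both exist). **Symbols.** For $x,y\in\mathbb R^{n+1}_+$ let $$F_{k,l}(s)=s^{n+k}\int_0^2(s^2+2t)^{-\lambda-\frac n2-1}(2t-t^2)^{\lambda-1}t^l\,dt\quad(s>0),\qquad H(x,y)=\frac{|x-y|}{|x_{n+1}y_{n+1}|^{1/2}},$$ $$h_l(x,y)=\frac{(x-y)_l}{|x-y|},\qquad a(x,y)=\Big(\frac{\min\{x_{n+1},y_{n+1}\}}{\max\{x_{n+1},y_{n+1}\}}\Big)^{1/2},\qquad b(x,y)=\chi_{\{x_{n+1}<y_{n+1}\}}.$$ **Proposition.** There is a constant $\kappa=\kappa^{[3]}_{n,\lambda}\in\mathbb R$, depending only on $n$ and $\lambda$, such that for every $f\in C_c^\infty(\mathbb R^{n+1})$ and every $1\le k\le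 n+1$, $$[R_{\lambda,k},M_{E^*f}]=\kappa\,\mathfrak S_{F_{2,0}\circ H}(T_k)+\kappa\,\delta_{k,n+1}\sum_{l=1}^{n+1}\big(\mathfrak S_{h_l}\circ\mathfrak S_a\circ\mathfrak S_{F_{1,1}\circ H}\big)(T_l)-\kappa\,\delta_{k,n+1}\sum_{l=1}^{n+1}\big(\mathfrak S_{h_l}\circ\mathfrak S_{h_{n+1}}\circ\mathfrak S_b\circ\mathfrak S_{F_{2,1}\circ H}\big)(T_l),$$ where all the Schur multipliers occurring are applied to operators in their domains. -/

import Mathlib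

open MeasureTheory Set
open scoped ENNReal ContDiff Distributions

noncomputable section

namespace BesselRiesz

/-! ### Multiplication operators, integral operators and Schur multipliers on `L²` spaces -/

section General

variable {X : Type*} [MeasurableSpace X]

/-- The bounded operator `L²(μ) → L²(ν)` of pointwise multiplication by `g`
(by convention `0` if there is no such bounded operator). -/
def mulOp (μ ν : Measure X) (g : X → ℂ) : Lp ℂ 2 μ →L[ℂ] Lp ℂ 2 ν :=
  open Classical in
  if h : ∃ T : Lp ℂ 2 μ →L[ℂ] Lp ℂ 2 ν, ∀ f : Lp ℂ 2 μ, T f =ᵐ[ν] fun x => g x * f x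
  then h.choose else 0

/-- A criterion for `mulOp` to be the genuine multiplication operator. -/
theorem mulOp_apply_of_bound (μ ν : Measure X) (hν : ν ≪ μ) (g : X → ℂ)
    (hm : AEStronglyMeasurable g ν) (C : ℝ)
    (hb : ∀ f : Lp ℂ 2 μ, eLpNorm (fun x => g x * f x) 2 ν ≤ ENNReal.ofReal C * eLpNorm f 2 μ)
    (f : Lp ℂ 2 μ) : mulOp μ ν g f =ᵐ[ν] fun x => g x * f x := by
  have hmem : ∀ f : Lp ℂ 2 μ, MemLp (fun x => g x * f x) 2 ν := fun f =>
    ⟨hm.mul ((Lp.aestronglyMeasurable f).mono_ac hν),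
      (hb f).trans_lt (ENNReal.mul_lt_top ENNReal.ofReal_lt_top (Lp.memLp f).2)⟩
  have h : ∃ T : Lp ℂ 2 μ →L[ℂ] Lp ℂ 2 ν, ∀ f : Lp ℂ 2 μ, T f =ᵐ[ν] fun x => g x * f x := by
    let T₀ : Lp ℂ 2 μ →ₗ[ℂ] Lp ℂ 2 ν :=
      { toFun := fun f => (hmem f).toLp _
        map_add' := fun f₁ f₂ => by
          rw [← MemLp.toLp_add]
          refine MemLp.toLp_congr _ _ ?_
          filter_upwards [hν.ae_le (Lp.coeFn_add f₁ f₂)] with x hx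
          change g x * (f₁ + f₂ : Lp ℂ 2 μ) x = g x * f₁ x + g x * f₂ x
          rw [hx, Pi.add_apply, mul_add]
        map_smul' := fun c f₁ => by
          rw [RingHom.id_apply, ← MemLp.toLp_const_smul]
          refine MemLp.toLp_congr _ _ ?_
          filter_upwards [hν.ae_le (Lp.coeFn_smul c f₁)] with x hx
          change g x * (c • f₁ : Lp ℂ 2 μ) x = c • (g x * f₁ x)
          rw [hx, Pi.smul_apply, smul_eq_mul, smul_eq_mul, mul_left_comm] }
    refine ⟨T₀.mkContinuous (max C 0) fun f => ?_, fun f => (hmem f).coeFn_toLp⟩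
    change ‖(hmem f).toLp _‖ ≤ _
    rw [Lp.norm_toLp, Lp.norm_def]
    have h1 := ENNReal.toReal_mono
      (ENNReal.mul_ne_top ENNReal.ofReal_ne_top (Lp.memLp f).2.ne) (hb f)
    rwa [ENNReal.toReal_mul, ENNReal.toReal_ofReal'] at h1
  rw [mulOp, dif_pos h]
  exact h.choose_spec f

/-- Multiplication by a bounded measurable function. -/
theorem mulOp_apply_of_bounded (μ : Measure X) (g : X → ℂ) (hm : AEStronglyMeasurable g μ)
    (C : ℝ) (hC : ∀ x, ‖g x‖ ≤ C) (f : Lp ℂ 2 μ) :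
    mulOp μ μ g f =ᵐ[μ] fun x => g x * f x := by
  refine mulOp_apply_of_bound μ μ Measure.AbsolutelyContinuous.rfl g hm C (fun f => ?_) f
  refine eLpNorm_le_mul_eLpNorm_of_ae_le_mul (Filter.Eventually.of_forall fun x => ?_) 2
  rw [norm_mul]
  exact mul_le_mul_of_nonneg_right (hC x) (norm_nonneg _)

/-- The bounded operator `T` on `L²(μ)` is the integral operator with kernel `K`:
`(T g)(x) = ∫ K(x,y) g(y) dμ(y)`, the integral being absolutely convergent for almost every `x`.
For a Hilbert–Schmidt operator this is its kernel in `L²(μ × μ)`. -/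
def HasIntegralKernel (μ : Measure X) (T : Lp ℂ 2 μ →L[ℂ] Lp ℂ 2 μ) (K : X → X → ℂ) : Prop :=
  AEStronglyMeasurable (Function.uncurry K) (μ.prod μ) ∧
  ∀ g : Lp ℂ 2 μ, ∀ᵐ x ∂μ,
    Integrable (fun y => K x y * g y) μ ∧ T g x = ∫ y, K x y * g y ∂μ

/-- `S` is the Schur multiplier with symbol `M` applied to `T`: the symbol is bounded, `T` is an
integral operator with some kernel `K`, and `S` is the integral operator with kernel `M · K`. -/
def IsSchurProduct (μ : Measure X) (M : X → X → ℂ) (T S : Lp ℂ 2 μ →L[ℂ] Lp ℂ 2 μ) : Prop :=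
  (∃ C : ℝ, ∀ x y, ‖M x y‖ ≤ C) ∧
  ∃ K : X → X → ℂ, HasIntegralKernel μ T K ∧ HasIntegralKernel μ S fun x y => M x y * K x y

/-- `T` lies in the domain of the Schur multiplier with symbol `M`. -/
def InSchurDomain (μ : Measure X) (M : X → X → ℂ) (T : Lp ℂ 2 μ →L[ℂ] Lp ℂ 2 μ) : Prop :=
  ∃ S, IsSchurProduct μ M T S

/-- The Schur multiplier `𝔖_M`, sending the operator with kernel `K` to the operator with kernel
`M · K` (by convention `0` outside its domain). -/
def schur (μ : Measure X) (M : X → X → ℂ) (T : Lp ℂ 2 μ →L[ℂ] Lp ℂ 2 μ) :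
    Lp ℂ 2 μ →L[ℂ] Lp ℂ 2 μ :=
  open Classical in
  if h : InSchurDomain μ M T then h.choose else 0

/-- The commutator `[A, B] = AB - BA`. -/
def comm {V : Type*} [NormedAddCommGroup V] [NormedSpace ℂ V] (A B : V →L[ℂ] V) : V →L[ℂ] V :=
  A ∘L B - B ∘L A

end General

/-! ### The half-space, its measures, and the zero extension -/

/-- Euclidean space `ℝ^{n+1}`. -/
abbrev Eu (n : ℕ) := EuclideanSpace ℝ (Fin (n + 1))

/-- The open upper half-space `ℝ^{n+1}_+ = ℝ^n × (0,∞)`. -/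
def halfSpace (n : ℕ) : TopologicalSpace.Opens (Eu n) :=
  ⟨{x | 0 < x (Fin.last n)}, isOpen_lt continuous_const (by fun_prop)⟩

/-- Lebesgue measure `dx` on the half-space. -/
def leb (n : ℕ) : Measure (halfSpace n) := Measure.comap Subtype.val volume

/-- The last coordinate `x_{n+1}` of a point of the half-space. -/
def ht {n : ℕ} (x : halfSpace n) : ℝ := x.1 (Fin.last n)

theorem ht_pos {n : ℕ} (x : halfSpace n) : 0 < ht x := x.2

theorem measurable_ht {n : ℕ} : Measurable (ht (n := n)) := by
  unfold ht; fun_prop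

/-- The measure `dm_λ(x) = x_{n+1}^{2λ} dx` on the half-space. -/
def mMeas (n : ℕ) (lam : ℝ) : Measure (halfSpace n) :=
  (leb n).withDensity fun x => ENNReal.ofReal (ht x ^ (2 * lam))

/-- `L²(ℝ^{n+1}, dx)`. -/
abbrev L2Eu (n : ℕ) := Lp ℂ 2 (volume : Measure (Eu n))

/-- `L²(ℝ^{n+1}_+, dx)`. -/
abbrev L2Half (n : ℕ) := Lp ℂ 2 (leb n)

/-- `L²(ℝ^{n+1}_+, dm_λ)`. -/
abbrev L2Bessel (n : ℕ) (lam : ℝ) := Lp ℂ 2 (mMeas n lam)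

/-- Multiplication by `x_{n+1}^λ`, from `L²(ℝ^{n+1}_+, dm_λ)` to `L²(ℝ^{n+1}_+, dx)`. -/
def weightOp (n : ℕ) (lam : ℝ) : L2Bessel n lam →L[ℂ] L2Half n :=
  mulOp _ _ fun x => ((ht x ^ lam : ℝ) : ℂ)

/-- Multiplication by `x_{n+1}^{-λ}`, from `L²(ℝ^{n+1}_+, dx)` to `L²(ℝ^{n+1}_+, dm_λ)`. -/
def invWeightOp (n : ℕ) (lam : ℝ) : L2Half n →L[ℂ] L2Bessel n lam :=
  mulOp _ _ fun x => ((ht x ^ (-lam) : ℝ) : ℂ)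

theorem measurable_density (n : ℕ) (lam : ℝ) :
    Measurable fun x : halfSpace n => ENNReal.ofReal (ht x ^ (2 * lam)) :=
  (measurable_ht.pow_const _).ennreal_ofReal

theorem volume_ac_mMeas (n : ℕ) (lam : ℝ) :
    leb n ≪ mMeas n lam :=
  withDensity_absolutelyContinuous' (measurable_density n lam).aemeasurable
    (Filter.Eventually.of_forall fun x => by
      simpa using Real.rpow_pos_of_pos (ht_pos x) (2 * lam))

theorem mMeas_ac_volume (n : ℕ) (lam : ℝ) :
    mMeas n lam ≪ leb n :=
  withDensity_absolutelyContinuous _ _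

theorem eLpNorm_weight (n : ℕ) (lam : ℝ) (f : halfSpace n → ℂ) :
    eLpNorm (fun x => ((ht x ^ lam : ℝ) : ℂ) * f x) 2 (leb n) = eLpNorm f 2 (mMeas n lam) := by
  rw [eLpNorm_eq_lintegral_rpow_enorm_toReal (by norm_num) (by norm_num),
    eLpNorm_eq_lintegral_rpow_enorm_toReal (by norm_num) (by norm_num), mMeas,
    lintegral_withDensity_eq_lintegral_mul_non_measurable _ (measurable_density n lam)
      (Filter.Eventually.of_forall fun x => ENNReal.ofReal_lt_top)]
  congr 1
  refine lintegral_congr fun x => ?_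
  have hx := ht_pos x
  have h0 : ‖((ht x ^ lam : ℝ) : ℂ)‖ₑ = ENNReal.ofReal (ht x ^ lam) := by
    rw [← ofReal_norm, Complex.norm_real, Real.norm_of_nonneg (by positivity)]
  simp only [Pi.mul_apply]
  rw [enorm_mul, ENNReal.mul_rpow_of_nonneg _ _ (by norm_num), h0,
    ENNReal.ofReal_rpow_of_nonneg (by positivity) (by norm_num), ← Real.rpow_mul hx.le]
  congr 3
  simp [mul_comm]

/-- `weightOp` is the genuine multiplication operator. -/
theorem weightOp_apply (n : ℕ) (lam : ℝ) (f : L2Bessel n lam) :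
    weightOp n lam f =ᵐ[leb n] fun x => ((ht x ^ lam : ℝ) : ℂ) * f x := by
  refine mulOp_apply_of_bound _ _ (volume_ac_mMeas n lam) _ ?_ 1 (fun f => ?_) f
  · exact (Complex.measurable_ofReal.comp (measurable_ht.pow_const _)).aestronglyMeasurable
  · simp [eLpNorm_weight]

/-- `invWeightOp` is the genuine multiplication operator. -/
theorem invWeightOp_apply (n : ℕ) (lam : ℝ) (f : L2Half n) :
    invWeightOp n lam f =ᵐ[mMeas n lam] fun x => ((ht x ^ (-lam) : ℝ) : ℂ) * f x := by
  refine mulOp_apply_of_bound _ _ (mMeas_ac_volume n lam) _ ?_ 1 (fun f => ?_) f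
  · exact (Complex.measurable_ofReal.comp (measurable_ht.pow_const _)).aestronglyMeasurable
  · rw [← eLpNorm_weight, ENNReal.ofReal_one, one_mul]
    refine le_of_eq (congrArg (fun g => eLpNorm g 2 (leb n)) (funext fun x => ?_))
    rw [← mul_assoc, ← Complex.ofReal_mul, ← Real.rpow_add (ht_pos x)]
    simp

/-- The extension by zero of a function on the half-space. -/
def extendZero {n : ℕ} (f : halfSpace n → ℂ) : Eu n → ℂ :=
  Function.extend (Subtype.val : halfSpace n → Eu n) f (fun _ => 0)

theorem extendZero_coe {n : ℕ} (f : halfSpace n → ℂ) (x : halfSpace n) :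
    extendZero f x.1 = f x :=
  Subtype.val_injective.extend_apply f (fun _ => 0) x

theorem extendZero_of_notMem {n : ℕ} (f : halfSpace n → ℂ) {x : Eu n} (hx : x ∉ halfSpace n) :
    extendZero f x = 0 := by
  refine Function.extend_apply' f (fun _ => 0) x ?_
  rintro ⟨y, rfl⟩
  exact hx y.2

theorem ae_extendZero {n : ℕ} {f g : halfSpace n → ℂ} (h : f =ᵐ[leb n] g) :
    extendZero f =ᵐ[volume] extendZero g := by
  have hms : MeasurableSet (halfSpace n : Set (Eu n)) := (halfSpace n).isOpen.measurableSet
  have h1 : ∀ᵐ x ∂(volume : Measure (Eu n)), ∀ hx : x ∈ (halfSpace n : Set (Eu n)),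
      f ⟨x, hx⟩ = g ⟨x, hx⟩ := by
    have h2 : ∀ᵐ x ∂(Measure.comap Subtype.val (volume : Measure (Eu n)) :
        Measure (halfSpace n)), f x = g x := h
    have h3 := (MeasurableEmbedding.subtype_coe hms).ae_map_iff
      (μ := Measure.comap Subtype.val (volume : Measure (Eu n)))
      (p := fun x => extendZero f x = extendZero g x)
    have h4 := h3.2 (h2.mono fun x hx => by
      change extendZero f x.1 = extendZero g x.1
      rw [extendZero_coe, extendZero_coe, hx])
    rw [map_comap_subtype_coe hms, ae_restrict_iff' hms] at h4
    filter_upwards [h4] with x hx hxm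
    have := hx hxm
    rwa [extendZero_coe f ⟨x, hxm⟩, extendZero_coe g ⟨x, hxm⟩] at this
  filter_upwards [h1] with x hx
  by_cases hxm : x ∈ halfSpace n
  · rw [extendZero_coe f ⟨x, hxm⟩, extendZero_coe g ⟨x, hxm⟩, hx hxm]
  · rw [extendZero_of_notMem f hxm, extendZero_of_notMem g hxm]

theorem memLp_extendZero {n : ℕ} {f : halfSpace n → ℂ} (hf : MemLp f 2 (leb n)) :
    MemLp (extendZero f) 2 volume ∧ eLpNorm (extendZero f) 2 volume = eLpNorm f 2 (leb n) := by
  have hms : MeasurableSet (halfSpace n : Set (Eu n)) := (halfSpace n).isOpen.measurableSet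
  have hemb : MeasurableEmbedding (Subtype.val : halfSpace n → Eu n) :=
    MeasurableEmbedding.subtype_coe hms
  have hind : indicator (halfSpace n : Set (Eu n)) (extendZero f) = extendZero f := by
    refine indicator_eq_self.2 fun x hx => ?_
    by_contra hxm
    exact hx (extendZero_of_notMem f hxm)
  have hcomp : extendZero f ∘ (Subtype.val : halfSpace n → Eu n) = f :=
    funext (extendZero_coe f)
  have hmap : Measure.map (Subtype.val : halfSpace n → Eu n) (leb n)
      = volume.restrict (halfSpace n : Set (Eu n)) := map_comap_subtype_coe hms volume
  constructor
  · rw [← hind, memLp_indicator_iff_restrict hms, ← hmap, hemb.memLp_map_measure_iff, hcomp]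
    exact hf
  · conv_lhs => rw [← hind]
    rw [eLpNorm_indicator_eq_eLpNorm_restrict hms, ← hmap, hemb.eLpNorm_map_measure, hcomp]

/-- The zero extension operator `E : L²(ℝ^{n+1}_+) → L²(ℝ^{n+1})`. -/
def extOp (n : ℕ) : L2Half n →L[ℂ] L2Eu n :=
  LinearMap.mkContinuous
    { toFun := fun f => (memLp_extendZero (Lp.memLp f)).1.toLp _
      map_add' := fun f g => by
        rw [← MemLp.toLp_add]
        refine MemLp.toLp_congr _ _ ((ae_extendZero (Lp.coeFn_add f g)).trans ?_)
        refine Filter.Eventually.of_forall fun x => ?_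
        by_cases hx : x ∈ halfSpace n
        · simp [extendZero_coe _ (⟨x, hx⟩ : halfSpace n)]
        · simp [extendZero_of_notMem _ hx]
      map_smul' := fun c f => by
        rw [RingHom.id_apply, ← MemLp.toLp_const_smul]
        refine MemLp.toLp_congr _ _ ((ae_extendZero (Lp.coeFn_smul c f)).trans ?_)
        refine Filter.Eventually.of_forall fun x => ?_
        by_cases hx : x ∈ halfSpace n
        · simp [extendZero_coe _ (⟨x, hx⟩ : halfSpace n)]
        · simp [extendZero_of_notMem _ hx] }
    1 fun f => by
      change ‖(memLp_extendZero (Lp.memLp f)).1.toLp _‖ ≤ _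
      rw [Lp.norm_toLp, (memLp_extendZero (Lp.memLp f)).2, Lp.norm_def, one_mul]

/-- The adjoint `E^*` of the zero extension operator. -/
def resOp (n : ℕ) : L2Eu n →L[ℂ] L2Half n := ContinuousLinearMap.adjoint (extOp n)

/-! ### The classical Riesz transforms -/

/-- The symbol of `∂_k Δ^{-1/2}` on `ℝ^{n+1}`. The Fourier transform
`f ↦ ∫ f(x) e^{-2πi⟨x,ξ⟩} dx` turns `∂_k` into `2πi ξ_k` and `Δ` into `4π²|ξ|²`. -/
def rieszSymbol (n : ℕ) (k : Fin (n + 1)) (ξ : Eu n) : ℂ :=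
  (2 * Real.pi * Complex.I * (ξ k : ℂ)) *
    (((4 * Real.pi ^ 2 * ‖ξ‖ ^ 2) ^ (-(1 / 2) : ℝ) : ℝ) : ℂ)

/-- The Fourier transform on `L²(ℝ^{n+1})` as a unitary operator. -/
def fourierL2 (n : ℕ) : L2Eu n ≃ₗᵢ[ℂ] L2Eu n := Lp.fourierTransformₗᵢ (Eu n) ℂ

/-- The classical Riesz transform `R_k = ∂_k Δ^{-1/2}` on `L²(ℝ^{n+1})`. -/
def riesz (n : ℕ) (k : Fin (n + 1)) : L2Eu n →L[ℂ] L2Eu n :=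
  (fourierL2 n).symm.toContinuousLinearEquiv.toContinuousLinearMap ∘L
    mulOp volume volume (rieszSymbol n k) ∘L
    (fourierL2 n).toContinuousLinearEquiv.toContinuousLinearMap

/-! ### The Bessel operator and the Bessel–Riesz transforms -/

/-- The Bessel function `J_ν` of the first kind, on `(0,∞)`. -/
def besselJ (ν s : ℝ) : ℝ :=
  ∑' m : ℕ, (-1) ^ m / ((m.factorial : ℝ) * Real.Gamma (m + ν + 1)) * (s / 2) ^ (2 * (m : ℝ) + ν)

/-- `φ_λ(s) = s^{1/2-λ} J_{λ-1/2}(s)`. -/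
def phi (lam s : ℝ) : ℝ := s ^ (1 / 2 - lam) * besselJ (lam - 1 / 2) s

/-- `(𝓕 ⊗ U_λ) f`, for `f ∈ C_c^∞(ℝ^{n+1}_+)`: the (unitarily normalised) Fourier transform in the
first `n` variables and the Fourier–Bessel transform in the last one. -/
def besselFourierIntegral (n : ℕ) (lam : ℝ) (f : Eu n → ℂ) (ξ : halfSpace n) : ℂ :=
  (((2 * Real.pi) ^ (-(n : ℝ) / 2) : ℝ) : ℂ) *
    ∫ y : halfSpace n,
      f y.1 * Complex.exp (-Complex.I * ((∑ j : Fin n, y.1 j.castSucc * ξ.1 j.castSucc : ℝ) : ℂ)) *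
        (phi lam (ht y * ht ξ) : ℂ) ∂(mMeas n lam)

/-- `W` is a unitary operator on `L²(m_λ)` extending `𝓕 ⊗ U_λ` from `C_c^∞(ℝ^{n+1}_+)`. -/
def IsBesselFourier (n : ℕ) (lam : ℝ) (W : L2Bessel n lam ≃ₗᵢ[ℂ] L2Bessel n lam) : Prop :=
  ∀ (φ : 𝓓(halfSpace n, ℂ)) (g : L2Bessel n lam), (g =ᵐ[mMeas n lam] fun x => φ x.1) →
    W g =ᵐ[mMeas n lam] besselFourierIntegral n lam φ

/-- The unitary operator `𝓕 ⊗ U_λ` on `L²(m_λ)`. -/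
def besselFourier (n : ℕ) (lam : ℝ) : L2Bessel n lam ≃ₗᵢ[ℂ] L2Bessel n lam :=
  open Classical in
  if h : ∃ W, IsBesselFourier n lam W then h.choose else LinearIsometryEquiv.refl ℂ _

/-- The graph of the power `Δ_λ^s` of `Δ_λ = (𝓕 ⊗ U_λ)⁻¹ M_{|ξ|²} (𝓕 ⊗ U_λ)`:
`g` lies in the domain of `Δ_λ^s` and `Δ_λ^s g = u`. -/
def IsBesselPow (n : ℕ) (lam s : ℝ) (g u : L2Bessel n lam) : Prop :=
  besselFourier n lam u =ᵐ[mMeas n lam]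
    fun ξ => (((‖ξ.1‖ ^ 2) ^ s : ℝ) : ℂ) * besselFourier n lam g ξ

/-- `v` is the weak derivative `∂_k u` in the open half-space. -/
def IsWeakDeriv {n : ℕ} (k : Fin (n + 1)) (u v : halfSpace n → ℂ) : Prop :=
  ∀ φ : 𝓓(halfSpace n, ℂ),
    ∫ x : halfSpace n, u x * fderiv ℝ φ x.1 (EuclideanSpace.single k 1) ∂(leb n) =
      -∫ x : halfSpace n, v x * φ x.1 ∂(leb n)

/-- `R` is the bounded extension to `L²(m_λ)` of `∂_k Δ_λ^{-1/2}`, which is defined on the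
(dense) domain of `Δ_λ^{-1/2}`. -/
def IsBesselRiesz (n : ℕ) (lam : ℝ) (k : Fin (n + 1))
    (R : L2Bessel n lam →L[ℂ] L2Bessel n lam) : Prop :=
  ∀ g u : L2Bessel n lam, IsBesselPow n lam (-(1 / 2)) g u → IsWeakDeriv k u (R g)

/-- The Bessel–Riesz transform `R_{λ,k} = ∂_k Δ_λ^{-1/2}` on `L²(m_λ)`. -/
def besselRiesz (n : ℕ) (lam : ℝ) (k : Fin (n + 1)) : L2Bessel n lam →L[ℂ] L2Bessel n lam :=
  open Classical in
  if h : ∃ R, IsBesselRiesz n lam k R then h.choose else 0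

/-! ### The symbols of the Schur multipliers -/

/-- `F_{k,l}(x) = x^{n+k} ∫_0^2 (x²+2t)^{-λ-n/2-1} (2t-t²)^{λ-1} t^l dt`. -/
def F (n : ℕ) (lam : ℝ) (k l : ℕ) (x : ℝ) : ℝ :=
  x ^ (n + k) *
    ∫ t in (0 : ℝ)..2, (x ^ 2 + 2 * t) ^ (-lam - n / 2 - 1) * (2 * t - t ^ 2) ^ (lam - 1) * t ^ l

/-- `H(x,y) = |x-y| / |x_{n+1} y_{n+1}|^{1/2}`. -/
def H {n : ℕ} (x y : halfSpace n) : ℝ := ‖x.1 - y.1‖ / Real.sqrt |ht x * ht y|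

/-- The symbol `F_{k,l} ∘ H`. -/
def symF (n : ℕ) (lam : ℝ) (k l : ℕ) (x y : halfSpace n) : ℂ := (F n lam k l (H x y) : ℂ)

/-- `h_k(x,y) = (x-y)_k / |x-y|`. -/
def symh {n : ℕ} (k : Fin (n + 1)) (x y : halfSpace n) : ℂ :=
  (((x.1 - y.1) k / ‖x.1 - y.1‖ : ℝ) : ℂ)

/-- `a(x,y) = (min{x_{n+1}, y_{n+1}} / max{x_{n+1}, y_{n+1}})^{1/2}`. -/
def syma {n : ℕ} (x y : halfSpace n) : ℂ :=
  (Real.sqrt (min (ht y) (ht x) / max (ht y) (ht x)) : ℂ)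

/-- `b(x,y) = 1` if `x_{n+1} < y_{n+1}`, and `0` otherwise. -/
def symb {n : ℕ} (x y : halfSpace n) : ℂ := if ht x < ht y then 1 else 0

/-! ### The operators in the commutator formula -/

/-- The conjugated, restricted classical commutator
`M_{x_{n+1}^{-λ}} E^* [R_l, M_f] E M_{x_{n+1}^λ}` on `L²(m_λ)`. -/
def conjComm (n : ℕ) (lam : ℝ) (f : Eu n → ℂ) (l : Fin (n + 1)) :
    L2Bessel n lam →L[ℂ] L2Bessel n lam :=
  invWeightOp n lam ∘L resOp n ∘L comm (riesz n l) (mulOp volume volume f) ∘L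
    extOp n ∘L weightOp n lam

/-- The Bessel–Riesz commutator `[R_{λ,k}, M_{E^* f}]` on `L²(m_λ)`, `E^* f` being the restriction
of `f` to the half-space. -/
def besselComm (n : ℕ) (lam : ℝ) (f : Eu n → ℂ) (k : Fin (n + 1)) :
    L2Bessel n lam →L[ℂ] L2Bessel n lam :=
  comm (besselRiesz n lam k) (mulOp (mMeas n lam) (mMeas n lam) fun x => f x.1)

end BesselRiesz

end

/-! A bounded operator is determined by its integral kernel, kernels are unique up to null sets
(`HasIntegralKernel.ae_unique`), and a Schur multiplier multiplies the kernel by its symbol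
(`HasIntegralKernel.schur`). The formula is therefore a pointwise identity between the kernels of the
two kinds of commutators, and the work lies in showing that both transforms exist and that their
commutators with a smooth compactly supported function have the expected kernels.

The Bessel–Fourier transform. By Poisson's integral (`besselE_eq_integral`) the transform of a
Gaussian is a multiple of a Gaussian, with an explicit inversion formula. The Gaussians times
exponentials determine functions (`ae_eq_zero_of_integral_mul_gaussE`, by Stone–Weierstrass), so the
transform extends to a unitary operator (`exists_isBesselFourier_gaussE`), which is given by its
integral on `L¹ ∩ L²` (`ae_eq_bfTransform_of_gaussE`). The Bessel–Riesz transforms are then Fourier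
multipliers (`isBesselRiesz_besselRiesz`), the last one between the transforms of parameters `λ` and
`λ + 1`.

The kernels. In `Δ^{-1/2} = π^{-1/2} ∫ t^{-1/2} e^{-tΔ} dt` the times are cut off to
`[1/(N+1), N+1]`, which makes `∂_k Δ^{-1/2}` an honest integral operator; its kernel comes from the
heat kernel, for `Δ_λ` a Poisson integral of Gaussians (`besselRiesz_besselReg_ae_eq`), and classically
from the Fourier transform of a Gaussian (`fourier_rieszSymbolReg`). As `N → ∞` these kernels converge
away from the diagonal, where the time integral is a Gamma integral (`integral_heatDensDeriv`,
`integral_classicalDens`). In the commutator with `M_f` the factor `f(y) - f(x)` removes the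
singularity: the kernels are dominated by `|f(x) - f(y)| |x - y|^{-n-1}`, up to the weight
`(x_{n+1} y_{n+1})^{-λ}`, which is `L²`-bounded by Schur's test near the diagonal and square integrable
away from it (`l2Bounded_commMaj`). Dominated convergence gives the kernels of both commutators
(`hasIntegralKernel_comm`, `hasIntegralKernel_besselComm`, `hasIntegralKernel_conjComm`). The
domination in the Bessel case, and the boundedness of the symbols, rest on `exists_F_le`.

The identity. Up to a constant, both kernels are `(x_{n+1} y_{n+1})^{-λ} |x - y|^{-n-1} (f(y) - f(x))`
times a symbol, which is `h_l` for `T_l`, and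
`h_k F_{2,0}(H) + δ_{k,n+1} (y_{n+1}/x_{n+1})^{1/2} F_{1,1}(H)` for the Bessel–Riesz transform. Here
`(y_{n+1}/x_{n+1})^{1/2} = a - h_{n+1} b H` and `F_{2,1} = H F_{1,1}` (`sqrt_mul_F`), and the operators
`T_l` combine through `∑ h_l² = 1` (`besselKer_eq`). The constant `κ` is the quotient of the constants
of the two Riesz kernels. -/

noncomputable section

namespace BesselRiesz

/-! ### Integral operators: uniqueness of kernels, and kernels dominated by bounded ones -/

section IntegralKernels

open Filter Topology

variable {X : Type*} [MeasurableSpace X] {μ : Measure X}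

/-- A function that is integrable on every set of finite measure of a countable exhaustion vanishes
almost everywhere once its integrals over the members of a countable `π`-system, intersected with
the exhausting sets, vanish. Stated for a family indexed by `x`, all null sets being chosen
at once. -/
theorem ae_ae_eq_zero_of_integral_mul_eq_zero [SigmaFinite μ]
    [MeasurableSpace.CountablyGenerated X] {D : X → X → ℂ}
    (hD : ∀ g : Lp ℂ 2 μ, ∀ᵐ x ∂μ,
      Integrable (fun y => D x y * g y) μ ∧ ∫ y, D x y * g y ∂μ = 0) :
    ∀ᵐ x ∂μ, ∀ᵐ y ∂μ, D x y = 0 := by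
  let gens : Set (Set X) := MeasurableSpace.countableGeneratingSet X
  let pis : Set (Set X) := (fun F : Set (Set X) => ⋂₀ F) '' {F | F.Finite ∧ F ⊆ gens}
  have hgens : ∀ s ∈ gens, MeasurableSet s := fun s hs =>
    MeasurableSpace.measurableSet_countableGeneratingSet hs
  have hpisc : pis.Countable :=
    (countable_ofPred_finite_subset MeasurableSpace.countable_countableGeneratingSet).image _
  have hpism : ∀ s ∈ pis, MeasurableSet s := by
    rintro _ ⟨F, ⟨hF, hF'⟩, rfl⟩
    exact MeasurableSet.sInter hF.countable fun s hs => hgens s (hF' hs)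
  have hpispi : IsPiSystem pis := by
    rintro _ ⟨F, ⟨hF, hF'⟩, rfl⟩ _ ⟨F₂, ⟨hF₂, hF₂'⟩, rfl⟩ -
    exact ⟨F ∪ F₂, ⟨hF.union hF₂, union_subset hF' hF₂'⟩, sInter_union F F₂⟩
  have hpisgen : ‹MeasurableSpace X› = MeasurableSpace.generateFrom pis := by
    refine le_antisymm ?_ (MeasurableSpace.generateFrom_le hpism)
    conv_lhs => rw [← MeasurableSpace.generateFrom_countableGeneratingSet (α := X)]
    refine MeasurableSpace.generateFrom_mono fun s hs => ⟨{s}, ⟨finite_singleton s, ?_⟩, ?_⟩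
    · exact singleton_subset_iff.2 hs
    · simp
  have huniv : univ ∈ pis := ⟨∅, ⟨finite_empty, empty_subset _⟩, by simp⟩
  let S : ℕ → Set X := spanningSets μ
  have key : ∀ s ∈ pis, ∀ k : ℕ, ∀ᵐ x ∂μ,
      IntegrableOn (D x) (s ∩ S k) μ ∧ ∫ y in s ∩ S k, D x y ∂μ = 0 := by
    intro s hs k
    have hm : MeasurableSet (s ∩ S k) := (hpism s hs).inter (measurableSet_spanningSets μ k)
    have hfin : μ (s ∩ S k) ≠ ⊤ :=
      ((measure_mono inter_subset_right).trans_lt (measure_spanningSets_lt_top μ k)).ne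
    filter_upwards [hD (indicatorConstLp 2 hm hfin 1)] with x hx
    have hae : (fun y => D x y * indicatorConstLp 2 hm hfin (1 : ℂ) y) =ᵐ[μ]
        (s ∩ S k).indicator (D x) := by
      filter_upwards [indicatorConstLp_coeFn (p := 2) (hs := hm) (hμs := hfin) (c := (1 : ℂ))]
        with y hy
      rw [hy]
      by_cases hys : y ∈ s ∩ S k <;> simp [hys]
    refine ⟨(integrable_indicator_iff hm).1 (hx.1.congr hae), ?_⟩
    rw [← integral_indicator hm, ← integral_congr_ae hae, hx.2]
  have key2 : ∀ᵐ x ∂μ, ∀ s ∈ pis, ∀ k : ℕ,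
      IntegrableOn (D x) (s ∩ S k) μ ∧ ∫ y in s ∩ S k, D x y ∂μ = 0 :=
    (ae_ball_iff hpisc).2 fun s hs => ae_all_iff.2 (key s hs)
  filter_upwards [key2] with x hx
  have hk : ∀ k : ℕ, ∀ᵐ y ∂(μ.restrict (S k)), D x y = 0 := by
    intro k
    have hI : Integrable (D x) (μ.restrict (S k)) := by
      simpa [IntegrableOn] using (hx univ huniv k).1
    refine hI.ae_eq_zero_of_forall_setIntegral_eq_zero fun s hs _ => ?_
    induction s, hs using MeasurableSpace.induction_on_inter hpisgen hpispi with
    | empty => simp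
    | basic t ht =>
      rw [Measure.restrict_restrict (hpism t ht)]
      exact (hx t ht k).2
    | compl t htm iht =>
      have h0 : ∫ y, D x y ∂(μ.restrict (S k)) = 0 := by
        simpa using (hx univ huniv k).2
      have := integral_add_compl htm hI
      rw [iht (measure_lt_top_of_subset (subset_univ _) ?_), h0, zero_add] at this
      · exact this
      · rw [Measure.restrict_apply_univ]
        exact (measure_spanningSets_lt_top μ k).ne
    | iUnion f hd hf ih =>
      rw [integral_iUnion hf hd hI.integrableOn]
      simp_rw [fun i => ih i (measure_lt_top_of_subset (subset_univ _) (by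
        rw [Measure.restrict_apply_univ]; exact (measure_spanningSets_lt_top μ k).ne))]
      simp
  have h3 : ∀ᵐ y ∂(μ.restrict (⋃ k, S k)), D x y = 0 := (ae_restrict_iUnion_iff _ _).2 hk
  rwa [iUnion_spanningSets, Measure.restrict_univ] at h3

/-- The kernel of an integral operator is unique up to null sets. -/
theorem HasIntegralKernel.ae_unique [SigmaFinite μ] [MeasurableSpace.CountablyGenerated X]
    {T : Lp ℂ 2 μ →L[ℂ] Lp ℂ 2 μ} {K K' : X → X → ℂ} (h : HasIntegralKernel μ T K)
    (h' : HasIntegralKernel μ T K') : ∀ᵐ x ∂μ, ∀ᵐ y ∂μ, K x y = K' x y := by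
  have := ae_ae_eq_zero_of_integral_mul_eq_zero (μ := μ) (D := fun x y => K x y - K' x y) ?_
  · filter_upwards [this] with x hx
    filter_upwards [hx] with y hy using sub_eq_zero.1 hy
  · intro g
    filter_upwards [h.2 g, h'.2 g] with x hx hx'
    simp_rw [sub_mul]
    refine ⟨hx.1.sub hx'.1, ?_⟩
    rw [integral_sub hx.1 hx'.1, ← hx.2, ← hx'.2, sub_self]

theorem HasIntegralKernel.congr {T : Lp ℂ 2 μ →L[ℂ] Lp ℂ 2 μ} {K K' : X → X → ℂ}
    (h : HasIntegralKernel μ T K)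
    (hm : AEStronglyMeasurable (Function.uncurry K') (μ.prod μ))
    (hK : ∀ᵐ x ∂μ, ∀ᵐ y ∂μ, K x y = K' x y) : HasIntegralKernel μ T K' := by
  refine ⟨hm, fun g => ?_⟩
  filter_upwards [h.2 g, hK] with x hx hxK
  have hae : (fun y => K x y * g y) =ᵐ[μ] fun y => K' x y * g y := by
    filter_upwards [hxK] with y hy
    rw [hy]
  exact ⟨hx.1.congr hae, hx.2.trans (integral_congr_ae hae)⟩

/-- An operator is determined by its integral kernel. -/
theorem HasIntegralKernel.ext {T S : Lp ℂ 2 μ →L[ℂ] Lp ℂ 2 μ} {K K' : X → X → ℂ}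
    (h : HasIntegralKernel μ T K) (h' : HasIntegralKernel μ S K')
    (hK : ∀ᵐ x ∂μ, ∀ᵐ y ∂μ, K x y = K' x y) : T = S := by
  ext1 g
  refine Lp.ext ?_
  filter_upwards [(h.congr h'.1 hK).2 g, h'.2 g] with x hx hx'
  rw [hx.2, hx'.2]

theorem HasIntegralKernel.add {T S : Lp ℂ 2 μ →L[ℂ] Lp ℂ 2 μ} {K K' : X → X → ℂ}
    (h : HasIntegralKernel μ T K) (h' : HasIntegralKernel μ S K') :
    HasIntegralKernel μ (T + S) fun x y => K x y + K' x y := by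
  refine ⟨h.1.add h'.1, fun g => ?_⟩
  filter_upwards [h.2 g, h'.2 g, Lp.coeFn_add (T g) (S g)] with x hx hx' hadd
  simp_rw [add_mul]
  refine ⟨hx.1.add hx'.1, ?_⟩
  rw [integral_add hx.1 hx'.1, ← hx.2, ← hx'.2]
  exact hadd

theorem HasIntegralKernel.smul {T : Lp ℂ 2 μ →L[ℂ] Lp ℂ 2 μ} {K : X → X → ℂ} (c : ℂ)
    (h : HasIntegralKernel μ T K) : HasIntegralKernel μ (c • T) fun x y => c * K x y := by
  refine ⟨h.1.const_mul c, fun g => ?_⟩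
  filter_upwards [h.2 g, Lp.coeFn_smul c (T g)] with x hx hsmul
  simp_rw [mul_assoc]
  refine ⟨hx.1.const_mul c, ?_⟩
  rw [integral_const_mul, ← hx.2]
  exact hsmul

theorem HasIntegralKernel.sub {T S : Lp ℂ 2 μ →L[ℂ] Lp ℂ 2 μ} {K K' : X → X → ℂ}
    (h : HasIntegralKernel μ T K) (h' : HasIntegralKernel μ S K') :
    HasIntegralKernel μ (T - S) fun x y => K x y - K' x y := by
  simpa [sub_eq_add_neg] using h.add (h'.smul (-1))

theorem hasIntegralKernel_zero :
    HasIntegralKernel μ (0 : Lp ℂ 2 μ →L[ℂ] Lp ℂ 2 μ) fun _ _ => 0 := by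
  refine ⟨aestronglyMeasurable_const, fun g => ?_⟩
  filter_upwards [Lp.coeFn_zero ℂ 2 μ] with x hx
  simpa using hx

theorem HasIntegralKernel.sum {ι : Type*} (s : Finset ι)
    {T : ι → Lp ℂ 2 μ →L[ℂ] Lp ℂ 2 μ} {K : ι → X → X → ℂ}
    (h : ∀ i ∈ s, HasIntegralKernel μ (T i) (K i)) :
    HasIntegralKernel μ (∑ i ∈ s, T i) fun x y => ∑ i ∈ s, K i x y := by
  classical
  induction s using Finset.induction_on with
  | empty => simpa using hasIntegralKernel_zero
  | insert i s hi ih =>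
    simp_rw [Finset.sum_insert hi]
    exact (h i (Finset.mem_insert_self i s)).add
      (ih fun j hj => h j (Finset.mem_insert_of_mem hj))

/-- If `T` has kernel `K` and some bounded operator has kernel `M · K`, then `T` lies in the domain
of the Schur multiplier with symbol `M`, and `𝔖_M T` has kernel `M · K`. -/
theorem HasIntegralKernel.schur [SigmaFinite μ] [MeasurableSpace.CountablyGenerated X]
    {T S : Lp ℂ 2 μ →L[ℂ] Lp ℂ 2 μ} {K M : X → X → ℂ} (h : HasIntegralKernel μ T K)
    (hM : ∃ C : ℝ, ∀ x y, ‖M x y‖ ≤ C)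
    (hS : HasIntegralKernel μ S fun x y => M x y * K x y) :
    InSchurDomain μ M T ∧ HasIntegralKernel μ (schur μ M T) fun x y => M x y * K x y := by
  have hdom : InSchurDomain μ M T := ⟨S, hM, K, h, hS⟩
  refine ⟨hdom, ?_⟩
  rw [BesselRiesz.schur, dif_pos hdom]
  obtain ⟨-, K', hK', hMK'⟩ := hdom.choose_spec
  refine hMK'.congr hS.1 ?_
  filter_upwards [hK'.ae_unique h] with x hx
  filter_upwards [hx] with y hy
  rw [hy]

/-- The integral operator with nonnegative kernel `k` is bounded on `L²(μ)`. -/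
def L2Bounded (μ : Measure X) (k : X → X → ℝ≥0∞) : Prop :=
  ∃ C : ℝ≥0∞, C ≠ ⊤ ∧ ∀ g : X → ℝ≥0∞, Measurable g →
    ∫⁻ x, (∫⁻ y, k x y * g y ∂μ) ^ 2 ∂μ ≤ C * ∫⁻ y, g y ^ 2 ∂μ

theorem L2Bounded.mono {k k' : X → X → ℝ≥0∞} (h : L2Bounded μ k) (hk : ∀ x y, k' x y ≤ k x y) :
    L2Bounded μ k' := by
  obtain ⟨C, hC, hb⟩ := h
  refine ⟨C, hC, fun g hg => le_trans ?_ (hb g hg)⟩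
  gcongr
  exact hk _ _

theorem L2Bounded.const_mul {k : X → X → ℝ≥0∞} (h : L2Bounded μ k) {c : ℝ≥0∞} (hc : c ≠ ⊤) :
    L2Bounded μ fun x y => c * k x y := by
  obtain ⟨C, hC, hb⟩ := h
  refine ⟨c ^ 2 * C, by finiteness, fun g hg => ?_⟩
  simp_rw [mul_assoc, lintegral_const_mul' _ _ hc, mul_pow]
  rw [lintegral_const_mul' _ _ (by finiteness)]
  gcongr
  exact hb g hg

theorem L2Bounded.add {k k' : X → X → ℝ≥0∞} (hkm : ∀ x, Measurable (k x))
    (h : L2Bounded μ k) (h' : L2Bounded μ k')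
    (hkm' : Measurable fun p : X × X => k p.1 p.2) [SFinite μ] :
    L2Bounded μ fun x y => k x y + k' x y := by
  obtain ⟨C, hC, hb⟩ := h
  obtain ⟨C', hC', hb'⟩ := h'
  refine ⟨2 * (C + C'), by finiteness, fun g hg => ?_⟩
  have hsq : ∀ a b : ℝ≥0∞, (a + b) ^ 2 ≤ 2 * (a ^ 2 + b ^ 2) := fun a b => by
    have := ENNReal.rpow_add_le_mul_rpow_add_rpow a b (p := 2) (by norm_num)
    norm_num at this
    exact_mod_cast this
  calc ∫⁻ x, (∫⁻ y, (k x y + k' x y) * g y ∂μ) ^ 2 ∂μ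
      = ∫⁻ x, ((∫⁻ y, k x y * g y ∂μ) + ∫⁻ y, k' x y * g y ∂μ) ^ 2 ∂μ := by
        refine lintegral_congr fun x => ?_
        simp_rw [add_mul]
        rw [lintegral_add_left (f := fun y => k x y * g y) ((hkm x).mul hg)]
    _ ≤ ∫⁻ x, 2 * ((∫⁻ y, k x y * g y ∂μ) ^ 2 + (∫⁻ y, k' x y * g y ∂μ) ^ 2) ∂μ :=
        lintegral_mono fun x => hsq _ _
    _ = 2 * ((∫⁻ x, (∫⁻ y, k x y * g y ∂μ) ^ 2 ∂μ) +
          ∫⁻ x, (∫⁻ y, k' x y * g y ∂μ) ^ 2 ∂μ) := by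
        rw [lintegral_const_mul' _ _ (by norm_num), lintegral_add_left]
        exact (Measurable.lintegral_prod_right' (f := fun p : X × X => k p.1 p.2 * g p.2)
          (hkm'.mul (hg.comp measurable_snd))).pow_const 2
    _ ≤ 2 * (C * (∫⁻ y, g y ^ 2 ∂μ) + C' * ∫⁻ y, g y ^ 2 ∂μ) := by
        gcongr
        exacts [hb g hg, hb' g hg]
    _ = 2 * (C + C') * ∫⁻ y, g y ^ 2 ∂μ := by ring

theorem sq_lintegral_mul_le {f g : X → ℝ≥0∞} (hf : AEMeasurable f μ) (hg : AEMeasurable g μ) :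
    (∫⁻ x, f x * g x ∂μ) ^ 2 ≤ (∫⁻ x, f x ^ 2 ∂μ) * ∫⁻ x, g x ^ 2 ∂μ := by
  have h := ENNReal.lintegral_mul_le_Lp_mul_Lq μ Real.HolderConjugate.two_two hf hg
  have h2 := pow_le_pow_left' h 2
  rw [mul_pow, ← ENNReal.rpow_mul_natCast, ← ENNReal.rpow_mul_natCast] at h2
  norm_num at h2
  exact_mod_cast h2

/-- Schur's test. -/
theorem l2Bounded_of_lintegral_le [SFinite μ] {k : X → X → ℝ≥0∞}
    (hkm : Measurable fun p : X × X => k p.1 p.2) {A B : ℝ≥0∞} (hA : A ≠ ⊤) (hB : B ≠ ⊤)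
    (h1 : ∀ x, ∫⁻ y, k x y ∂μ ≤ A) (h2 : ∀ y, ∫⁻ x, k x y ∂μ ≤ B) : L2Bounded μ k := by
  refine ⟨A * B, by finiteness, fun g hg => ?_⟩
  have hs : ∀ a : ℝ≥0∞, (a ^ (1 / 2 : ℝ)) ^ 2 = a := fun a => by
    rw [← ENNReal.rpow_mul_natCast]; norm_num
  have hkx : ∀ x, Measurable (k x) := fun x => hkm.comp measurable_prodMk_left
  calc ∫⁻ x, (∫⁻ y, k x y * g y ∂μ) ^ 2 ∂μ
      ≤ ∫⁻ x, A * ∫⁻ y, k x y * g y ^ 2 ∂μ ∂μ := by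
        refine lintegral_mono fun x => ?_
        have := sq_lintegral_mul_le (μ := μ) (f := fun y => k x y ^ (1 / 2 : ℝ))
          (g := fun y => k x y ^ (1 / 2 : ℝ) * g y) ((hkx x).pow_const _).aemeasurable
          (((hkx x).pow_const _).mul hg).aemeasurable
        simp_rw [← mul_assoc, ← pow_two, mul_pow, hs] at this
        exact this.trans (by gcongr; exact h1 x)
    _ = A * ∫⁻ y, ∫⁻ x, k x y * g y ^ 2 ∂μ ∂μ := by
        rw [lintegral_const_mul' _ _ hA, lintegral_lintegral_swap]
        exact (hkm.mul ((hg.comp measurable_snd).pow_const 2)).aemeasurable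
    _ ≤ A * ∫⁻ y, B * g y ^ 2 ∂μ := by
        gcongr with y
        rw [lintegral_mul_const (f := fun x => k x y) _ (hkm.comp measurable_prodMk_right)]
        gcongr
        exact h2 y
    _ = A * B * ∫⁻ y, g y ^ 2 ∂μ := by
        rw [lintegral_const_mul' _ _ hB, mul_assoc]

/-- Hilbert–Schmidt kernels. -/
theorem l2Bounded_of_lintegral_sq_ne_top {k : X → X → ℝ≥0∞} (hkx : ∀ x, Measurable (k x))
    (hk : ∫⁻ x, ∫⁻ y, k x y ^ 2 ∂μ ∂μ ≠ ⊤) : L2Bounded μ k := by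
  -- the summand `1` makes the bound meaningful when `g` is not square integrable
  refine ⟨1 + ∫⁻ x, ∫⁻ y, k x y ^ 2 ∂μ ∂μ, by finiteness, fun g hg => ?_⟩
  by_cases hg' : ∫⁻ y, g y ^ 2 ∂μ = ⊤
  · rw [hg', ENNReal.mul_top (by simp)]
    exact le_top
  calc ∫⁻ x, (∫⁻ y, k x y * g y ∂μ) ^ 2 ∂μ
      ≤ ∫⁻ x, (∫⁻ y, k x y ^ 2 ∂μ) * ∫⁻ y, g y ^ 2 ∂μ ∂μ :=
        lintegral_mono fun x => sq_lintegral_mul_le (hkx x).aemeasurable hg.aemeasurable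
    _ = (∫⁻ x, ∫⁻ y, k x y ^ 2 ∂μ ∂μ) * ∫⁻ y, g y ^ 2 ∂μ := lintegral_mul_const' _ _ hg'
    _ ≤ _ := by gcongr; exact le_add_self

/-- A kernel dominated by an `L²`-bounded nonnegative kernel defines a bounded operator. -/
theorem L2Bounded.exists_hasIntegralKernel [SFinite μ] {k : X → X → ℝ≥0∞} (hk : L2Bounded μ k)
    {K : X → X → ℂ} (hm : AEStronglyMeasurable (Function.uncurry K) (μ.prod μ))
    (hK : ∀ x y, ‖K x y‖ₑ ≤ k x y) : ∃ T : Lp ℂ 2 μ →L[ℂ] Lp ℂ 2 μ, HasIntegralKernel μ T K := by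
  obtain ⟨C, hC, hb⟩ := hk
  have hm2 : ∀ g : Lp ℂ 2 μ,
      AEStronglyMeasurable (fun p : X × X => K p.1 p.2 * g p.2) (μ.prod μ) := fun g =>
    hm.mul (Lp.aestronglyMeasurable g).comp_snd
  have hsq : ∀ g : Lp ℂ 2 μ, ∫⁻ x, (∫⁻ y, ‖K x y * g y‖ₑ ∂μ) ^ 2 ∂μ ≤
      C * ∫⁻ y, ‖g y‖ₑ ^ 2 ∂μ := fun g => by
    refine le_trans ?_ (hb (fun y => ‖g y‖ₑ) (Lp.stronglyMeasurable g).measurable.enorm)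
    simp_rw [enorm_mul]
    gcongr
    exact hK _ _
  have hgfin : ∀ g : Lp ℂ 2 μ, ∫⁻ y, ‖g y‖ₑ ^ 2 ∂μ < ⊤ := fun g => by
    have := lintegral_rpow_enorm_lt_top_of_eLpNorm_lt_top (by norm_num) (by norm_num)
      (Lp.memLp g).2
    simpa using this
  have hint : ∀ g : Lp ℂ 2 μ, ∀ᵐ x ∂μ, Integrable (fun y => K x y * g y) μ := fun g => by
    have h1 : ∫⁻ x, (∫⁻ y, ‖K x y * g y‖ₑ ∂μ) ^ 2 ∂μ ≠ ⊤ :=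
      ((hsq g).trans_lt (ENNReal.mul_lt_top hC.lt_top (hgfin g))).ne
    have h2 := ae_lt_top' ((hm2 g).enorm.lintegral_prod_right'.pow_const 2) h1
    filter_upwards [h2, (hm2 g).prodMk_left] with x hx hxm
    refine ⟨hxm, ?_⟩
    rw [HasFiniteIntegral]
    by_contra hcon
    rw [not_lt, top_le_iff] at hcon
    rw [hcon] at hx
    simp at hx
  have henorm : ∀ (h : X → ℂ), eLpNorm h 2 μ ^ 2 = ∫⁻ x, ‖h x‖ₑ ^ 2 ∂μ := fun h => by
    rw [eLpNorm_eq_lintegral_rpow_enorm_toReal (by norm_num) (by norm_num)]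
    rw [← ENNReal.rpow_mul_natCast]
    norm_num
  let A : Lp ℂ 2 μ → X → ℂ := fun g x => ∫ y, K x y * g y ∂μ
  have hA2 : ∀ g, eLpNorm (A g) 2 μ ^ 2 ≤ C * eLpNorm g 2 μ ^ 2 := fun g => by
    rw [henorm, henorm]
    refine le_trans (lintegral_mono fun x => ?_) (hsq g)
    gcongr
    exact enorm_integral_le_lintegral_enorm _
  have hA2' : ∀ g, eLpNorm (A g) 2 μ ≤ C ^ (1 / 2 : ℝ) * eLpNorm g 2 μ := fun g => by
    have := hA2 g
    have h3 : C * eLpNorm g 2 μ ^ 2 = (C ^ (1 / 2 : ℝ) * eLpNorm g 2 μ) ^ 2 := by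
      rw [mul_pow, ← ENNReal.rpow_mul_natCast]; norm_num
    rw [h3] at this
    exact (ENNReal.pow_le_pow_left_iff (by norm_num)).1 this
  have hmem : ∀ g, MemLp (A g) 2 μ := fun g => by
    refine ⟨(hm2 g).integral_prod_right', (hA2' g).trans_lt ?_⟩
    exact ENNReal.mul_lt_top (ENNReal.rpow_lt_top_of_nonneg (by norm_num) hC) (Lp.memLp g).2
  let T₀ : Lp ℂ 2 μ →ₗ[ℂ] Lp ℂ 2 μ :=
    { toFun := fun g => (hmem g).toLp _
      map_add' := fun g h => by
        rw [← MemLp.toLp_add]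
        refine MemLp.toLp_congr _ _ ?_
        filter_upwards [hint g, hint h] with x hx hx'
        change ∫ y, K x y * (g + h : Lp ℂ 2 μ) y ∂μ = (∫ y, K x y * g y ∂μ) + ∫ y, K x y * h y ∂μ
        rw [← integral_add hx hx']
        refine integral_congr_ae ?_
        filter_upwards [Lp.coeFn_add g h] with y hy
        rw [hy, Pi.add_apply, mul_add]
      map_smul' := fun c g => by
        rw [RingHom.id_apply, ← MemLp.toLp_const_smul]
        refine MemLp.toLp_congr _ _ (Eventually.of_forall fun x => ?_)
        change ∫ y, K x y * (c • g : Lp ℂ 2 μ) y ∂μ = c * ∫ y, K x y * g y ∂μ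
        rw [← integral_const_mul]
        refine integral_congr_ae ?_
        filter_upwards [Lp.coeFn_smul c g] with y hy
        rw [hy, Pi.smul_apply, smul_eq_mul, mul_left_comm] }
  refine ⟨T₀.mkContinuous (C ^ (1 / 2 : ℝ)).toReal fun g => ?_, hm, fun g => ?_⟩
  · change ‖(hmem g).toLp _‖ ≤ _
    rw [Lp.norm_toLp, Lp.norm_def, ← ENNReal.toReal_mul]
    refine ENNReal.toReal_mono (ENNReal.mul_ne_top ?_ (Lp.memLp g).2.ne) (hA2' g)
    exact ENNReal.rpow_ne_top_of_nonneg (by norm_num) hC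
  · filter_upwards [hint g, (hmem g).coeFn_toLp] with x hx hx'
    exact ⟨hx, hx'⟩

/-- If functions represented by dominated kernels converge in `L²`, the limit is represented by the
pointwise limit of the kernels. -/
theorem ae_eq_integral_of_tendsto {B : Lp ℂ 2 μ} {BN : ℕ → Lp ℂ 2 μ}
    (hB : Tendsto BN atTop (𝓝 B)) {KN : ℕ → X → X → ℂ} {K : X → X → ℂ} {bound : X → X → ℝ}
    (hN : ∀ N, BN N =ᵐ[μ] fun x => ∫ y, KN N x y ∂μ)
    (hm : ∀ N, ∀ᵐ x ∂μ, AEStronglyMeasurable (KN N x) μ)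
    (hlim : ∀ᵐ x ∂μ, ∀ᵐ y ∂μ, Tendsto (fun N => KN N x y) atTop (𝓝 (K x y)))
    (hbd : ∀ N, ∀ᵐ x ∂μ, ∀ᵐ y ∂μ, ‖KN N x y‖ ≤ bound x y)
    (hint : ∀ᵐ x ∂μ, Integrable (bound x) μ) :
    B =ᵐ[μ] fun x => ∫ y, K x y ∂μ := by
  obtain ⟨ns, hns, hae⟩ := (tendstoInMeasure_of_tendsto_Lp hB).exists_seq_tendsto_ae
  filter_upwards [hae, ae_all_iff.2 hN, ae_all_iff.2 hm, hlim, ae_all_iff.2 hbd, hint]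
    with x h1 h2 h3 h4 h5 h6
  have h7 : Tendsto (fun N => ∫ y, KN N x y ∂μ) atTop (𝓝 (∫ y, K x y ∂μ)) :=
    tendsto_integral_of_dominated_convergence (bound x) h3 h6 h5 h4
  have h8 := h7.comp hns.tendsto_atTop
  refine tendsto_nhds_unique h1 (h8.congr fun i => ?_)
  exact (h2 (ns i)).symm

end IntegralKernels

/-! ### The entire function behind the Bessel function -/

section BesselFunction

open Filter Topology

/-- The Poisson weight `(2s - s²)^{λ-1} ds` on `(0,2)`, that is `sin^{2λ-1} θ dθ` under
`s = 1 - cos θ`. -/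
def poissonMeas (lam : ℝ) : Measure ℝ :=
  (volume.restrict (Ioo 0 2)).withDensity fun s => ENNReal.ofReal ((2 * s - s ^ 2) ^ (lam - 1))

variable {lam : ℝ}

theorem two_mul_sub_sq_pos {s : ℝ} (hs : s ∈ Ioo (0 : ℝ) 2) : 0 < 2 * s - s ^ 2 := by
  nlinarith [hs.1, hs.2, mul_pos hs.1 (sub_pos.2 hs.2)]

theorem intervalIntegrable_poissonWeight (hlam : 0 < lam) :
    IntervalIntegrable (fun s : ℝ => (2 * s - s ^ 2) ^ (lam - 1)) volume 0 2 := by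
  have h01 : IntervalIntegrable (fun s : ℝ => (2 * s - s ^ 2) ^ (lam - 1)) volume 0 1 := by
    have h1 : IntervalIntegrable (fun s : ℝ => s ^ (lam - 1)) volume 0 1 :=
      intervalIntegral.intervalIntegrable_rpow' (by linarith)
    have h2 : ContinuousOn (fun s : ℝ => (2 - s) ^ (lam - 1)) (uIcc 0 1) := by
      refine ContinuousOn.rpow_const (by fun_prop) fun s hs => Or.inl ?_
      rw [uIcc_of_le zero_le_one] at hs
      linarith [hs.2]
    refine (h1.mul_continuousOn h2).congr fun s hs => ?_
    rw [uIoc_of_le zero_le_one] at hs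
    rw [← Real.mul_rpow hs.1.le (by linarith [hs.2])]
    congr 1; ring
  refine h01.trans ?_
  have h3 := (h01.comp_sub_left 2).symm
  norm_num at h3
  refine h3.congr fun s _ => ?_
  congr 1; ring

theorem integral_poissonMeas (h : ℝ → ℂ) :
    ∫ s, h s ∂(poissonMeas lam) = ∫ s in Ioo (0 : ℝ) 2, ((2 * s - s ^ 2) ^ (lam - 1) : ℝ) • h s := by
  rw [poissonMeas, integral_withDensity_eq_integral_toReal_smul (by fun_prop) (by simp)]
  refine setIntegral_congr_fun measurableSet_Ioo fun s hs => ?_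
  rw [ENNReal.toReal_ofReal (Real.rpow_nonneg (two_mul_sub_sq_pos hs).le _)]

theorem integral_poissonMeas_real (h : ℝ → ℝ) :
    ∫ s, h s ∂(poissonMeas lam) = ∫ s in (0 : ℝ)..2, (2 * s - s ^ 2) ^ (lam - 1) * h s := by
  rw [poissonMeas, integral_withDensity_eq_integral_toReal_smul (by fun_prop) (by simp),
    intervalIntegral.integral_of_le (by norm_num), integral_Ioc_eq_integral_Ioo]
  refine setIntegral_congr_fun measurableSet_Ioo fun s hs => ?_
  rw [ENNReal.toReal_ofReal (Real.rpow_nonneg (two_mul_sub_sq_pos hs).le _), smul_eq_mul]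

theorem isFiniteMeasure_poissonMeas (hlam : 0 < lam) : IsFiniteMeasure (poissonMeas lam) := by
  refine isFiniteMeasure_withDensity_ofReal ?_
  have := intervalIntegrable_poissonWeight hlam
  rw [intervalIntegrable_iff_integrableOn_Ioo_of_le (by norm_num)] at this
  exact this.2

theorem ae_mem_poissonMeas : ∀ᵐ s ∂(poissonMeas lam), s ∈ Ioo (0 : ℝ) 2 :=
  (withDensity_absolutelyContinuous _ _).ae_le (ae_restrict_mem measurableSet_Ioo)

/-- The even moments of the Poisson weight. -/
def poissonMoment (lam : ℝ) (j : ℕ) : ℝ := ∫ s, (1 - s) ^ (2 * j) ∂(poissonMeas lam)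

theorem poissonMoment_zero_pos (hlam : 0 < lam) : 0 < poissonMoment lam 0 := by
  rw [poissonMoment, integral_poissonMeas_real]
  simp only [mul_zero, pow_zero, mul_one]
  exact intervalIntegral.intervalIntegral_pos_of_pos_on (intervalIntegrable_poissonWeight hlam)
    (fun s hs => Real.rpow_pos_of_pos (two_mul_sub_sq_pos hs) _) (by norm_num)

/-- Integration by parts of `((1-s)^{2j+1} (2s-s²)^λ)'` over `(0,2)`. -/
theorem poissonMoment_succ (hlam : 0 < lam) (j : ℕ) :
    (j + lam + 1 / 2) * poissonMoment lam (j + 1) = (j + 1 / 2) * poissonMoment lam j := by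
  have hI : ∀ k : ℕ, IntervalIntegrable
      (fun s : ℝ => (2 * s - s ^ 2) ^ (lam - 1) * (1 - s) ^ k) volume 0 2 := fun k =>
    (intervalIntegrable_poissonWeight hlam).mul_continuousOn (by fun_prop)
  have hftc := intervalIntegral.integral_eq_sub_of_hasDerivAt_of_le (a := 0) (b := 2)
    (f := fun s : ℝ => (1 - s) ^ (2 * j + 1) * (2 * s - s ^ 2) ^ lam)
    (f' := fun s : ℝ => (2 * (j + lam) + 1) * ((2 * s - s ^ 2) ^ (lam - 1) * (1 - s) ^ (2 * (j + 1)))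
      - (2 * j + 1) * ((2 * s - s ^ 2) ^ (lam - 1) * (1 - s) ^ (2 * j))) (by norm_num)
    ((by fun_prop : ContinuousOn (fun s : ℝ => (1 - s) ^ (2 * j + 1)) _).mul
      (ContinuousOn.rpow_const (by fun_prop) fun s _ => Or.inr hlam.le)) ?_
    (((hI _).const_mul _).sub ((hI _).const_mul _))
  · rw [intervalIntegral.integral_sub ((hI _).const_mul _) ((hI _).const_mul _),
      intervalIntegral.integral_const_mul, intervalIntegral.integral_const_mul] at hftc
    rw [poissonMoment, poissonMoment, integral_poissonMeas_real, integral_poissonMeas_real]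
    norm_num [Real.zero_rpow hlam.ne'] at hftc
    linarith
  · intro s hs
    have hpos := two_mul_sub_sq_pos hs
    have h1 : HasDerivAt (fun s : ℝ => (1 - s) ^ (2 * j + 1))
        (((2 * j + 1 : ℕ) : ℝ) * (1 - s) ^ (2 * j) * (-1)) s := by
      simpa using ((hasDerivAt_id' s).const_sub 1).fun_pow (2 * j + 1)
    have h2 : HasDerivAt (fun s : ℝ => 2 * s - s ^ 2) (2 - 2 * s) s := by
      have := ((hasDerivAt_id' s).const_mul 2).fun_sub ((hasDerivAt_id' s).fun_pow 2)
      simpa using this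
    have h3 := h1.mul (h2.rpow_const (p := lam) (Or.inl hpos.ne'))
    refine h3.congr_deriv ?_
    have hr : (2 * s - s ^ 2) ^ lam = (2 * s - s ^ 2) ^ (lam - 1) * (2 * s - s ^ 2) := by
      rw [← Real.rpow_add_one hpos.ne']; simp
    rw [hr]
    push_cast
    ring

/-- The Taylor coefficients of `besselE` in `z²`. -/
def besselCoeff (lam : ℝ) (j : ℕ) : ℝ := 1 / (4 ^ j * j.factorial * Real.Gamma (j + lam + 1 / 2))

theorem besselCoeff_pos (hlam : 0 < lam) (j : ℕ) : 0 < besselCoeff lam j := by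
  have : 0 < Real.Gamma (j + lam + 1 / 2) := Real.Gamma_pos_of_pos (by positivity)
  unfold besselCoeff
  positivity

/-- The constant of Poisson's integral. -/
def poissonConst (lam : ℝ) : ℝ := 1 / (Real.Gamma (lam + 1 / 2) * poissonMoment lam 0)

theorem poissonConst_pos (hlam : 0 < lam) : 0 < poissonConst lam := by
  have : 0 < Real.Gamma (lam + 1 / 2) := Real.Gamma_pos_of_pos (by positivity)
  have := poissonMoment_zero_pos hlam
  unfold poissonConst
  positivity

theorem besselCoeff_eq_moment (hlam : 0 < lam) (j : ℕ) :
    besselCoeff lam j = poissonConst lam * poissonMoment lam j / (2 * j).factorial := by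
  induction j with
  | zero =>
    have h1 : 0 < Real.Gamma (lam + 1 / 2) := Real.Gamma_pos_of_pos (by positivity)
    have h2 := poissonMoment_zero_pos hlam
    simp [besselCoeff, poissonConst]
    field_simp
  | succ j ih =>
    have hG : Real.Gamma ((j + 1 : ℕ) + lam + 1 / 2) =
        (j + lam + 1 / 2) * Real.Gamma (j + lam + 1 / 2) := by
      rw [← Real.Gamma_add_one (by positivity)]; push_cast; ring_nf
    have h1 : 0 < Real.Gamma (j + lam + 1 / 2) := Real.Gamma_pos_of_pos (by positivity)
    have h2 : besselCoeff lam (j + 1) = besselCoeff lam j / (4 * (j + 1) * (j + lam + 1 / 2)) := by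
      rw [besselCoeff, besselCoeff, hG, Nat.factorial_succ, pow_succ]
      push_cast
      field_simp
    have h3 : poissonMoment lam (j + 1) =
        (j + 1 / 2) * poissonMoment lam j / (j + lam + 1 / 2) := by
      rw [← poissonMoment_succ hlam j]; field_simp
    have h4 : ((2 * (j + 1)).factorial : ℝ) = (2 * j + 2) * ((2 * j + 1) * (2 * j).factorial) := by
      rw [show 2 * (j + 1) = 2 * j + 1 + 1 by ring, Nat.factorial_succ, Nat.factorial_succ]
      push_cast; ring
    rw [h2, ih, h3, h4]
    field_simp
    ring

/-- The entire function `∑ z^{2j} / (4^j j! Γ(j+λ+1/2))`, which is `(z/2)^{1/2-λ} I_{λ-1/2}(z)` in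
terms of the modified Bessel function. -/
def besselE (lam : ℝ) (z : ℂ) : ℂ := ∑' j : ℕ, (besselCoeff lam j : ℂ) * z ^ (2 * j)

/-- Poisson's integral. -/
theorem hasSum_besselE (hlam : 0 < lam) (z : ℂ) :
    HasSum (fun j : ℕ => (besselCoeff lam j : ℂ) * z ^ (2 * j))
      (poissonConst lam * ∫ s, Complex.cosh (z * (1 - s)) ∂(poissonMeas lam)) := by
  have := isFiniteMeasure_poissonMeas hlam
  have h := hasSum_integral_of_dominated_convergence (μ := poissonMeas lam)
    (F := fun (j : ℕ) (s : ℝ) => (z * (1 - s)) ^ (2 * j) / ((2 * j).factorial : ℂ))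
    (f := fun s : ℝ => Complex.cosh (z * (1 - s)))
    (fun j _ => ‖z‖ ^ (2 * j) / (2 * j).factorial)
    (fun j => by fun_prop) (fun j => ?_) ?_ (integrable_const _) ?_
  · have h2 := h.mul_left (poissonConst lam : ℂ)
    refine h2.congr_fun ?_ |> fun h => h
    intro j
    rw [besselCoeff_eq_moment hlam, poissonMoment]
    simp_rw [mul_pow, mul_div_assoc]
    rw [integral_const_mul, integral_div]
    have : ∫ s : ℝ, ((1 : ℂ) - s) ^ (2 * j) ∂(poissonMeas lam) =
        ((∫ s : ℝ, (1 - s) ^ (2 * j) ∂(poissonMeas lam) : ℝ) : ℂ) := by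
      rw [← integral_complex_ofReal]; push_cast; rfl
    rw [this]
    push_cast
    ring
  · filter_upwards [ae_mem_poissonMeas] with s hs
    rw [norm_div, norm_pow, norm_mul, Complex.norm_natCast]
    gcongr
    refine mul_le_of_le_one_right (norm_nonneg _) ?_
    rw [← Complex.ofReal_one, ← Complex.ofReal_sub, Complex.norm_real, Real.norm_eq_abs, abs_le]
    constructor <;> linarith [hs.1, hs.2]
  · refine Eventually.of_forall fun s => ?_
    exact (Real.summable_pow_div_factorial ‖z‖).comp_injective
      (mul_right_injective₀ (two_ne_zero' ℕ))
  · exact Eventually.of_forall fun s => Complex.hasSum_cosh _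

theorem summable_besselE (hlam : 0 < lam) (z : ℂ) :
    Summable fun j : ℕ => (besselCoeff lam j : ℂ) * z ^ (2 * j) := (hasSum_besselE hlam z).summable

theorem integral_poissonMeas_symm (h : ℝ → ℂ) :
    ∫ s, h (2 - s) ∂(poissonMeas lam) = ∫ s, h s ∂(poissonMeas lam) := by
  rw [integral_poissonMeas, integral_poissonMeas, ← integral_Ioc_eq_integral_Ioo,
    ← integral_Ioc_eq_integral_Ioo, ← intervalIntegral.integral_of_le (by norm_num),
    ← intervalIntegral.integral_of_le (by norm_num)]
  have := intervalIntegral.integral_comp_sub_left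
    (fun s : ℝ => ((2 * s - s ^ 2) ^ (lam - 1) : ℝ) • h s) (a := 0) (b := 2) 2
  rw [sub_zero, sub_self] at this
  rw [← this]
  refine intervalIntegral.integral_congr fun s _ => ?_
  rw [show 2 * (2 - s) - (2 - s) ^ 2 = 2 * s - s ^ 2 by ring]

theorem integrable_cexp_poissonMeas (hlam : 0 < lam) (z : ℂ) :
    Integrable (fun s : ℝ => Complex.exp (z * (1 - s))) (poissonMeas lam) := by
  have := isFiniteMeasure_poissonMeas hlam
  refine Integrable.of_bound (by fun_prop) (Real.exp ‖z‖) ?_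
  filter_upwards [ae_mem_poissonMeas] with s hs
  rw [Complex.norm_exp]
  gcongr
  refine (Complex.re_le_norm _).trans ?_
  rw [norm_mul]
  refine mul_le_of_le_one_right (norm_nonneg _) ?_
  rw [← Complex.ofReal_one, ← Complex.ofReal_sub, Complex.norm_real, Real.norm_eq_abs, abs_le]
  constructor <;> linarith [hs.1, hs.2]

/-- Poisson's integral representation of the Bessel function. -/
theorem besselE_eq_integral (hlam : 0 < lam) (z : ℂ) :
    besselE lam z = poissonConst lam * ∫ s, Complex.exp (z * (1 - s)) ∂(poissonMeas lam) := by
  rw [besselE, (hasSum_besselE hlam z).tsum_eq]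
  congr 1
  have h1 : ∀ s : ℝ, Complex.cosh (z * (1 - s)) =
      (Complex.exp (z * (1 - s)) + Complex.exp (-z * (1 - s))) / 2 := fun s => by
    rw [Complex.cosh]; ring_nf
  simp_rw [h1]
  rw [integral_div, integral_add (integrable_cexp_poissonMeas hlam z)
    (integrable_cexp_poissonMeas hlam (-z)),
    ← integral_poissonMeas_symm (fun s : ℝ => Complex.exp (-z * (1 - s)))]
  have h2 : ∀ s : ℝ, Complex.exp (-z * (1 - ((2 - s : ℝ) : ℂ))) = Complex.exp (z * (1 - s)) :=
    fun s => by push_cast; ring_nf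
  simp_rw [h2]
  ring

theorem norm_besselE_le (hlam : 0 < lam) (z : ℂ) :
    ‖besselE lam z‖ ≤ poissonConst lam * poissonMoment lam 0 * Real.exp |z.re| := by
  have := isFiniteMeasure_poissonMeas hlam
  rw [besselE_eq_integral hlam, norm_mul, Complex.norm_real,
    Real.norm_of_nonneg (poissonConst_pos hlam).le, mul_assoc]
  refine mul_le_mul_of_nonneg_left ?_ (poissonConst_pos hlam).le
  have := norm_integral_le_of_norm_le_const (μ := poissonMeas lam)
    (f := fun s : ℝ => Complex.exp (z * (1 - s))) (C := Real.exp |z.re|) ?_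
  · refine this.trans (le_of_eq ?_)
    simp [poissonMoment, mul_comm]
  · filter_upwards [ae_mem_poissonMeas] with s hs
    rw [Complex.norm_exp]
    gcongr
    have : (z * (1 - (s : ℂ))).re = z.re * (1 - s) := by simp
    rw [this]
    refine (le_abs_self _).trans ?_
    rw [abs_mul]
    refine mul_le_of_le_one_right (abs_nonneg _) (abs_le.2 ?_)
    constructor <;> linarith [hs.1, hs.2]

theorem besselCoeff_succ (hlam : 0 < lam) (j : ℕ) :
    besselCoeff lam (j + 1) * (2 * (j + 1)) = besselCoeff (lam + 1) j / 2 := by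
  have h1 : 0 < Real.Gamma (j + (lam + 1) + 1 / 2) := Real.Gamma_pos_of_pos (by positivity)
  rw [besselCoeff, besselCoeff, Nat.factorial_succ, pow_succ,
    show ((j + 1 : ℕ) : ℝ) + lam + 1 / 2 = j + (lam + 1) + 1 / 2 by push_cast; ring]
  push_cast
  field_simp
  ring

theorem hasDerivAt_besselE (hlam : 0 < lam) (z : ℂ) :
    HasDerivAt (besselE lam) (z / 2 * besselE (lam + 1) z) z := by
  have hlam1 : 0 < lam + 1 := by linarith
  let g' : ℕ → ℂ → ℂ := fun j w => (besselCoeff lam j : ℂ) * ((2 * j : ℕ) * w ^ (2 * j - 1))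
  have hshift : ∀ w : ℂ, (fun j => g' (j + 1) w) =
      fun j => w / 2 * ((besselCoeff (lam + 1) j : ℂ) * w ^ (2 * j)) := fun w => by
    funext j
    have := besselCoeff_succ hlam j
    have hc : (besselCoeff lam (j + 1) : ℂ) * (2 * (j + 1)) = (besselCoeff (lam + 1) j : ℂ) / 2 := by
      exact_mod_cast congrArg (fun x : ℝ => (x : ℂ)) this
    simp only [g']
    rw [show 2 * (j + 1) - 1 = 2 * j + 1 by lia, pow_succ]
    push_cast
    linear_combination (w ^ (2 * j) * w) * hc
  have hsum' : ∀ w : ℂ, HasSum (fun j => g' j w) (w / 2 * besselE (lam + 1) w) := fun w => by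
    rw [← hasSum_nat_add_iff' 1, hshift w]
    have h0 : ∑ i ∈ Finset.range 1, g' i w = 0 := by simp [g']
    rw [h0, sub_zero]
    exact (summable_besselE hlam1 w).hasSum.mul_left (w / 2)
  let R : ℝ := ‖z‖ + 1
  have hu : Summable fun j : ℕ => ‖g' j (R : ℂ)‖ := (hsum' R).summable.norm
  have h := hasDerivAt_tsum_of_isPreconnected (𝕜 := ℂ) hu (t := Metric.ball 0 R)
    (g := fun j w => (besselCoeff lam j : ℂ) * w ^ (2 * j)) (g' := g') Metric.isOpen_ball
    (convex_ball _ _).isPreconnected (fun j w _ => ?_) (fun j w hw => ?_) (y₀ := z) (y := z)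
    (by simp [R]) (summable_besselE hlam z) (by simp [R])
  · rw [(hsum' z).tsum_eq] at h
    exact h
  · exact (hasDerivAt_pow (2 * j) w).const_mul _
  · simp only [g', norm_mul, norm_pow]
    gcongr
    rw [mem_ball_zero_iff] at hw
    refine hw.le.trans (le_of_eq ?_)
    rw [Complex.norm_real, Real.norm_of_nonneg (by positivity)]

theorem differentiable_besselE (hlam : 0 < lam) : Differentiable ℂ (besselE lam) :=
  fun z => (hasDerivAt_besselE hlam z).differentiableAt

theorem continuous_besselE (hlam : 0 < lam) : Continuous (besselE lam) :=
  (differentiable_besselE hlam).continuous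

theorem phi_eq_besselE {s : ℝ} (hs : 0 < s) :
    (phi lam s : ℂ) = ((2 ^ (1 / 2 - lam) : ℝ) : ℂ) * besselE lam (Complex.I * s) := by
  rw [phi, besselJ, besselE, ← tsum_mul_left, ← tsum_mul_left, Complex.ofReal_tsum]
  refine tsum_congr fun m => ?_
  have h1 : (s / 2) ^ (2 * (m : ℝ) + (lam - 1 / 2)) = (s / 2) ^ (2 * m) * (s / 2) ^ (lam - 1 / 2) := by
    rw [Real.rpow_add (by positivity)]
    congr 1
    exact_mod_cast Real.rpow_natCast (s / 2) (2 * m)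
  have h2 : s ^ (1 / 2 - lam) * (s / 2) ^ (lam - 1 / 2) = 2 ^ (1 / 2 - lam) := by
    rw [Real.div_rpow hs.le (by norm_num), mul_div_assoc', ← Real.rpow_add hs,
      show (1 / 2 - lam) + (lam - 1 / 2) = 0 by ring, Real.rpow_zero,
      show (1 / 2 - lam) = -(lam - 1 / 2) by ring, Real.rpow_neg (by norm_num), one_div]
  have h3 : (Complex.I * (s : ℂ)) ^ (2 * m) = (((-1) ^ m * s ^ (2 * m) : ℝ) : ℂ) := by
    rw [mul_pow, pow_mul, Complex.I_sq]; push_cast; ring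
  rw [h3, h1, ← Complex.ofReal_mul, ← Complex.ofReal_mul, ← h2, besselCoeff]
  congr 1
  rw [show (m : ℝ) + (lam - 1 / 2) + 1 = m + lam + 1 / 2 by ring, div_pow s 2 (2 * m),
    pow_mul 2 2 m]
  norm_num
  field_simp

/-- A Gaussian integral, evaluated term by term: the heat semigroup generated by the Bessel operator
and the Bessel transform of a Gaussian are both read off from it. -/
theorem integral_gaussian_mul_besselE (hlam : 0 < lam) {a : ℝ} (ha : 0 < a) (z : ℂ) :
    ∫ y in Ioi (0 : ℝ), ((y ^ (2 * lam) * Real.exp (-a * y ^ 2) : ℝ) : ℂ) * besselE lam (z * y) =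
      ((a ^ (-(lam + 1 / 2)) / 2 : ℝ) : ℂ) * Complex.exp (z ^ 2 / (4 * a)) := by
  let Fj : ℕ → ℝ → ℂ := fun j y =>
    (((besselCoeff lam j : ℝ) : ℂ) * z ^ (2 * j)) * ((y ^ (2 * lam + 2 * j) * Real.exp (-a * y ^ 2) : ℝ) : ℂ)
  have hq : ∀ j : ℕ, -1 < 2 * lam + 2 * (j : ℝ) := fun j => by
    have : (0 : ℝ) ≤ j := Nat.cast_nonneg j
    linarith
  have hint : ∀ j : ℕ, IntegrableOn (fun y : ℝ => y ^ (2 * lam + 2 * (j : ℝ)) * Real.exp (-a * y ^ 2))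
      (Ioi 0) := fun j => by
    simpa using integrableOn_rpow_mul_exp_neg_mul_sq ha (hq j)
  have hval : ∀ j : ℕ, ∫ y in Ioi (0 : ℝ), y ^ (2 * lam + 2 * (j : ℝ)) * Real.exp (-a * y ^ 2) =
      a ^ (-(lam + 1 / 2)) / 2 * (Real.Gamma (j + lam + 1 / 2) / a ^ j) := fun j => by
    have := integral_rpow_mul_exp_neg_mul_rpow (p := 2) two_pos (hq j) ha
    simp only [Real.rpow_two] at this
    rw [this, show -(2 * lam + 2 * (j : ℝ) + 1) / 2 = -(lam + 1 / 2) - j by ring,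
      show (2 * lam + 2 * (j : ℝ) + 1) / 2 = j + lam + 1 / 2 by ring, Real.rpow_sub ha,
      Real.rpow_natCast]
    ring
  have hcoef : ∀ j : ℕ, besselCoeff lam j * (Real.Gamma (j + lam + 1 / 2) / a ^ j) =
      (1 / (4 * a)) ^ j / j.factorial := fun j => by
    have h1 : 0 < Real.Gamma (j + lam + 1 / 2) := Real.Gamma_pos_of_pos (by positivity)
    rw [besselCoeff, one_div_pow, mul_pow]
    field_simp
  have hnorm : ∀ j : ℕ, ∫ y in Ioi (0 : ℝ), ‖Fj j y‖ =
      a ^ (-(lam + 1 / 2)) / 2 * ((‖z‖ ^ 2 / (4 * a)) ^ j / j.factorial) := fun j => by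
    have : ∀ y ∈ Ioi (0 : ℝ), ‖Fj j y‖ = besselCoeff lam j * ‖z‖ ^ (2 * j) *
        (y ^ (2 * lam + 2 * (j : ℝ)) * Real.exp (-a * y ^ 2)) := fun y hy => by
      have hy' : (0 : ℝ) < y := hy
      simp only [Fj]
      rw [norm_mul, norm_mul, norm_pow, Complex.norm_real, Complex.norm_real,
        Real.norm_of_nonneg (besselCoeff_pos hlam j).le, Real.norm_of_nonneg (by positivity)]
    rw [setIntegral_congr_fun measurableSet_Ioi this, integral_const_mul, hval]
    rw [show ∀ A B C D : ℝ, A * B * (C * D) = C * B * (A * D) by intros; ring, hcoef, div_pow,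
      div_pow, one_pow, pow_mul]
    ring
  have hsum := hasSum_integral_of_summable_integral_norm (μ := volume.restrict (Ioi (0 : ℝ)))
    (F := Fj) (fun j => ((hint j).ofReal).const_mul _) (by
      simp_rw [hnorm]
      exact (Real.summable_pow_div_factorial _).mul_left _)
  have hl : ∀ y ∈ Ioi (0 : ℝ), ((y ^ (2 * lam) * Real.exp (-a * y ^ 2) : ℝ) : ℂ) *
      besselE lam (z * y) = ∑' j, Fj j y := fun y hy => by
    have hy' : (0 : ℝ) < y := hy
    rw [besselE, ← tsum_mul_left]
    refine tsum_congr fun j => ?_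
    have : y ^ (2 * lam + 2 * (j : ℝ)) = y ^ (2 * lam) * y ^ (2 * j) := by
      rw [Real.rpow_add hy']
      congr 1
      exact_mod_cast Real.rpow_natCast y (2 * j)
    simp only [Fj, this, mul_pow]
    push_cast
    ring
  rw [setIntegral_congr_fun measurableSet_Ioi hl, ← hsum.tsum_eq]
  have hterm : ∀ j : ℕ, ∫ y in Ioi (0 : ℝ), Fj j y =
      ((a ^ (-(lam + 1 / 2)) / 2 : ℝ) : ℂ) * ((z ^ 2 / (4 * a)) ^ j / j.factorial) := fun j => by
    simp only [Fj]
    rw [integral_const_mul, integral_complex_ofReal, hval]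
    have := congrArg (fun x : ℝ => (x : ℂ)) (hcoef j)
    push_cast at this ⊢
    rw [show ∀ A B C D : ℂ, A * B * (C * D) = C * B * (A * D) by intros; ring, this, div_pow,
      div_pow, one_pow, pow_mul]
    ring
  simp_rw [hterm]
  rw [tsum_mul_left]
  congr 1
  rw [Complex.exp_eq_exp_ℂ, NormedSpace.exp_eq_tsum_div]

end BesselFunction

/-! ### Integration on the half-space -/

section HalfSpace

variable {n : ℕ} {lam : ℝ}

theorem measurableSet_halfSpace (n : ℕ) : MeasurableSet (halfSpace n : Set (Eu n)) :=
  (halfSpace n).isOpen.measurableSet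

instance instSigmaFiniteLeb (n : ℕ) : SigmaFinite (leb n) :=
  SigmaFinite.of_map _ measurable_subtype_coe.aemeasurable (by
    have h : Measure.map (Subtype.val : halfSpace n → Eu n) (leb n)
      = volume.restrict (halfSpace n : Set (Eu n)) :=
      map_comap_subtype_coe (measurableSet_halfSpace n) volume
    rw [h]
    infer_instance)

instance instSigmaFiniteMMeas (n : ℕ) (lam : ℝ) : SigmaFinite (mMeas n lam) :=
  SigmaFinite.withDensity_ofReal _

theorem continuous_ht : Continuous (ht (n := n)) := by
  unfold ht; fun_prop

theorem integral_leb (f : Eu n → ℂ) :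
    ∫ y : halfSpace n, f y.1 ∂(leb n) = ∫ y in (halfSpace n : Set (Eu n)), f y :=
  integral_subtype_comap (measurableSet_halfSpace n) f

theorem integral_mMeas (f : halfSpace n → ℂ) :
    ∫ y, f y ∂(mMeas n lam) = ∫ y, ((ht y ^ (2 * lam) : ℝ) : ℂ) * f y ∂(leb n) := by
  rw [mMeas, integral_withDensity_eq_integral_toReal_smul (measurable_density n lam) (by simp)]
  refine integral_congr_ae (Filter.Eventually.of_forall fun y => ?_)
  simp only
  rw [ENNReal.toReal_ofReal (Real.rpow_nonneg (ht_pos y).le _), Complex.real_smul]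

theorem integrable_mMeas_iff (f : halfSpace n → ℂ) :
    Integrable f (mMeas n lam) ↔
      Integrable (fun y => ((ht y ^ (2 * lam) : ℝ) : ℂ) * f y) (leb n) := by
  rw [mMeas, integrable_withDensity_iff_integrable_smul' (measurable_density n lam) (by simp)]
  refine integrable_congr (Filter.Eventually.of_forall fun y => ?_)
  simp only
  rw [ENNReal.toReal_ofReal (Real.rpow_nonneg (ht_pos y).le _), Complex.real_smul]

theorem integrable_leb_iff (f : Eu n → ℂ) :
    Integrable (fun y : halfSpace n => f y.1) (leb n) ↔
      IntegrableOn f (halfSpace n : Set (Eu n)) :=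
  ((MeasurableEmbedding.subtype_coe (measurableSet_halfSpace n)).integrableOn_range_iff_comap).symm.trans
    (by simp)

/-- The factors of a product function on `ℝ^{n+1}`, the last one being cut off to `(0,∞)` and
multiplied by the density `s^{2λ}`. -/
def prodFactor (lam : ℝ) (f : Fin n → ℝ → ℂ) (k : ℝ → ℂ) : Fin (n + 1) → ℝ → ℂ :=
  Fin.lastCases (motive := fun _ => ℝ → ℂ)
    ((Ioi (0 : ℝ)).indicator fun s => ((s ^ (2 * lam) : ℝ) : ℂ) * k s) f

theorem prod_prodFactor (f : Fin n → ℝ → ℂ) (k : ℝ → ℂ) (y : Eu n) :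
    ∏ i, prodFactor lam f k i (y i) = (halfSpace n : Set (Eu n)).indicator
      (fun y => ((y (Fin.last n) ^ (2 * lam) : ℝ) : ℂ) *
        ((∏ j, f j (y j.castSucc)) * k (y (Fin.last n)))) y := by
  rw [Fin.prod_univ_castSucc]
  simp only [prodFactor, Fin.lastCases_castSucc, Fin.lastCases_last]
  by_cases hy : 0 < y (Fin.last n)
  · rw [indicator_of_mem (show y (Fin.last n) ∈ Ioi (0 : ℝ) from hy),
      indicator_of_mem (show y ∈ (halfSpace n : Set (Eu n)) from hy)]
    ring
  · rw [indicator_of_notMem (show y (Fin.last n) ∉ Ioi (0 : ℝ) from hy),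
      indicator_of_notMem (show y ∉ (halfSpace n : Set (Eu n)) from hy), mul_zero]

/-- Fubini's theorem for product functions on the half-space. -/
theorem integral_mMeas_prod (f : Fin n → ℝ → ℂ) (k : ℝ → ℂ) :
    ∫ y : halfSpace n, (∏ j, f j (y.1 j.castSucc)) * k (ht y) ∂(mMeas n lam) =
      (∏ j, ∫ s, f j s) * ∫ s in Ioi (0 : ℝ), ((s ^ (2 * lam) : ℝ) : ℂ) * k s := by
  rw [integral_mMeas]
  refine (integral_leb fun y : Eu n => ((y (Fin.last n) ^ (2 * lam) : ℝ) : ℂ) *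
        ((∏ j, f j (y j.castSucc)) * k (y (Fin.last n)))).trans ?_
  rw [← integral_indicator (measurableSet_halfSpace n)]
  simp_rw [← prod_prodFactor]
  have h := (PiLp.volume_preserving_ofLp (Fin (n + 1))).integral_comp
    (MeasurableEquiv.toLp 2 (Fin (n + 1) → ℝ)).symm.measurableEmbedding
    (fun y : Fin (n + 1) → ℝ => ∏ i, prodFactor lam f k i (y i))
  refine h.trans ?_
  rw [integral_fintype_prod_volume_eq_prod, Fin.prod_univ_castSucc]
  simp only [prodFactor, Fin.lastCases_castSucc, Fin.lastCases_last]
  rw [integral_indicator measurableSet_Ioi]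

theorem integrable_mMeas_prod {f : Fin n → ℝ → ℂ} {k : ℝ → ℂ} (hf : ∀ j, Integrable (f j))
    (hk : IntegrableOn (fun s : ℝ => ((s ^ (2 * lam) : ℝ) : ℂ) * k s) (Ioi 0)) :
    Integrable (fun y : halfSpace n => (∏ j, f j (y.1 j.castSucc)) * k (ht y)) (mMeas n lam) := by
  rw [integrable_mMeas_iff]
  refine (integrable_leb_iff fun y : Eu n => ((y (Fin.last n) ^ (2 * lam) : ℝ) : ℂ) *
        ((∏ j, f j (y j.castSucc)) * k (y (Fin.last n)))).2 ?_
  rw [← integrable_indicator_iff (measurableSet_halfSpace n)]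
  have h1 : Integrable (fun y : Fin (n + 1) → ℝ => ∏ i, prodFactor lam f k i (y i)) := by
    refine Integrable.fintype_prod fun i => ?_
    refine Fin.lastCases ?_ (fun j => ?_) i
    · simp only [prodFactor, Fin.lastCases_last]
      exact (integrable_indicator_iff measurableSet_Ioi).2 hk
    · simp only [prodFactor, Fin.lastCases_castSucc]
      exact hf j
  have h2 := ((PiLp.volume_preserving_ofLp (Fin (n + 1))).integrable_comp_emb
    (MeasurableEquiv.toLp 2 (Fin (n + 1) → ℝ)).symm.measurableEmbedding).2 h1
  refine h2.congr (Filter.Eventually.of_forall fun y => ?_)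
  exact prod_prodFactor f k y

end HalfSpace

/-! ### Gaussians on the half-space -/

section Gaussians

variable {n : ℕ} {lam : ℝ}

/-- Half the homogeneous dimension `n + 2λ + 1` of `m_λ`. -/
def halfDim (n : ℕ) (lam : ℝ) : ℝ := n / 2 + lam + 1 / 2

theorem halfDim_pos (n : ℕ) (hlam : 0 < lam) : 0 < halfDim n lam := by
  unfold halfDim; positivity

/-- The Gaussian `exp(-a|y|² + ∑_{j ≤ n} w_j y_j)`; it is even in the last variable. -/
def gaussE (a : ℝ) (w : Fin n → ℂ) (y : Eu n) : ℂ :=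
  Complex.exp (-(a : ℂ) * ((‖y‖ ^ 2 : ℝ) : ℂ) + ∑ j, w j * (y j.castSucc : ℂ))

theorem continuous_gaussE (a : ℝ) (w : Fin n → ℂ) : Continuous (gaussE a w) := by
  unfold gaussE; fun_prop

theorem gaussE_add (a b : ℝ) (w v : Fin n → ℂ) (y : Eu n) :
    gaussE (a + b) (w + v) y = gaussE a w y * gaussE b v y := by
  rw [gaussE, gaussE, gaussE, ← Complex.exp_add]
  congr 1
  simp only [Pi.add_apply, add_mul, Finset.sum_add_distrib]
  push_cast
  ring

theorem conj_gaussE (a : ℝ) (w : Fin n → ℂ) (y : Eu n) :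
    (starRingEnd ℂ) (gaussE a w y) = gaussE a (fun j => (starRingEnd ℂ) (w j)) y := by
  rw [gaussE, gaussE, ← Complex.exp_conj]
  simp

theorem gaussE_eq_prod (a : ℝ) (w : Fin n → ℂ) (y : Eu n) :
    gaussE a w y = (∏ j, Complex.exp (-(a : ℂ) * (y j.castSucc : ℂ) ^ 2 + w j * y j.castSucc + 0)) *
      ((Real.exp (-a * y (Fin.last n) ^ 2) : ℝ) : ℂ) := by
  rw [gaussE, ← Complex.exp_sum, Complex.ofReal_exp, ← Complex.exp_add,
    EuclideanSpace.norm_sq_eq, Fin.sum_univ_castSucc]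
  congr 1
  simp only [Finset.sum_add_distrib, ← Finset.mul_sum, Real.norm_eq_abs, sq_abs]
  push_cast
  simp
  ring

theorem integrableOn_gaussian_mul_besselE (hlam : 0 < lam) (a : ℝ) (ha : 0 < a) (z : ℂ) :
    IntegrableOn (fun s : ℝ => ((s ^ (2 * lam) : ℝ) : ℂ) *
      (((Real.exp (-a * s ^ 2) : ℝ) : ℂ) * besselE lam (z * s))) (Ioi 0) := by
  set C := poissonConst lam * poissonMoment lam 0 with hC
  have hC0 : 0 < C := mul_pos (poissonConst_pos hlam) (poissonMoment_zero_pos hlam)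
  have h1 : IntegrableOn (fun s : ℝ => C * Real.exp (|z.re| ^ 2 / (2 * a)) *
      (s ^ (2 * lam) * Real.exp (-(a / 2) * s ^ 2))) (Ioi 0) :=
    (integrableOn_rpow_mul_exp_neg_mul_sq (by positivity) (by linarith)).const_mul _
  refine Integrable.mono' h1 ?_ ?_
  · have h2 : Measurable fun s : ℝ => ((s ^ (2 * lam) : ℝ) : ℂ) :=
      Complex.measurable_ofReal.comp (measurable_id.pow_const _)
    have h3 : Continuous fun s : ℝ => ((Real.exp (-a * s ^ 2) : ℝ) : ℂ) * besselE lam (z * s) := by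
      have := continuous_besselE hlam
      fun_prop
    exact (h2.mul h3.measurable).aestronglyMeasurable
  · filter_upwards [ae_restrict_mem measurableSet_Ioi] with s hs
    have hs' : (0 : ℝ) < s := hs
    rw [norm_mul, norm_mul, Complex.norm_real, Complex.norm_real, Real.norm_of_nonneg (by positivity),
      Real.norm_of_nonneg (by positivity)]
    have h4 := norm_besselE_le hlam (z * s)
    have h5 : |(z * (s : ℂ)).re| = |z.re| * s := by
      simp [abs_mul, abs_of_pos hs']
    rw [← hC, h5] at h4
    have h6 : Real.exp (-a * s ^ 2) * Real.exp (|z.re| * s) ≤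
        Real.exp (|z.re| ^ 2 / (2 * a)) * Real.exp (-(a / 2) * s ^ 2) := by
      rw [← Real.exp_add, ← Real.exp_add]
      refine Real.exp_le_exp.2 ?_
      have : |z.re| * s ≤ |z.re| ^ 2 / (2 * a) + a / 2 * s ^ 2 := by
        have h7 : |z.re| ^ 2 / (2 * a) + a / 2 * s ^ 2 - |z.re| * s =
            (|z.re| - a * s) ^ 2 / (2 * a) := by
          field_simp; ring
        have h8 : 0 ≤ (|z.re| - a * s) ^ 2 / (2 * a) := by positivity
        linarith
      linarith
    calc s ^ (2 * lam) * (Real.exp (-a * s ^ 2) * ‖besselE lam (z * s)‖)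
        ≤ s ^ (2 * lam) * (Real.exp (-a * s ^ 2) * (C * Real.exp (|z.re| * s))) := by gcongr
      _ = C * s ^ (2 * lam) * (Real.exp (-a * s ^ 2) * Real.exp (|z.re| * s)) := by ring
      _ ≤ C * s ^ (2 * lam) *
          (Real.exp (|z.re| ^ 2 / (2 * a)) * Real.exp (-(a / 2) * s ^ 2)) := by gcongr
      _ = _ := by ring

theorem integrable_gaussE_mul_besselE (hlam : 0 < lam) {a : ℝ} (ha : 0 < a) (w : Fin n → ℂ) (z : ℂ) :
    Integrable (fun y : halfSpace n => gaussE a w y.1 * besselE lam (z * ht y)) (mMeas n lam) := by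
  have h := integrable_mMeas_prod (n := n) (lam := lam)
    (f := fun j s => Complex.exp (-(a : ℂ) * (s : ℂ) ^ 2 + w j * s + 0))
    (k := fun s => ((Real.exp (-a * s ^ 2) : ℝ) : ℂ) * besselE lam (z * s))
    (fun j => integrable_cexp_quadratic' (by simpa using ha) _ _)
    (integrableOn_gaussian_mul_besselE hlam a ha z)
  refine h.congr (Filter.Eventually.of_forall fun y => ?_)
  simp only
  rw [gaussE_eq_prod, mul_assoc]
  rfl

/-- The basic Gaussian integral on the half-space. -/
theorem integral_gaussE_mul_besselE (hlam : 0 < lam) {a : ℝ} (ha : 0 < a) (w : Fin n → ℂ) (z : ℂ) :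
    ∫ y : halfSpace n, gaussE a w y.1 * besselE lam (z * ht y) ∂(mMeas n lam) =
      ((Real.pi ^ ((n : ℝ) / 2) / 2 * a ^ (-halfDim n lam) : ℝ) : ℂ) *
        Complex.exp ((∑ j, w j ^ 2 + z ^ 2) / (4 * a)) := by
  have h := integral_mMeas_prod (n := n) (lam := lam)
    (fun j s => Complex.exp (-(a : ℂ) * (s : ℂ) ^ 2 + w j * s + 0))
    (fun s => ((Real.exp (-a * s ^ 2) : ℝ) : ℂ) * besselE lam (z * s))
  have h1 : ∀ j, ∫ s : ℝ, Complex.exp (-(a : ℂ) * (s : ℂ) ^ 2 + w j * s + 0) =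
      (((Real.pi / a) ^ (1 / 2 : ℝ) : ℝ) : ℂ) * Complex.exp (w j ^ 2 / (4 * a)) := fun j => by
    rw [integral_cexp_quadratic (by simpa using ha), Complex.ofReal_cpow (by positivity)]
    push_cast
    congr 2
    · simp
    · rw [zero_sub, mul_neg, div_neg, neg_neg]
  have h2 : ∫ s in Ioi (0 : ℝ), ((s ^ (2 * lam) : ℝ) : ℂ) *
      (((Real.exp (-a * s ^ 2) : ℝ) : ℂ) * besselE lam (z * s)) =
      ((a ^ (-(lam + 1 / 2)) / 2 : ℝ) : ℂ) * Complex.exp (z ^ 2 / (4 * a)) := by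
    rw [← integral_gaussian_mul_besselE hlam ha z]
    refine setIntegral_congr_fun measurableSet_Ioi fun s _ => ?_
    push_cast
    ring
  have h3 : ∀ y : halfSpace n, gaussE a w y.1 * besselE lam (z * ht y) =
      (∏ j, Complex.exp (-(a : ℂ) * (y.1 j.castSucc : ℂ) ^ 2 + w j * y.1 j.castSucc + 0)) *
        (((Real.exp (-a * ht y ^ 2) : ℝ) : ℂ) * besselE lam (z * ht y)) := fun y => by
    rw [gaussE_eq_prod, mul_assoc]
    rfl
  simp_rw [h3]
  rw [h, h2]
  simp_rw [h1]
  rw [Finset.prod_mul_distrib, Finset.prod_const, ← Complex.exp_sum, Finset.card_univ,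
    Fintype.card_fin, add_div, Complex.exp_add, ← Finset.sum_div]
  have h4 : ((Real.pi / a) ^ (1 / 2 : ℝ)) ^ n * (a ^ (-(lam + 1 / 2)) / 2) =
      Real.pi ^ ((n : ℝ) / 2) / 2 * a ^ (-halfDim n lam) := by
    rw [← Real.rpow_mul_natCast (by positivity), Real.div_rpow Real.pi_pos.le ha.le,
      show -halfDim n lam = -(lam + 1 / 2) - (1 / 2 * n) by unfold halfDim; ring,
      Real.rpow_sub ha, show (n : ℝ) / 2 = 1 / 2 * n by ring]
    ring
  rw [← h4]
  push_cast
  ring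

theorem besselE_zero : besselE lam 0 = besselCoeff lam 0 := by
  rw [besselE, tsum_eq_single 0]
  · simp
  · intro j hj; simp [hj]

theorem integrable_gaussE (hlam : 0 < lam) {a : ℝ} (ha : 0 < a) (w : Fin n → ℂ) :
    Integrable (fun y : halfSpace n => gaussE a w y.1) (mMeas n lam) := by
  have h := integrable_gaussE_mul_besselE hlam ha w 0
  simp only [zero_mul, besselE_zero] at h
  have h0 : (besselCoeff lam 0 : ℂ) ≠ 0 := by exact_mod_cast (besselCoeff_pos hlam 0).ne'
  simpa [mul_assoc, h0] using h.mul_const ((besselCoeff lam 0 : ℂ)⁻¹)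

theorem memLp_gaussE (hlam : 0 < lam) {a : ℝ} (ha : 0 < a) (w : Fin n → ℂ) :
    MemLp (fun y : halfSpace n => gaussE a w y.1) 2 (mMeas n lam) := by
  have hm : AEStronglyMeasurable (fun y : halfSpace n => gaussE a w y.1) (mMeas n lam) :=
    ((continuous_gaussE a w).comp continuous_subtype_val).aestronglyMeasurable
  rw [memLp_two_iff_integrable_sq_norm hm]
  have h := (integrable_gaussE (n := n) hlam (a := a + a) (by linarith)
    ((fun j => (starRingEnd ℂ) (w j)) + w)).norm
  refine h.congr (Filter.Eventually.of_forall fun y => ?_)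
  simp only
  rw [gaussE_add, ← conj_gaussE, norm_mul, RCLike.norm_conj, pow_two]

/-! ### The Bessel–Fourier kernel -/

/-- The kernel `(2π)^{-n/2} e^{-iε⟨y',ξ'⟩} φ_λ(y_{n+1} ξ_{n+1})`: that of `𝓕 ⊗ U_λ` for `ε = 1`, and its
complex conjugate, that of the inverse, for `ε = -1`. -/
def bfKernel (n : ℕ) (lam ε : ℝ) (y ξ : halfSpace n) : ℂ :=
  (((2 * Real.pi) ^ (-(n : ℝ) / 2) : ℝ) : ℂ) *
    (Complex.exp (-(ε : ℂ) * Complex.I * ((∑ j : Fin n, y.1 j.castSucc * ξ.1 j.castSucc : ℝ) : ℂ)) *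
      (phi lam (ht y * ht ξ) : ℂ))

/-- The integral transform with kernel `bfKernel`. -/
def bfTransform (n : ℕ) (lam ε : ℝ) (f : halfSpace n → ℂ) (ξ : halfSpace n) : ℂ :=
  ∫ y, f y * bfKernel n lam ε y ξ ∂(mMeas n lam)

theorem besselFourierIntegral_eq (f : Eu n → ℂ) :
    besselFourierIntegral n lam f = bfTransform n lam 1 fun y => f y.1 := by
  funext ξ
  rw [besselFourierIntegral, bfTransform, ← integral_const_mul]
  refine integral_congr_ae (Filter.Eventually.of_forall fun y => ?_)
  simp only [bfKernel, Complex.ofReal_one, neg_mul, one_mul]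
  ring

theorem bfKernel_comm (ε : ℝ) (y ξ : halfSpace n) :
    bfKernel n lam ε y ξ = bfKernel n lam ε ξ y := by
  simp only [bfKernel, mul_comm]

theorem conj_bfKernel (ε : ℝ) (y ξ : halfSpace n) :
    (starRingEnd ℂ) (bfKernel n lam ε y ξ) = bfKernel n lam (-ε) y ξ := by
  simp only [bfKernel, map_mul, Complex.conj_ofReal, ← Complex.exp_conj, Complex.conj_I, map_neg]
  congr 3
  push_cast
  ring

theorem conj_bfTransform (ε : ℝ) (f : halfSpace n → ℂ) (ξ : halfSpace n) :
    (starRingEnd ℂ) (bfTransform n lam ε f ξ) =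
      bfTransform n lam (-ε) (fun y => (starRingEnd ℂ) (f y)) ξ := by
  rw [bfTransform, bfTransform, ← integral_conj]
  simp only [map_mul, conj_bfKernel]

theorem bfKernel_eq (ε : ℝ) (y ξ : halfSpace n) :
    bfKernel n lam ε y ξ =
      (((2 * Real.pi) ^ (-(n : ℝ) / 2) * 2 ^ (1 / 2 - lam) : ℝ) : ℂ) *
        (Complex.exp (∑ j : Fin n, (-(ε : ℂ) * Complex.I * ξ.1 j.castSucc) * y.1 j.castSucc) *
          besselE lam (Complex.I * ht ξ * ht y)) := by
  rw [bfKernel, phi_eq_besselE (mul_pos (ht_pos y) (ht_pos ξ))]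
  push_cast
  rw [Finset.mul_sum, show Complex.I * ((ht y : ℂ) * ht ξ) = Complex.I * ht ξ * ht y by ring]
  have : ∀ j : Fin n, -(ε : ℂ) * Complex.I * ((y.1 j.castSucc : ℂ) * ξ.1 j.castSucc) =
      -(ε : ℂ) * Complex.I * ξ.1 j.castSucc * y.1 j.castSucc := fun j => by ring
  simp_rw [this]
  ring

theorem continuous_bfKernel (hlam : 0 < lam) (ε : ℝ) :
    Continuous fun p : halfSpace n × halfSpace n => bfKernel n lam ε p.1 p.2 := by
  simp_rw [bfKernel_eq]
  have h1 := continuous_besselE hlam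
  have h2 := continuous_ht (n := n)
  fun_prop

/-- A bound for `|bfKernel|`. -/
def bfBound (n : ℕ) (lam : ℝ) : ℝ :=
  (2 * Real.pi) ^ (-(n : ℝ) / 2) * 2 ^ (1 / 2 - lam) * (poissonConst lam * poissonMoment lam 0)

theorem norm_bfKernel_le (hlam : 0 < lam) (ε : ℝ) (y ξ : halfSpace n) :
    ‖bfKernel n lam ε y ξ‖ ≤ bfBound n lam := by
  rw [bfKernel_eq, norm_mul, norm_mul, Complex.norm_real, Complex.norm_exp,
    Real.norm_of_nonneg (by positivity), bfBound]
  have h1 : (∑ j : Fin n, (-(ε : ℂ) * Complex.I * ξ.1 j.castSucc) * y.1 j.castSucc).re = 0 := by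
    simp
  have h2 := norm_besselE_le hlam (Complex.I * ht ξ * ht y)
  have h3 : (Complex.I * (ht ξ : ℂ) * ht y).re = 0 := by simp
  rw [h3, abs_zero, Real.exp_zero, mul_one] at h2
  rw [h1, Real.exp_zero, one_mul]
  gcongr

/-- Fubini's theorem for the transform. -/
theorem integral_bfTransform_mul (hlam : 0 < lam) (ε : ℝ) {f g : halfSpace n → ℂ}
    (hf : Integrable f (mMeas n lam)) (hg : Integrable g (mMeas n lam)) :
    ∫ ξ, bfTransform n lam ε f ξ * g ξ ∂(mMeas n lam) =
      ∫ y, f y * bfTransform n lam ε g y ∂(mMeas n lam) := by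
  have hI : Integrable (Function.uncurry fun ξ y : halfSpace n => f y * bfKernel n lam ε y ξ * g ξ)
      ((mMeas n lam).prod (mMeas n lam)) := by
    have h1 : Integrable (fun p : halfSpace n × halfSpace n => g p.1 * f p.2)
        ((mMeas n lam).prod (mMeas n lam)) := hg.mul_prod hf
    have h2 := h1.mul_bdd (c := bfBound n lam)
      (g := fun p : halfSpace n × halfSpace n => bfKernel n lam ε p.2 p.1)
      ((continuous_bfKernel hlam ε).comp continuous_swap).aestronglyMeasurable
      (Filter.Eventually.of_forall fun p => norm_bfKernel_le hlam ε p.2 p.1)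
    refine h2.congr (Filter.Eventually.of_forall fun p => ?_)
    simp only [Function.uncurry]
    ring
  simp only [bfTransform, ← integral_mul_const, ← integral_const_mul]
  rw [integral_integral_swap hI]
  refine integral_congr_ae (Filter.Eventually.of_forall fun y => ?_)
  refine integral_congr_ae (Filter.Eventually.of_forall fun ξ => ?_)
  simp only
  rw [bfKernel_comm ε ξ y]
  ring

/-- The transform of a Gaussian is a Gaussian. -/
theorem bfTransform_gaussE (hlam : 0 < lam) {ε : ℝ} (hε : ε ^ 2 = 1) {a : ℝ} (ha : 0 < a)
    (w : Fin n → ℂ) (ξ : halfSpace n) :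
    bfTransform n lam ε (fun y => gaussE a w y.1) ξ =
      (((2 * a) ^ (-halfDim n lam) : ℝ) : ℂ) * Complex.exp ((∑ j, w j ^ 2) / (4 * a)) *
        gaussE (1 / (4 * a)) (fun j => -(ε : ℂ) * Complex.I * w j / (2 * a)) ξ.1 := by
  have h1 : ∀ y : halfSpace n, gaussE a w y.1 * bfKernel n lam ε y ξ =
      (((2 * Real.pi) ^ (-(n : ℝ) / 2) * 2 ^ (1 / 2 - lam) : ℝ) : ℂ) *
        (gaussE a (fun j => w j + -(ε : ℂ) * Complex.I * ξ.1 j.castSucc) y.1 *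
          besselE lam (Complex.I * ht ξ * ht y)) := fun y => by
    rw [bfKernel_eq]
    have : gaussE a (fun j => w j + -(ε : ℂ) * Complex.I * ξ.1 j.castSucc) y.1 = gaussE a w y.1 *
        Complex.exp (∑ j : Fin n, (-(ε : ℂ) * Complex.I * ξ.1 j.castSucc) * y.1 j.castSucc) := by
      rw [gaussE, gaussE, ← Complex.exp_add, add_assoc, ← Finset.sum_add_distrib]
      simp_rw [add_mul]
    rw [this]
    ring
  rw [bfTransform]
  simp_rw [h1]
  rw [integral_const_mul, integral_gaussE_mul_besselE hlam ha, ← mul_assoc, ← Complex.ofReal_mul]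
  have hconst : (2 * Real.pi) ^ (-(n : ℝ) / 2) * 2 ^ (1 / 2 - lam) *
      (Real.pi ^ ((n : ℝ) / 2) / 2 * a ^ (-halfDim n lam)) = (2 * a) ^ (-halfDim n lam) := by
    have h2 : (2 : ℝ) ^ (-halfDim n lam) = 2 ^ (-((n : ℝ) / 2)) * 2 ^ (1 / 2 - lam) / 2 := by
      rw [← Real.rpow_add two_pos, ← Real.rpow_sub_one two_ne_zero]
      congr 1
      unfold halfDim; ring
    rw [Real.mul_rpow (by norm_num) Real.pi_pos.le, Real.mul_rpow (by norm_num) ha.le, h2,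
      show -(n : ℝ) / 2 = -((n : ℝ) / 2) by ring, Real.rpow_neg Real.pi_pos.le]
    have := Real.rpow_pos_of_pos Real.pi_pos ((n : ℝ) / 2)
    field_simp
  rw [hconst, mul_assoc, gaussE, ← Complex.exp_add]
  congr 2
  rw [EuclideanSpace.norm_sq_eq, Fin.sum_univ_castSucc]
  have hε' : (ε : ℂ) ^ 2 = 1 := by exact_mod_cast hε
  have hsq : ∀ j : Fin n, (w j + -(ε : ℂ) * Complex.I * ξ.1 j.castSucc) ^ 2 =
      w j ^ 2 - (ξ.1 j.castSucc : ℂ) ^ 2 + -(ε : ℂ) * Complex.I * w j * (2 * ξ.1 j.castSucc) :=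
    fun j => by
      linear_combination (Complex.I ^ 2 * (ξ.1 j.castSucc : ℂ) ^ 2) * hε' +
        (ξ.1 j.castSucc : ℂ) ^ 2 * Complex.I_sq
  simp_rw [hsq]
  rw [Finset.sum_add_distrib, Finset.sum_sub_distrib]
  have ha' : (a : ℂ) ≠ 0 := by exact_mod_cast ha.ne'
  have hs2 : ∑ j : Fin n, -(ε : ℂ) * Complex.I * w j / (2 * a) * (ξ.1 j.castSucc : ℂ) =
      (∑ j : Fin n, -(ε : ℂ) * Complex.I * w j * (2 * ξ.1 j.castSucc)) / (4 * a) := by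
    rw [Finset.sum_div]
    refine Finset.sum_congr rfl fun j _ => ?_
    field_simp
    ring
  rw [hs2]
  simp only [Real.norm_eq_abs, sq_abs, mul_pow, Complex.I_sq, ht]
  push_cast
  field_simp
  ring_nf

theorem bfTransform_const_mul (ε : ℝ) (c : ℂ) (f : halfSpace n → ℂ) (ξ : halfSpace n) :
    bfTransform n lam ε (fun y => c * f y) ξ = c * bfTransform n lam ε f ξ := by
  simp only [bfTransform, mul_assoc, integral_const_mul]

/-- The heat semigroup `exp(-tΔ_λ)` on Gaussians: multiplication by `e^{-t|ξ|²}` between the transform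
and its inverse. For `t = 0` this is the inversion formula. -/
theorem bfTransform_heat_gaussE (hlam : 0 < lam) {ε : ℝ} (hε : ε ^ 2 = 1) {a t : ℝ} (ha : 0 < a)
    (ht : 0 ≤ t) (w : Fin n → ℂ) (y : halfSpace n) :
    bfTransform n lam (-ε) (fun ξ => ((Real.exp (-t * ‖ξ.1‖ ^ 2) : ℝ) : ℂ) *
        bfTransform n lam ε (fun y => gaussE a w y.1) ξ) y =
      (((1 + 4 * a * t) ^ (-halfDim n lam) : ℝ) : ℂ) *
        Complex.exp (t * (∑ j, w j ^ 2) / (1 + 4 * a * t)) *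
          gaussE (a / (1 + 4 * a * t)) (fun j => w j / (1 + 4 * a * t)) y.1 := by
  have hD : 0 < 1 + 4 * a * t := by positivity
  have hε' : (ε : ℂ) ^ 2 = 1 := by exact_mod_cast hε
  have ha' : (a : ℂ) ≠ 0 := by exact_mod_cast ha.ne'
  have hD' : (1 + 4 * a * t : ℂ) ≠ 0 := by exact_mod_cast hD.ne'
  have h1 : ∀ ξ : halfSpace n, ((Real.exp (-t * ‖ξ.1‖ ^ 2) : ℝ) : ℂ) *
      bfTransform n lam ε (fun y => gaussE a w y.1) ξ =
      ((((2 * a) ^ (-halfDim n lam) : ℝ) : ℂ) * Complex.exp ((∑ j, w j ^ 2) / (4 * a))) *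
        gaussE (1 / (4 * a) + t) (fun j => -(ε : ℂ) * Complex.I * w j / (2 * a)) ξ.1 := fun ξ => by
    rw [bfTransform_gaussE hlam hε ha]
    have h2 := gaussE_add (1 / (4 * a)) t (fun j => -(ε : ℂ) * Complex.I * w j / (2 * a)) 0 ξ.1
    rw [add_zero] at h2
    rw [h2]
    have h3 : gaussE t 0 ξ.1 = ((Real.exp (-t * ‖ξ.1‖ ^ 2) : ℝ) : ℂ) := by
      simp [gaussE]
    rw [h3]
    ring
  simp_rw [h1]
  rw [bfTransform_const_mul, bfTransform_gaussE hlam (by rw [neg_sq, hε]) (by positivity)]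
  have hpar : 1 / (4 * a) + t = (1 + 4 * a * t) / (4 * a) := by field_simp
  have hconst : (2 * a) ^ (-halfDim n lam) * (2 * (1 / (4 * a) + t)) ^ (-halfDim n lam) =
      (1 + 4 * a * t) ^ (-halfDim n lam) := by
    rw [← Real.mul_rpow (by positivity) (by positivity)]
    congr 1
    field_simp
    norm_num
  rw [← hconst]
  have hg : gaussE (1 / (4 * (1 / (4 * a) + t)))
      (fun j => -((-ε : ℝ) : ℂ) * Complex.I * (-(ε : ℂ) * Complex.I * w j / (2 * a)) /
        (2 * ((1 / (4 * a) + t : ℝ) : ℂ))) y.1 =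
      gaussE (a / (1 + 4 * a * t)) (fun j => w j / (1 + 4 * a * t)) y.1 := by
    congr 1
    · field_simp
    · funext j
      rw [hpar]
      push_cast
      field_simp
      linear_combination (-(4 * w j * Complex.I ^ 2 / (1 + 4 * a * t))) * hε' -
        4 * w j / (1 + 4 * a * t) * Complex.I_sq
  have hsum : (∑ j, (-(ε : ℂ) * Complex.I * w j / (2 * a)) ^ 2) = -(∑ j, w j ^ 2) / (4 * a ^ 2) := by
    rw [neg_div, Finset.sum_div, ← Finset.sum_neg_distrib]
    refine Finset.sum_congr rfl fun j _ => ?_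
    field_simp
    linear_combination (4 * Complex.I ^ 2 * w j ^ 2) * hε' + 4 * w j ^ 2 * Complex.I_sq
  have he : Complex.exp ((∑ j, w j ^ 2) / (4 * a)) * Complex.exp
      ((∑ j, (-(ε : ℂ) * Complex.I * w j / (2 * a)) ^ 2) / (4 * ((1 / (4 * a) + t : ℝ) : ℂ))) =
      Complex.exp (t * (∑ j, w j ^ 2) / (1 + 4 * a * t)) := by
    rw [← Complex.exp_add, hsum, hpar]
    congr 1
    push_cast
    field_simp
    ring
  rw [hg, ← he]
  push_cast
  ring

end Gaussians

/-! ### Gaussians determine functions -/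

section Uniqueness

open BoundedContinuousFunction in
/-- A real integrable function that annihilates a point separating star algebra of bounded
continuous functions vanishes: the measures defined by its positive and negative parts agree. -/
theorem ae_eq_zero_of_integral_ofReal_mul_eq_zero {X : Type*} [TopologicalSpace X] [PolishSpace X]
    [MeasurableSpace X] [BorelSpace X] {μ : Measure X} [SigmaFinite μ] {r : X → ℝ} (hr : Integrable r μ)
    (A : StarSubalgebra ℂ (X →ᵇ ℂ)) (hA : (A.map (toContinuousMapStarₐ ℂ)).SeparatesPoints)
    (h : ∀ φ ∈ A, ∫ x, (r x : ℂ) * φ x ∂μ = 0) : r =ᵐ[μ] 0 := by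
  let ν₁ := μ.withDensity fun x => ENNReal.ofReal (r x)
  let ν₂ := μ.withDensity fun x => ENNReal.ofReal (-r x)
  have : IsFiniteMeasure ν₁ := isFiniteMeasure_withDensity_ofReal hr.2
  have : IsFiniteMeasure ν₂ := isFiniteMeasure_withDensity_ofReal hr.neg.2
  have hm1 : AEMeasurable (fun x => ENNReal.ofReal (r x)) μ := hr.1.aemeasurable.ennreal_ofReal
  have hm2 : AEMeasurable (fun x => ENNReal.ofReal (-r x)) μ := hr.1.aemeasurable.neg.ennreal_ofReal
  have hν : ν₁ = ν₂ := by
    refine ext_of_forall_mem_subalgebra_integral_eq_of_polish hA fun φ hφ => ?_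
    have h1 : ∀ s : X → ℝ, Integrable s μ → ∫ x, φ x ∂(μ.withDensity fun x => ENNReal.ofReal (s x)) =
        ∫ x, ((max (s x) 0 : ℝ) : ℂ) * φ x ∂μ := fun s hs => by
      rw [integral_withDensity_eq_integral_toReal_smul₀ hs.1.aemeasurable.ennreal_ofReal
        (Filter.Eventually.of_forall fun x => ENNReal.ofReal_lt_top)]
      refine integral_congr_ae (Filter.Eventually.of_forall fun x => ?_)
      simp only
      rw [ENNReal.toReal_ofReal', Complex.real_smul]
    have hb : ∀ s : X → ℝ, Integrable s μ → Integrable (fun x => ((max (s x) 0 : ℝ) : ℂ) * φ x) μ :=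
      fun s hs => hs.pos_part.ofReal.mul_bdd (c := ‖φ‖) φ.continuous.aestronglyMeasurable
        (Filter.Eventually.of_forall fun x => φ.norm_coe_le_norm x)
    have hn : Integrable (fun x => -r x) μ := hr.neg
    rw [h1 r hr, h1 (fun x => -r x) hn, ← sub_eq_zero, ← integral_sub (hb r hr) (hb _ hn),
      ← h φ hφ]
    refine integral_congr_ae (Filter.Eventually.of_forall fun x => ?_)
    simp only
    rw [← sub_mul, ← Complex.ofReal_sub, max_zero_sub_max_neg_zero_eq_self]
  have h2 := (withDensity_eq_iff hm1 hm2 hr.lintegral_lt_top.ne).1 hν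
  filter_upwards [h2] with x hx
  rcases le_total 0 (r x) with h0 | h0
  · rw [ENNReal.ofReal_of_nonpos (neg_nonpos.2 h0), ENNReal.ofReal_eq_zero] at hx
    exact le_antisymm hx h0
  · rw [ENNReal.ofReal_of_nonpos h0, eq_comm, ENNReal.ofReal_eq_zero] at hx
    exact le_antisymm h0 (neg_nonpos.1 hx)

open BoundedContinuousFunction in
/-- The complex form of the preceding lemma, from the real and imaginary parts of `P`. -/
theorem ae_eq_zero_of_integral_mul_eq_zero {X : Type*} [TopologicalSpace X] [PolishSpace X]
    [MeasurableSpace X] [BorelSpace X] {μ : Measure X} [SigmaFinite μ] {P : X → ℂ} (hP : Integrable P μ)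
    (A : StarSubalgebra ℂ (X →ᵇ ℂ)) (hA : (A.map (toContinuousMapStarₐ ℂ)).SeparatesPoints)
    (h : ∀ φ ∈ A, ∫ x, P x * φ x ∂μ = 0) : P =ᵐ[μ] 0 := by
  have hint : ∀ φ : X →ᵇ ℂ, Integrable (fun x => P x * φ x) μ := fun φ =>
    hP.mul_bdd (c := ‖φ‖) φ.continuous.aestronglyMeasurable
        (Filter.Eventually.of_forall fun x => φ.norm_coe_le_norm x)
  have hint' : ∀ φ : X →ᵇ ℂ, Integrable (fun x => (starRingEnd ℂ) (P x) * φ x) μ := fun φ =>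
    (Complex.conjLIE.toContinuousLinearEquiv.toContinuousLinearMap.integrable_comp hP).mul_bdd
      (c := ‖φ‖) φ.continuous.aestronglyMeasurable
        (Filter.Eventually.of_forall fun x => φ.norm_coe_le_norm x)
  have h' : ∀ φ ∈ A, ∫ x, (starRingEnd ℂ) (P x) * φ x ∂μ = 0 := fun φ hφ => by
    have := h (star φ) (star_mem hφ)
    rw [← map_eq_zero (starRingEnd ℂ), ← integral_conj] at this
    simpa using this
  have hre := ae_eq_zero_of_integral_ofReal_mul_eq_zero hP.re A hA fun φ hφ => by
    have : ∀ x, ((RCLike.re (P x) : ℝ) : ℂ) * φ x =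
        (P x * φ x + (starRingEnd ℂ) (P x) * φ x) / 2 := fun x => by
      rw [← add_mul, RCLike.re_eq_complex_re, Complex.add_conj]
      push_cast; ring
    simp_rw [this]
    rw [integral_div, integral_add (hint φ) (hint' φ), h φ hφ, h' φ hφ]
    simp
  have him := ae_eq_zero_of_integral_ofReal_mul_eq_zero hP.im A hA fun φ hφ => by
    have : ∀ x, ((RCLike.im (P x) : ℝ) : ℂ) * φ x =
        (P x * φ x - (starRingEnd ℂ) (P x) * φ x) / (2 * Complex.I) := fun x => by
      rw [← sub_mul, RCLike.im_eq_complex_im, Complex.sub_conj]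
      push_cast
      field_simp
    simp_rw [this]
    rw [integral_div, integral_sub (hint φ) (hint' φ), h φ hφ, h' φ hφ]
    simp
  filter_upwards [hre, him] with x h1 h2
  exact Complex.ext h1 h2

variable {n : ℕ} {lam : ℝ}

open BoundedContinuousFunction

theorem norm_gaussE_I_le {a : ℝ} (ha : 0 ≤ a) (η : Fin n → ℝ) (y : Eu n) :
    ‖gaussE a (fun j => Complex.I * η j) y‖ ≤ 1 := by
  rw [gaussE, Complex.norm_exp]
  refine Real.exp_le_one_iff.2 ?_
  have : (∑ j, Complex.I * (η j : ℂ) * (y j.castSucc : ℂ)).re = 0 := by simp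
  rw [Complex.add_re, this, add_zero]
  have h : (-(a : ℂ) * ((‖y‖ ^ 2 : ℝ) : ℂ)).re = -a * ‖y‖ ^ 2 := by
    rw [← Complex.ofReal_neg, ← Complex.ofReal_mul, Complex.ofReal_re]
  rw [h]
  nlinarith [sq_nonneg ‖y‖]

/-- The function `exp(-a|y|² + i⟨η,y'⟩)`, `a ≥ 0`, as a bounded continuous function. -/
def gaussB (n : ℕ) (p : {a : ℝ // 0 ≤ a} × (Fin n → ℝ)) : halfSpace n →ᵇ ℂ :=
  BoundedContinuousFunction.ofNormedAddCommGroup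
    (fun y : halfSpace n => gaussE p.1.1 (fun j => Complex.I * p.2 j) y.1)
    ((continuous_gaussE _ _).comp continuous_subtype_val) 1
    (fun y => norm_gaussE_I_le p.1.2 p.2 y.1)

theorem gaussB_apply (p : {a : ℝ // 0 ≤ a} × (Fin n → ℝ)) (y : halfSpace n) :
    gaussB n p y = gaussE p.1.1 (fun j => Complex.I * p.2 j) y.1 := rfl

theorem gaussB_mul (p q : {a : ℝ // 0 ≤ a} × (Fin n → ℝ)) :
    gaussB n p * gaussB n q = gaussB n (⟨p.1.1 + q.1.1, add_nonneg p.1.2 q.1.2⟩, p.2 + q.2) := by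
  ext y
  rw [BoundedContinuousFunction.mul_apply, gaussB_apply, gaussB_apply, gaussB_apply, ← gaussE_add]
  congr 1
  funext j
  simp [mul_add]

theorem star_gaussB (p : {a : ℝ // 0 ≤ a} × (Fin n → ℝ)) :
    star (gaussB n p) = gaussB n (p.1, -p.2) := by
  ext y
  rw [BoundedContinuousFunction.star_apply, gaussB_apply, gaussB_apply]
  change (starRingEnd ℂ) _ = _
  rw [conj_gaussE]
  congr 1
  funext j
  simp

/-- The star algebra spanned by the functions `gaussB`. -/
def gaussAlg (n : ℕ) : StarSubalgebra ℂ (halfSpace n →ᵇ ℂ) where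
  carrier := Submodule.span ℂ (range (gaussB n))
  add_mem' := fun ha hb => Submodule.add_mem _ ha hb
  algebraMap_mem' := fun c => by
    have h1 : gaussB n (⟨0, le_rfl⟩, 0) = 1 := by
      ext y
      rw [gaussB_apply]
      simp [gaussE]
    have h2 : algebraMap ℂ (halfSpace n →ᵇ ℂ) c = c • gaussB n (⟨0, le_rfl⟩, 0) := by
      rw [h1, Algebra.algebraMap_eq_smul_one]
    rw [h2]
    exact Submodule.smul_mem _ _ (Submodule.subset_span ⟨_, rfl⟩)
  mul_mem' := fun {a b} ha hb => by
    change a * b ∈ Submodule.span ℂ (range (gaussB n))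
    have h1 : a * b ∈ Submodule.span ℂ (range (gaussB n)) * Submodule.span ℂ (range (gaussB n)) :=
      Submodule.mul_mem_mul ha hb
    rw [Submodule.span_mul_span] at h1
    refine Submodule.span_mono ?_ h1
    rintro _ ⟨_, ⟨p, rfl⟩, _, ⟨q, rfl⟩, rfl⟩
    exact ⟨_, (gaussB_mul p q).symm⟩
  star_mem' := fun {a} ha => by
    change star a ∈ Submodule.span ℂ (range (gaussB n))
    change a ∈ Submodule.span ℂ (range (gaussB n)) at ha
    induction ha using Submodule.span_induction with
    | mem x hx =>
      obtain ⟨p, rfl⟩ := hx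
      rw [star_gaussB]
      exact Submodule.subset_span ⟨_, rfl⟩
    | zero => rw [star_zero]; exact Submodule.zero_mem _
    | add x y _ _ hx hy => rw [star_add]; exact Submodule.add_mem _ hx hy
    | smul c x _ hx => rw [star_smul]; exact Submodule.smul_mem _ _ hx

theorem gaussB_mem_gaussAlg (p : {a : ℝ // 0 ≤ a} × (Fin n → ℝ)) : gaussB n p ∈ gaussAlg n :=
  Submodule.subset_span (s := range (gaussB n)) ⟨p, rfl⟩

/-- Two points of the half-space with the same `y'` and the same `|y|²` agree, since `y_{n+1} > 0`. -/
theorem gaussAlg_separatesPoints (n : ℕ) :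
    ((gaussAlg n).map (toContinuousMapStarₐ ℂ)).SeparatesPoints := by
  intro y z hyz
  suffices ∃ p, gaussB n p y ≠ gaussB n p z by
    obtain ⟨p, hp⟩ := this
    refine ⟨gaussB n p, ?_, hp⟩
    simp only [StarSubalgebra.coe_toSubalgebra, StarSubalgebra.coe_map, Set.mem_image,
      SetLike.mem_coe, exists_exists_and_eq_and]
    exact ⟨gaussB n p, gaussB_mem_gaussAlg p, rfl⟩
  by_cases h : ∃ j : Fin n, y.1 j.castSucc ≠ z.1 j.castSucc
  · obtain ⟨j, hj⟩ := h
    have hj0 : y.1 j.castSucc - z.1 j.castSucc ≠ 0 := sub_ne_zero.2 hj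
    refine ⟨(⟨0, le_rfl⟩, Pi.single j (Real.pi / (y.1 j.castSucc - z.1 j.castSucc))), ?_⟩
    rw [gaussB_apply, gaussB_apply]
    have key : ∀ x : Eu n, gaussE 0 (fun i => Complex.I *
        (Pi.single j (Real.pi / (y.1 j.castSucc - z.1 j.castSucc)) : Fin n → ℝ) i) x =
        Complex.exp (Complex.I * (Real.pi / (y.1 j.castSucc - z.1 j.castSucc) : ℝ) * x j.castSucc) :=
      fun x => by
        rw [gaussE]
        congr 1
        rw [Finset.sum_eq_single j]
        · simp
        · intro b _ hb
          simp [Pi.single_eq_of_ne hb]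
        · simp
    simp only [key]
    intro hcon
    have h1 : Complex.exp (Complex.I * (Real.pi / (y.1 j.castSucc - z.1 j.castSucc) : ℝ) * y.1 j.castSucc)
        = Complex.exp (Complex.I * (Real.pi / (y.1 j.castSucc - z.1 j.castSucc) : ℝ) * z.1 j.castSucc) *
          Complex.exp (Real.pi * Complex.I) := by
      rw [← Complex.exp_add]
      congr 1
      have hc : ((y.1 j.castSucc : ℂ) - z.1 j.castSucc) ≠ 0 := by
        rw [← Complex.ofReal_sub]
        exact Complex.ofReal_ne_zero.2 hj0
      push_cast
      field_simp
      ring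
    rw [h1, Complex.exp_pi_mul_I, mul_neg_one] at hcon
    exact Complex.exp_ne_zero _ (self_eq_neg.1 hcon.symm)
  · push Not at h
    refine ⟨(⟨1, zero_le_one⟩, 0), ?_⟩
    rw [gaussB_apply, gaussB_apply]
    have key : ∀ x : Eu n, gaussE 1 (fun i => Complex.I * ((0 : Fin n → ℝ) i : ℂ)) x =
        ((Real.exp (-‖x‖ ^ 2) : ℝ) : ℂ) := fun x => by
      simp [gaussE]
    simp only [key]
    intro hcon
    have h1 := Real.exp_injective (Complex.ofReal_injective hcon)
    have h2 : ht y ^ 2 = ht z ^ 2 := by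
      rw [EuclideanSpace.norm_sq_eq, EuclideanSpace.norm_sq_eq, Fin.sum_univ_castSucc,
        Fin.sum_univ_castSucc] at h1
      simp only [Real.norm_eq_abs, sq_abs, h] at h1
      unfold ht
      linarith
    have h3 : ht y = ht z := (pow_left_inj₀ (ht_pos y).le (ht_pos z).le two_ne_zero).1 h2
    refine hyz (Subtype.ext (PiLp.ext fun i => ?_))
    exact Fin.lastCases h3 h i

instance instPolishSpaceHalfSpace (n : ℕ) : PolishSpace (halfSpace n) :=
  (halfSpace n).isOpen.polishSpace

/-- A function orthogonal to all Gaussians vanishes. -/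
theorem ae_eq_zero_of_integral_mul_gaussE {h : halfSpace n → ℂ}
    (hI : ∀ (a : ℝ) (w : Fin n → ℂ), 0 < a → Integrable (fun y => h y * gaussE a w y.1) (mMeas n lam))
    (h0 : ∀ (a : ℝ) (w : Fin n → ℂ), 0 < a → ∫ y, h y * gaussE a w y.1 ∂(mMeas n lam) = 0) :
    h =ᵐ[mMeas n lam] 0 := by
  have h1 := ae_eq_zero_of_integral_mul_eq_zero (hI 1 0 one_pos) (gaussAlg n)
    (gaussAlg_separatesPoints n) fun φ hφ => by
      have hint : ∀ φ : halfSpace n →ᵇ ℂ,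
          Integrable (fun y => h y * gaussE 1 0 y.1 * φ y) (mMeas n lam) := fun φ =>
        (hI 1 0 one_pos).mul_bdd (c := ‖φ‖) φ.continuous.aestronglyMeasurable
          (Filter.Eventually.of_forall fun x => φ.norm_coe_le_norm x)
      change φ ∈ Submodule.span ℂ (range (gaussB n)) at hφ
      induction hφ using Submodule.span_induction with
      | mem x hx =>
        obtain ⟨p, rfl⟩ := hx
        have := h0 (1 + p.1.1) (0 + fun j => Complex.I * p.2 j) (by linarith [p.1.2])
        simp_rw [gaussE_add, ← mul_assoc] at this
        exact this
      | zero => simp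
      | add x y _ _ hx hy =>
        simp only [BoundedContinuousFunction.add_apply, mul_add]
        rw [integral_add (hint x) (hint y), hx, hy, add_zero]
      | smul c x _ hx =>
        simp only [BoundedContinuousFunction.smul_apply, smul_eq_mul, mul_left_comm _ c]
        rw [integral_const_mul, hx, mul_zero]
  filter_upwards [h1] with y hy
  exact (mul_eq_zero.1 hy).resolve_right (Complex.exp_ne_zero _)

end Uniqueness

/-! ### The unitary Bessel–Fourier transform -/

section Unitary

variable {n : ℕ} {lam : ℝ}

open ComplexConjugate

theorem inner_eq_integral {X : Type*} [MeasurableSpace X] {μ : Measure X} (f g : Lp ℂ 2 μ) :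
    inner ℂ f g = ∫ x, conj (f x) * g x ∂μ := by
  rw [L2.inner_def]
  refine integral_congr_ae (Filter.Eventually.of_forall fun x => ?_)
  simp [mul_comm]

theorem integrable_bfTransform_gaussE (hlam : 0 < lam) {ε : ℝ} (hε : ε ^ 2 = 1) {a : ℝ} (ha : 0 < a)
    (w : Fin n → ℂ) :
    Integrable (bfTransform n lam ε fun y => gaussE a w y.1) (mMeas n lam) := by
  have : (bfTransform n lam ε fun y => gaussE a w y.1) = _ :=
    funext fun ξ => bfTransform_gaussE hlam hε ha w ξ
  rw [this]
  exact (integrable_gaussE hlam (by positivity) _).const_mul _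

theorem memLp_bfTransform_gaussE (hlam : 0 < lam) {ε : ℝ} (hε : ε ^ 2 = 1) {a : ℝ} (ha : 0 < a)
    (w : Fin n → ℂ) :
    MemLp (bfTransform n lam ε fun y => gaussE a w y.1) 2 (mMeas n lam) := by
  have : (bfTransform n lam ε fun y => gaussE a w y.1) = _ :=
    funext fun ξ => bfTransform_gaussE hlam hε ha w ξ
  rw [this]
  exact (memLp_gaussE hlam (by positivity) _).const_mul _

/-- Inversion on Gaussians. -/
theorem bfTransform_bfTransform_gaussE (hlam : 0 < lam) {ε : ℝ} (hε : ε ^ 2 = 1) {a : ℝ} (ha : 0 < a)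
    (w : Fin n → ℂ) (y : halfSpace n) :
    bfTransform n lam (-ε) (bfTransform n lam ε fun y => gaussE a w y.1) y = gaussE a w y.1 := by
  have := bfTransform_heat_gaussE hlam hε ha le_rfl w y
  simpa using this

/-- The transform preserves inner products of Gaussians, by Fubini's theorem and inversion, and both
the Gaussians and their transforms span a dense subspace, so it extends to a unitary operator. -/
theorem exists_isBesselFourier_gaussE (hlam : 0 < lam) :
    ∃ W : L2Bessel n lam ≃ₗᵢ[ℂ] L2Bessel n lam, ∀ (a : ℝ) (ha : 0 < a) (w : Fin n → ℂ),
      W ((memLp_gaussE hlam ha w).toLp _) =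
        (memLp_bfTransform_gaussE hlam (one_pow 2) ha w).toLp _ := by
  let v : {a : ℝ // 0 < a} × (Fin n → ℂ) → L2Bessel n lam := fun p =>
    (memLp_gaussE hlam p.1.2 p.2).toLp _
  let v' : {a : ℝ // 0 < a} × (Fin n → ℂ) → L2Bessel n lam := fun p =>
    (memLp_bfTransform_gaussE hlam (one_pow 2) p.1.2 p.2).toLp _
  have hinner : ∀ p q, inner ℂ (v' p) (v' q) = inner ℂ (v p) (v q) := fun p q => by
    have h1 : inner ℂ (v' p) (v' q) = ∫ ξ,
        bfTransform n lam (-1) (fun y => conj (gaussE p.1.1 p.2 y.1)) ξ *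
          bfTransform n lam 1 (fun y => gaussE q.1.1 q.2 y.1) ξ ∂(mMeas n lam) := by
      rw [inner_eq_integral]
      refine integral_congr_ae ?_
      filter_upwards [MemLp.coeFn_toLp (memLp_bfTransform_gaussE hlam (one_pow 2) p.1.2 p.2),
        MemLp.coeFn_toLp (memLp_bfTransform_gaussE hlam (one_pow 2) q.1.2 q.2)] with ξ h2 h3
      rw [h2, h3, conj_bfTransform]
    have h4 : inner ℂ (v p) (v q) = ∫ y, conj (gaussE p.1.1 p.2 y.1) * gaussE q.1.1 q.2 y.1
        ∂(mMeas n lam) := by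
      rw [inner_eq_integral]
      refine integral_congr_ae ?_
      filter_upwards [MemLp.coeFn_toLp (memLp_gaussE hlam p.1.2 p.2),
        MemLp.coeFn_toLp (memLp_gaussE hlam q.1.2 q.2)] with ξ h2 h3
      rw [h2, h3]
    rw [h1, h4, integral_bfTransform_mul hlam]
    · simp_rw [bfTransform_bfTransform_gaussE hlam (one_pow 2) q.1.2]
    · simp_rw [conj_gaussE]
      exact integrable_gaussE hlam p.1.2 _
    · exact integrable_bfTransform_gaussE hlam (one_pow 2) q.1.2 _
  have hnorm : ∀ x, ‖Finsupp.linearCombination ℂ v' x‖ = ‖Finsupp.linearCombination ℂ v x‖ :=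
    fun x => by
      have h1 : inner ℂ (Finsupp.linearCombination ℂ v' x) (Finsupp.linearCombination ℂ v' x) =
          inner ℂ (Finsupp.linearCombination ℂ v x) (Finsupp.linearCombination ℂ v x) := by
        simp only [Finsupp.linearCombination_apply, Finsupp.sum, sum_inner, inner_sum,
          inner_smul_left, inner_smul_right, hinner]
      rw [@norm_eq_sqrt_re_inner ℂ, @norm_eq_sqrt_re_inner ℂ, h1]
  have hdense : ∀ u : {a : ℝ // 0 < a} × (Fin n → ℂ) → L2Bessel n lam,
      (∀ x : L2Bessel n lam, (∀ p, inner ℂ (u p) x = 0) → x = 0) →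
      DenseRange (Finsupp.linearCombination ℂ u) := fun u hu => by
    have h1 : (Submodule.span ℂ (range u)).topologicalClosure = ⊤ := by
      rw [Submodule.topologicalClosure_eq_top_iff, Submodule.eq_bot_iff]
      intro x hx
      refine hu x fun p => ?_
      exact (Submodule.mem_orthogonal _ _).1 hx _ (Submodule.subset_span ⟨p, rfl⟩)
    have h2 : (range (Finsupp.linearCombination ℂ u) : Set (L2Bessel n lam)) =
        Submodule.span ℂ (range u) := by
      rw [← Finsupp.range_linearCombination]; rfl
    rw [DenseRange, h2]
    exact (Submodule.dense_iff_topologicalClosure_eq_top).2 h1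
  have hzero : ∀ x : L2Bessel n lam, (∀ p, inner ℂ (v p) x = 0) → x = 0 := fun x hx => by
    refine (Lp.eq_zero_iff_ae_eq_zero).2 ?_
    refine ae_eq_zero_of_integral_mul_gaussE
      (fun a w ha => (Lp.memLp x).integrable_mul (memLp_gaussE hlam ha w))
      fun a w ha => ?_
    rw [← hx (⟨a, ha⟩, fun j => conj (w j)), inner_eq_integral]
    refine integral_congr_ae ?_
    filter_upwards [MemLp.coeFn_toLp (memLp_gaussE (lam := lam) hlam ha fun j => conj (w j))]
      with y hy
    rw [hy, conj_gaussE, mul_comm]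
    simp
  have hzero' : ∀ x : L2Bessel n lam, (∀ p, inner ℂ (v' p) x = 0) → x = 0 := fun x hx => by
    refine hzero x fun p => ?_
    -- the Gaussian whose transform is a multiple of the given one
    have h4 : 0 < 1 / (4 * p.1.1) := by have := p.1.2; positivity
    let q : {a : ℝ // 0 < a} × (Fin n → ℂ) :=
      (⟨1 / (4 * p.1.1), h4⟩, fun j => Complex.I * p.2 j / (2 * p.1.1))
    have hq : ∃ c : ℂ, c ≠ 0 ∧ v' q = c • v p := by
      refine ⟨(((2 * q.1.1) ^ (-halfDim n lam) : ℝ) : ℂ) *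
        Complex.exp ((∑ j, q.2 j ^ 2) / (4 * q.1.1)), ?_, ?_⟩
      · refine mul_ne_zero ?_ (Complex.exp_ne_zero _)
        have := q.1.2
        exact_mod_cast (Real.rpow_pos_of_pos (by positivity) _).ne'
      · rw [← MemLp.toLp_const_smul]
        refine MemLp.toLp_congr _ _ (Filter.Eventually.of_forall fun ξ => ?_)
        simp only [Pi.smul_apply, smul_eq_mul]
        rw [bfTransform_gaussE hlam (one_pow 2) q.1.2]
        congr 2
        · have := p.1.2
          simp only [q]; field_simp
        · funext j
          have hp0 : (p.1.1 : ℂ) ≠ 0 := by exact_mod_cast p.1.2.ne'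
          simp only [q]
          push_cast
          field_simp
          linear_combination (-4 * p.2 j) * Complex.I_sq
    obtain ⟨c, hc, hcv⟩ := hq
    have := hx q
    rw [hcv, inner_smul_left, mul_eq_zero] at this
    exact this.resolve_left (by simpa using hc)
  refine ⟨(LinearEquiv.refl ℂ _).extendOfIsometry (Finsupp.linearCombination ℂ v)
    (Finsupp.linearCombination ℂ v') (hdense v hzero) (hdense v' hzero') hnorm, fun a ha w => ?_⟩
  have h1 : (memLp_gaussE hlam ha w).toLp _ =
      Finsupp.linearCombination ℂ v (Finsupp.single (⟨a, ha⟩, w) 1) := by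
    simp [v]
  rw [h1]
  refine (LinearEquiv.extendOfIsometry_eq (LinearEquiv.refl ℂ _) (Finsupp.linearCombination ℂ v)
    (Finsupp.linearCombination ℂ v') (hdense v hzero) (hdense v' hzero') hnorm _).trans ?_
  simp [v']

end Unitary

/-! ### Test functions on the half-space -/

section TestFunctions

variable {n : ℕ} {lam : ℝ}

theorem continuousOn_last_rpow (s : ℝ) :
    ContinuousOn (fun x : Eu n => ((x (Fin.last n) ^ s : ℝ) : ℂ)) (halfSpace n : Set (Eu n)) := by
  refine Complex.continuous_ofReal.comp_continuousOn (ContinuousOn.rpow_const (by fun_prop) ?_)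
  exact fun x hx => Or.inl (ne_of_gt hx)

theorem contDiffOn_last_rpow (s : ℝ) :
    ContDiffOn ℝ ∞ (fun x : Eu n => ((x (Fin.last n) ^ s : ℝ) : ℂ)) (halfSpace n : Set (Eu n)) := by
  refine Complex.ofRealCLM.contDiff.comp_contDiffOn (ContDiffOn.rpow_const_of_ne ?_ ?_)
  · exact (EuclideanSpace.proj (𝕜 := ℝ) (Fin.last n)).contDiff.contDiffOn
  · exact fun x hx => ne_of_gt hx

/-- The product of a test function and a function that is smooth on the half-space. -/
def mulTest (c : Eu n → ℂ) (hc : ContDiffOn ℝ ∞ c (halfSpace n : Set (Eu n)))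
    (φ : 𝓓(halfSpace n, ℂ)) : 𝓓(halfSpace n, ℂ) where
  toFun := fun x => c x * φ x
  contDiff' := by
    rw [contDiff_iff_contDiffAt]
    intro x
    by_cases hx : x ∈ tsupport φ
    · have hx' : x ∈ (halfSpace n : Set (Eu n)) := φ.tsupport_subset hx
      exact (hc.contDiffAt ((halfSpace n).isOpen.mem_nhds hx')).mul φ.contDiff.contDiffAt
    · have h0 := notMem_tsupport_iff_eventuallyEq.1 hx
      refine (contDiffAt_const (c := (0 : ℂ))).congr_of_eventuallyEq ?_
      filter_upwards [h0] with y hy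
      rw [hy]; simp
  hasCompactSupport' := φ.hasCompactSupport.mul_left
  tsupport_subset' := (tsupport_mul_subset_right).trans φ.tsupport_subset

theorem mulTest_apply (c : Eu n → ℂ) (hc : ContDiffOn ℝ ∞ c (halfSpace n : Set (Eu n)))
    (φ : 𝓓(halfSpace n, ℂ)) (x : Eu n) : mulTest c hc φ x = c x * φ x := rfl

/-- The complex conjugate of a test function. -/
def conjTest (φ : 𝓓(halfSpace n, ℂ)) : 𝓓(halfSpace n, ℂ) where
  toFun := fun x => (starRingEnd ℂ) (φ x)
  contDiff' := Complex.conjCLE.contDiff.comp φ.contDiff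
  hasCompactSupport' := φ.hasCompactSupport.comp_left (map_zero _)
  tsupport_subset' := (tsupport_comp_subset (g := (starRingEnd ℂ : ℂ → ℂ)) (map_zero _) _).trans
    φ.tsupport_subset

theorem conjTest_apply (φ : 𝓓(halfSpace n, ℂ)) (x : Eu n) :
    conjTest φ x = (starRingEnd ℂ) (φ x) := rfl

/-- The partial derivative of a test function. -/
def derivTest (k : Fin (n + 1)) (φ : 𝓓(halfSpace n, ℂ)) : 𝓓(halfSpace n, ℂ) where
  toFun := fun x => fderiv ℝ φ x (EuclideanSpace.single k 1)
  contDiff' := by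
    have h : ContDiff ℝ ∞ (fderiv ℝ φ) := φ.contDiff.fderiv_right (by simp)
    exact h.clm_apply contDiff_const
  hasCompactSupport' := φ.hasCompactSupport.fderiv_apply ℝ _
  tsupport_subset' := (tsupport_fderiv_apply_subset ℝ _).trans φ.tsupport_subset

theorem integrable_mMeas_of_hasCompactSupport (hlam : 0 < lam) {f : Eu n → ℂ} (hf : Continuous f)
    (hf' : HasCompactSupport f) : Integrable (fun y : halfSpace n => f y.1) (mMeas n lam) := by
  rw [integrable_mMeas_iff]
  refine (integrable_leb_iff fun y : Eu n => ((y (Fin.last n) ^ (2 * lam) : ℝ) : ℂ) * f y).2 ?_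
  refine Integrable.integrableOn ?_
  refine Continuous.integrable_of_hasCompactSupport ?_ hf'.mul_left
  have h1 : Continuous fun y : Eu n => y (Fin.last n) ^ (2 * lam) :=
    Continuous.rpow_const (by fun_prop) fun y => Or.inr (by linarith)
  fun_prop

theorem memLp_mMeas_of_hasCompactSupport (hlam : 0 < lam) {f : Eu n → ℂ} (hf : Continuous f)
    (hf' : HasCompactSupport f) : MemLp (fun y : halfSpace n => f y.1) 2 (mMeas n lam) := by
  have hm : AEStronglyMeasurable (fun y : halfSpace n => f y.1) (mMeas n lam) :=
    (hf.comp continuous_subtype_val).aestronglyMeasurable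
  rw [memLp_two_iff_integrable_sq_norm hm]
  have h := (integrable_mMeas_of_hasCompactSupport (lam := lam) hlam (f := fun x => f x * f x)
    (by fun_prop) hf'.mul_left).norm
  refine h.congr (Filter.Eventually.of_forall fun y => ?_)
  simp only [norm_mul, pow_two]

theorem integrable_test (hlam : 0 < lam) (φ : 𝓓(halfSpace n, ℂ)) :
    Integrable (fun y : halfSpace n => φ y.1) (mMeas n lam) :=
  integrable_mMeas_of_hasCompactSupport hlam φ.continuous φ.hasCompactSupport

theorem memLp_test (hlam : 0 < lam) (φ : 𝓓(halfSpace n, ℂ)) :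
    MemLp (fun y : halfSpace n => φ y.1) 2 (mMeas n lam) :=
  memLp_mMeas_of_hasCompactSupport hlam φ.continuous φ.hasCompactSupport

/-- Local integrability in the open half-space. -/
def LocInt (h : halfSpace n → ℂ) : Prop :=
  LocallyIntegrableOn (extendZero h) (halfSpace n : Set (Eu n)) volume

theorem LocInt.of_memLp {u : halfSpace n → ℂ} (hu : MemLp u 2 (mMeas n lam)) (s : ℝ) :
    LocInt fun x => ((ht x ^ s : ℝ) : ℂ) * u x := by
  have h1 : MemLp (fun x => ((ht x ^ lam : ℝ) : ℂ) * u x) 2 (leb n) := by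
    refine ⟨?_, by rw [eLpNorm_weight]; exact hu.2⟩
    exact (Complex.measurable_ofReal.comp (measurable_ht.pow_const _)).aestronglyMeasurable.mul
      (hu.1.mono_ac (volume_ac_mMeas n lam))
  have h2 := ((memLp_extendZero h1).1.locallyIntegrable (by norm_num)).locallyIntegrableOn
    (halfSpace n : Set (Eu n))
  have h3 := h2.continuousOn_mul (continuousOn_last_rpow (s - lam))
    (halfSpace n).isOpen.isLocallyClosed
  unfold LocInt
  convert h3 using 1
  funext x
  by_cases hx : x ∈ halfSpace n
  · rw [extendZero_coe _ (⟨x, hx⟩ : halfSpace n), extendZero_coe _ (⟨x, hx⟩ : halfSpace n),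
      ← mul_assoc, ← Complex.ofReal_mul, show x (Fin.last n) = ht (⟨x, hx⟩ : halfSpace n) from rfl,
      ← Real.rpow_add (ht_pos _)]
    simp
  · rw [extendZero_of_notMem _ hx, extendZero_of_notMem _ hx, mul_zero]

theorem LocInt.of_memLp' {u : halfSpace n → ℂ} (hu : MemLp u 2 (mMeas n lam)) : LocInt u := by
  simpa using LocInt.of_memLp hu 0

theorem integral_extendZero_mul (h : halfSpace n → ℂ) (φ : Eu n → ℂ) :
    ∫ x, φ x * extendZero h x = ∫ x : halfSpace n, h x * φ x.1 ∂(leb n) := by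
  have h1 : ∫ x : halfSpace n, h x * φ x.1 ∂(leb n) =
      ∫ x : halfSpace n, (fun x => φ x * extendZero h x) x.1 ∂(leb n) := by
    refine integral_congr_ae (Filter.Eventually.of_forall fun x => ?_)
    simp only
    rw [extendZero_coe, mul_comm]
  rw [h1, integral_leb fun x => φ x * extendZero h x,
    setIntegral_eq_integral_of_forall_compl_eq_zero]
  intro x hx
  rw [extendZero_of_notMem _ hx, mul_zero]

/-- The fundamental lemma of the calculus of variations on the half-space. -/
theorem ae_eq_zero_of_integral_test {h : halfSpace n → ℂ} (hh : LocInt h)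
    (h0 : ∀ φ : 𝓓(halfSpace n, ℂ), ∫ x : halfSpace n, h x * φ x.1 ∂(leb n) = 0) :
    h =ᵐ[leb n] 0 := by
  have h1 : ∀ᵐ x ∂(volume : Measure (Eu n)), x ∈ (halfSpace n : Set (Eu n)) → extendZero h x = 0 := by
    refine (halfSpace n).isOpen.ae_eq_zero_of_integral_contDiff_smul_eq_zero hh fun g hg hgc hgs => ?_
    let φ : 𝓓(halfSpace n, ℂ) :=
      { toFun := fun x => (g x : ℂ)
        contDiff' := Complex.ofRealCLM.contDiff.comp hg
        hasCompactSupport' := hgc.comp_left Complex.ofReal_zero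
        tsupport_subset' := (tsupport_comp_subset (g := (Complex.ofReal : ℝ → ℂ))
          Complex.ofReal_zero _).trans hgs }
    rw [← h0 φ, ← integral_extendZero_mul h φ]
    refine integral_congr_ae (Filter.Eventually.of_forall fun x => ?_)
    simp only [Complex.real_smul]
    rfl
  rw [← ae_restrict_iff' (measurableSet_halfSpace n)] at h1
  have hmap : Measure.map (Subtype.val : halfSpace n → Eu n) (leb n)
      = volume.restrict (halfSpace n : Set (Eu n)) :=
    map_comap_subtype_coe (measurableSet_halfSpace n) volume
  rw [← hmap] at h1
  have h3 := (MeasurableEmbedding.subtype_coe (measurableSet_halfSpace n)).ae_map_iff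
    (μ := leb n) (p := fun x => extendZero h x = 0)
  refine (h3.1 h1).mono fun x hx => ?_
  rwa [extendZero_coe] at hx

theorem LocInt.sub {h h' : halfSpace n → ℂ} (hh : LocInt h) (hh' : LocInt h') :
    LocInt fun x => h x - h' x := by
  unfold LocInt
  have h1 := LocallyIntegrableOn.sub hh hh'
  convert h1 using 1
  funext x
  by_cases hx : x ∈ halfSpace n
  · simp [extendZero_coe _ (⟨x, hx⟩ : halfSpace n)]
  · simp [extendZero_of_notMem _ hx]

theorem LocInt.integrable_mul_test {h : halfSpace n → ℂ} (hh : LocInt h) (φ : 𝓓(halfSpace n, ℂ)) :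
    Integrable (fun x : halfSpace n => h x * φ x.1) (leb n) := by
  have h1 : IntegrableOn (fun x => extendZero h x * φ x) (tsupport φ) :=
    (hh.integrableOn_compact_subset φ.tsupport_subset φ.hasCompactSupport).mul_continuousOn
      φ.continuous.continuousOn φ.hasCompactSupport
  have h2 : Integrable (fun x => extendZero h x * φ x) :=
    (integrableOn_iff_integrable_of_support_subset
      ((Function.support_mul_subset_right _ _).trans (subset_tsupport _))).1 h1
  have h3 := (integrable_leb_iff fun x => extendZero h x * φ x).2 h2.integrableOn
  simpa only [extendZero_coe] using h3

/-- The weak derivative is unique. -/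
theorem IsWeakDeriv.ae_unique {k : Fin (n + 1)} {u v v' : halfSpace n → ℂ} (h : IsWeakDeriv k u v)
    (h' : IsWeakDeriv k u v') (hv : LocInt v) (hv' : LocInt v') : v =ᵐ[leb n] v' := by
  have h0 := ae_eq_zero_of_integral_test (hv.sub hv') fun φ => by
    have h1 := h φ
    rw [h' φ, neg_inj] at h1
    simp_rw [sub_mul]
    rw [integral_sub (hv.integrable_mul_test φ) (hv'.integrable_mul_test φ), h1, sub_self]
  filter_upwards [h0] with x hx using sub_eq_zero.1 hx

theorem integral_mul_test_mMeas (u : halfSpace n → ℂ) (φ : 𝓓(halfSpace n, ℂ)) :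
    ∫ x, u x * mulTest _ (contDiffOn_last_rpow (-(2 * lam))) φ x.1 ∂(mMeas n lam) =
      ∫ x, u x * φ x.1 ∂(leb n) := by
  rw [integral_mMeas]
  refine integral_congr_ae (Filter.Eventually.of_forall fun x => ?_)
  simp only [mulTest_apply]
  rw [show x.1 (Fin.last n) = ht x from rfl, Real.rpow_neg (ht_pos x).le]
  have : ((ht x ^ (2 * lam) : ℝ) : ℂ) ≠ 0 :=
    Complex.ofReal_ne_zero.2 (Real.rpow_pos_of_pos (ht_pos x) _).ne'
  push_cast
  field_simp

theorem eq_zero_of_inner_test (hlam : 0 < lam) (u : L2Bessel n lam)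
    (h : ∀ φ : 𝓓(halfSpace n, ℂ), inner ℂ ((memLp_test hlam φ).toLp _) u = 0) : u = 0 := by
  refine (Lp.eq_zero_iff_ae_eq_zero).2 ((mMeas_ac_volume n lam).ae_le ?_)
  refine ae_eq_zero_of_integral_test (LocInt.of_memLp' (Lp.memLp u)) fun φ => ?_
  rw [← integral_mul_test_mMeas (lam := lam),
    ← h (conjTest (mulTest _ (contDiffOn_last_rpow (-(2 * lam))) φ)), inner_eq_integral]
  refine integral_congr_ae ?_
  filter_upwards [MemLp.coeFn_toLp (memLp_test (lam := lam) hlam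
    (conjTest (mulTest _ (contDiffOn_last_rpow (-(2 * lam))) φ)))] with x hx
  rw [hx, conjTest_apply, Complex.conj_conj, mul_comm]

/-- Bounded operators that agree on test functions are equal. -/
theorem ext_of_eq_on_test (hlam : 0 < lam) {A B : L2Bessel n lam →L[ℂ] L2Bessel n lam}
    (h : ∀ φ : 𝓓(halfSpace n, ℂ), A ((memLp_test hlam φ).toLp _) = B ((memLp_test hlam φ).toLp _)) :
    A = B := by
  suffices hAB : ContinuousLinearMap.adjoint (A - B) = 0 by
    have := (ContinuousLinearMap.adjoint (𝕜 := ℂ)).map_eq_zero_iff.1 hAB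
    exact sub_eq_zero.1 this
  ext1 u
  rw [zero_apply]
  refine eq_zero_of_inner_test hlam _ fun φ => ?_
  rw [ContinuousLinearMap.adjoint_inner_right, sub_apply, h φ, sub_self,
    inner_zero_left]

end TestFunctions

/-! ### The operator `𝓕 ⊗ U_λ` -/

section BesselFourier

variable {n : ℕ} {lam : ℝ}

open ComplexConjugate

theorem norm_bfTransform_le (hlam : 0 < lam) (ε : ℝ) {f : halfSpace n → ℂ}
    (hf : Integrable f (mMeas n lam)) (ξ : halfSpace n) :
    ‖bfTransform n lam ε f ξ‖ ≤ bfBound n lam * ∫ y, ‖f y‖ ∂(mMeas n lam) := by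
  rw [bfTransform, ← integral_const_mul]
  refine norm_integral_le_of_norm_le (hf.norm.const_mul _) (Filter.Eventually.of_forall fun y => ?_)
  rw [norm_mul, mul_comm]
  gcongr
  exact norm_bfKernel_le hlam ε y ξ

theorem aestronglyMeasurable_bfTransform (hlam : 0 < lam) (ε : ℝ) {f : halfSpace n → ℂ}
    (hf : Integrable f (mMeas n lam)) :
    AEStronglyMeasurable (bfTransform n lam ε f) (mMeas n lam) := by
  refine AEStronglyMeasurable.integral_prod_right' (f := fun p : halfSpace n × halfSpace n =>
    f p.2 * bfKernel n lam ε p.2 p.1) ?_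
  exact hf.1.comp_snd.mul ((continuous_bfKernel hlam ε).comp continuous_swap).aestronglyMeasurable

/-- A unitary operator that agrees with the integral transform on Gaussians does so on
`L¹ ∩ L²`. -/
theorem ae_eq_bfTransform_of_gaussE (hlam : 0 < lam) {W : L2Bessel n lam ≃ₗᵢ[ℂ] L2Bessel n lam}
    (hW : ∀ (a : ℝ) (ha : 0 < a) (w : Fin n → ℂ), W ((memLp_gaussE hlam ha w).toLp _) =
        (memLp_bfTransform_gaussE hlam (one_pow 2) ha w).toLp _)
    {f : halfSpace n → ℂ} (hf : Integrable f (mMeas n lam)) (g : L2Bessel n lam)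
    (hg : g =ᵐ[mMeas n lam] f) : W g =ᵐ[mMeas n lam] bfTransform n lam 1 f := by
  have hI1 : ∀ (a : ℝ) (w : Fin n → ℂ), 0 < a →
      Integrable (fun y => W g y * gaussE a w y.1) (mMeas n lam) := fun a w ha =>
    (Lp.memLp (W g)).integrable_mul (memLp_gaussE hlam ha w)
  have hI2 : ∀ (a : ℝ) (w : Fin n → ℂ), 0 < a →
      Integrable (fun y => bfTransform n lam 1 f y * gaussE a w y.1) (mMeas n lam) :=
    fun a w ha => (integrable_gaussE hlam ha w).bdd_mul (aestronglyMeasurable_bfTransform hlam 1 hf)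
      (Filter.Eventually.of_forall fun ξ => norm_bfTransform_le hlam 1 hf ξ)
  have h0 := ae_eq_zero_of_integral_mul_gaussE (lam := lam)
    (h := fun ξ => W g ξ - bfTransform n lam 1 f ξ) (fun a w ha => by
      simp_rw [sub_mul]
      exact (hI1 a w ha).sub (hI2 a w ha)) fun a w ha => by
    simp_rw [sub_mul]
    rw [integral_sub (hI1 a w ha) (hI2 a w ha), integral_bfTransform_mul hlam 1 hf
      (integrable_gaussE hlam ha w)]
    -- the Gaussian is the inverse transform of `G`, the transform of a Gaussian
    set G := bfTransform n lam 1 fun y => gaussE a w y.1 with hG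
    have hGE : ∃ (c : ℂ) (b : ℝ) (v : Fin n → ℂ), 0 < b ∧ G = fun y => c * gaussE b v y.1 :=
      ⟨_, 1 / (4 * a), _, by positivity, funext fun ξ => bfTransform_gaussE hlam (one_pow 2) ha w ξ⟩
    obtain ⟨c, b, v, hb, hGE⟩ := hGE
    have hcG : (fun y => conj (G y)) = fun y => conj c * gaussE b (fun j => conj (v j)) y.1 := by
      funext y
      rw [hGE, map_mul, conj_gaussE]
    have hW' : W (conj c • (memLp_gaussE hlam hb fun j => conj (v j)).toLp _) =ᵐ[mMeas n lam]
        fun y => conj (gaussE a w y.1) := by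
      rw [map_smul, hW b hb]
      filter_upwards [Lp.coeFn_smul (conj c) ((memLp_bfTransform_gaussE hlam (one_pow 2) hb
        fun j => conj (v j)).toLp _), MemLp.coeFn_toLp (memLp_bfTransform_gaussE hlam (one_pow 2) hb
        fun j => conj (v j))] with y h1 h2
      rw [h1, Pi.smul_apply, h2, smul_eq_mul, ← bfTransform_const_mul, ← hcG,
        ← bfTransform_bfTransform_gaussE hlam (one_pow 2) ha w y, conj_bfTransform, neg_neg]
    have h3 : ∫ y, W g y * gaussE a w y.1 ∂(mMeas n lam) =
        inner ℂ (W (conj c • (memLp_gaussE hlam hb fun j => conj (v j)).toLp _)) (W g) := by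
      rw [inner_eq_integral]
      refine integral_congr_ae ?_
      filter_upwards [hW'] with y hy
      rw [hy, Complex.conj_conj, mul_comm]
    rw [h3, W.inner_map_map, inner_eq_integral, sub_eq_zero]
    refine integral_congr_ae ?_
    filter_upwards [Lp.coeFn_smul (conj c) ((memLp_gaussE (lam := lam) hlam hb fun j => conj (v j)).toLp _), MemLp.coeFn_toLp (memLp_gaussE (lam := lam) hlam hb fun j => conj (v j)), hg]
      with y h1 h2 h4
    rw [h1, Pi.smul_apply, h2, smul_eq_mul, ← congrFun hcG y, Complex.conj_conj, h4, mul_comm]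
  filter_upwards [h0] with ξ hξ using sub_eq_zero.1 hξ

theorem isBesselFourier_besselFourier (n : ℕ) (hlam : 0 < lam) :
    IsBesselFourier n lam (besselFourier n lam) := by
  have h : ∃ W, IsBesselFourier n lam W := by
    obtain ⟨W, hW⟩ := exists_isBesselFourier_gaussE (n := n) hlam
    refine ⟨W, fun φ g hg => ?_⟩
    rw [besselFourierIntegral_eq]
    exact ae_eq_bfTransform_of_gaussE hlam hW (integrable_test hlam φ) g hg
  rw [besselFourier, dif_pos h]
  exact h.choose_spec

/-- The integral formula for `𝓕 ⊗ U_λ`, given on test functions, holds on `L¹ ∩ L²`. -/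
theorem besselFourier_ae_eq (hlam : 0 < lam) {f : halfSpace n → ℂ} (hf : Integrable f (mMeas n lam))
    (g : L2Bessel n lam) (hg : g =ᵐ[mMeas n lam] f) :
    besselFourier n lam g =ᵐ[mMeas n lam] bfTransform n lam 1 f := by
  obtain ⟨W, hW⟩ := exists_isBesselFourier_gaussE (n := n) hlam
  have heq : (besselFourier n lam).toContinuousLinearEquiv.toContinuousLinearMap =
      W.toContinuousLinearEquiv.toContinuousLinearMap := by
    refine ext_of_eq_on_test hlam fun φ => Lp.ext ?_
    have h1 := isBesselFourier_besselFourier n hlam φ ((memLp_test hlam φ).toLp _)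
      (MemLp.coeFn_toLp _)
    have h2 := ae_eq_bfTransform_of_gaussE hlam hW (integrable_test hlam φ)
      ((memLp_test hlam φ).toLp _) (MemLp.coeFn_toLp _)
    rw [besselFourierIntegral_eq] at h1
    exact h1.trans h2.symm
  have h1 : besselFourier n lam g = W g := DFunLike.congr_fun heq g
  rw [h1]
  exact ae_eq_bfTransform_of_gaussE hlam hW hf g hg

/-- Parseval's formula. -/
theorem integral_mul_eq_integral_besselFourier_mul (hlam : 0 < lam) (u : L2Bessel n lam)
    {ψ : halfSpace n → ℂ} (hψ : Integrable ψ (mMeas n lam)) (hψ2 : MemLp ψ 2 (mMeas n lam)) :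
    ∫ y, u y * ψ y ∂(mMeas n lam) =
      ∫ ξ, besselFourier n lam u ξ * bfTransform n lam (-1) ψ ξ ∂(mMeas n lam) := by
  have hc2 : MemLp (fun y => conj (ψ y)) 2 (mMeas n lam) := hψ2.star
  have hc : Integrable (fun y => conj (ψ y)) (mMeas n lam) :=
    Complex.conjLIE.toContinuousLinearEquiv.toContinuousLinearMap.integrable_comp hψ
  have h1 := (besselFourier n lam).inner_map_map (hc2.toLp _) u
  rw [inner_eq_integral, inner_eq_integral] at h1
  have h2 := besselFourier_ae_eq hlam hc (hc2.toLp _) hc2.coeFn_toLp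
  rw [show (∫ y, u y * ψ y ∂(mMeas n lam)) = ∫ y, conj ((hc2.toLp _ : L2Bessel n lam) y) * u y
    ∂(mMeas n lam) from ?_, ← h1]
  · refine integral_congr_ae ?_
    filter_upwards [h2] with ξ hξ
    rw [hξ, conj_bfTransform, mul_comm]
    simp
  · refine integral_congr_ae ?_
    filter_upwards [hc2.coeFn_toLp] with y hy
    rw [hy, Complex.conj_conj, mul_comm]

end BesselFourier

/-! ### Existence of the Bessel–Riesz transforms -/

section RieszExistence

variable {n : ℕ} {lam : ℝ}

theorem integral_leb_mul_test (K : Eu n → ℂ) (φ : 𝓓(halfSpace n, ℂ)) :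
    ∫ x : halfSpace n, K x.1 * φ x.1 ∂(leb n) = ∫ x, K x * φ x := by
  rw [integral_leb fun x => K x * φ x, setIntegral_eq_integral_of_forall_compl_eq_zero]
  intro x hx
  rw [image_eq_zero_of_notMem_tsupport fun h => hx (φ.tsupport_subset h), mul_zero]

theorem derivTest_apply (k : Fin (n + 1)) (φ : 𝓓(halfSpace n, ℂ)) (x : Eu n) :
    derivTest k φ x = fderiv ℝ φ x (EuclideanSpace.single k 1) := rfl

/-- Integration by parts against a test function. -/
theorem integral_mul_derivTest (k : Fin (n + 1)) (φ : 𝓓(halfSpace n, ℂ)) {K K' : Eu n → ℂ}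
    (hK : Continuous K) (hK' : Continuous K')
    (hd : ∀ x, HasLineDerivAt ℝ K (K' x) x (EuclideanSpace.single k 1)) :
    ∫ x : halfSpace n, K x.1 * derivTest k φ x.1 ∂(leb n) =
      -∫ x : halfSpace n, K' x.1 * φ x.1 ∂(leb n) := by
  have hI : ∀ (K : Eu n → ℂ) (φ : 𝓓(halfSpace n, ℂ)), Continuous K →
      Integrable (fun x => K x * φ x) := fun K φ hK =>
    (hK.mul φ.continuous).integrable_of_hasCompactSupport φ.hasCompactSupport.mul_left
  rw [integral_leb_mul_test, integral_leb_mul_test]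
  refine integral_bilinear_hasLineDerivAt_right_eq_neg_left_of_integrable
    (B := ContinuousLinearMap.mul ℝ ℂ) (hI K' φ hK') (hI K (derivTest k φ) hK) (hI K φ hK)
    (v := EuclideanSpace.single k 1) (fun x _ => hd x) fun x _ => ?_
  exact ((φ.contDiff.differentiable (by simp)) x).hasFDerivAt.hasLineDerivAt _

/-- The function `bfKernel · ξ`, extended to the whole space. -/
def bfKernelExt (n : ℕ) (lam ε : ℝ) (ξ : halfSpace n) (y : Eu n) : ℂ :=
  (((2 * Real.pi) ^ (-(n : ℝ) / 2) * 2 ^ (1 / 2 - lam) : ℝ) : ℂ) *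
    (Complex.exp (∑ j : Fin n, (-(ε : ℂ) * Complex.I * ξ.1 j.castSucc) * y j.castSucc) *
      besselE lam (Complex.I * ht ξ * y (Fin.last n)))

theorem continuous_bfKernelExt (hlam : 0 < lam) (ε : ℝ) (ξ : halfSpace n) :
    Continuous (bfKernelExt n lam ε ξ) := by
  have h1 := continuous_besselE hlam
  unfold bfKernelExt
  fun_prop

theorem hasLineDerivAt_bfKernelExt_castSucc (ε : ℝ) (ξ : halfSpace n) (i : Fin n)
    (y : Eu n) : HasLineDerivAt ℝ (bfKernelExt n lam ε ξ)
      (-(ε : ℂ) * Complex.I * ξ.1 i.castSucc * bfKernelExt n lam ε ξ y) y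
      (EuclideanSpace.single i.castSucc 1) := by
  have h0 : ∀ τ : ℝ, bfKernelExt n lam ε ξ (y + τ • EuclideanSpace.single i.castSucc 1) =
      bfKernelExt n lam ε ξ y * Complex.exp ((-(ε : ℂ) * Complex.I * ξ.1 i.castSucc) * τ) := by
    intro τ
    have h1 : ∑ j : Fin n, (-(ε : ℂ) * Complex.I * ξ.1 j.castSucc) *
        ((y + τ • EuclideanSpace.single i.castSucc (1 : ℝ) : Eu n) j.castSucc : ℂ) =
        (∑ j : Fin n, (-(ε : ℂ) * Complex.I * ξ.1 j.castSucc) * y j.castSucc) +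
          (-(ε : ℂ) * Complex.I * ξ.1 i.castSucc) * τ := by
      rw [← Finset.sum_erase_add _ _ (Finset.mem_univ i),
        ← Finset.sum_erase_add (a := i) Finset.univ
          (fun j : Fin n => (-(ε : ℂ) * Complex.I * ξ.1 j.castSucc) * (y j.castSucc : ℂ))
          (Finset.mem_univ i), add_assoc]
      congr 1
      · refine Finset.sum_congr rfl fun j hj => ?_
        have hji : j ≠ i := Finset.ne_of_mem_erase hj
        simp [hji]
      · simp
        ring
    have h2 : (y + τ • EuclideanSpace.single i.castSucc (1 : ℝ) : Eu n) (Fin.last n) =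
        y (Fin.last n) := by
      simp [(Fin.castSucc_lt_last i).ne']
    rw [bfKernelExt, h1, h2, Complex.exp_add, bfKernelExt]
    ring
  unfold HasLineDerivAt
  simp_rw [h0]
  have h3 : HasDerivAt (fun τ : ℝ => Complex.exp ((-(ε : ℂ) * Complex.I * ξ.1 i.castSucc) * τ))
      (Complex.exp ((-(ε : ℂ) * Complex.I * ξ.1 i.castSucc) * (0 : ℝ)) *
        ((-(ε : ℂ) * Complex.I * ξ.1 i.castSucc) * 1)) 0 := by
    refine HasDerivAt.cexp (HasDerivAt.const_mul _ ?_)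
    exact (hasDerivAt_id (0 : ℝ)).ofReal_comp
  refine (h3.const_mul (bfKernelExt n lam ε ξ y)).congr_deriv ?_
  simp only [Complex.ofReal_zero, mul_zero, Complex.exp_zero]
  ring

theorem hasLineDerivAt_bfKernelExt_last (hlam : 0 < lam) (ε : ℝ) (ξ : halfSpace n)
    (y : Eu n) : HasLineDerivAt ℝ (bfKernelExt n lam ε ξ)
      (-(ht ξ : ℂ) ^ 2 * (y (Fin.last n) * bfKernelExt n (lam + 1) ε ξ y)) y
      (EuclideanSpace.single (Fin.last n) 1) := by
  have h0 : ∀ τ : ℝ, bfKernelExt n lam ε ξ (y + τ • EuclideanSpace.single (Fin.last n) 1) =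
      (((2 * Real.pi) ^ (-(n : ℝ) / 2) * 2 ^ (1 / 2 - lam) : ℝ) : ℂ) *
    (Complex.exp (∑ j : Fin n, (-(ε : ℂ) * Complex.I * ξ.1 j.castSucc) * y j.castSucc) *
      besselE lam (Complex.I * ht ξ * (y (Fin.last n) + τ))) := by
    intro τ
    have h1 : ∀ j : Fin n, (y + τ • EuclideanSpace.single (Fin.last n) (1 : ℝ) : Eu n) j.castSucc =
        y j.castSucc := fun j => by simp [(Fin.castSucc_lt_last j).ne]
    simp only [bfKernelExt, h1]
    simp
  unfold HasLineDerivAt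
  simp_rw [h0]
  set z := Complex.I * ht ξ * y (Fin.last n) with hz
  have h3 : HasDerivAt (fun τ : ℝ => besselE lam (Complex.I * ht ξ * (y (Fin.last n) + τ)))
      (z / 2 * besselE (lam + 1) z * (Complex.I * ht ξ * 1)) 0 := by
    refine HasDerivAt.comp (h₂ := besselE lam) (0 : ℝ) ?_
      (HasDerivAt.const_mul _ (HasDerivAt.const_add _ (hasDerivAt_id (0 : ℝ)).ofReal_comp))
    have : Complex.I * ht ξ * ((y (Fin.last n) : ℂ) + ((0 : ℝ) : ℂ)) = z := by simp [hz]
    rw [this]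
    exact hasDerivAt_besselE hlam z
  refine ((h3.const_mul (Complex.exp (∑ j : Fin n,
    (-(ε : ℂ) * Complex.I * ξ.1 j.castSucc) * y j.castSucc))).const_mul
    (((2 * Real.pi) ^ (-(n : ℝ) / 2) * 2 ^ (1 / 2 - lam) : ℝ) : ℂ)).congr_deriv ?_
  rw [bfKernelExt, ← hz, show (1 / 2 - (lam + 1) : ℝ) = (1 / 2 - lam) - 1 by ring,
    Real.rpow_sub_one (by norm_num)]
  rw [hz]
  push_cast
  linear_combination ((1 / 2) * ((2 * Real.pi : ℝ) ^ (-(n : ℝ) / 2) : ℝ) * ((2 : ℝ) ^ (1 / 2 - lam) : ℝ) *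
    Complex.exp (∑ j : Fin n, (-(ε : ℂ) * Complex.I * ξ.1 j.castSucc) * y j.castSucc) *
    besselE (lam + 1) z * ht ξ ^ 2 * y (Fin.last n) : ℂ) * Complex.I_sq

/-- The test function `x_{n+1}^s φ`. -/
abbrev weightTest (s : ℝ) (φ : 𝓓(halfSpace n, ℂ)) : 𝓓(halfSpace n, ℂ) :=
  mulTest _ (contDiffOn_last_rpow s) φ

theorem bfTransform_weightTest (ε : ℝ) (φ : 𝓓(halfSpace n, ℂ)) (ξ : halfSpace n) :
    bfTransform n lam ε (fun y => weightTest (-(2 * lam)) φ y.1) ξ =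
      ∫ y : halfSpace n, bfKernelExt n lam ε ξ y.1 * φ y.1 ∂(leb n) := by
  rw [← integral_mul_test_mMeas (lam := lam) fun y : halfSpace n => bfKernelExt n lam ε ξ y.1]
  refine integral_congr_ae (Filter.Eventually.of_forall fun y => ?_)
  simp only
  rw [bfKernel_eq, mul_comm]
  rfl

theorem bfTransform_derivTest_castSucc (hlam : 0 < lam) (ε : ℝ) (φ : 𝓓(halfSpace n, ℂ)) (i : Fin n)
    (ξ : halfSpace n) :
    bfTransform n lam ε (fun y => weightTest (-(2 * lam)) (derivTest i.castSucc φ) y.1) ξ =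
      ε * Complex.I * ξ.1 i.castSucc *
        bfTransform n lam ε (fun y => weightTest (-(2 * lam)) φ y.1) ξ := by
  rw [bfTransform_weightTest, bfTransform_weightTest, integral_mul_derivTest _ _
    (continuous_bfKernelExt hlam ε ξ) ((continuous_bfKernelExt hlam ε ξ).const_mul _)
    (hasLineDerivAt_bfKernelExt_castSucc ε ξ i)]
  simp_rw [mul_assoc (-(ε : ℂ) * Complex.I * ξ.1 i.castSucc), integral_const_mul]
  ring

/-- The derivative in the last variable intertwines the transforms of order `λ` and `λ + 1`. -/
theorem bfTransform_derivTest_last (hlam : 0 < lam) (ε : ℝ) (φ : 𝓓(halfSpace n, ℂ))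
    (ξ : halfSpace n) :
    bfTransform n lam ε (fun y => weightTest (-(2 * lam)) (derivTest (Fin.last n) φ) y.1) ξ =
      (ht ξ : ℂ) ^ 2 *
        bfTransform n (lam + 1) ε
          (fun y => weightTest (-(2 * (lam + 1))) (weightTest 1 φ) y.1) ξ := by
  have h1 := continuous_bfKernelExt (lam := lam + 1) (by linarith) ε ξ
  rw [bfTransform_weightTest, bfTransform_weightTest, integral_mul_derivTest _ _
    (continuous_bfKernelExt hlam ε ξ) (by fun_prop)
    (hasLineDerivAt_bfKernelExt_last hlam ε ξ), ← integral_const_mul, ← integral_neg]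
  refine integral_congr_ae (Filter.Eventually.of_forall fun y => ?_)
  simp only [mulTest_apply, Real.rpow_one]
  ring

theorem sq_norm_rpow_neg_half (x : Eu n) : ((‖x‖ ^ 2) ^ (-(1 / 2) : ℝ) : ℝ) = ‖x‖⁻¹ := by
  rw [Real.rpow_neg (by positivity), ← Real.sqrt_eq_rpow, Real.sqrt_sq (norm_nonneg _)]

theorem abs_apply_le_norm (x : Eu n) (k : Fin (n + 1)) : |x k| ≤ ‖x‖ := by
  simpa using PiLp.norm_apply_le x k

theorem abs_apply_mul_inv_le (x : Eu n) (k : Fin (n + 1)) : |x k| * ‖x‖⁻¹ ≤ 1 := by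
  rw [← div_eq_mul_inv]
  exact div_le_one_of_le₀ (abs_apply_le_norm x k) (norm_nonneg _)

theorem isWeakDeriv_iff (k : Fin (n + 1)) (u v : halfSpace n → ℂ) :
    IsWeakDeriv k u v ↔ ∀ φ : 𝓓(halfSpace n, ℂ),
      ∫ x, u x * weightTest (-(2 * lam)) (derivTest k φ) x.1 ∂(mMeas n lam) =
        -∫ x : halfSpace n, v x * φ x.1 ∂(leb n) := by
  refine forall_congr' fun φ => ?_
  rw [integral_mul_test_mMeas]
  rfl

theorem exists_isBesselRiesz_castSucc (hlam : 0 < lam) (i : Fin n) :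
    ∃ R, IsBesselRiesz n lam i.castSucc R := by
  let σ : halfSpace n → ℂ := fun ξ =>
    Complex.I * ξ.1 i.castSucc * (((‖ξ.1‖ ^ 2) ^ (-(1 / 2) : ℝ) : ℝ) : ℂ)
  have hσm : AEStronglyMeasurable σ (mMeas n lam) := by
    have : Measurable σ := by fun_prop
    exact this.aestronglyMeasurable
  have hσb : ∀ ξ, ‖σ ξ‖ ≤ 1 := fun ξ => by
    simp only [σ, norm_mul, Complex.norm_I, one_mul, Complex.norm_real, sq_norm_rpow_neg_half,
      Real.norm_eq_abs, abs_inv, abs_norm]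
    exact abs_apply_mul_inv_le _ _
  let W := besselFourier n lam
  refine ⟨W.symm.toContinuousLinearEquiv.toContinuousLinearMap ∘L mulOp _ _ σ ∘L
    W.toContinuousLinearEquiv.toContinuousLinearMap, fun g u hgu => ?_⟩
  rw [isWeakDeriv_iff (lam := lam)]
  intro φ
  rw [integral_mul_eq_integral_besselFourier_mul hlam u (integrable_test hlam _)
    (memLp_test hlam _), ← integral_mul_test_mMeas (lam := lam),
    integral_mul_eq_integral_besselFourier_mul hlam _ (integrable_test hlam _)
    (memLp_test hlam _), ← integral_neg]
  refine integral_congr_ae ?_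
  have h1 := mulOp_apply_of_bounded (mMeas n lam) σ hσm 1 hσb (W g)
  have h2 : besselFourier n lam ((W.symm.toContinuousLinearEquiv.toContinuousLinearMap ∘L
    mulOp _ _ σ ∘L W.toContinuousLinearEquiv.toContinuousLinearMap) g) = mulOp _ _ σ (W g) :=
    W.apply_symm_apply _
  rw [h2]
  filter_upwards [hgu, h1] with ξ h3 h4
  rw [h3, h4, bfTransform_derivTest_castSucc hlam]
  simp only [σ, W]
  push_cast
  ring

theorem eLpNorm_mMeas_succ (f : halfSpace n → ℂ) :
    eLpNorm f 2 (mMeas n (lam + 1)) = eLpNorm (fun x => (ht x : ℂ) * f x) 2 (mMeas n lam) := by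
  rw [← eLpNorm_weight, ← eLpNorm_weight]
  congr 1
  funext x
  rw [Real.rpow_add (ht_pos x), Real.rpow_one]
  push_cast
  ring

theorem mMeas_ac_mMeas (lam mu : ℝ) : mMeas n lam ≪ mMeas n mu :=
  (mMeas_ac_volume n lam).trans (volume_ac_mMeas n mu)

theorem exists_isBesselRiesz_last (hlam : 0 < lam) :
    ∃ R, IsBesselRiesz n lam (Fin.last n) R := by
  have hlam1 : 0 < lam + 1 := by linarith
  let σ : halfSpace n → ℂ := fun ξ => (((‖ξ.1‖ ^ 2) ^ (-(1 / 2) : ℝ) : ℝ) : ℂ)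
  have hσm : AEStronglyMeasurable σ (mMeas n (lam + 1)) := by
    have : Measurable σ := by fun_prop
    exact this.aestronglyMeasurable
  have hσ : ∀ f : L2Bessel n lam, mulOp (mMeas n lam) (mMeas n (lam + 1)) σ f
      =ᵐ[mMeas n (lam + 1)] fun ξ => σ ξ * f ξ := by
    refine mulOp_apply_of_bound _ _ (mMeas_ac_mMeas _ _) σ hσm 1 fun f => ?_
    rw [eLpNorm_mMeas_succ]
    refine eLpNorm_le_mul_eLpNorm_of_ae_le_mul (Filter.Eventually.of_forall fun ξ => ?_) 2
    simp only [σ, norm_mul, Complex.norm_real, sq_norm_rpow_neg_half, Real.norm_eq_abs, abs_inv,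
      abs_norm, ← mul_assoc]
    exact mul_le_mul_of_nonneg_right (abs_apply_mul_inv_le _ _) (norm_nonneg _)
  have hτ : ∀ f : L2Bessel n (lam + 1), mulOp (mMeas n (lam + 1)) (mMeas n lam)
      (fun x => -(ht x : ℂ)) f =ᵐ[mMeas n lam] fun x => -(ht x : ℂ) * f x := by
    refine mulOp_apply_of_bound _ _ (mMeas_ac_mMeas _ _) _
      (Complex.measurable_ofReal.comp measurable_ht).neg.aestronglyMeasurable 1 fun f => ?_
    rw [eLpNorm_mMeas_succ, ENNReal.ofReal_one, one_mul, ← eLpNorm_neg]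
    simp only [neg_mul]
    exact le_of_eq (congrArg (fun g => eLpNorm g 2 (mMeas n lam)) (by funext x; simp))
  let W := besselFourier n lam
  let W' := besselFourier n (lam + 1)
  refine ⟨mulOp _ _ (fun x => -(ht x : ℂ)) ∘L
    W'.symm.toContinuousLinearEquiv.toContinuousLinearMap ∘L mulOp _ _ σ ∘L
    W.toContinuousLinearEquiv.toContinuousLinearMap, fun g u hgu => ?_⟩
  rw [isWeakDeriv_iff (lam := lam)]
  intro φ
  set v := W'.symm (mulOp _ _ σ (W g)) with hv
  have hR : (mulOp _ _ (fun x => -(ht x : ℂ)) ∘L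
    W'.symm.toContinuousLinearEquiv.toContinuousLinearMap ∘L mulOp _ _ σ ∘L
    W.toContinuousLinearEquiv.toContinuousLinearMap) g = mulOp (mMeas n (lam + 1)) (mMeas n lam)
      (fun x => -(ht x : ℂ)) v := rfl
  have h1 : -∫ x : halfSpace n, mulOp (mMeas n (lam + 1)) (mMeas n lam)
      (fun x => -(ht x : ℂ)) v x * φ x.1 ∂(leb n) =
      ∫ x : halfSpace n, v x * weightTest 1 φ x.1 ∂(leb n) := by
    rw [← integral_neg]
    refine integral_congr_ae ?_
    filter_upwards [(volume_ac_mMeas n lam).ae_le (hτ v)] with x hx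
    rw [hx, mulTest_apply, Real.rpow_one, show x.1 (Fin.last n) = ht x from rfl]
    ring
  rw [hR, h1, integral_mul_eq_integral_besselFourier_mul hlam u (integrable_test hlam _)
    (memLp_test hlam _), ← integral_mul_test_mMeas (lam := lam + 1),
    integral_mul_eq_integral_besselFourier_mul hlam1 v (integrable_test hlam1 _)
    (memLp_test hlam1 _), integral_mMeas, integral_mMeas]
  refine integral_congr_ae ?_
  have h2 : besselFourier n (lam + 1) v = mulOp _ _ σ (W g) := W'.apply_symm_apply _
  rw [h2]
  filter_upwards [(volume_ac_mMeas n lam).ae_le hgu,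
    (volume_ac_mMeas n (lam + 1)).ae_le (hσ (W g))] with ξ h3 h4
  rw [h3, h4, bfTransform_derivTest_last hlam, mul_add, Real.rpow_add (ht_pos ξ)]
  simp only [σ, W]
  rw [show (2 * 1 : ℝ) = ((2 : ℕ) : ℝ) by norm_num, Real.rpow_natCast]
  push_cast
  ring

/-- For `k ≤ n` the operator is `M_{i ξ_k/|ξ|}` conjugated by `𝓕 ⊗ U_λ`. For `k = n + 1` the derivative
of the Bessel function of order `λ - 1/2` involves the one of order `λ + 1/2`, so the operator is a
multiplication between the transforms of parameters `λ` and `λ + 1`. -/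
theorem isBesselRiesz_besselRiesz (hlam : 0 < lam) (k : Fin (n + 1)) :
    IsBesselRiesz n lam k (besselRiesz n lam k) := by
  have h : ∃ R, IsBesselRiesz n lam k R := by
    refine Fin.lastCases ?_ (fun i => ?_) k
    · exact exists_isBesselRiesz_last hlam
    · exact exists_isBesselRiesz_castSucc hlam i
  rw [besselRiesz, dif_pos h]
  exact h.choose_spec

end RieszExistence

/-! ### Fubini's theorem and strong convergence of multiplication operators -/

section General

open Filter Topology

variable {T X Y : Type*} [MeasurableSpace T] [MeasurableSpace X] [MeasurableSpace Y]

theorem integrable_of_norm_le_mul {ν : Measure T} [IsFiniteMeasure ν] {μ : Measure X} [SFinite μ]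
    {μ' : Measure Y} [SFinite μ'] {G : T → X → Y → ℂ} {a : X → ℝ} {b : Y → ℝ}
    (hG : Measurable fun q : T × X × Y => G q.1 q.2.1 q.2.2)
    (ha : Integrable a μ) (hb : Integrable b μ') (hab : ∀ᵐ t ∂ν, ∀ x y, ‖G t x y‖ ≤ a x * b y) :
    Integrable (fun q : T × X × Y => G q.1 q.2.1 q.2.2) (ν.prod (μ.prod μ')) := by
  have h1 : Integrable (fun q : T × X × Y => (1 : ℝ) * (a q.2.1 * b q.2.2)) (ν.prod (μ.prod μ')) :=
    (integrable_const (1 : ℝ)).mul_prod (ha.mul_prod hb)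
  refine h1.mono' hG.aestronglyMeasurable ?_
  have h2 : ∀ᵐ q : T × X × Y ∂(ν.prod (μ.prod μ')), ∀ x y, ‖G q.1 x y‖ ≤ a x * b y :=
    Measure.quasiMeasurePreserving_fst.ae hab
  filter_upwards [h2] with q hq
  rw [one_mul]
  exact hq _ _

theorem integral_integral_integral_swap {ν : Measure T} [IsFiniteMeasure ν] {μ : Measure X}
    [SFinite μ] {μ' : Measure Y} [SFinite μ'] {G : T → X → Y → ℂ}
    (hG : Integrable (fun q : T × X × Y => G q.1 q.2.1 q.2.2) (ν.prod (μ.prod μ'))) :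
    Integrable (fun x => ∫ y, ∫ t, G t x y ∂ν ∂μ') μ ∧
    ∫ x, ∫ y, ∫ t, G t x y ∂ν ∂μ' ∂μ = ∫ t, ∫ y, ∫ x, G t x y ∂μ ∂μ' ∂ν := by
  have h1 : Integrable (fun z : X × Y => ∫ t, G t z.1 z.2 ∂ν) (μ.prod μ') := hG.integral_prod_right
  refine ⟨h1.integral_prod_left, ?_⟩
  rw [← integral_prod (fun z : X × Y => ∫ t, G t z.1 z.2 ∂ν) h1]
  rw [← integral_prod_symm (fun q : T × X × Y => G q.1 q.2.1 q.2.2) hG, integral_prod _ hG]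
  refine integral_congr_ae ?_
  filter_upwards [hG.prod_right_ae] with t ht
  rw [integral_prod_symm _ ht]

theorem tendsto_mulOp {μ : Measure X} {θ : ℕ → X → ℂ} (hm : ∀ N, AEStronglyMeasurable (θ N) μ)
    (hb : ∀ N x, ‖θ N x‖ ≤ 1) (hl : ∀ x, Tendsto (fun N => θ N x) atTop (𝓝 1)) (v : Lp ℂ 2 μ) :
    Tendsto (fun N => mulOp μ μ (θ N) v) atTop (𝓝 v) := by
  rw [Lp.tendsto_Lp_iff_tendsto_eLpNorm']
  have hv : ∫⁻ x, (2 * ‖v x‖ₑ) ^ (2 : ℝ) ∂μ ≠ ⊤ := by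
    have h1 := (Lp.memLp v).2
    rw [eLpNorm_lt_top_iff_lintegral_rpow_enorm_lt_top (by norm_num) (by norm_num)] at h1
    simp_rw [ENNReal.mul_rpow_of_nonneg _ _ (zero_le_two (α := ℝ))]
    rw [lintegral_const_mul' _ _ (by finiteness)]
    exact ENNReal.mul_ne_top (by finiteness) (by simpa using h1.ne)
  have h0 : Tendsto (fun N => ∫⁻ x, ‖θ N x * v x - v x‖ₑ ^ (2 : ℝ) ∂μ) atTop
      (𝓝 (∫⁻ _, 0 ∂μ)) := by
    refine tendsto_lintegral_of_dominated_convergence' (fun x => (2 * ‖v x‖ₑ) ^ (2 : ℝ))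
      (fun N => ?_) (fun N => ?_) hv ?_
    · exact ((((hm N).mul (Lp.aestronglyMeasurable v)).sub
        (Lp.aestronglyMeasurable v)).enorm).pow_const _
    · refine Eventually.of_forall fun x => ENNReal.rpow_le_rpow ?_ (by norm_num)
      rw [two_mul]
      refine (enorm_sub_le).trans (add_le_add ?_ le_rfl)
      rw [enorm_mul]
      calc ‖θ N x‖ₑ * ‖v x‖ₑ ≤ 1 * ‖v x‖ₑ := by
            gcongr
            rw [← ofReal_norm]
            exact ENNReal.ofReal_le_one.2 (hb N x)
        _ = ‖v x‖ₑ := one_mul _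
    · refine Eventually.of_forall fun x => ?_
      have h1 : Tendsto (fun N => ‖θ N x * v x - v x‖ₑ ^ (2 : ℝ)) atTop
          (𝓝 (‖1 * v x - v x‖ₑ ^ (2 : ℝ))) :=
        (ENNReal.continuous_rpow_const.tendsto _).comp
          ((continuous_enorm.tendsto _).comp (((hl x).mul_const _).sub_const _))
      simpa using h1
  rw [lintegral_zero] at h0
  have h1 := (ENNReal.continuous_rpow_const (y := (1 / 2 : ℝ))).tendsto 0 |>.comp h0
  rw [ENNReal.zero_rpow_of_pos (by norm_num)] at h1
  refine h1.congr fun N => ?_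
  rw [eLpNorm_eq_lintegral_rpow_enorm_toReal (by norm_num) (by norm_num)]
  simp only [Function.comp_apply, ENNReal.toReal_ofNat]
  congr 1
  refine lintegral_congr_ae ?_
  filter_upwards [mulOp_apply_of_bounded μ (θ N) (hm N) 1 (hb N) v] with x hx
  simp [hx]

end General

/-! ### Subordination to the heat semigroup -/

section Subordination

open Filter Topology

/-- `π^{-1/2} ∫ t^{-1/2} e^{-t r²} dt` over `[1/(N+1), N+1]`; as `N → ∞` it tends to `1/r`. -/
def cutInv (N : ℕ) (r : ℝ) : ℝ :=
  ∫ t in Icc (1 / (N + 1 : ℝ)) (N + 1), Real.pi ^ (-(1 / 2) : ℝ) * t ^ (-(1 / 2) : ℝ) * Real.exp (-t * r ^ 2)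

theorem pos_of_mem_Icc {N : ℕ} {t : ℝ} (h : t ∈ Icc (1 / (N + 1 : ℝ)) (N + 1)) : 0 < t :=
  lt_of_lt_of_le (by positivity) h.1

theorem integral_subordination {r : ℝ} (hr : 0 < r) :
    IntegrableOn (fun t => Real.pi ^ (-(1 / 2) : ℝ) * t ^ (-(1 / 2) : ℝ) * Real.exp (-t * r ^ 2))
      (Ioi 0) ∧
    ∫ t in Ioi (0 : ℝ), Real.pi ^ (-(1 / 2) : ℝ) * t ^ (-(1 / 2) : ℝ) * Real.exp (-t * r ^ 2) =
      r⁻¹ := by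
  have h1 := Real.integral_rpow_mul_exp_neg_mul_Ioi (a := 1 / 2) (r := r ^ 2) (by norm_num)
    (by positivity)
  have h2 : ∀ t : ℝ, Real.pi ^ (-(1 / 2) : ℝ) * t ^ (-(1 / 2) : ℝ) * Real.exp (-t * r ^ 2) =
      Real.pi ^ (-(1 / 2) : ℝ) * (t ^ ((1 / 2 : ℝ) - 1) * Real.exp (-(r ^ 2 * t))) := fun t => by
    rw [show ((1 / 2 : ℝ) - 1) = -(1 / 2) by norm_num, mul_assoc, show -t * r ^ 2 = -(r ^ 2 * t) by ring]
  simp_rw [h2]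
  have h3 : Real.pi ^ (-(1 / 2) : ℝ) * ((1 / r ^ 2) ^ (1 / 2 : ℝ) * Real.Gamma (1 / 2)) = r⁻¹ := by
    rw [Real.Gamma_one_half_eq, ← Real.sqrt_eq_rpow, Real.rpow_neg Real.pi_pos.le,
      ← Real.sqrt_eq_rpow, Real.sqrt_div zero_le_one, Real.sqrt_sq hr.le]
    have : Real.sqrt Real.pi ≠ 0 := (Real.sqrt_pos.2 Real.pi_pos).ne'
    field_simp
    simp
  refine ⟨Integrable.const_mul ?_ _, by rw [integral_const_mul, h1, h3]⟩
  refine not_imp_comm.1 integral_undef ?_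
  rw [h1]
  have := Real.Gamma_pos_of_pos (s := 1 / 2) (by norm_num)
  positivity

theorem Icc_subset_Ioi (N : ℕ) : Icc (1 / (N + 1 : ℝ)) (N + 1) ⊆ Ioi (0 : ℝ) :=
  fun _ h => pos_of_mem_Icc h

theorem cutInv_nonneg (N : ℕ) (r : ℝ) : 0 ≤ cutInv N r :=
  setIntegral_nonneg measurableSet_Icc fun t ht => by
    have := pos_of_mem_Icc ht
    positivity

theorem cutInv_le (N : ℕ) {r : ℝ} (hr : 0 < r) : cutInv N r ≤ r⁻¹ := by
  rw [← (integral_subordination hr).2]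
  refine setIntegral_mono_set (integral_subordination hr).1 ?_
    (Icc_subset_Ioi N).eventuallyLE
  filter_upwards [ae_restrict_mem measurableSet_Ioi] with t ht
  have : (0 : ℝ) < t := ht
  simp only [Pi.zero_apply]
  positivity

theorem monotone_Icc_inv : Monotone fun N : ℕ => Icc (1 / (N + 1 : ℝ)) (N + 1) := by
  intro N M h
  have h' : (N : ℝ) ≤ M := by exact_mod_cast h
  refine Icc_subset_Icc ?_ (by linarith)
  exact one_div_le_one_div_of_le (by positivity) (by linarith)

theorem iUnion_Icc_inv : ⋃ N : ℕ, Icc (1 / (N + 1 : ℝ)) (N + 1) = Ioi 0 := by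
  refine subset_antisymm (iUnion_subset Icc_subset_Ioi) fun t ht => ?_
  have ht : 0 < t := ht
  obtain ⟨N, hN⟩ := exists_nat_gt (max t t⁻¹)
  have h1 : t < N := (le_max_left _ _).trans_lt hN
  have h2 : t⁻¹ < N := (le_max_right _ _).trans_lt hN
  refine mem_iUnion.2 ⟨N, ?_, by linarith⟩
  rw [one_div]
  exact inv_le_of_inv_le₀ ht (by linarith)

theorem tendsto_cutInv {r : ℝ} (hr : 0 < r) :
    Tendsto (fun N => cutInv N r) atTop (𝓝 r⁻¹) := by
  rw [← (integral_subordination hr).2, ← iUnion_Icc_inv]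
  refine tendsto_setIntegral_of_monotone (fun N => measurableSet_Icc) monotone_Icc_inv ?_
  rw [iUnion_Icc_inv]
  exact (integral_subordination hr).1

theorem measurable_cutInv (N : ℕ) : Measurable (cutInv N) := by
  refine (StronglyMeasurable.integral_prod_right (f := fun (r t : ℝ) => Real.pi ^ (-(1 / 2) : ℝ) *
    t ^ (-(1 / 2) : ℝ) * Real.exp (-t * r ^ 2)) ?_).measurable
  have : Measurable (Function.uncurry fun (r t : ℝ) => Real.pi ^ (-(1 / 2) : ℝ) *
    t ^ (-(1 / 2) : ℝ) * Real.exp (-t * r ^ 2)) := by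
    unfold Function.uncurry
    fun_prop
  exact this.stronglyMeasurable

/-- On `[1/(N+1), N+1]`, negative powers are bounded. -/
theorem rpow_neg_le_of_mem_Icc {N : ℕ} {t : ℝ} (h : t ∈ Icc (1 / (N + 1 : ℝ)) (N + 1)) {s : ℝ}
    (hs : 0 ≤ s) : t ^ (-s) ≤ (N + 1 : ℝ) ^ s := by
  rw [Real.rpow_neg (pos_of_mem_Icc h).le, ← Real.inv_rpow (pos_of_mem_Icc h).le]
  refine Real.rpow_le_rpow (inv_nonneg.2 (pos_of_mem_Icc h).le) ?_ hs
  refine inv_le_of_inv_le₀ (by positivity) ?_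
  rw [← one_div]
  exact h.1

end Subordination

/-! ### The heat kernel of the Bessel operator -/

section HeatKernel

open Filter Topology

variable {n : ℕ} {lam : ℝ}

/-- The normalising constant of the subordinated heat kernel. -/
def heatConst (n : ℕ) (lam : ℝ) : ℝ :=
  Real.pi ^ (-(1 / 2) : ℝ) *
    (4 ^ (-halfDim n lam) * (2 * poissonConst lam / Real.pi ^ ((n : ℝ) / 2)))

theorem heatConst_pos (n : ℕ) (hlam : 0 < lam) : 0 < heatConst n lam := by
  have := poissonConst_pos hlam
  have := Real.pi_pos
  unfold heatConst
  positivity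

/-- The density of `Δ_λ^{-1/2}` with respect to the time `p.1` of the heat semigroup and the variable
`p.2` of Poisson's integral for the Bessel function. -/
def heatDens (n : ℕ) (lam : ℝ) (p : ℝ × ℝ) (x y : Eu n) : ℝ :=
  heatConst n lam * (p.1 ^ (-(halfDim n lam + 1 / 2)) *
    Real.exp (-(‖x - y‖ ^ 2 + 2 * x (Fin.last n) * y (Fin.last n) * p.2) / (4 * p.1)))

/-- The derivative of `heatDens` in the variable `x_k`. -/
def heatDensDeriv (n : ℕ) (lam : ℝ) (k : Fin (n + 1)) (p : ℝ × ℝ) (x y : Eu n) : ℝ :=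
  -((x k - y k) + (if k = Fin.last n then y (Fin.last n) * p.2 else 0)) / (2 * p.1) *
    heatDens n lam p x y

theorem measurable_heatDens : Measurable fun q : (ℝ × ℝ) × Eu n × Eu n =>
    heatDens n lam q.1 q.2.1 q.2.2 := by
  unfold heatDens; fun_prop

theorem measurable_heatDensDeriv (k : Fin (n + 1)) :
    Measurable fun q : (ℝ × ℝ) × Eu n × Eu n => heatDensDeriv n lam k q.1 q.2.1 q.2.2 := by
  have := measurable_heatDens (n := n) (lam := lam)
  unfold heatDensDeriv
  split_ifs <;> fun_prop

theorem continuous_heatDens (p : ℝ × ℝ) (y : Eu n) :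
    Continuous fun x => heatDens n lam p x y := by
  unfold heatDens; fun_prop

theorem continuous_heatDensDeriv (k : Fin (n + 1)) (p : ℝ × ℝ) (y : Eu n) :
    Continuous fun x => heatDensDeriv n lam k p x y := by
  have := continuous_heatDens (n := n) (lam := lam) p y
  unfold heatDensDeriv
  split_ifs <;> fun_prop

theorem hasLineDerivAt_heatDens (k : Fin (n + 1)) (p : ℝ × ℝ) (x y : Eu n) :
    HasLineDerivAt ℝ (fun x => (heatDens n lam p x y : ℂ)) (heatDensDeriv n lam k p x y : ℂ) x
      (EuclideanSpace.single k 1) := by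
  have h1 : HasDerivAt (fun τ : ℝ => x + τ • (EuclideanSpace.single k 1 : Eu n) - y)
      (EuclideanSpace.single k 1 : Eu n) 0 := by
    simpa using (((hasDerivAt_id (0 : ℝ)).smul_const
      (EuclideanSpace.single k 1 : Eu n)).const_add x).sub_const y
  have h2 := h1.norm_sq
  have h3 : HasDerivAt (fun τ : ℝ => (x + τ • (EuclideanSpace.single k 1 : Eu n)) (Fin.last n))
      (if k = Fin.last n then 1 else 0) 0 := by
    have h4 : ∀ τ : ℝ, (x + τ • (EuclideanSpace.single k 1 : Eu n)) (Fin.last n) =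
        x (Fin.last n) + τ * (if k = Fin.last n then 1 else 0) := fun τ => by
      simp [eq_comm]
    simp_rw [h4]
    simpa using ((hasDerivAt_id (0 : ℝ)).mul_const (if k = Fin.last n then (1 : ℝ) else 0)).const_add
      (x (Fin.last n))
  have h5 := (((h2.add (((h3.const_mul 2).mul_const (y (Fin.last n))).mul_const p.2)).neg.div_const
    (4 * p.1)).exp.const_mul (p.1 ^ (-(halfDim n lam + 1 / 2)))).const_mul (heatConst n lam)
  refine HasDerivAt.ofReal_comp (f := fun τ : ℝ =>
    heatDens n lam p (x + τ • EuclideanSpace.single k 1) y) (h5.congr_deriv ?_)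
  simp only [zero_smul, add_zero, heatDensDeriv, heatDens, Pi.add_apply, Pi.neg_apply]
  have h6 : inner ℝ (x - y) (EuclideanSpace.single k (1 : ℝ) : Eu n) = x k - y k := by
    rw [real_inner_comm]
    simp [EuclideanSpace.inner_single_left]
  rw [h6]
  split_ifs <;> ring

/-- The time and Poisson variables, with the time cut off to `[1/(N+1), N+1]`. -/
def cutMeas (lam : ℝ) (N : ℕ) : Measure (ℝ × ℝ) :=
  (volume.restrict (Icc (1 / (N + 1 : ℝ)) (N + 1))).prod (poissonMeas lam)

theorem isFiniteMeasure_cutMeas (hlam : 0 < lam) (N : ℕ) : IsFiniteMeasure (cutMeas lam N) := by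
  have := isFiniteMeasure_poissonMeas hlam
  unfold cutMeas
  infer_instance

theorem ae_mem_cutMeas (hlam : 0 < lam) (N : ℕ) :
    ∀ᵐ p ∂(cutMeas lam N), p.1 ∈ Icc (1 / (N + 1 : ℝ)) (N + 1) ∧ p.2 ∈ Ioo (0 : ℝ) 2 := by
  have := isFiniteMeasure_poissonMeas hlam
  exact (Measure.quasiMeasurePreserving_fst.ae (ae_restrict_mem measurableSet_Icc)).and
    (Measure.quasiMeasurePreserving_snd.ae ae_mem_poissonMeas)

theorem heatDens_nonneg (hlam : 0 < lam) {p : ℝ × ℝ} (hp : 0 ≤ p.1) (x y : Eu n) :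
    0 ≤ heatDens n lam p x y := by
  have := heatConst_pos n hlam
  unfold heatDens; positivity

theorem heatDens_le (hlam : 0 < lam) {N : ℕ} {p : ℝ × ℝ} (hp : p.1 ∈ Icc (1 / (N + 1 : ℝ)) (N + 1))
    (hp2 : 0 ≤ p.2) (x y : halfSpace n) :
    heatDens n lam p x.1 y.1 ≤ heatConst n lam * (N + 1 : ℝ) ^ (halfDim n lam + 1 / 2) := by
  have h0 := heatConst_pos n hlam
  have h1 := halfDim_pos n hlam
  have ht := pos_of_mem_Icc hp
  have hx : 0 < x.1 (Fin.last n) := ht_pos x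
  have hy : 0 < y.1 (Fin.last n) := ht_pos y
  refine mul_le_mul_of_nonneg_left ?_ h0.le
  rw [← mul_one ((N + 1 : ℝ) ^ (halfDim n lam + 1 / 2))]
  refine mul_le_mul (rpow_neg_le_of_mem_Icc hp (by positivity)) ?_ (Real.exp_nonneg _) (by positivity)
  rw [Real.exp_le_one_iff, neg_div, neg_nonpos]
  positivity

/-- The integral over the Poisson variable, in terms of the Bessel function. -/
theorem integral_heatDens_poissonMeas (hlam : 0 < lam) {t : ℝ} (ht : 0 < t) (x y : Eu n) :
    ∫ s, (heatDens n lam (t, s) x y : ℂ) ∂(poissonMeas lam) =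
      ((Real.pi ^ (-(1 / 2) : ℝ) * t ^ (-(1 / 2) : ℝ) *
        (2 / Real.pi ^ ((n : ℝ) / 2) * (4 * t) ^ (-halfDim n lam) *
          Real.exp (-‖y‖ ^ 2 / (4 * t))) : ℝ) : ℂ) *
        (gaussE (1 / (4 * t)) (fun j => (y j.castSucc : ℂ) / (2 * t)) x *
          besselE lam ((y (Fin.last n) : ℂ) / (2 * t) * x (Fin.last n))) := by
  have hpi := Real.pi_pos
  have h1 : ∀ s : ℝ, (heatDens n lam (t, s) x y : ℂ) =
      ((heatConst n lam * t ^ (-(halfDim n lam + 1 / 2)) * Real.exp (-‖y‖ ^ 2 / (4 * t)) : ℝ) : ℂ) *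
        gaussE (1 / (4 * t)) (fun j => (y j.castSucc : ℂ) / (2 * t)) x *
        Complex.exp ((y (Fin.last n) : ℂ) / (2 * t) * x (Fin.last n) * (1 - s)) := by
    intro s
    have h2 : ‖x - y‖ ^ 2 = ‖x‖ ^ 2 - 2 * (∑ j : Fin n, y j.castSucc * x j.castSucc +
        y (Fin.last n) * x (Fin.last n)) + ‖y‖ ^ 2 := by
      rw [norm_sub_sq_real, PiLp.inner_apply, Fin.sum_univ_castSucc]
      simp
    rw [heatDens, gaussE]
    push_cast
    simp only [mul_assoc, ← Complex.exp_add]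
    congr 3
    have h3 : ∑ j : Fin n, (y j.castSucc : ℂ) / (2 * t) * (x j.castSucc : ℂ) =
        (∑ j : Fin n, (y j.castSucc : ℂ) * x j.castSucc) / (2 * t) := by
      rw [Finset.sum_div]
      exact Finset.sum_congr rfl fun j _ => by ring
    rw [h3]
    have h4 := congrArg (fun r : ℝ => (r : ℂ)) h2
    simp only at h4
    push_cast at h4
    rw [h4]
    have ht' : (t : ℂ) ≠ 0 := Complex.ofReal_ne_zero.2 ht.ne'
    field_simp
    ring
  simp_rw [h1]
  rw [integral_const_mul, besselE_eq_integral hlam]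
  have h5 : t ^ (-(halfDim n lam + 1 / 2)) = t ^ (-halfDim n lam) * t ^ (-(1 / 2) : ℝ) := by
    rw [← Real.rpow_add ht]; congr 1; ring
  rw [h5, heatConst, Real.mul_rpow (by norm_num) ht.le]
  push_cast
  ring

/-- Integration of a Gaussian against the heat kernel. -/
theorem integral_gaussE_mul_heatDens (hlam : 0 < lam) {a t : ℝ} (ha : 0 < a) (ht : 0 < t)
    (w : Fin n → ℂ) (y : halfSpace n) {ε : ℝ} (hε : ε ^ 2 = 1) :
    ∫ x : halfSpace n, gaussE a w x.1 * ∫ s, (heatDens n lam (t, s) x.1 y.1 : ℂ) ∂(poissonMeas lam)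
      ∂(mMeas n lam) =
      ((Real.pi ^ (-(1 / 2) : ℝ) * t ^ (-(1 / 2) : ℝ) : ℝ) : ℂ) *
        bfTransform n lam (-ε) (fun ξ => ((Real.exp (-t * ‖ξ.1‖ ^ 2) : ℝ) : ℂ) *
          bfTransform n lam ε (fun y => gaussE a w y.1) ξ) y := by
  have hpi := Real.pi_pos
  rw [bfTransform_heat_gaussE hlam hε ha ht.le]
  simp_rw [integral_heatDens_poissonMeas hlam ht]
  set c := ((Real.pi ^ (-(1 / 2) : ℝ) * t ^ (-(1 / 2) : ℝ) *
        (2 / Real.pi ^ ((n : ℝ) / 2) * (4 * t) ^ (-halfDim n lam) *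
          Real.exp (-‖y.1‖ ^ 2 / (4 * t))) : ℝ) : ℂ) with hc
  have h1 : ∀ x : halfSpace n, gaussE a w x.1 *
      (c * (gaussE (1 / (4 * t)) (fun j => (y.1 j.castSucc : ℂ) / (2 * t)) x.1 *
          besselE lam ((y.1 (Fin.last n) : ℂ) / (2 * t) * x.1 (Fin.last n)))) =
      c * (gaussE (a + 1 / (4 * t)) (w + fun j => (y.1 j.castSucc : ℂ) / (2 * t)) x.1 *
        besselE lam ((y.1 (Fin.last n) : ℂ) / (2 * t) * BesselRiesz.ht x)) := fun x => by
    rw [gaussE_add, BesselRiesz.ht]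
    ring
  simp_rw [h1]
  have hD : 0 < 1 + 4 * a * t := by positivity
  rw [integral_const_mul, integral_gaussE_mul_besselE hlam (by positivity), hc]
  have h2 : (a + 1 / (4 * t)) ^ (-halfDim n lam) =
      (1 + 4 * a * t) ^ (-halfDim n lam) * ((4 * t) ^ (-halfDim n lam))⁻¹ := by
    rw [← Real.inv_rpow (by positivity), ← Real.mul_rpow (by positivity) (by positivity)]
    congr 1
    field_simp
    ring
  rw [h2, gaussE]
  have h3 : Complex.exp ((∑ j : Fin n, (w + fun j : Fin n => (y.1 j.castSucc : ℂ) / (2 * t)) j ^ 2 +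
      ((y.1 (Fin.last n) : ℂ) / (2 * t)) ^ 2) / (4 * ((a + 1 / (4 * t) : ℝ) : ℂ))) *
        ((Real.exp (-‖y.1‖ ^ 2 / (4 * t)) : ℝ) : ℂ) =
      Complex.exp (t * (∑ j, w j ^ 2) / (1 + 4 * a * t)) *
        Complex.exp (-((a / (1 + 4 * a * t) : ℝ) : ℂ) * ((‖y.1‖ ^ 2 : ℝ) : ℂ) +
          ∑ j, w j / (1 + 4 * a * t) * (y.1 j.castSucc : ℂ)) := by
    rw [Complex.ofReal_exp, ← Complex.exp_add, ← Complex.exp_add]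
    congr 1
    have h4 : ‖y.1‖ ^ 2 = (∑ j : Fin n, y.1 j.castSucc ^ 2) + y.1 (Fin.last n) ^ 2 := by
      rw [EuclideanSpace.norm_sq_eq, Fin.sum_univ_castSucc]
      simp
    have h5 : ∑ j : Fin n, (w + fun j : Fin n => (y.1 j.castSucc : ℂ) / (2 * t)) j ^ 2 =
        (∑ j, w j ^ 2) + (∑ j, w j * y.1 j.castSucc) / t +
          (∑ j : Fin n, (y.1 j.castSucc : ℂ) ^ 2) / (4 * t ^ 2) := by
      rw [Finset.sum_div, Finset.sum_div, ← Finset.sum_add_distrib, ← Finset.sum_add_distrib]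
      refine Finset.sum_congr rfl fun j _ => ?_
      have ht' : (t : ℂ) ≠ 0 := Complex.ofReal_ne_zero.2 ht.ne'
      simp only [Pi.add_apply]
      field_simp
      ring
    have h6 : ∑ j, w j / (1 + 4 * a * t) * (y.1 j.castSucc : ℂ) =
        (∑ j, w j * y.1 j.castSucc) / (1 + 4 * a * t) := by
      rw [Finset.sum_div]
      exact Finset.sum_congr rfl fun j _ => by ring
    rw [h5, h6, h4]
    have ht' : (t : ℂ) ≠ 0 := Complex.ofReal_ne_zero.2 ht.ne'
    have hD' : (1 + 4 * a * t : ℂ) ≠ 0 := by exact_mod_cast hD.ne'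
    push_cast
    have h7 : (4 * ((a : ℂ) + 1 / (4 * t))) = (1 + 4 * a * t) / t := by field_simp; ring
    rw [h7]
    obtain ⟨D, hDdef⟩ : ∃ D : ℂ, D = 1 + 4 * a * t := ⟨_, rfl⟩
    rw [← hDdef] at hD' ⊢
    field_simp
    rw [hDdef]
    ring
  have h8 : ((4 * t) ^ (-halfDim n lam) : ℝ) ≠ 0 := by positivity
  have h9 : (Real.pi ^ ((n : ℝ) / 2) : ℝ) ≠ 0 := by positivity
  linear_combination (norm := skip) ((Real.pi ^ (-(1 / 2) : ℝ) * t ^ (-(1 / 2) : ℝ) *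
    (1 + 4 * a * t) ^ (-halfDim n lam) : ℝ) : ℂ) * h3
  have h8' : (((4 * t) ^ (-halfDim n lam) : ℝ) : ℂ) ≠ 0 := Complex.ofReal_ne_zero.2 h8
  have h9' : ((Real.pi ^ ((n : ℝ) / 2) : ℝ) : ℂ) ≠ 0 := Complex.ofReal_ne_zero.2 h9
  simp only [Complex.ofReal_mul, Complex.ofReal_div, Complex.ofReal_inv]
  field_simp
  push_cast
  ring

end HeatKernel

/-! ### The regularised Bessel–Riesz transforms -/

section Regularised

open Filter Topology

variable {n : ℕ} {lam : ℝ}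

theorem cutInv_le_cutInv_zero (N : ℕ) (r : ℝ) : cutInv N r ≤ cutInv N 0 := by
  have hI : ∀ r : ℝ, IntegrableOn (fun t : ℝ => Real.pi ^ (-(1 / 2) : ℝ) * t ^ (-(1 / 2) : ℝ) *
      Real.exp (-t * r ^ 2)) (Icc (1 / (N + 1 : ℝ)) (N + 1)) := fun r =>
    ContinuousOn.integrableOn_Icc ((continuousOn_const.mul (ContinuousOn.rpow_const continuousOn_id
      fun t ht => Or.inl (pos_of_mem_Icc ht).ne')).mul (by fun_prop))
  refine setIntegral_mono_on (hI r) (hI 0) measurableSet_Icc fun t ht => ?_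
  have := pos_of_mem_Icc ht
  refine mul_le_mul_of_nonneg_left (Real.exp_le_exp.2 ?_) (by positivity)
  nlinarith [sq_nonneg r]

theorem mulOp_cutInv_apply (N : ℕ) (g : L2Bessel n lam) :
    mulOp (mMeas n lam) (mMeas n lam) (fun ξ => (cutInv N ‖ξ.1‖ : ℂ)) g =ᵐ[mMeas n lam]
      fun ξ => (cutInv N ‖ξ.1‖ : ℂ) * g ξ := by
  have hm := measurable_cutInv N
  have hm' : Measurable fun ξ : halfSpace n => (cutInv N ‖ξ.1‖ : ℂ) := by fun_prop
  refine mulOp_apply_of_bounded _ _ hm'.aestronglyMeasurable (cutInv N 0) (fun ξ => ?_) g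
  rw [Complex.norm_real, Real.norm_of_nonneg (cutInv_nonneg _ _)]
  exact cutInv_le_cutInv_zero _ _

/-- The operator `Δ_λ^{1/2} S_N`, where `S_N` is the approximation of `Δ_λ^{-1/2}` obtained by
subordination to the heat semigroup over the times in `[1/(N+1), N+1]`. -/
def besselReg (n : ℕ) (lam : ℝ) (N : ℕ) : L2Bessel n lam →L[ℂ] L2Bessel n lam :=
  (besselFourier n lam).symm.toContinuousLinearEquiv.toContinuousLinearMap ∘L
    mulOp _ _ (fun ξ : halfSpace n => ((‖ξ.1‖ * cutInv N ‖ξ.1‖ : ℝ) : ℂ)) ∘L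
    (besselFourier n lam).toContinuousLinearEquiv.toContinuousLinearMap

theorem norm_pos_of_mem (ξ : halfSpace n) : 0 < ‖ξ.1‖ :=
  (ht_pos ξ).trans_le ((le_abs_self _).trans (abs_apply_le_norm ξ.1 (Fin.last n)))

theorem norm_mul_cutInv_le (N : ℕ) (ξ : halfSpace n) :
    ‖((‖ξ.1‖ * cutInv N ‖ξ.1‖ : ℝ) : ℂ)‖ ≤ 1 := by
  have h0 := norm_pos_of_mem ξ
  rw [Complex.norm_real, Real.norm_of_nonneg (mul_nonneg h0.le (cutInv_nonneg _ _))]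
  calc ‖ξ.1‖ * cutInv N ‖ξ.1‖ ≤ ‖ξ.1‖ * ‖ξ.1‖⁻¹ := by
        gcongr
        exact cutInv_le N h0
    _ = 1 := mul_inv_cancel₀ h0.ne'

theorem tendsto_besselReg (g : L2Bessel n lam) :
    Tendsto (fun N => besselReg n lam N g) atTop (𝓝 g) := by
  have h1 : Tendsto (fun N => mulOp (mMeas n lam) (mMeas n lam)
      (fun ξ : halfSpace n => ((‖ξ.1‖ * cutInv N ‖ξ.1‖ : ℝ) : ℂ)) (besselFourier n lam g)) atTop
      (𝓝 (besselFourier n lam g)) := by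
    refine tendsto_mulOp (fun N => ?_) norm_mul_cutInv_le (fun ξ => ?_) _
    · have hm := measurable_cutInv N
      fun_prop
    · have h0 := norm_pos_of_mem ξ
      have := (tendsto_cutInv h0).const_mul ‖ξ.1‖
      rw [mul_inv_cancel₀ h0.ne'] at this
      exact (Complex.continuous_ofReal.tendsto _).comp this
  have h2 := ((besselFourier n lam).symm.continuous.tendsto _).comp h1
  rw [LinearIsometryEquiv.symm_apply_apply] at h2
  exact h2

/-- The approximation of `Δ_λ^{-1/2}`. -/
def besselInvReg (n : ℕ) (lam : ℝ) (N : ℕ) : L2Bessel n lam →L[ℂ] L2Bessel n lam :=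
  (besselFourier n lam).symm.toContinuousLinearEquiv.toContinuousLinearMap ∘L
    mulOp _ _ (fun ξ : halfSpace n => (cutInv N ‖ξ.1‖ : ℂ)) ∘L
    (besselFourier n lam).toContinuousLinearEquiv.toContinuousLinearMap

theorem besselFourier_besselInvReg (N : ℕ) (g : L2Bessel n lam) :
    besselFourier n lam (besselInvReg n lam N g) =ᵐ[mMeas n lam]
      fun ξ => (cutInv N ‖ξ.1‖ : ℂ) * besselFourier n lam g ξ := by
  have : besselFourier n lam (besselInvReg n lam N g) = mulOp _ _
    (fun ξ : halfSpace n => (cutInv N ‖ξ.1‖ : ℂ)) (besselFourier n lam g) :=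
    (besselFourier n lam).apply_symm_apply _
  rw [this]
  exact mulOp_cutInv_apply N _

theorem isBesselPow_besselReg (N : ℕ) (g : L2Bessel n lam) :
    IsBesselPow n lam (-(1 / 2)) (besselReg n lam N g) (besselInvReg n lam N g) := by
  have h1 : besselFourier n lam (besselReg n lam N g) = mulOp _ _
    (fun ξ : halfSpace n => ((‖ξ.1‖ * cutInv N ‖ξ.1‖ : ℝ) : ℂ)) (besselFourier n lam g) :=
    (besselFourier n lam).apply_symm_apply _
  have hm := measurable_cutInv N
  unfold IsBesselPow
  rw [h1]
  filter_upwards [besselFourier_besselInvReg N g, mulOp_apply_of_bounded (mMeas n lam)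
    (fun ξ : halfSpace n => ((‖ξ.1‖ * cutInv N ‖ξ.1‖ : ℝ) : ℂ)) (by fun_prop) 1
    (norm_mul_cutInv_le N) (besselFourier n lam g)] with ξ h2 h3
  rw [h2, h3, sq_norm_rpow_neg_half]
  have h0 : ((‖ξ.1‖ : ℝ) : ℂ) ≠ 0 := Complex.ofReal_ne_zero.2 (norm_pos_of_mem ξ).ne'
  push_cast
  field_simp

theorem integrable_of_bound_cutMeas (hlam : 0 < lam) (N : ℕ) {h : ℝ × ℝ → ℝ} (hm : Measurable h)
    {C : ℝ} (hC : ∀ p : ℝ × ℝ, p.1 ∈ Icc (1 / (N + 1 : ℝ)) (N + 1) → p.2 ∈ Ioo (0 : ℝ) 2 → |h p| ≤ C) :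
    Integrable (fun p => (h p : ℂ)) (cutMeas lam N) := by
  have := isFiniteMeasure_cutMeas hlam N
  refine Integrable.of_bound (by fun_prop) C ?_
  filter_upwards [ae_mem_cutMeas hlam N] with p hp
  rw [Complex.norm_real]
  exact hC p hp.1 hp.2

theorem abs_heatDens_le (hlam : 0 < lam) {N : ℕ} {p : ℝ × ℝ}
    (hp : p.1 ∈ Icc (1 / (N + 1 : ℝ)) (N + 1)) (hp2 : 0 ≤ p.2) (x y : halfSpace n) :
    |heatDens n lam p x.1 y.1| ≤ heatConst n lam * (N + 1 : ℝ) ^ (halfDim n lam + 1 / 2) := by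
  rw [abs_of_nonneg (heatDens_nonneg hlam (pos_of_mem_Icc hp).le _ _)]
  exact heatDens_le hlam hp hp2 x y

theorem measurable_heatDens_left (x y : Eu n) : Measurable fun p => heatDens n lam p x y :=
  measurable_heatDens.comp (g := fun q : (ℝ × ℝ) × Eu n × Eu n => heatDens n lam q.1 q.2.1 q.2.2)
    (f := fun p => (p, x, y)) (by fun_prop)

/-- The regularised potential is an integral operator on test functions. -/
theorem besselInvReg_ae_eq (hlam : 0 < lam) (N : ℕ) (φ : 𝓓(halfSpace n, ℂ)) :
    besselInvReg n lam N ((memLp_test hlam φ).toLp _) =ᵐ[mMeas n lam]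
      fun x => ∫ y, ∫ p, (heatDens n lam p x.1 y.1 : ℂ) * φ y.1 ∂(cutMeas lam N) ∂(mMeas n lam) := by
  have hfin := isFiniteMeasure_poissonMeas hlam
  set g : L2Bessel n lam := (memLp_test hlam φ).toLp _ with hg
  set C := heatConst n lam * (N + 1 : ℝ) ^ (halfDim n lam + 1 / 2) with hC
  have hC0 : 0 ≤ C := mul_nonneg (heatConst_pos n hlam).le (by positivity)
  set ν := volume.restrict (Icc (1 / (N + 1 : ℝ)) (N + 1)) with hν
  let h : ℝ → halfSpace n → halfSpace n → ℂ := fun t x y =>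
    ∫ s, (heatDens n lam (t, s) x.1 y.1 : ℂ) ∂(poissonMeas lam)
  have hhm : Measurable fun q : ℝ × halfSpace n × halfSpace n => h q.1 q.2.1 q.2.2 := by
    refine (StronglyMeasurable.integral_prod_right (ν := poissonMeas lam)
      (f := fun (q : ℝ × halfSpace n × halfSpace n) (s : ℝ) =>
      (heatDens n lam (q.1, s) q.2.1.1 q.2.2.1 : ℂ)) ?_).measurable
    have : Measurable fun z : (ℝ × halfSpace n × halfSpace n) × ℝ =>
        heatDens n lam (z.1.1, z.2) z.1.2.1.1 z.1.2.2.1 :=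
      measurable_heatDens.comp (g := fun q : (ℝ × ℝ) × Eu n × Eu n => heatDens n lam q.1 q.2.1 q.2.2)
        (f := fun z : (ℝ × halfSpace n × halfSpace n) × ℝ =>
          ((z.1.1, z.2), z.1.2.1.1, z.1.2.2.1)) (by fun_prop)
    exact (Complex.measurable_ofReal.comp this).stronglyMeasurable
  set M := (poissonMeas lam).real univ with hM
  have hhb : ∀ᵐ t ∂ν, ∀ x y, ‖h t x y‖ ≤ C * M := by
    filter_upwards [ae_restrict_mem measurableSet_Icc] with t ht x y
    refine norm_integral_le_of_norm_le_const ?_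
    filter_upwards [ae_mem_poissonMeas] with s hs
    rw [Complex.norm_real]
    exact abs_heatDens_le hlam (p := (t, s)) ht hs.1.le x y
  have hinner : ∀ x y : halfSpace n, ∫ p, (heatDens n lam p x.1 y.1 : ℂ) ∂(cutMeas lam N) =
      ∫ t, h t x y ∂ν := fun x y => by
    refine integral_prod _ ?_
    exact integrable_of_bound_cutMeas hlam N (measurable_heatDens_left _ _)
      fun p hp hp2 => abs_heatDens_le hlam hp hp2.1.le x y
  have hφm : Measurable fun y : halfSpace n => φ y.1 :=
    (φ.continuous.comp continuous_subtype_val).measurable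
  -- Fubini's theorem for the kernel against a Gaussian
  have hF : ∀ (a : ℝ) (w : Fin n → ℂ), 0 < a → Integrable (fun q : ℝ × halfSpace n × halfSpace n =>
      h q.1 q.2.1 q.2.2 * φ q.2.2.1 * gaussE a w q.2.1.1)
      (ν.prod ((mMeas n lam).prod (mMeas n lam))) := fun a w ha => by
    refine integrable_of_norm_le_mul (a := fun x => C * M * ‖gaussE a w x.1‖)
      (b := fun y => ‖φ y.1‖) (G := fun t x y => h t x y * φ y.1 * gaussE a w x.1) ?_
      ((integrable_gaussE hlam ha w).norm.const_mul _) (integrable_test hlam φ).norm ?_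
    · have := (continuous_gaussE a w).measurable
      exact (hhm.mul (hφm.comp (by fun_prop))).mul (by fun_prop)
    · filter_upwards [hhb] with t ht x y
      rw [norm_mul, norm_mul]
      calc ‖h t x y‖ * ‖φ y.1‖ * ‖gaussE a w x.1‖ ≤ C * M * ‖φ y.1‖ * ‖gaussE a w x.1‖ := by
            gcongr
            exact ht x y
        _ = C * M * ‖gaussE a w x.1‖ * ‖φ y.1‖ := by ring
  have hU : ∀ (a : ℝ) (w : Fin n → ℂ) (x : halfSpace n),
      (∫ y, ∫ p, (heatDens n lam p x.1 y.1 : ℂ) * φ y.1 ∂(cutMeas lam N) ∂(mMeas n lam)) *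
        gaussE a w x.1 =
      ∫ y, ∫ t, h t x y * φ y.1 * gaussE a w x.1 ∂ν ∂(mMeas n lam) := fun a w x => by
    rw [← integral_mul_const]
    refine integral_congr_ae (Eventually.of_forall fun y => ?_)
    simp only
    rw [integral_mul_const, integral_mul_const, integral_mul_const, hinner]
  have hI1 : ∀ (a : ℝ) (w : Fin n → ℂ), 0 < a →
      Integrable (fun y => besselInvReg n lam N g y * gaussE a w y.1) (mMeas n lam) := fun a w ha =>
    (Lp.memLp _).integrable_mul (memLp_gaussE hlam ha w)
  have hI2 : ∀ (a : ℝ) (w : Fin n → ℂ), 0 < a →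
      Integrable (fun x : halfSpace n =>
        (∫ y, ∫ p, (heatDens n lam p x.1 y.1 : ℂ) * φ y.1 ∂(cutMeas lam N) ∂(mMeas n lam)) *
        gaussE a w x.1) (mMeas n lam) := fun a w ha => by
    simp_rw [hU]
    exact (integral_integral_integral_swap (hF a w ha)).1
  have h0 := ae_eq_zero_of_integral_mul_gaussE (lam := lam)
    (h := fun x => besselInvReg n lam N g x -
      ∫ y, ∫ p, (heatDens n lam p x.1 y.1 : ℂ) * φ y.1 ∂(cutMeas lam N) ∂(mMeas n lam))
    (fun a w ha => by
      simp_rw [sub_mul]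
      exact (hI1 a w ha).sub (hI2 a w ha)) fun a w ha => by
    simp_rw [sub_mul]
    rw [integral_sub (hI1 a w ha) (hI2 a w ha), sub_eq_zero]
    simp_rw [hU]
    rw [(integral_integral_integral_swap (hF a w ha)).2,
      integral_mul_eq_integral_besselFourier_mul hlam _ (integrable_gaussE hlam ha w)
        (memLp_gaussE hlam ha w)]
    set V := bfTransform n lam (-1) fun y => gaussE a w y.1 with hV
    have hVI : Integrable V (mMeas n lam) := integrable_bfTransform_gaussE hlam (by norm_num) ha w
    have hφI := integrable_test hlam φ
    let c : ℝ → ℝ := fun t => Real.pi ^ (-(1 / 2) : ℝ) * t ^ (-(1 / 2) : ℝ)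
    have h1 : ∫ ξ, besselFourier n lam (besselInvReg n lam N g) ξ * V ξ ∂(mMeas n lam) =
        ∫ ξ, ∫ t, ((c t * Real.exp (-t * ‖ξ.1‖ ^ 2) : ℝ) : ℂ) *
          (bfTransform n lam 1 (fun y => φ y.1) ξ * V ξ) ∂ν ∂(mMeas n lam) := by
      refine integral_congr_ae ?_
      filter_upwards [besselFourier_besselInvReg N g, besselFourier_ae_eq hlam hφI g
        (MemLp.coeFn_toLp _)] with ξ h2 h3
      rw [h2, h3, integral_mul_const, integral_complex_ofReal, mul_assoc]
      rfl
    rw [h1, integral_integral_swap]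
    · refine setIntegral_congr_fun measurableSet_Icc fun t ht => ?_
      have ht0 := pos_of_mem_Icc ht
      have h2 : ∀ ξ : halfSpace n, ((c t * Real.exp (-t * ‖ξ.1‖ ^ 2) : ℝ) : ℂ) *
          (bfTransform n lam 1 (fun y => φ y.1) ξ * V ξ) = (c t : ℂ) *
          (bfTransform n lam 1 (fun y => φ y.1) ξ * (((Real.exp (-t * ‖ξ.1‖ ^ 2) : ℝ) : ℂ) * V ξ)) :=
        fun ξ => by push_cast; ring
      simp_rw [h2]
      have h3 : Integrable (fun ξ : halfSpace n => ((Real.exp (-t * ‖ξ.1‖ ^ 2) : ℝ) : ℂ) * V ξ)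
          (mMeas n lam) := by
        refine hVI.bdd_mul (c := 1) (by fun_prop) (Eventually.of_forall fun ξ => ?_)
        rw [Complex.norm_real, Real.norm_of_nonneg (Real.exp_nonneg _), Real.exp_le_one_iff]
        nlinarith [sq_nonneg ‖ξ.1‖]
      rw [integral_const_mul, integral_bfTransform_mul hlam 1 hφI h3, ← integral_const_mul]
      refine integral_congr_ae (Eventually.of_forall fun y => ?_)
      have h4 := integral_gaussE_mul_heatDens hlam ha ht0 w y (ε := -1) (by norm_num)
      rw [neg_neg] at h4
      simp only
      rw [mul_left_comm, ← h4, ← integral_const_mul]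
      refine integral_congr_ae (Eventually.of_forall fun x => ?_)
      simp only [h]
      ring
    · have hb := norm_bfTransform_le (n := n) hlam 1 hφI
      set B := bfBound n lam * ∫ y, ‖φ y.1‖ ∂(mMeas n lam)
      have h5 : Integrable (fun ξ => bfTransform n lam 1 (fun y => φ y.1) ξ * V ξ) (mMeas n lam) :=
        hVI.bdd_mul (aestronglyMeasurable_bfTransform hlam 1 hφI) (Eventually.of_forall hb)
      have h6 : Integrable (fun z : halfSpace n × ℝ =>
          (bfTransform n lam 1 (fun y => φ y.1) z.1 * V z.1) * (1 : ℂ))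
          ((mMeas n lam).prod ν) := h5.mul_prod (integrable_const (1 : ℂ))
      have h7 : ∀ᵐ z : halfSpace n × ℝ ∂((mMeas n lam).prod ν),
          z.2 ∈ Icc (1 / (N + 1 : ℝ)) (N + 1) :=
        Measure.quasiMeasurePreserving_snd.ae (ae_restrict_mem measurableSet_Icc)
      have h8 := h6.bdd_mul (f := fun z : halfSpace n × ℝ =>
          ((c z.2 * Real.exp (-z.2 * ‖z.1.1‖ ^ 2) : ℝ) : ℂ))
        (c := Real.pi ^ (-(1 / 2) : ℝ) * (N + 1 : ℝ) ^ (1 / 2 : ℝ)) (by fun_prop) ?_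
      · simpa [Function.uncurry_def] using h8
      · filter_upwards [h7] with z hz
        have hz0 := pos_of_mem_Icc hz
        have hpi := Real.pi_pos
        rw [Complex.norm_real, Real.norm_of_nonneg (by positivity)]
        simp only [c]
        rw [← mul_one (Real.pi ^ (-(1 / 2) : ℝ) * (N + 1 : ℝ) ^ (1 / 2 : ℝ))]
        refine mul_le_mul (mul_le_mul_of_nonneg_left (rpow_neg_le_of_mem_Icc hz (by norm_num))
          (by positivity)) ?_ (Real.exp_nonneg _) (by positivity)
        rw [Real.exp_le_one_iff]
        nlinarith [sq_nonneg ‖z.1.1‖]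
  filter_upwards [h0] with x hx using sub_eq_zero.1 hx

end Regularised

/-! ### Kernels of the regularised Bessel–Riesz transforms -/

section Regularised

open Filter Topology

variable {n : ℕ} {lam : ℝ}

theorem LocInt.of_bound {V : halfSpace n → ℂ} (hV : Measurable V) {B : ℝ}
    (hb : ∀ x, ‖V x‖ ≤ B * (1 + ‖x.1‖)) : LocInt V := by
  have h1 : LocallyIntegrable (fun x : Eu n => |B| * (1 + ‖x‖)) :=
    Continuous.locallyIntegrable (by fun_prop)
  refine (h1.mono ?_ (Eventually.of_forall fun x => ?_)).locallyIntegrableOn _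
  · exact ((MeasurableEmbedding.subtype_coe (measurableSet_halfSpace n)).measurable_extend hV
      measurable_const).aestronglyMeasurable
  · rw [Real.norm_of_nonneg (by positivity)]
    by_cases hx : x ∈ halfSpace n
    · rw [extendZero_coe V ⟨x, hx⟩]
      refine (hb _).trans ?_
      gcongr
      exact le_abs_self B
    · rw [extendZero_of_notMem _ hx, norm_zero]
      positivity

theorem abs_heatDensDeriv_le (hlam : 0 < lam) (k : Fin (n + 1)) {N : ℕ} {p : ℝ × ℝ}
    (hp : p.1 ∈ Icc (1 / (N + 1 : ℝ)) (N + 1)) (hp2 : p.2 ∈ Ioo (0 : ℝ) 2) (x y : halfSpace n) :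
    |heatDensDeriv n lam k p x.1 y.1| ≤
      3 * (N + 1) * (heatConst n lam * (N + 1 : ℝ) ^ (halfDim n lam + 1 / 2)) *
        ((1 + ‖x.1‖) * (1 + ‖y.1‖)) := by
  have h0 := abs_heatDens_le hlam hp hp2.1.le x y
  set C := heatConst n lam * (N + 1 : ℝ) ^ (halfDim n lam + 1 / 2)
  have hC : 0 ≤ C := (abs_nonneg _).trans h0
  have ht := pos_of_mem_Icc hp
  have h1 : |-((x.1 k - y.1 k) + (if k = Fin.last n then y.1 (Fin.last n) * p.2 else 0))| ≤
      3 * ((1 + ‖x.1‖) * (1 + ‖y.1‖)) := by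
    rw [abs_neg]
    have h2 := abs_apply_le_norm x.1 k
    have h3 := abs_apply_le_norm y.1 k
    have h4 := abs_apply_le_norm y.1 (Fin.last n)
    have h5 : |(if k = Fin.last n then y.1 (Fin.last n) * p.2 else 0)| ≤ 2 * ‖y.1‖ := by
      split_ifs
      · rw [abs_mul, abs_of_pos hp2.1]
        nlinarith [hp2.2, hp2.1, abs_nonneg (y.1 (Fin.last n)), norm_nonneg y.1]
      · simp
    have h6 := abs_add_le (x.1 k - y.1 k) (if k = Fin.last n then y.1 (Fin.last n) * p.2 else 0)
    have h7 := abs_sub (x.1 k) (y.1 k)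
    nlinarith [norm_nonneg x.1, norm_nonneg y.1, mul_nonneg (norm_nonneg x.1) (norm_nonneg y.1)]
  have h8 : (2 * p.1)⁻¹ ≤ N + 1 := by
    have h9 : p.1⁻¹ ≤ N + 1 := by
      refine inv_le_of_inv_le₀ (by positivity) ?_
      rw [← one_div]
      exact hp.1
    rw [mul_inv]
    have := inv_pos.2 ht
    linarith
  rw [heatDensDeriv, abs_mul, div_eq_mul_inv, abs_mul, abs_of_pos (inv_pos.2 (by positivity : 0 < 2 * p.1))]
  calc _ ≤ 3 * ((1 + ‖x.1‖) * (1 + ‖y.1‖)) * (N + 1) * C := by gcongr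
    _ = _ := by ring

theorem measurable_comp_coe {h : ℝ × ℝ → Eu n → Eu n → ℝ}
    (hm : Measurable fun q : (ℝ × ℝ) × Eu n × Eu n => h q.1 q.2.1 q.2.2) :
    Measurable fun q : (ℝ × ℝ) × halfSpace n × halfSpace n => (h q.1 q.2.1.1 q.2.2.1 : ℂ) :=
  Complex.measurable_ofReal.comp
    (hm.comp (g := fun q : (ℝ × ℝ) × Eu n × Eu n => h q.1 q.2.1 q.2.2)
      (f := fun q : (ℝ × ℝ) × halfSpace n × halfSpace n => (q.1, q.2.1.1, q.2.2.1)) (by fun_prop))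

theorem integrable_norm_mul_test (χ : 𝓓(halfSpace n, ℂ)) {a : Eu n → ℝ} (ha : Continuous a) :
    Integrable (fun x : halfSpace n => a x.1 * ‖χ x.1‖) (leb n) := by
  have h2 : Integrable fun x => ((a x * ‖χ x‖ : ℝ) : ℂ) :=
    Continuous.integrable_of_hasCompactSupport
      (Complex.continuous_ofReal.comp (ha.mul χ.continuous.norm))
      ((χ.hasCompactSupport.norm.mul_left).comp_left Complex.ofReal_zero)
  have h3 := ((integrable_leb_iff fun x => ((a x * ‖χ x‖ : ℝ) : ℂ)).2 h2.integrableOn).re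
  exact h3

theorem integrable_kernel_mul_test (hlam : 0 < lam) (N : ℕ) {h : ℝ × ℝ → Eu n → Eu n → ℝ}
    (hm : Measurable fun q : (ℝ × ℝ) × Eu n × Eu n => h q.1 q.2.1 q.2.2) {B : ℝ}
    (hb : ∀ p : ℝ × ℝ, p.1 ∈ Icc (1 / (N + 1 : ℝ)) (N + 1) → p.2 ∈ Ioo (0 : ℝ) 2 →
      ∀ x y : halfSpace n, |h p x.1 y.1| ≤ B * ((1 + ‖x.1‖) * (1 + ‖y.1‖)))
    (φ χ : 𝓓(halfSpace n, ℂ)) :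
    Integrable (fun q : (ℝ × ℝ) × halfSpace n × halfSpace n =>
      (h q.1 q.2.1.1 q.2.2.1 : ℂ) * φ q.2.2.1 * χ q.2.1.1)
      ((cutMeas lam N).prod ((leb n).prod (mMeas n lam))) := by
  have := isFiniteMeasure_cutMeas hlam N
  have hφm : Measurable fun y : halfSpace n => φ y.1 :=
    (φ.continuous.comp continuous_subtype_val).measurable
  have hχm : Measurable fun y : halfSpace n => χ y.1 :=
    (χ.continuous.comp continuous_subtype_val).measurable
  have ha := integrable_norm_mul_test χ (a := fun x => B * (1 + ‖x‖)) (by fun_prop)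
  have hc : Continuous fun y : Eu n => (((1 + ‖y‖ : ℝ)) : ℂ) * φ y := by
    have := φ.continuous
    fun_prop
  have hb' := (integrable_mMeas_of_hasCompactSupport (n := n) hlam hc
    φ.hasCompactSupport.mul_left).norm
  let G : ℝ × ℝ → halfSpace n → halfSpace n → ℂ := fun p x y => (h p x.1 y.1 : ℂ) * φ y.1 * χ x.1
  have hG : Measurable fun q : (ℝ × ℝ) × halfSpace n × halfSpace n => G q.1 q.2.1 q.2.2 :=
    ((measurable_comp_coe hm).mul (hφm.comp (measurable_snd.comp measurable_snd))).mul
      (hχm.comp (measurable_fst.comp measurable_snd))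
  have hab : ∀ᵐ p ∂(cutMeas lam N), ∀ x y, ‖G p x y‖ ≤ (B * (1 + ‖x.1‖) * ‖χ x.1‖) *
      ‖(((1 + ‖y.1‖ : ℝ)) : ℂ) * φ y.1‖ := by
    filter_upwards [ae_mem_cutMeas hlam N] with p hp x y
    have := hb p hp.1 hp.2 x y
    rw [norm_mul, norm_mul, norm_mul, Complex.norm_real, Complex.norm_real, Real.norm_eq_abs,
      Real.norm_of_nonneg (by positivity : 0 ≤ 1 + ‖y.1‖)]
    calc _ ≤ B * ((1 + ‖x.1‖) * (1 + ‖y.1‖)) * ‖φ y.1‖ * ‖χ x.1‖ := by gcongr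
      _ = _ := by ring
  exact integrable_of_norm_le_mul (ν := cutMeas lam N) (μ := leb n) (μ' := mMeas n lam) hG ha hb' hab

/-- Differentiation under the integral sign, in the weak sense. -/
theorem isWeakDeriv_heatPotential (hlam : 0 < lam) (k : Fin (n + 1)) (N : ℕ) (φ : 𝓓(halfSpace n, ℂ)) :
    IsWeakDeriv k
      (fun x => ∫ y, ∫ p, (heatDens n lam p x.1 y.1 : ℂ) * φ y.1 ∂(cutMeas lam N) ∂(mMeas n lam))
      (fun x => ∫ y, ∫ p, (heatDensDeriv n lam k p x.1 y.1 : ℂ) * φ y.1 ∂(cutMeas lam N)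
        ∂(mMeas n lam)) := by
  have := isFiniteMeasure_cutMeas hlam N
  intro χ
  set C := heatConst n lam * (N + 1 : ℝ) ^ (halfDim n lam + 1 / 2) with hC
  have hC0 : 0 ≤ C := mul_nonneg (heatConst_pos n hlam).le (by positivity)
  have hI1 := integrable_kernel_mul_test hlam N (B := C) measurable_heatDens
    (fun p hp hp2 x y => (abs_heatDens_le hlam hp hp2.1.le x y).trans (by
      refine le_mul_of_one_le_right hC0 ?_
      nlinarith [norm_nonneg x.1, norm_nonneg y.1, mul_nonneg (norm_nonneg x.1) (norm_nonneg y.1)]))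
    φ (derivTest k χ)
  have hI2 := integrable_kernel_mul_test hlam N (measurable_heatDensDeriv k)
    (fun p hp hp2 x y => abs_heatDensDeriv_le hlam k hp hp2 x y) φ χ
  have hU : ∀ (h : ℝ × ℝ → Eu n → Eu n → ℝ) (χ : 𝓓(halfSpace n, ℂ)) (x : halfSpace n),
      (∫ y, ∫ p, (h p x.1 y.1 : ℂ) * φ y.1 ∂(cutMeas lam N) ∂(mMeas n lam)) * χ x.1 =
      ∫ y, ∫ p, (h p x.1 y.1 : ℂ) * φ y.1 * χ x.1 ∂(cutMeas lam N) ∂(mMeas n lam) := fun h χ x => by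
    simp_rw [integral_mul_const]
  let G₁ : ℝ × ℝ → halfSpace n → halfSpace n → ℂ := fun p x y =>
    (heatDens n lam p x.1 y.1 : ℂ) * φ y.1 * derivTest k χ x.1
  let G₂ : ℝ × ℝ → halfSpace n → halfSpace n → ℂ := fun p x y =>
    (heatDensDeriv n lam k p x.1 y.1 : ℂ) * φ y.1 * χ x.1
  have h1 := (integral_integral_integral_swap (ν := cutMeas lam N) (μ := leb n)
    (μ' := mMeas n lam) (G := G₁) hI1).2
  have h2 := (integral_integral_integral_swap (ν := cutMeas lam N) (μ := leb n)
    (μ' := mMeas n lam) (G := G₂) hI2).2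
  simp_rw [← derivTest_apply, hU]
  refine h1.trans (Eq.trans ?_ (congrArg Neg.neg h2).symm)
  rw [← integral_neg]
  refine integral_congr_ae (Eventually.of_forall fun p => ?_)
  simp only
  rw [← integral_neg]
  refine integral_congr_ae (Eventually.of_forall fun y => ?_)
  have h3 := integral_mul_derivTest k χ (K := fun x => (heatDens n lam p x y.1 : ℂ))
    (K' := fun x => (heatDensDeriv n lam k p x y.1 : ℂ))
    (Complex.continuous_ofReal.comp (continuous_heatDens p y.1))
    (Complex.continuous_ofReal.comp (continuous_heatDensDeriv k p y.1))
    fun x => hasLineDerivAt_heatDens k p x y.1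
  simp only [G₁, G₂]
  simp_rw [mul_right_comm _ (φ y.1)]
  rw [integral_mul_const, integral_mul_const, h3]
  ring

/-- The regularised Bessel–Riesz transform is an integral operator on test functions: its kernel is the
`x_k`-derivative of the heat kernel, integrated over the times in `[1/(N+1), N+1]`. -/
theorem besselRiesz_besselReg_ae_eq (hlam : 0 < lam) (k : Fin (n + 1)) (N : ℕ) (φ : 𝓓(halfSpace n, ℂ)) :
    besselRiesz n lam k (besselReg n lam N ((memLp_test hlam φ).toLp _)) =ᵐ[mMeas n lam]
      fun x => ∫ y, ∫ p, (heatDensDeriv n lam k p x.1 y.1 : ℂ) * φ y.1 ∂(cutMeas lam N)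
        ∂(mMeas n lam) := by
  have := isFiniteMeasure_cutMeas hlam N
  have h1 := isBesselRiesz_besselRiesz hlam k _ _
    (isBesselPow_besselReg N ((memLp_test (n := n) hlam φ).toLp _))
  have h2 : IsWeakDeriv k (besselInvReg n lam N ((memLp_test hlam φ).toLp _))
      (fun x => ∫ y, ∫ p, (heatDensDeriv n lam k p x.1 y.1 : ℂ) * φ y.1 ∂(cutMeas lam N)
        ∂(mMeas n lam)) := by
    intro χ
    rw [← isWeakDeriv_heatPotential hlam k N φ χ]
    refine integral_congr_ae ?_
    filter_upwards [(volume_ac_mMeas n lam).ae_le (besselInvReg_ae_eq hlam N φ)] with x hx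
    rw [hx]
  refine (mMeas_ac_volume n lam).ae_le
    (h1.ae_unique h2 (LocInt.of_memLp' (Lp.memLp _)) ?_)
  set C := heatConst n lam * (N + 1 : ℝ) ^ (halfDim n lam + 1 / 2) with hC
  have hφI := (integrable_mMeas_of_hasCompactSupport (n := n) hlam
    (f := fun y => (((1 + ‖y‖ : ℝ)) : ℂ) * φ y)
        (by have := φ.continuous; fun_prop) φ.hasCompactSupport.mul_left).norm
  refine LocInt.of_bound (B := ∫ y : halfSpace n, 3 * (N + 1) * C * (cutMeas lam N).real univ *
    ‖(((1 + ‖y.1‖ : ℝ)) : ℂ) * φ y.1‖ ∂(mMeas n lam)) ?_ fun x => ?_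
  · have hφm : Measurable fun y : halfSpace n => φ y.1 :=
      (φ.continuous.comp continuous_subtype_val).measurable
    have hm1 : Measurable fun z : (halfSpace n × halfSpace n) × (ℝ × ℝ) =>
        (heatDensDeriv n lam k z.2 z.1.1.1 z.1.2.1 : ℂ) * φ z.1.2.1 :=
      ((measurable_comp_coe (measurable_heatDensDeriv (lam := lam) k)).comp
        (f := fun z : (halfSpace n × halfSpace n) × (ℝ × ℝ) => (z.2, z.1.1, z.1.2))
        (by fun_prop)).mul (by fun_prop)
    have hm2 := hm1.stronglyMeasurable.integral_prod_right' (ν := cutMeas lam N)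
    exact (hm2.integral_prod_right' (ν := mMeas n lam)).measurable
  · rw [← integral_mul_const]
    refine norm_integral_le_of_norm_le ((hφI.const_mul _).mul_const _) (Eventually.of_forall fun y => ?_)
    have h3 := norm_integral_le_of_norm_le_const (μ := cutMeas lam N)
      (f := fun p => (heatDensDeriv n lam k p x.1 y.1 : ℂ) * φ y.1)
      (C := 3 * (N + 1) * C * ((1 + ‖x.1‖) * (1 + ‖y.1‖)) * ‖φ y.1‖) ?_
    · refine h3.trans (le_of_eq ?_)
      rw [norm_mul, Complex.norm_real, Real.norm_of_nonneg (by positivity : 0 ≤ 1 + ‖y.1‖)]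
      ring
    · filter_upwards [ae_mem_cutMeas hlam N] with p hp
      have := abs_heatDensDeriv_le hlam k hp.1 hp.2 x y
      rw [norm_mul, Complex.norm_real, Real.norm_eq_abs]
      gcongr

end Regularised

/-! ### Bounds for the symbols `F_{k,l}` -/

section SymbolBounds

open Filter Topology

variable {n : ℕ} {lam : ℝ}

theorem F_eq (k l : ℕ) (x : ℝ) :
    F n lam k l x = x ^ (n + k) * ∫ s, (x ^ 2 + 2 * s) ^ (-lam - n / 2 - 1) * s ^ l ∂(poissonMeas lam) := by
  rw [F, integral_poissonMeas_real]
  congr 1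
  exact intervalIntegral.integral_congr fun s _ => by ring

theorem F_zero (k l : ℕ) (h : n + k ≠ 0) : F n lam k l 0 = 0 := by
  rw [F, zero_pow h, zero_mul]

theorem F_nonneg (k l : ℕ) {x : ℝ} (hx : 0 ≤ x) : 0 ≤ F n lam k l x := by
  rw [F_eq]
  refine mul_nonneg (by positivity) (integral_nonneg_of_ae ?_)
  filter_upwards [ae_mem_poissonMeas] with s hs
  have : 0 < s := hs.1
  simp only [Pi.zero_apply]
  positivity

theorem integrable_rpow_poissonMeas (hlam : 0 < lam) {A B : ℝ} (hA : 0 < A) (hB : 0 ≤ B) (s : ℝ)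
    (l : ℕ) : Integrable (fun t => (A + B * t) ^ s * t ^ l) (poissonMeas lam) := by
  have := isFiniteMeasure_poissonMeas hlam
  have hc : ContinuousOn (fun t : ℝ => (A + B * t) ^ s * t ^ l) (Icc 0 2) := by
    refine ContinuousOn.mul (ContinuousOn.rpow_const (by fun_prop) fun t ht => Or.inl ?_) (by fun_prop)
    have := ht.1
    positivity
  obtain ⟨C, hC⟩ := isCompact_Icc.exists_bound_of_continuousOn hc
  refine Integrable.of_bound (Measurable.aestronglyMeasurable (by fun_prop)) C ?_
  filter_upwards [ae_mem_poissonMeas] with t ht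
  exact hC t ⟨ht.1.le, ht.2.le⟩

/-- The majorant `∫ x² (x² + 2s)^{-λ-1} (2s - s²)^{λ-1} ds` of the symbols is bounded, the function
`(s/(x² + 2s))^λ` being an antiderivative of the integrand without the factor `(2-s)^{λ-1}`. -/
theorem exists_integral_poissonMeas_le (hlam : 0 < lam) :
    ∃ C : ℝ, ∀ x : ℝ, 0 < x → ∫ s, x ^ 2 * (x ^ 2 + 2 * s) ^ (-lam - 1) ∂(poissonMeas lam) ≤ C := by
  refine ⟨(2 ^ (lam - 1) + 1) * (1 / lam) + poissonMoment lam 0, fun x hx => ?_⟩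
  let d : ℝ → ℝ := fun t => t ^ (lam - 1) * (x ^ 2 * (x ^ 2 + 2 * t) ^ (-lam - 1))
  have hcont : ContinuousOn (fun t : ℝ => (t / (x ^ 2 + 2 * t)) ^ lam / lam) (Icc 0 2) := by
    refine ContinuousOn.div_const (ContinuousOn.rpow_const (ContinuousOn.div (by fun_prop) (by fun_prop)
      fun t ht => ?_) fun t _ => Or.inr hlam.le) _
    have := ht.1
    positivity
  have hderiv : ∀ t ∈ Ioo (0 : ℝ) 2, HasDerivAt (fun t : ℝ => (t / (x ^ 2 + 2 * t)) ^ lam / lam) (d t) t := by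
    intro t ht
    have ht0 : 0 < t := ht.1
    have hD : 0 < x ^ 2 + 2 * t := by positivity
    have h1 : HasDerivAt (fun t : ℝ => x ^ 2 + 2 * t) (2 * 1) t :=
      ((hasDerivAt_id t).const_mul 2).const_add _
    have h2 := (((hasDerivAt_id t).div h1 hD.ne').rpow_const (p := lam)
      (Or.inl (div_pos ht0 hD).ne')).div_const lam
    refine h2.congr_deriv ?_
    simp only [d, id, Pi.div_apply]
    have h3 : (x ^ 2 + 2 * t) ^ (-lam - 1) =
        ((x ^ 2 + 2 * t) ^ (lam - 1) * (x ^ 2 + 2 * t) ^ 2)⁻¹ := by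
      rw [← Real.rpow_natCast (x ^ 2 + 2 * t) 2, ← Real.rpow_add hD, ← Real.rpow_neg hD.le]
      congr 1
      push_cast
      ring
    rw [Real.div_rpow ht0.le hD.le, h3]
    have := Real.rpow_pos_of_pos hD (lam - 1)
    field_simp
    ring
  have hd0 : ∀ t ∈ Ioo (0 : ℝ) 2, 0 ≤ d t := fun t ht => by
    have : 0 < t := ht.1
    simp only [d]
    positivity
  have hdI : IntervalIntegrable d volume 0 2 := by
    rw [intervalIntegrable_iff_integrableOn_Ioc_of_le (by norm_num)]
    exact intervalIntegral.integrableOn_deriv_of_nonneg hcont hderiv hd0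
  have hint : ∫ t in (0 : ℝ)..2, d t ≤ 1 / lam := by
    rw [intervalIntegral.integral_eq_sub_of_hasDerivAt_of_le (by norm_num) hcont hderiv hdI]
    simp only [zero_div, Real.zero_rpow hlam.ne', sub_zero]
    refine div_le_div_of_nonneg_right ?_ hlam.le
    refine Real.rpow_le_one (by positivity) ?_ hlam.le
    rw [div_le_one (by positivity)]
    nlinarith [sq_nonneg x]
  have hM : poissonMoment lam 0 = ∫ t in (0 : ℝ)..2, (2 * t - t ^ 2) ^ (lam - 1) := by
    rw [poissonMoment, integral_poissonMeas_real]
    simp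
  rw [integral_poissonMeas_real, hM]
  have hwI := intervalIntegrable_poissonWeight hlam
  have hlI : IntervalIntegrable (fun t : ℝ => (2 * t - t ^ 2) ^ (lam - 1) *
      (x ^ 2 * (x ^ 2 + 2 * t) ^ (-lam - 1))) volume 0 2 := by
    refine hwI.mul_continuousOn (ContinuousOn.mul (by fun_prop) (ContinuousOn.rpow_const (by fun_prop)
      fun t ht => Or.inl ?_))
    rw [uIcc_of_le (by norm_num)] at ht
    have := ht.1
    positivity
  calc ∫ t in (0 : ℝ)..2, (2 * t - t ^ 2) ^ (lam - 1) * (x ^ 2 * (x ^ 2 + 2 * t) ^ (-lam - 1))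
      ≤ ∫ t in (0 : ℝ)..2, ((2 ^ (lam - 1) + 1) * d t + (2 * t - t ^ 2) ^ (lam - 1)) := by
        refine intervalIntegral.integral_mono_on_of_le_Ioo (by norm_num) hlI
          ((hdI.const_mul _).add hwI) fun t ht => ?_
        have ht0 : 0 < t := ht.1
        have ht2 : 0 < 2 - t := by linarith [ht.2]
        have hD : 0 < x ^ 2 + 2 * t := by positivity
        have hw : (2 * t - t ^ 2) ^ (lam - 1) = t ^ (lam - 1) * (2 - t) ^ (lam - 1) := by
          rw [← Real.mul_rpow ht0.le ht2.le]; congr 1; ring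
        have hw0 : 0 ≤ (2 * t - t ^ 2) ^ (lam - 1) := by rw [hw]; positivity
        rcases le_total t 1 with h1 | h1
        · have h2 : (2 - t) ^ (lam - 1) ≤ 2 ^ (lam - 1) + 1 := by
            rcases le_total 0 (lam - 1) with h3 | h3
            · have := Real.rpow_le_rpow ht2.le (by linarith : 2 - t ≤ 2) h3
              linarith
            · have := Real.rpow_le_one_of_one_le_of_nonpos (by linarith : 1 ≤ 2 - t) h3
              have := Real.rpow_nonneg (zero_le_two (α := ℝ)) (lam - 1)
              linarith
          have h4 : (2 * t - t ^ 2) ^ (lam - 1) * (x ^ 2 * (x ^ 2 + 2 * t) ^ (-lam - 1)) =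
              (2 - t) ^ (lam - 1) * d t := by rw [hw]; simp only [d]; ring
          rw [h4]
          have := mul_le_mul_of_nonneg_right h2 (hd0 t ht)
          linarith
        · have h2 : x ^ 2 * (x ^ 2 + 2 * t) ^ (-lam - 1) ≤ 1 := by
            rw [Real.rpow_sub hD, Real.rpow_one, ← mul_div_assoc, div_le_one hD, mul_comm]
            have h3 : (x ^ 2 + 2 * t) ^ (-lam) ≤ 1 :=
              Real.rpow_le_one_of_one_le_of_nonpos (by nlinarith [sq_nonneg x]) (by linarith)
            nlinarith [sq_nonneg x]
          have h3 := mul_le_mul_of_nonneg_left h2 hw0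
          have h4 := mul_nonneg (by positivity : (0 : ℝ) ≤ 2 ^ (lam - 1) + 1) (hd0 t ht)
          linarith
    _ = (2 ^ (lam - 1) + 1) * (∫ t in (0 : ℝ)..2, d t) +
          ∫ t in (0 : ℝ)..2, (2 * t - t ^ 2) ^ (lam - 1) := by
        rw [intervalIntegral.integral_add (hdI.const_mul _) hwI, intervalIntegral.integral_const_mul]
    _ ≤ _ := by gcongr

theorem rpow_split {B : ℝ} (hB : 0 < B) :
    B ^ (-lam - n / 2 - 1) = B ^ (-lam - 1) * (Real.sqrt B ^ n)⁻¹ := by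
  rw [Real.sqrt_eq_rpow, ← Real.rpow_natCast, ← Real.rpow_mul hB.le, ← Real.rpow_neg hB.le,
    ← Real.rpow_add hB]
  congr 1
  ring

/-- Boundedness of the symbols. With `B = s² + 2t`, the factors `s^n` and `t` are absorbed by powers of
`B^{1/2}`, and what remains is `s² ∫ B^{-λ-1} (2t - t²)^{λ-1} dt`, bounded uniformly in `s`. For
`F_{1,1}` one factor `s` of `s^{n+1}` is kept beside `s^n`, so that `n ≥ 1` is needed here. -/
theorem exists_F_le (hn : 1 ≤ n) (hlam : 0 < lam) :
    ∃ C : ℝ, ∀ x : ℝ, 0 ≤ x → F n lam 2 0 x ≤ C ∧ F n lam 1 1 x ≤ C ∧ F n lam 2 1 x ≤ C := by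
  obtain ⟨C, hC⟩ := exists_integral_poissonMeas_le hlam
  have hC0 : 0 ≤ C := by
    refine le_trans (integral_nonneg_of_ae ?_) (hC 1 one_pos)
    filter_upwards [ae_mem_poissonMeas] with s hs
    have : 0 < s := hs.1
    simp only [Pi.zero_apply]
    positivity
  refine ⟨2 * C, fun x hx => ?_⟩
  rcases hx.eq_or_lt with rfl | hx
  · rw [F_zero _ _ (by omega), F_zero _ _ (by omega), F_zero _ _ (by omega)]
    exact ⟨by positivity, by positivity, by positivity⟩
  have hI : ∀ l : ℕ, Integrable (fun s => (x ^ 2 + 2 * s) ^ (-lam - n / 2 - 1) * s ^ l)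
      (poissonMeas lam) := fun l =>
    integrable_rpow_poissonMeas hlam (by positivity) (by norm_num) _ l
  have hJ : Integrable (fun s => x ^ 2 * (x ^ 2 + 2 * s) ^ (-lam - 1)) (poissonMeas lam) := by
    simpa using (integrable_rpow_poissonMeas hlam (A := x ^ 2) (B := 2) (by positivity)
      (by norm_num) (-lam - 1) 0).const_mul (x ^ 2)
  have key : ∀ (k l : ℕ), (∀ s ∈ Ioo (0 : ℝ) 2, x ^ (n + k) * ((x ^ 2 + 2 * s) ^ (-lam - n / 2 - 1) * s ^ l) ≤
      2 * (x ^ 2 * (x ^ 2 + 2 * s) ^ (-lam - 1))) → F n lam k l x ≤ 2 * C := by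
    intro k l h
    rw [F_eq, ← integral_const_mul]
    calc _ ≤ ∫ s, 2 * (x ^ 2 * (x ^ 2 + 2 * s) ^ (-lam - 1)) ∂(poissonMeas lam) := by
          refine integral_mono_ae ((hI l).const_mul _) (hJ.const_mul _) ?_
          filter_upwards [ae_mem_poissonMeas] with s hs using h s hs
      _ ≤ 2 * C := by
          rw [integral_const_mul]
          have := hC x hx
          linarith
  have hbase : ∀ s ∈ Ioo (0 : ℝ) 2, 0 < x ^ 2 + 2 * s ∧ x ≤ Real.sqrt (x ^ 2 + 2 * s) ∧
      s ≤ Real.sqrt (x ^ 2 + 2 * s) := fun s hs => by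
    have hs0 : 0 < s := hs.1
    refine ⟨by positivity, Real.le_sqrt_of_sq_le (by linarith), Real.le_sqrt_of_sq_le ?_⟩
    nlinarith [hs.2, sq_nonneg x]
  have h20 : ∀ s ∈ Ioo (0 : ℝ) 2, x ^ (n + 2) * (x ^ 2 + 2 * s) ^ (-lam - n / 2 - 1) ≤
      x ^ 2 * (x ^ 2 + 2 * s) ^ (-lam - 1) := fun s hs => by
    obtain ⟨hB, h1, -⟩ := hbase s hs
    have hb := Real.sqrt_pos.2 hB
    rw [rpow_split hB]
    set b := Real.sqrt (x ^ 2 + 2 * s)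
    set P := (x ^ 2 + 2 * s) ^ (-lam - 1) with hP
    have hP0 : 0 ≤ P := by positivity
    calc x ^ (n + 2) * (P * (b ^ n)⁻¹) = x ^ 2 * P * (x ^ n * (b ^ n)⁻¹) := by ring
      _ ≤ x ^ 2 * P * 1 := by
          gcongr
          rw [← div_eq_mul_inv]
          exact div_le_one_of_le₀ (pow_le_pow_left₀ hx.le h1 n) (by positivity)
      _ = _ := by ring
  refine ⟨key 2 0 fun s hs => ?_, key 1 1 fun s hs => ?_, key 2 1 fun s hs => ?_⟩
  · have h1 := h20 s hs
    obtain ⟨hB, -, -⟩ := hbase s hs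
    have : 0 ≤ x ^ 2 * (x ^ 2 + 2 * s) ^ (-lam - 1) := by positivity
    rw [pow_zero, mul_one]
    linarith
  · obtain ⟨hB, h1, h2⟩ := hbase s hs
    have hb := Real.sqrt_pos.2 hB
    -- `x ^ (n + 1) = x ^ 2 * x ^ (n - 1)`
    obtain ⟨m, rfl⟩ := Nat.exists_eq_add_of_le' hn
    rw [rpow_split hB]
    set b := Real.sqrt (x ^ 2 + 2 * s)
    set P := (x ^ 2 + 2 * s) ^ (-lam - 1) with hP
    have hP0 : 0 ≤ P := by positivity
    have hs0 : 0 ≤ s := hs.1.le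
    calc x ^ (m + 1 + 1) * (P * (b ^ (m + 1))⁻¹ * s ^ 1) =
          x ^ 2 * P * ((x ^ m * (b ^ m)⁻¹) * (s * b⁻¹)) := by
            rw [pow_succ b m, mul_inv]; ring
      _ ≤ x ^ 2 * P * (1 * 1) := by
          gcongr
          · rw [← div_eq_mul_inv]
            exact div_le_one_of_le₀ (pow_le_pow_left₀ hx.le h1 m) (by positivity)
          · rw [← div_eq_mul_inv]
            exact div_le_one_of_le₀ h2 hb.le
      _ ≤ _ := by
          have : 0 ≤ x ^ 2 * P := by positivity
          linarith
  · have h1 := h20 s hs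
    obtain ⟨hB, -, -⟩ := hbase s hs
    have h2 : 0 ≤ x ^ (n + 2) * (x ^ 2 + 2 * s) ^ (-lam - n / 2 - 1) := by positivity
    have h3 := hs.2
    rw [pow_one]
    nlinarith [hs.1]

end SymbolBounds

/-! ### `L²`-boundedness of the commutator kernels -/

section KernelBounds

open Filter Topology

variable {n : ℕ} {lam : ℝ}

theorem integrable_near (n : ℕ) :
    Integrable fun z : Eu n => (Iic (1 : ℝ)).indicator (fun r => (r ^ n)⁻¹) ‖z‖ := by
  rw [integrable_fun_norm_addHaar]
  have h1 : IntegrableOn ((Iic (1 : ℝ)).indicator fun _ => (1 : ℝ)) (Ioi 0) := by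
    rw [IntegrableOn, integrable_indicator_iff measurableSet_Iic, IntegrableOn,
      Measure.restrict_restrict measurableSet_Iic, Iic_inter_Ioi]
    exact integrable_const _
  refine h1.congr_fun (fun r hr => ?_) measurableSet_Ioi
  have hr : 0 < r := hr
  simp only [finrank_euclideanSpace, Fintype.card_fin, Nat.add_sub_cancel, smul_eq_mul]
  by_cases h : r ≤ 1
  · rw [indicator_of_mem (show r ∈ Iic 1 from h), indicator_of_mem (show r ∈ Iic 1 from h),
      mul_inv_cancel₀ (by positivity)]
  · rw [indicator_of_notMem (show r ∉ Iic 1 from h), indicator_of_notMem (show r ∉ Iic 1 from h),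
      mul_zero]

theorem integrable_far (n : ℕ) :
    Integrable fun z : Eu n => (Ioi (1 : ℝ)).indicator (fun r => (r ^ (2 * n + 2))⁻¹) ‖z‖ := by
  rw [integrable_fun_norm_addHaar]
  have h1 : IntegrableOn ((Ioi (1 : ℝ)).indicator fun r => r ^ (-(n + 2) : ℝ)) (Ioi 0) := by
    rw [IntegrableOn, integrable_indicator_iff measurableSet_Ioi, IntegrableOn,
      Measure.restrict_restrict measurableSet_Ioi, inter_eq_left.2 (Ioi_subset_Ioi zero_le_one)]
    exact integrableOn_Ioi_rpow_of_lt (by linarith [Nat.cast_nonneg (α := ℝ) n]) one_pos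
  refine h1.congr_fun (fun r hr => ?_) measurableSet_Ioi
  have hr : 0 < r := hr
  simp only [finrank_euclideanSpace, Fintype.card_fin, Nat.add_sub_cancel, smul_eq_mul]
  by_cases h : 1 < r
  · rw [indicator_of_mem (show r ∈ Ioi 1 from h), indicator_of_mem (show r ∈ Ioi 1 from h),
      Real.rpow_neg hr.le, show ((n : ℝ) + 2) = ((n + 2 : ℕ) : ℝ) by push_cast; ring,
      Real.rpow_natCast]
    field_simp
    ring
  · rw [indicator_of_notMem (show r ∉ Ioi 1 from h), indicator_of_notMem (show r ∉ Ioi 1 from h),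
      mul_zero]

/-- The majorant `|f(x) - f(y)| |x - y|^{-n-1}` of the kernels of the commutators with `M_f`. -/
def commMaj (f : Eu n → ℂ) (x y : Eu n) : ℝ≥0∞ :=
  ‖f x - f y‖ₑ * ENNReal.ofReal ((‖x - y‖ ^ (n + 1))⁻¹)

theorem measurable_near : Measurable fun p : Eu n × Eu n =>
    ENNReal.ofReal ((Iic (1 : ℝ)).indicator (fun r => (r ^ n)⁻¹) ‖p.1 - p.2‖) := by
  refine ENNReal.measurable_ofReal.comp (Measurable.comp (g := (Iic (1 : ℝ)).indicator
    fun r => (r ^ n)⁻¹) ?_ (by fun_prop))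
  exact Measurable.indicator (by fun_prop) measurableSet_Iic

theorem l2Bounded_near {L : ℝ} :
    L2Bounded (volume : Measure (Eu n)) fun x y => ENNReal.ofReal L *
      ENNReal.ofReal ((Iic (1 : ℝ)).indicator (fun r => (r ^ n)⁻¹) ‖x - y‖) := by
  refine L2Bounded.const_mul ?_ ENNReal.ofReal_ne_top
  have h1 := (integrable_near n).lintegral_lt_top.ne
  refine l2Bounded_of_lintegral_le measurable_near h1 h1 (fun x => ?_) fun y => ?_
  · exact (lintegral_sub_left_eq_self (fun z : Eu n =>
      ENNReal.ofReal ((Iic (1 : ℝ)).indicator (fun r => (r ^ n)⁻¹) ‖z‖)) x).le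
  · exact (lintegral_sub_right_eq_self (fun z : Eu n =>
      ENNReal.ofReal ((Iic (1 : ℝ)).indicator (fun r => (r ^ n)⁻¹) ‖z‖)) y).le

theorem measurable_far : Measurable fun p : Eu n × Eu n =>
    (Ioi (1 : ℝ)).indicator (fun r => (r ^ (n + 1))⁻¹) ‖p.1 - p.2‖ := by
  refine Measurable.comp (g := (Ioi (1 : ℝ)).indicator fun r => (r ^ (n + 1))⁻¹) ?_ (by fun_prop)
  exact Measurable.indicator (by fun_prop) measurableSet_Ioi

theorem l2Bounded_far {f : Eu n → ℂ} (hf : Continuous f) (hf' : HasCompactSupport f) :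
    L2Bounded (volume : Measure (Eu n)) fun x y => ‖f x - f y‖ₑ *
      ENNReal.ofReal ((Ioi (1 : ℝ)).indicator (fun r => (r ^ (n + 1))⁻¹) ‖x - y‖) := by
  have hfm := hf.measurable
  refine l2Bounded_of_lintegral_sq_ne_top (fun x => ?_) ?_
  · have := (measurable_far (n := n)).comp (measurable_prodMk_left (x := x))
    simp only [Function.comp_def] at this
    fun_prop
  set ν : Eu n → ℝ≥0∞ := fun z =>
    ENNReal.ofReal ((Ioi (1 : ℝ)).indicator (fun r => (r ^ (2 * n + 2))⁻¹) ‖z‖) with hν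
  have hνm : Measurable ν := by
    refine ENNReal.measurable_ofReal.comp (Measurable.comp (g := (Ioi (1 : ℝ)).indicator
      fun r => (r ^ (2 * n + 2))⁻¹) ?_ (by fun_prop))
    exact Measurable.indicator (by fun_prop) measurableSet_Ioi
  have hνI : ∫⁻ z, ν z ≠ ⊤ := (integrable_far n).lintegral_lt_top.ne
  have hfI : ∫⁻ x, ‖f x‖ₑ ^ 2 ≠ ⊤ := by
    have h1 : Integrable fun x => f x * f x :=
      (hf.mul hf).integrable_of_hasCompactSupport hf'.mul_left
    have h2 := h1.2
    simp only [HasFiniteIntegral, ← pow_two, enorm_pow] at h2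
    exact h2.ne
  have hpt : ∀ x y, (‖f x - f y‖ₑ *
      ENNReal.ofReal ((Ioi (1 : ℝ)).indicator (fun r => (r ^ (n + 1))⁻¹) ‖x - y‖)) ^ 2 ≤
      2 * (‖f x‖ₑ ^ 2 * ν (x - y) + ‖f y‖ₑ ^ 2 * ν (x - y)) := fun x y => by
    have h1 : ENNReal.ofReal ((Ioi (1 : ℝ)).indicator (fun r => (r ^ (n + 1))⁻¹) ‖x - y‖) ^ 2 =
        ν (x - y) := by
      rw [hν, ← ENNReal.ofReal_pow (indicator_nonneg (fun r hr => by
        have : (0 : ℝ) < r := one_pos.trans hr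
        positivity) _)]
      congr 1
      by_cases h : 1 < ‖x - y‖
      · rw [indicator_of_mem (show ‖x - y‖ ∈ Ioi 1 from h), indicator_of_mem
          (show ‖x - y‖ ∈ Ioi 1 from h), inv_pow, ← pow_mul]
        congr 2
        ring
      · rw [indicator_of_notMem (show ‖x - y‖ ∉ Ioi 1 from h), indicator_of_notMem
          (show ‖x - y‖ ∉ Ioi 1 from h)]
        simp
    have h2 : ‖f x - f y‖ₑ ^ 2 ≤ 2 * (‖f x‖ₑ ^ 2 + ‖f y‖ₑ ^ 2) := by
      have h3 : ‖f x - f y‖ ^ 2 ≤ 2 * (‖f x‖ ^ 2 + ‖f y‖ ^ 2) := by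
        have := norm_sub_le (f x) (f y)
        nlinarith [sq_nonneg (‖f x‖ - ‖f y‖), norm_nonneg (f x - f y), norm_nonneg (f x),
          norm_nonneg (f y)]
      have h4 := ENNReal.ofReal_le_ofReal h3
      rw [ENNReal.ofReal_mul (by norm_num), ENNReal.ofReal_add (by positivity) (by positivity),
        ENNReal.ofReal_pow (norm_nonneg _), ENNReal.ofReal_pow (norm_nonneg _),
        ENNReal.ofReal_pow (norm_nonneg _), ofReal_norm, ofReal_norm, ofReal_norm] at h4
      simpa using h4
    rw [mul_pow, h1, ← add_mul, ← mul_assoc]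
    gcongr
  refine ne_top_of_le_ne_top ?_ (lintegral_mono fun x => lintegral_mono fun y => hpt x y)
  have h1 : ∀ x, ∫⁻ y, ‖f x‖ₑ ^ 2 * ν (x - y) = ‖f x‖ₑ ^ 2 * ∫⁻ z, ν z := fun x => by
    rw [lintegral_const_mul _ (by fun_prop), lintegral_sub_left_eq_self ν x]
  have h2 : ∫⁻ x, ∫⁻ y, ‖f y‖ₑ ^ 2 * ν (x - y) = (∫⁻ y, ‖f y‖ₑ ^ 2) * ∫⁻ z, ν z := by
    rw [lintegral_lintegral_swap (Measurable.aemeasurable (by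
      unfold Function.uncurry
      fun_prop)), ← lintegral_mul_const _ (by fun_prop)]
    refine lintegral_congr fun y => ?_
    rw [lintegral_const_mul _ (by fun_prop), lintegral_sub_right_eq_self ν y]
  have h3 : ∀ x, ∫⁻ y, 2 * (‖f x‖ₑ ^ 2 * ν (x - y) + ‖f y‖ₑ ^ 2 * ν (x - y)) =
      2 * (‖f x‖ₑ ^ 2 * (∫⁻ z, ν z) + ∫⁻ y, ‖f y‖ₑ ^ 2 * ν (x - y)) := fun x => by
    rw [lintegral_const_mul _ (by fun_prop), lintegral_add_left (by fun_prop), h1]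
  simp_rw [h3]
  rw [lintegral_const_mul' _ _ (by simp), lintegral_add_left (by fun_prop), h2,
    lintegral_mul_const _ (by fun_prop)]
  exact ENNReal.mul_ne_top (by simp) (ENNReal.add_ne_top.2
    ⟨ENNReal.mul_ne_top hfI hνI, ENNReal.mul_ne_top hfI hνI⟩)

/-- The commutator kernel is bounded by an `L²`-bounded one: near the diagonal Schur's test applies,
`f` being Lipschitz, and away from it the kernel is square integrable. -/
theorem l2Bounded_commMaj {f : Eu n → ℂ} (hf : ContDiff ℝ ∞ f) (hf' : HasCompactSupport f) :
    L2Bounded (volume : Measure (Eu n)) (commMaj f) := by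
  obtain ⟨L, hL⟩ := hf.lipschitzWith_of_hasCompactSupport hf' (by simp)
  refine (L2Bounded.add (fun x => ?_) (l2Bounded_near (n := n) (L := L))
    (l2Bounded_far hf.continuous hf') ?_).mono fun x y => ?_
  · exact (measurable_near.comp measurable_prodMk_left).const_mul _
  · exact measurable_near.const_mul _
  · unfold commMaj
    rcases le_or_gt ‖x - y‖ 1 with h | h
    · refine le_trans ?_ le_self_add
      rw [indicator_of_mem (show ‖x - y‖ ∈ Iic 1 from h), ← ofReal_norm,
        ← ENNReal.ofReal_mul (norm_nonneg _), ← ENNReal.ofReal_mul (NNReal.coe_nonneg L)]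
      refine ENNReal.ofReal_le_ofReal ?_
      rcases (norm_nonneg (x - y)).eq_or_lt with h0 | h0
      · have : x - y = 0 := norm_eq_zero.1 h0.symm
        rw [sub_eq_zero.1 this]
        simp only [sub_self, norm_zero, zero_mul]
        positivity
      · have h1 : ‖f x - f y‖ ≤ L * ‖x - y‖ := by
          simpa [dist_eq_norm] using hL.dist_le_mul x y
        calc ‖f x - f y‖ * (‖x - y‖ ^ (n + 1))⁻¹ ≤ L * ‖x - y‖ * (‖x - y‖ ^ (n + 1))⁻¹ := by gcongr
          _ = L * (‖x - y‖ ^ n)⁻¹ := by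
              rw [pow_succ]
              field_simp
    · refine le_trans ?_ le_add_self
      rw [indicator_of_mem (show ‖x - y‖ ∈ Ioi 1 from h)]

/-- Transfer of `L²`-boundedness from `ℝ^{n+1}` to the half-space with the measure `m_λ`. -/
theorem L2Bounded.mMeas {k : Eu n → Eu n → ℝ≥0∞} (hk : L2Bounded (volume : Measure (Eu n)) k)
    (lam : ℝ) :
    L2Bounded (mMeas n lam) fun x y =>
      ENNReal.ofReal ((BesselRiesz.ht x * BesselRiesz.ht y) ^ (-lam)) * k x.1 y.1 := by
  obtain ⟨C, hC, hb⟩ := hk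
  refine ⟨C, hC, fun g hg => ?_⟩
  have hht := measurable_ht (n := n)
  have hms := measurableSet_halfSpace n
  let G : Eu n → ℝ≥0∞ := Function.extend (Subtype.val : halfSpace n → Eu n)
    (fun y => ENNReal.ofReal (ht y ^ lam) * g y) fun _ => 0
  have hG : Measurable G :=
    (MeasurableEmbedding.subtype_coe hms).measurable_extend (by fun_prop) measurable_const
  have hGc : ∀ y : halfSpace n, G y.1 = ENNReal.ofReal (ht y ^ lam) * g y := fun y =>
    Subtype.val_injective.extend_apply _ _ y
  have hG0 : ∀ y ∉ (halfSpace n : Set (Eu n)), G y = 0 := fun y hy =>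
    Function.extend_apply' _ _ _ (by rintro ⟨z, rfl⟩; exact hy z.2)
  have hleb : ∀ h : Eu n → ℝ≥0∞, ∫⁻ y : halfSpace n, h y.1 ∂(leb n) =
      ∫⁻ y in (halfSpace n : Set (Eu n)), h y := fun h => lintegral_subtype_comap hms h
  have hpow : ∀ (x : halfSpace n) (s t : ℝ), ENNReal.ofReal (ht x ^ s) * ENNReal.ofReal (ht x ^ t) =
      ENNReal.ofReal (ht x ^ (s + t)) := fun x s t => by
    rw [← ENNReal.ofReal_mul (Real.rpow_nonneg (ht_pos x).le _), ← Real.rpow_add (ht_pos x)]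
  have hwd : ∀ h : halfSpace n → ℝ≥0∞, ∫⁻ y, h y ∂(BesselRiesz.mMeas n lam) =
      ∫⁻ y, ENNReal.ofReal (ht y ^ (2 * lam)) * h y ∂(leb n) := fun h => by
    rw [BesselRiesz.mMeas, lintegral_withDensity_eq_lintegral_mul_non_measurable _
      (measurable_density n lam) (Eventually.of_forall fun x => ENNReal.ofReal_lt_top)]
    rfl
  have hinner : ∀ x : halfSpace n, ∫⁻ y, ENNReal.ofReal ((ht x * ht y) ^ (-lam)) * k x.1 y.1 * g y
      ∂(BesselRiesz.mMeas n lam) = ENNReal.ofReal (ht x ^ (-lam)) * ∫⁻ y, k x.1 y * G y := fun x => by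
    have h1 : ∀ y : halfSpace n, ENNReal.ofReal (ht y ^ (2 * lam)) *
        (ENNReal.ofReal ((ht x * ht y) ^ (-lam)) * k x.1 y.1 * g y) =
        ENNReal.ofReal (ht x ^ (-lam)) * (fun y => k x.1 y * G y) y.1 := fun y => by
      simp only
      rw [hGc, Real.mul_rpow (ht_pos x).le (ht_pos y).le,
        ENNReal.ofReal_mul (Real.rpow_nonneg (ht_pos x).le _)]
      have h2 := hpow y (2 * lam) (-lam)
      rw [show 2 * lam + -lam = lam by ring] at h2
      rw [← h2]
      ring
    rw [hwd]
    simp_rw [h1]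
    rw [lintegral_const_mul' _ _ ENNReal.ofReal_ne_top, hleb fun y => k x.1 y * G y, setLIntegral_eq_of_support_subset]
    intro y hy
    by_contra h
    exact hy (by simp [hG0 y h])
  calc ∫⁻ x, (∫⁻ y, ENNReal.ofReal ((ht x * ht y) ^ (-lam)) * k x.1 y.1 * g y
        ∂(BesselRiesz.mMeas n lam)) ^ 2 ∂(BesselRiesz.mMeas n lam)
      = ∫⁻ x : halfSpace n, (fun x => (∫⁻ y, k x y * G y) ^ 2) x.1 ∂(leb n) := by
        rw [hwd]
        refine lintegral_congr fun x => ?_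
        rw [hinner, mul_pow, ← mul_assoc, pow_two (ENNReal.ofReal _), hpow, hpow]
        simp only
        rw [show 2 * lam + (-lam + -lam) = 0 by ring, Real.rpow_zero, ENNReal.ofReal_one, one_mul]
    _ ≤ ∫⁻ x, (∫⁻ y, k x y * G y) ^ 2 := by
        rw [hleb fun x => (∫⁻ y, k x y * G y) ^ 2]
        exact setLIntegral_le_lintegral _ _
    _ ≤ C * ∫⁻ y, G y ^ 2 := hb G hG
    _ = C * ∫⁻ y, g y ^ 2 ∂(BesselRiesz.mMeas n lam) := by
        congr 1
        rw [hwd, ← setLIntegral_eq_of_support_subset (s := (halfSpace n : Set (Eu n)))]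
        · rw [← hleb fun y => G y ^ 2]
          refine lintegral_congr fun y => ?_
          rw [hGc, mul_pow, pow_two (ENNReal.ofReal _), hpow, two_mul]
        · intro y hy
          by_contra h
          exact hy (by simp [hG0 y h])

end KernelBounds

/-! ### The kernels of the Bessel–Riesz transforms -/

section RieszKernel

open Filter Topology

variable {n : ℕ} {lam : ℝ}

/-- The substitution `t ↦ 1/t` in the Gamma integral. -/
theorem integral_rpow_mul_exp_neg_div {A ρ : ℝ} (hA : 0 < A) (hρ : 0 < ρ) :
    IntegrableOn (fun t : ℝ => t ^ (-(ρ + 1)) * Real.exp (-A / (4 * t))) (Ioi 0) ∧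
    ∫ t in Ioi (0 : ℝ), t ^ (-(ρ + 1)) * Real.exp (-A / (4 * t)) =
      Real.Gamma ρ * (4 ^ ρ * A ^ (-ρ)) := by
  have h1 : ∀ t ∈ Ioi (0 : ℝ), t ^ (-(ρ + 1)) * Real.exp (-A / (4 * t)) =
      (|(-1 : ℝ)| * t ^ ((-1 : ℝ) - 1)) •
        (fun u : ℝ => u ^ (ρ - 1) * Real.exp (-(A / 4 * u))) (t ^ (-1 : ℝ)) := fun t ht => by
    have ht : 0 < t := ht
    simp only [smul_eq_mul, abs_neg, abs_one, one_mul]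
    rw [← Real.rpow_mul ht.le, ← mul_assoc, ← Real.rpow_add ht, Real.rpow_neg_one]
    congr 2
    · ring
    · field_simp
  have h2 := Real.integral_rpow_mul_exp_neg_mul_Ioi hρ (by positivity : 0 < A / 4)
  have hG := Real.Gamma_pos_of_pos hρ
  have h3 : IntegrableOn (fun u : ℝ => u ^ (ρ - 1) * Real.exp (-(A / 4 * u))) (Ioi 0) := by
    refine not_imp_comm.1 integral_undef ?_
    rw [h2]
    positivity
  refine ⟨?_, ?_⟩
  · refine IntegrableOn.congr_fun ?_ (fun t ht => (h1 t ht).symm) measurableSet_Ioi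
    exact (integrableOn_Ioi_comp_rpow_iff _ (by norm_num)).2 h3
  · rw [setIntegral_congr_fun measurableSet_Ioi h1, 
      integral_comp_rpow_Ioi (fun u : ℝ => u ^ (ρ - 1) * Real.exp (-(A / 4 * u))) (p := -1)
        (by norm_num), h2, one_div_div, Real.div_rpow (by norm_num) hA.le, Real.rpow_neg hA.le]
    ring

/-- The coefficient `(x-y)_k + δ_{k,n+1} y_{n+1} s` in the derivative of the heat kernel. -/
def derivCoeff (k : Fin (n + 1)) (s : ℝ) (x y : halfSpace n) : ℝ :=
  (x.1 k - y.1 k) + (if k = Fin.last n then ht y * s else 0)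

/-- The quantity `|x-y|² + 2 x_{n+1} y_{n+1} s`. -/
def poissonDist (s : ℝ) (x y : halfSpace n) : ℝ := ‖x.1 - y.1‖ ^ 2 + 2 * (ht x * ht y) * s

/-- The dependence on the time `t` in the form of a Gamma integral. -/
theorem heatDensDeriv_eq (k : Fin (n + 1)) {t : ℝ} (ht : 0 < t) (s : ℝ) (x y : halfSpace n) :
    heatDensDeriv n lam k (t, s) x.1 y.1 = (-(heatConst n lam / 2) * derivCoeff k s x y) *
      (t ^ (-((halfDim n lam + 1 / 2) + 1)) * Real.exp (-poissonDist s x y / (4 * t))) := by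
  rw [neg_add (halfDim n lam + 1 / 2), ← sub_eq_add_neg, Real.rpow_sub_one ht.ne']
  simp only [heatDensDeriv, heatDens, derivCoeff, poissonDist, BesselRiesz.ht]
  rw [← mul_assoc 2 (x.1 (Fin.last n))]
  field_simp

theorem norm_sub_pos {x y : halfSpace n} (hxy : y ≠ x) : 0 < ‖x.1 - y.1‖ :=
  norm_pos_iff.2 (sub_ne_zero.2 fun h => hxy (Subtype.ext h.symm))

theorem poissonDist_pos {x y : halfSpace n} (hxy : y ≠ x) {s : ℝ} (hs : 0 ≤ s) :
    0 < poissonDist s x y := by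
  have := norm_sub_pos hxy
  have := ht_pos x
  have := ht_pos y
  unfold poissonDist
  positivity

/-- The constant in the kernel of the Bessel–Riesz transforms. -/
def rieszConst (n : ℕ) (lam : ℝ) : ℝ :=
  heatConst n lam / 2 * (Real.Gamma (halfDim n lam + 1 / 2) * 4 ^ (halfDim n lam + 1 / 2))

theorem rieszConst_pos (n : ℕ) (hlam : 0 < lam) : 0 < rieszConst n lam := by
  have := heatConst_pos n hlam
  have h1 := halfDim_pos n hlam
  have := Real.Gamma_pos_of_pos (s := halfDim n lam + 1 / 2) (by positivity)
  unfold rieszConst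
  positivity

theorem integrable_derivCoeff_mul (hlam : 0 < lam) (k : Fin (n + 1)) {x y : halfSpace n} (hxy : y ≠ x) :
    Integrable (fun s => derivCoeff k s x y * poissonDist s x y ^ (-(halfDim n lam + 1 / 2)))
      (poissonMeas lam) := by
  have hA : 0 < ‖x.1 - y.1‖ ^ 2 := by have := norm_sub_pos hxy; positivity
  have hB : 0 ≤ 2 * (ht x * ht y) := by have := ht_pos x; have := ht_pos y; positivity
  have h0 := (integrable_rpow_poissonMeas hlam hA hB (-(halfDim n lam + 1 / 2)) 0).const_mul
    (x.1 k - y.1 k)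
  have h1 := (integrable_rpow_poissonMeas hlam hA hB (-(halfDim n lam + 1 / 2)) 1).const_mul
    (if k = Fin.last n then ht y else 0)
  refine (h0.add h1).congr (Eventually.of_forall fun s => ?_)
  simp only [Pi.add_apply, derivCoeff, poissonDist]
  split_ifs <;> ring

/-- The integral over all times of the derivative of the heat kernel. -/
theorem integral_heatDensDeriv (hlam : 0 < lam) (k : Fin (n + 1)) {x y : halfSpace n} (hxy : y ≠ x) :
    Integrable (fun p => heatDensDeriv n lam k p x.1 y.1)
      ((volume.restrict (Ioi 0)).prod (poissonMeas lam)) ∧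
    ∫ p, heatDensDeriv n lam k p x.1 y.1 ∂((volume.restrict (Ioi 0)).prod (poissonMeas lam)) =
      -rieszConst n lam * ∫ s, derivCoeff k s x y * poissonDist s x y ^ (-(halfDim n lam + 1 / 2))
        ∂(poissonMeas lam) ∧
    ∫ p, |heatDensDeriv n lam k p x.1 y.1| ∂((volume.restrict (Ioi 0)).prod (poissonMeas lam)) =
      rieszConst n lam * ∫ s, |derivCoeff k s x y * poissonDist s x y ^ (-(halfDim n lam + 1 / 2))|
        ∂(poissonMeas lam) := by
  have := isFiniteMeasure_poissonMeas hlam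
  have hρ : 0 < halfDim n lam + 1 / 2 := by have := halfDim_pos n hlam; positivity
  have hc := heatConst_pos n hlam
  set ρ := halfDim n lam + 1 / 2 with hρd
  have hG := Real.Gamma_pos_of_pos hρ
  have hpt : ∀ s t : ℝ, t ∈ Ioi (0 : ℝ) → heatDensDeriv n lam k (t, s) x.1 y.1 =
      (-(heatConst n lam / 2) * derivCoeff k s x y) *
        (t ^ (-(ρ + 1)) * Real.exp (-poissonDist s x y / (4 * t))) := fun s t ht =>
    heatDensDeriv_eq k ht s x y
  have habs : ∀ s t : ℝ, t ∈ Ioi (0 : ℝ) → |heatDensDeriv n lam k (t, s) x.1 y.1| =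
      |-(heatConst n lam / 2) * derivCoeff k s x y| *
        (t ^ (-(ρ + 1)) * Real.exp (-poissonDist s x y / (4 * t))) := fun s t ht => by
    rw [hpt s t ht, abs_mul]
    congr 1
    have : (0 : ℝ) < t := ht
    exact abs_of_nonneg (by positivity)
  have hs1 : ∀ s ∈ Ioo (0 : ℝ) 2, ∫ t in Ioi (0 : ℝ), heatDensDeriv n lam k (t, s) x.1 y.1 =
      -rieszConst n lam * (derivCoeff k s x y * poissonDist s x y ^ (-ρ)) := fun s hs => by
    rw [setIntegral_congr_fun measurableSet_Ioi (hpt s), integral_const_mul,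
      (integral_rpow_mul_exp_neg_div (poissonDist_pos hxy hs.1.le) hρ).2, rieszConst]
    ring
  have hs2 : ∀ s ∈ Ioo (0 : ℝ) 2, ∫ t in Ioi (0 : ℝ), |heatDensDeriv n lam k (t, s) x.1 y.1| =
      rieszConst n lam * |derivCoeff k s x y * poissonDist s x y ^ (-ρ)| := fun s hs => by
    have hd := poissonDist_pos hxy hs.1.le
    rw [setIntegral_congr_fun measurableSet_Ioi (habs s), integral_const_mul,
      (integral_rpow_mul_exp_neg_div hd hρ).2, rieszConst, abs_mul, abs_mul, abs_neg,
      abs_of_pos (by positivity : 0 < heatConst n lam / 2),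
      abs_of_pos (Real.rpow_pos_of_pos hd (-ρ))]
    ring
  have hI : Integrable (fun p => heatDensDeriv n lam k p x.1 y.1)
      ((volume.restrict (Ioi 0)).prod (poissonMeas lam)) := by
    have hm : Measurable fun p => heatDensDeriv n lam k p x.1 y.1 :=
      (measurable_heatDensDeriv k).comp
        (g := fun q : (ℝ × ℝ) × Eu n × Eu n => heatDensDeriv n lam k q.1 q.2.1 q.2.2)
        (f := fun p => (p, x.1, y.1)) (by fun_prop)
    rw [integrable_prod_iff' hm.aestronglyMeasurable]
    refine ⟨?_, ?_⟩
    · filter_upwards [ae_mem_poissonMeas] with s hs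
      refine IntegrableOn.congr_fun (Integrable.const_mul
        (integral_rpow_mul_exp_neg_div (poissonDist_pos hxy hs.1.le) hρ).1 _)
        (fun t ht => (hpt s t ht).symm) measurableSet_Ioi
    · refine ((integrable_derivCoeff_mul hlam k hxy).abs.const_mul (rieszConst n lam)).congr ?_
      filter_upwards [ae_mem_poissonMeas] with s hs
      simp only [Real.norm_eq_abs]
      rw [hs2 s hs]
  refine ⟨hI, ?_, ?_⟩
  · rw [integral_prod_symm _ hI, ← integral_const_mul]
    refine integral_congr_ae ?_
    filter_upwards [ae_mem_poissonMeas] with s hs using hs1 s hs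
  · rw [integral_prod_symm _ hI.abs, ← integral_const_mul]
    refine integral_congr_ae ?_
    filter_upwards [ae_mem_poissonMeas] with s hs using hs2 s hs

/-- The weight `(x_{n+1} y_{n+1})^{-λ} |x-y|^{-n-1}`, the size of the Riesz kernels. -/
def kerWeight (n : ℕ) (lam : ℝ) (x y : halfSpace n) : ℝ :=
  (ht x * ht y) ^ (-lam) * (‖x.1 - y.1‖ ^ (n + 1))⁻¹

theorem kerWeight_nonneg (x y : halfSpace n) : 0 ≤ kerWeight n lam x y := by
  have := ht_pos x
  have := ht_pos y
  unfold kerWeight; positivity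

theorem H_eq (x y : halfSpace n) : H x y = ‖x.1 - y.1‖ / Real.sqrt (ht x * ht y) := by
  rw [H, abs_of_pos (mul_pos (ht_pos x) (ht_pos y))]

theorem H_nonneg (x y : halfSpace n) : 0 ≤ H x y := by
  rw [H_eq]; positivity

/-- The symbols `F_{k,l}` arise from Poisson's integral, as
`|x-y|² + 2 x_{n+1} y_{n+1} s = x_{n+1} y_{n+1} (H(x,y)² + 2 s)`. -/
theorem integral_poissonDist (k l : ℕ) (x y : halfSpace n) :
    ‖x.1 - y.1‖ ^ (n + k) * ∫ s, poissonDist s x y ^ (-(halfDim n lam + 1 / 2)) * s ^ l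
      ∂(poissonMeas lam) =
    (ht x * ht y) ^ (-lam - 1 + k / 2 : ℝ) * F n lam k l (H x y) := by
  have hP : 0 < ht x * ht y := mul_pos (ht_pos x) (ht_pos y)
  set P := ht x * ht y with hPd
  have hsq := Real.sqrt_pos.2 hP
  have h1 : ∀ s ∈ Ioo (0 : ℝ) 2, poissonDist s x y ^ (-(halfDim n lam + 1 / 2)) * s ^ l =
      P ^ (-(halfDim n lam + 1 / 2)) * ((H x y ^ 2 + 2 * s) ^ (-lam - n / 2 - 1) * s ^ l) := by
    intro s hs
    have hs0 : 0 < s := hs.1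
    have h2 : poissonDist s x y = P * (H x y ^ 2 + 2 * s) := by
      rw [poissonDist, H_eq, ← hPd, div_pow, Real.sq_sqrt hP.le]
      field_simp
    rw [h2, Real.mul_rpow hP.le (by positivity), mul_assoc]
    congr 3
    unfold halfDim
    ring
  have h3 : ∫ s, poissonDist s x y ^ (-(halfDim n lam + 1 / 2)) * s ^ l ∂(poissonMeas lam) =
      P ^ (-(halfDim n lam + 1 / 2)) *
        ∫ s, (H x y ^ 2 + 2 * s) ^ (-lam - n / 2 - 1) * s ^ l ∂(poissonMeas lam) := by
    rw [← integral_const_mul]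
    refine integral_congr_ae ?_
    filter_upwards [ae_mem_poissonMeas] with s hs using h1 s hs
  have h4 : ‖x.1 - y.1‖ = H x y * Real.sqrt P := by
    rw [H_eq, ← hPd]
    field_simp
  have h5 : Real.sqrt P ^ (n + k) * P ^ (-(halfDim n lam + 1 / 2)) = P ^ (-lam - 1 + k / 2 : ℝ) := by
    rw [Real.sqrt_eq_rpow, ← Real.rpow_natCast, ← Real.rpow_mul hP.le, ← Real.rpow_add hP]
    congr 1
    unfold halfDim
    push_cast
    ring
  rw [h3, h4, F_eq, ← h5, mul_pow]
  ring

/-- The kernel of the `k`-th Bessel–Riesz transform, divided by `kerWeight`. -/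
def rieszSym (n : ℕ) (lam : ℝ) (k : Fin (n + 1)) (x y : halfSpace n) : ℝ :=
  (x.1 - y.1) k / ‖x.1 - y.1‖ * F n lam 2 0 (H x y) +
    if k = Fin.last n then Real.sqrt (ht y / ht x) * F n lam 1 1 (H x y) else 0

theorem integral_poissonDist_zero {x y : halfSpace n} (hxy : y ≠ x) :
    ∫ s, poissonDist s x y ^ (-(halfDim n lam + 1 / 2)) ∂(poissonMeas lam) =
      kerWeight n lam x y * (‖x.1 - y.1‖⁻¹ * F n lam 2 0 (H x y)) := by
  have h0 := integral_poissonDist (lam := lam) 2 0 x y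
  have hr := norm_sub_pos hxy
  simp only [pow_zero, mul_one] at h0
  rw [show (-lam - 1 + ((2 : ℕ) : ℝ) / 2) = -lam by push_cast; ring] at h0
  rw [kerWeight]
  set I := ∫ s, poissonDist s x y ^ (-(halfDim n lam + 1 / 2)) ∂(poissonMeas lam)
  set r := ‖x.1 - y.1‖
  have h1 : (ht x * ht y) ^ (-lam) * (r ^ (n + 1))⁻¹ * (r⁻¹ * F n lam 2 0 (H x y)) =
      (r ^ (n + 2))⁻¹ * ((ht x * ht y) ^ (-lam) * F n lam 2 0 (H x y)) := by
    rw [pow_succ r (n + 1), mul_inv]; ring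
  rw [h1, ← h0, inv_mul_cancel_left₀ (by positivity)]

theorem integral_poissonDist_one {x y : halfSpace n} (hxy : y ≠ x) :
    ht y * ∫ s, poissonDist s x y ^ (-(halfDim n lam + 1 / 2)) * s ∂(poissonMeas lam) =
      kerWeight n lam x y * (Real.sqrt (ht y / ht x) * F n lam 1 1 (H x y)) := by
  have h0 := integral_poissonDist (lam := lam) 1 1 x y
  have hr := norm_sub_pos hxy
  have hx := ht_pos x
  have hy := ht_pos y
  simp only [pow_one] at h0
  rw [show (-lam - 1 + ((1 : ℕ) : ℝ) / 2) = -lam - 1 / 2 by push_cast; ring,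
    Real.rpow_sub (mul_pos hx hy), ← Real.sqrt_eq_rpow] at h0
  rw [kerWeight]
  set I := ∫ s, poissonDist s x y ^ (-(halfDim n lam + 1 / 2)) * s ∂(poissonMeas lam)
  set r := ‖x.1 - y.1‖
  have h2 : Real.sqrt (ht y / ht x) = ht y / Real.sqrt (ht x * ht y) := by
    rw [eq_div_iff (Real.sqrt_pos.2 (mul_pos hx hy)).ne', ← Real.sqrt_mul (by positivity)]
    rw [show ht y / ht x * (ht x * ht y) = ht y ^ 2 by field_simp, Real.sqrt_sq hy.le]
  have h1 : (ht x * ht y) ^ (-lam) * (r ^ (n + 1))⁻¹ * (Real.sqrt (ht y / ht x) * F n lam 1 1 (H x y)) =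
      ht y * ((r ^ (n + 1))⁻¹ *
        ((ht x * ht y) ^ (-lam) / Real.sqrt (ht x * ht y) * F n lam 1 1 (H x y))) := by
    rw [h2]; ring
  rw [h1, ← h0, inv_mul_cancel_left₀ (by positivity)]

theorem integrable_poissonDist (hlam : 0 < lam) {x y : halfSpace n} (hxy : y ≠ x) (l : ℕ) :
    Integrable (fun s => poissonDist s x y ^ (-(halfDim n lam + 1 / 2)) * s ^ l) (poissonMeas lam) := by
  have hA : 0 < ‖x.1 - y.1‖ ^ 2 := by have := norm_sub_pos hxy; positivity
  have hB : 0 ≤ 2 * (ht x * ht y) := by have := ht_pos x; have := ht_pos y; positivity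
  exact integrable_rpow_poissonMeas hlam hA hB (-(halfDim n lam + 1 / 2)) l

/-- The part of the Bessel–Riesz kernel depending on the Poisson variable, through the symbols `F_{k,l}`. -/
theorem integral_derivCoeff_mul (hlam : 0 < lam) (k : Fin (n + 1)) {x y : halfSpace n} (hxy : y ≠ x) :
    ∫ s, derivCoeff k s x y * poissonDist s x y ^ (-(halfDim n lam + 1 / 2)) ∂(poissonMeas lam) =
      kerWeight n lam x y * rieszSym n lam k x y := by
  have h0 := integrable_poissonDist hlam hxy 0
  have h1 := integrable_poissonDist hlam hxy 1
  simp only [pow_zero, mul_one] at h0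
  simp only [pow_one] at h1
  have h2 : ∀ s, derivCoeff k s x y * poissonDist s x y ^ (-(halfDim n lam + 1 / 2)) =
      (x.1 - y.1) k * poissonDist s x y ^ (-(halfDim n lam + 1 / 2)) +
        (if k = Fin.last n then ht y else 0) *
          (poissonDist s x y ^ (-(halfDim n lam + 1 / 2)) * s) := fun s => by
    simp only [derivCoeff, PiLp.sub_apply]
    split_ifs <;> ring
  simp_rw [h2]
  rw [integral_add (h0.const_mul _) (h1.const_mul _), integral_const_mul, integral_const_mul,
    integral_poissonDist_zero hxy, rieszSym]
  split_ifs
  · rw [integral_poissonDist_one hxy]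
    ring
  · ring

theorem integral_abs_derivCoeff_mul_le (hlam : 0 < lam) (k : Fin (n + 1)) {x y : halfSpace n}
    (hxy : y ≠ x) :
    ∫ s, |derivCoeff k s x y * poissonDist s x y ^ (-(halfDim n lam + 1 / 2))| ∂(poissonMeas lam) ≤
      kerWeight n lam x y *
        (F n lam 2 0 (H x y) + Real.sqrt (ht y / ht x) * F n lam 1 1 (H x y)) := by
  have h0 := integrable_poissonDist hlam hxy 0
  have h1 := integrable_poissonDist hlam hxy 1
  simp only [pow_zero, mul_one] at h0
  simp only [pow_one] at h1
  have hr := norm_sub_pos hxy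
  have hy := ht_pos y
  calc _ ≤ ∫ s, (‖x.1 - y.1‖ * poissonDist s x y ^ (-(halfDim n lam + 1 / 2)) +
        ht y * (poissonDist s x y ^ (-(halfDim n lam + 1 / 2)) * s)) ∂(poissonMeas lam) := by
        refine integral_mono_ae (integrable_derivCoeff_mul hlam k hxy).abs
          ((h0.const_mul _).add (h1.const_mul _)) ?_
        filter_upwards [ae_mem_poissonMeas] with s hs
        have hs0 : 0 < s := hs.1
        have hd := Real.rpow_pos_of_pos (poissonDist_pos hxy hs.1.le) (-(halfDim n lam + 1 / 2))
        have h3 : |derivCoeff k s x y| ≤ ‖x.1 - y.1‖ + ht y * s := by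
          refine (abs_add_le _ _).trans (add_le_add ?_ ?_)
          · simpa using abs_apply_le_norm (x.1 - y.1) k
          · split_ifs
            · rw [abs_of_pos (by positivity)]
            · rw [abs_zero]; positivity
        rw [abs_mul, abs_of_pos hd]
        have := mul_le_mul_of_nonneg_right h3 hd.le
        linarith
    _ = _ := by
        rw [integral_add (h0.const_mul _) (h1.const_mul _), integral_const_mul, integral_const_mul,
          integral_poissonDist_zero hxy, integral_poissonDist_one hxy]
        field_simp

/-- If `y_{n+1} > x_{n+1}`, then `(y_{n+1}/x_{n+1})^{1/2} = (x_{n+1}/y_{n+1})^{1/2} +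
(y_{n+1} - x_{n+1}) (x_{n+1} y_{n+1})^{-1/2}`. -/
theorem sqrt_mul_F {x y : halfSpace n} (hxy : y ≠ x) :
    Real.sqrt (ht y / ht x) * F n lam 1 1 (H x y) =
      Real.sqrt (min (ht y) (ht x) / max (ht y) (ht x)) * F n lam 1 1 (H x y) -
        (x.1 - y.1) (Fin.last n) / ‖x.1 - y.1‖ * ((if ht x < ht y then 1 else 0) *
          F n lam 2 1 (H x y)) := by
  have hx := ht_pos x
  have hy := ht_pos y
  have hr := norm_sub_pos hxy
  by_cases h : ht x < ht y
  · rw [min_eq_right h.le, max_eq_left h.le, if_pos h, one_mul]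
    have hF : F n lam 2 1 (H x y) = H x y * F n lam 1 1 (H x y) := by
      rw [F, F]; ring
    have hlast : (x.1 - y.1) (Fin.last n) = ht x - ht y := rfl
    rw [hF]
    set G := F n lam 1 1 (H x y)
    rw [H_eq, hlast, Real.sqrt_div hy.le, Real.sqrt_div hx.le, Real.sqrt_mul hx.le]
    have h1 := Real.sqrt_pos.2 hx
    have h2 := Real.sqrt_pos.2 hy
    have h3 := Real.sq_sqrt hx.le
    have h4 := Real.sq_sqrt hy.le
    set a := Real.sqrt (ht x)
    set b := Real.sqrt (ht y)
    rw [← h3, ← h4]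
    field_simp
    ring
  · push Not at h
    rw [min_eq_left h, max_eq_right h, if_neg (not_lt.2 h)]
    ring

end RieszKernel

/-! ### Kernels of commutators with multiplication operators -/

section CommutatorKernel

open Filter Topology

/-- The kernel of the commutator of an operator `R` with a multiplication operator. Only regularised
versions `R ∘ reg N` of `R` need to be integral operators, with kernels converging to `k` away from
the diagonal; the factor `f y - f x` removes the singularity of `k`. -/
theorem hasIntegralKernel_comm {X : Type*} [MeasurableSpace X] {μ : Measure X} [SFinite μ]
    {R : Lp ℂ 2 μ →L[ℂ] Lp ℂ 2 μ} {f : X → ℂ} (hfm : Measurable f) {Cf : ℝ} (hf : ∀ x, ‖f x‖ ≤ Cf)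
    {w : X → X → ℝ} (hwm : Measurable fun p : X × X => w p.1 p.2)
    (hw : L2Bounded μ fun x y => ‖f x - f y‖ₑ * ENNReal.ofReal (w x y))
    {k : X → X → ℂ} (hkm : Measurable fun p : X × X => k p.1 p.2) (hk : ∀ x y, ‖k x y‖ ≤ w x y)
    {kN : ℕ → X → X → ℂ} (hkNm : ∀ N x, Measurable (kN N x))
    (hkN : ∀ N, ∀ᵐ x ∂μ, ∀ᵐ y ∂μ, ‖kN N x y‖ ≤ w x y)
    (hlim : ∀ᵐ x ∂μ, ∀ᵐ y ∂μ, Tendsto (fun N => kN N x y) atTop (𝓝 (k x y)))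
    {reg : ℕ → Lp ℂ 2 μ →L[ℂ] Lp ℂ 2 μ} (hreg : ∀ g, Tendsto (fun N => reg N g) atTop (𝓝 g))
    {S : Set (Lp ℂ 2 μ)}
    (hS : ∀ A B : Lp ℂ 2 μ →L[ℂ] Lp ℂ 2 μ, (∀ g ∈ S, A g = B g) → A = B)
    (hfS : ∀ g ∈ S, mulOp μ μ f g ∈ S)
    (hR : ∀ g ∈ S, ∀ N, ∀ᵐ x ∂μ,
      Integrable (fun y => kN N x y * g y) μ ∧ R (reg N g) x = ∫ y, kN N x y * g y ∂μ) :
    HasIntegralKernel μ (comm R (mulOp μ μ f)) fun x y => k x y * (f y - f x) := by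
  have hM := mulOp_apply_of_bounded μ f hfm.aestronglyMeasurable Cf hf
  have hw0 : ∀ x y, 0 ≤ w x y := fun x y => (norm_nonneg _).trans (hk x y)
  have hdm : Measurable fun p : X × X => f p.2 - f p.1 := by fun_prop
  obtain ⟨T, hT⟩ := hw.exists_hasIntegralKernel (K := fun x y => k x y * (f y - f x))
    (hkm.mul hdm).aestronglyMeasurable fun x y => by
      rw [enorm_mul, mul_comm, ← enorm_neg (f y - f x), neg_sub]
      gcongr
      rw [← ofReal_norm]
      exact ENNReal.ofReal_le_ofReal (hk x y)
  obtain ⟨T', hT'⟩ := hw.exists_hasIntegralKernel (K := fun x y => (w x y : ℂ) * (f y - f x))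
    ((Complex.measurable_ofReal.comp hwm).mul hdm).aestronglyMeasurable fun x y => by
      rw [enorm_mul, mul_comm, ← enorm_neg (f y - f x), neg_sub]
      gcongr
      rw [← ofReal_norm, Complex.norm_real, Real.norm_of_nonneg (hw0 x y)]
  suffices h : comm R (mulOp μ μ f) = T by rw [h]; exact hT
  refine hS _ _ fun g hg => Lp.ext ?_
  have hB : Tendsto (fun N => R (reg N (mulOp μ μ f g)) - mulOp μ μ f (R (reg N g))) atTop
      (𝓝 (comm R (mulOp μ μ f) g)) :=
    ((R.continuous.tendsto _).comp (hreg _)).sub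
      (((mulOp μ μ f).continuous.tendsto _).comp ((R.continuous.tendsto _).comp (hreg _)))
  have h1 := ae_eq_integral_of_tendsto hB
    (KN := fun N x y => kN N x y * (f y - f x) * g y) (K := fun x y => k x y * (f y - f x) * g y)
    (bound := fun x y => ‖(w x y : ℂ) * (f y - f x) * g y‖) ?_ ?_ ?_ ?_ ?_
  · filter_upwards [h1, hT.2 g] with x hx hx'
    rw [hx, hx'.2]
  · intro N
    filter_upwards [hR _ (hfS g hg) N, hR g hg N, hM (R (reg N g)),
      Lp.coeFn_sub (R (reg N (mulOp μ μ f g))) (mulOp μ μ f (R (reg N g)))] with x h2 h3 h4 h5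
    have h6 : (fun y => kN N x y * mulOp μ μ f g y) =ᵐ[μ] fun y => kN N x y * (f y * g y) := by
      filter_upwards [hM g] with y hy
      rw [hy]
    rw [h5, Pi.sub_apply, h4, h2.2, h3.2, integral_congr_ae h6, ← integral_const_mul,
      ← integral_sub (h2.1.congr h6) (h3.1.const_mul _)]
    refine integral_congr_ae (Eventually.of_forall fun y => ?_)
    simp only
    ring
  · intro N
    exact Eventually.of_forall fun x =>
      ((hkNm N x).mul (hfm.sub_const _)).aestronglyMeasurable.mul (Lp.aestronglyMeasurable g)
  · filter_upwards [hlim] with x hx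
    filter_upwards [hx] with y hy
    exact (hy.mul_const _).mul_const _
  · intro N
    filter_upwards [hkN N] with x hx
    filter_upwards [hx] with y hy
    rw [norm_mul, norm_mul, norm_mul, norm_mul, Complex.norm_real, Real.norm_of_nonneg (hw0 x y)]
    gcongr
  · filter_upwards [hT'.2 g] with x hx using hx.1.norm

end CommutatorKernel

/-! ### The kernel of the Bessel–Riesz commutator -/

section BesselCommutator

open Filter Topology

variable {n : ℕ} {lam : ℝ}

theorem cutMeas_eq (hlam : 0 < lam) (N : ℕ) : cutMeas lam N =
    ((volume.restrict (Ioi 0)).prod (poissonMeas lam)).restrict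
      (Icc (1 / (N + 1 : ℝ)) (N + 1) ×ˢ univ) := by
  have := isFiniteMeasure_poissonMeas hlam
  rw [← Measure.prod_restrict, Measure.restrict_univ, cutMeas,
    Measure.restrict_restrict measurableSet_Icc, inter_eq_left.2 (Icc_subset_Ioi N)]

/-- The kernel of the regularised Bessel–Riesz transform. -/
def rieszKerReg (n : ℕ) (lam : ℝ) (k : Fin (n + 1)) (N : ℕ) (x y : halfSpace n) : ℝ :=
  ∫ p, heatDensDeriv n lam k p x.1 y.1 ∂(cutMeas lam N)

/-- Away from the diagonal the regularised kernels converge to the singular integral kernel. -/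
theorem tendsto_rieszKerReg (hlam : 0 < lam) (k : Fin (n + 1)) {x y : halfSpace n} (hxy : y ≠ x) :
    Tendsto (fun N => rieszKerReg n lam k N x y) atTop
      (𝓝 (-rieszConst n lam * (kerWeight n lam x y * rieszSym n lam k x y))) := by
  have := isFiniteMeasure_poissonMeas hlam
  have h := integral_heatDensDeriv hlam k hxy
  have hU : ⋃ N : ℕ, Icc (1 / (N + 1 : ℝ)) (N + 1) ×ˢ (univ : Set ℝ) = Ioi 0 ×ˢ univ := by
    rw [← iUnion_prod_const, iUnion_Icc_inv]
  have hR : ((volume.restrict (Ioi (0 : ℝ))).prod (poissonMeas lam)).restrict (Ioi 0 ×ˢ univ) =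
      (volume.restrict (Ioi 0)).prod (poissonMeas lam) := by
    rw [← Measure.prod_restrict, Measure.restrict_univ,
      Measure.restrict_restrict measurableSet_Ioi, inter_self]
  have h1 := tendsto_setIntegral_of_monotone (μ := (volume.restrict (Ioi (0 : ℝ))).prod (poissonMeas lam))
    (f := fun p => heatDensDeriv n lam k p x.1 y.1)
    (s := fun N : ℕ => Icc (1 / (N + 1 : ℝ)) (N + 1) ×ˢ (univ : Set ℝ))
    (fun N => measurableSet_Icc.prod MeasurableSet.univ)
    (fun N M hNM => prod_mono (monotone_Icc_inv hNM) subset_rfl) (by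
      rw [hU, IntegrableOn, hR]; exact h.1)
  rw [hU, hR, h.2.1, integral_derivCoeff_mul hlam k hxy] at h1
  refine h1.congr fun N => ?_
  rw [rieszKerReg, cutMeas_eq hlam]

theorem abs_rieszKerReg_le (hlam : 0 < lam) (k : Fin (n + 1)) (N : ℕ) {x y : halfSpace n}
    (hxy : y ≠ x) : |rieszKerReg n lam k N x y| ≤ rieszConst n lam * (kerWeight n lam x y *
      (F n lam 2 0 (H x y) + Real.sqrt (ht y / ht x) * F n lam 1 1 (H x y))) := by
  have := isFiniteMeasure_poissonMeas hlam
  have h := integral_heatDensDeriv hlam k hxy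
  calc |rieszKerReg n lam k N x y| ≤ ∫ p, |heatDensDeriv n lam k p x.1 y.1| ∂(cutMeas lam N) :=
        abs_integral_le_integral_abs
    _ ≤ ∫ p, |heatDensDeriv n lam k p x.1 y.1|
        ∂((volume.restrict (Ioi 0)).prod (poissonMeas lam)) := by
        rw [cutMeas_eq hlam]
        exact setIntegral_le_integral h.1.abs (Eventually.of_forall fun p => abs_nonneg _)
    _ ≤ _ := by
        rw [h.2.2]
        exact mul_le_mul_of_nonneg_left (integral_abs_derivCoeff_mul_le hlam k hxy)
          (rieszConst_pos n hlam).le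

theorem abs_sub_div_norm_le (k : Fin (n + 1)) (x y : halfSpace n) :
    |(x.1 - y.1) k / ‖x.1 - y.1‖| ≤ 1 := by
  rw [abs_div, abs_norm]
  exact div_le_one_of_le₀ (abs_apply_le_norm _ _) (norm_nonneg _)

theorem sqrt_min_div_max_le (x y : halfSpace n) :
    Real.sqrt (min (ht y) (ht x) / max (ht y) (ht x)) ≤ 1 := by
  refine Real.sqrt_le_iff.2 ⟨zero_le_one, ?_⟩
  rw [one_pow]
  exact div_le_one_of_le₀ min_le_max (le_max_of_le_left (ht_pos y).le)

theorem sqrt_mul_F_le {C : ℝ} {x y : halfSpace n} (hxy : y ≠ x)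
    (hC : ∀ x, 0 ≤ x → F n lam 2 0 x ≤ C ∧ F n lam 1 1 x ≤ C ∧ F n lam 2 1 x ≤ C) :
    0 ≤ Real.sqrt (ht y / ht x) * F n lam 1 1 (H x y) ∧
      Real.sqrt (ht y / ht x) * F n lam 1 1 (H x y) ≤ 2 * C := by
  have h0 := H_nonneg x y
  obtain ⟨-, h1, h2⟩ := hC _ h0
  have h3 := F_nonneg (n := n) (lam := lam) 1 1 h0
  have h4 := F_nonneg (n := n) (lam := lam) 2 1 h0
  refine ⟨by positivity, ?_⟩
  rw [sqrt_mul_F hxy, sub_eq_add_neg, two_mul]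
  refine add_le_add ?_ ?_
  · calc _ ≤ 1 * F n lam 1 1 (H x y) := by gcongr; exact sqrt_min_div_max_le x y
      _ ≤ C := by rwa [one_mul]
  · refine (neg_le_abs _).trans ?_
    rw [abs_mul]
    have h5 : |(if ht x < ht y then 1 else 0) * F n lam 2 1 (H x y)| ≤ C := by
      split_ifs
      · rwa [one_mul, abs_of_nonneg h4]
      · rw [zero_mul, abs_zero]; exact h4.trans h2
    calc _ ≤ 1 * C := by
          gcongr
          exact abs_sub_div_norm_le _ _ _
      _ = C := one_mul C

theorem abs_rieszSym_le {C : ℝ} (k : Fin (n + 1)) {x y : halfSpace n} (hxy : y ≠ x)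
    (hC : ∀ x, 0 ≤ x → F n lam 2 0 x ≤ C ∧ F n lam 1 1 x ≤ C ∧ F n lam 2 1 x ≤ C) :
    |rieszSym n lam k x y| ≤ 3 * C := by
  have h0 := H_nonneg x y
  have h1 := sqrt_mul_F_le hxy hC
  have h2 := F_nonneg (n := n) (lam := lam) 2 0 h0
  have h3 := (hC _ h0).1
  have h4 : |(x.1 - y.1) k / ‖x.1 - y.1‖ * F n lam 2 0 (H x y)| ≤ C := by
    rw [abs_mul, abs_of_nonneg h2]
    calc _ ≤ 1 * F n lam 2 0 (H x y) := by gcongr; exact abs_sub_div_norm_le _ _ _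
      _ ≤ C := by rwa [one_mul]
  rw [rieszSym]
  refine (abs_add_le _ _).trans ?_
  have h5 : |if k = Fin.last n then Real.sqrt (ht y / ht x) * F n lam 1 1 (H x y) else 0| ≤ 2 * C := by
    split_ifs
    · rw [abs_of_nonneg h1.1]; exact h1.2
    · rw [abs_zero]; exact h1.1.trans h1.2
  linarith

theorem kerWeight_self (x : halfSpace n) : kerWeight n lam x x = 0 := by
  simp [kerWeight]

theorem measurable_kerWeight :
    Measurable fun p : halfSpace n × halfSpace n => kerWeight n lam p.1 p.2 := by
  have := measurable_ht (n := n)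
  unfold kerWeight
  fun_prop

theorem measurable_H : Measurable fun p : halfSpace n × halfSpace n => H p.1 p.2 := by
  have := measurable_ht (n := n)
  unfold H
  fun_prop

theorem measurable_F (k l : ℕ) : Measurable (F n lam k l) := by
  have hm : StronglyMeasurable fun p : ℝ × ℝ => (p.1 ^ 2 + 2 * p.2) ^ (-lam - n / 2 - 1) *
      (2 * p.2 - p.2 ^ 2) ^ (lam - 1) * p.2 ^ l := by
    refine Measurable.stronglyMeasurable ?_
    fun_prop
  unfold F
  simp_rw [intervalIntegral.integral_of_le (zero_le_two (α := ℝ))]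
  exact (measurable_id.pow_const _).mul
    (hm.integral_prod_right' (ν := volume.restrict (Ioc (0 : ℝ) 2))).measurable

theorem measurable_rieszSym (k : Fin (n + 1)) :
    Measurable fun p : halfSpace n × halfSpace n => rieszSym n lam k p.1 p.2 := by
  have := measurable_ht (n := n)
  have h0 := (measurable_F (n := n) (lam := lam) 2 0).comp (measurable_H (n := n))
  have h1 := (measurable_F (n := n) (lam := lam) 1 1).comp (measurable_H (n := n))
  simp only [Function.comp_def] at h0 h1
  unfold rieszSym
  split_ifs <;> fun_prop

theorem ae_mMeas_ne (x : halfSpace n) : ∀ᵐ y ∂(mMeas n lam), y ≠ x := by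
  refine (mMeas_ac_volume n lam).ae_le (compl_mem_ae_iff.2 ?_)
  have h := (MeasurableEmbedding.subtype_coe (measurableSet_halfSpace n)).comap_apply
    (volume : Measure (Eu n)) {x}
  rw [image_singleton] at h
  exact h.trans (measure_singleton x.1)

/-- The singular integral kernel of the Bessel–Riesz transform, in its commutator with a smooth
function. -/
theorem hasIntegralKernel_besselComm (hn : 1 ≤ n) (hlam : 0 < lam) {f : Eu n → ℂ}
    (hf : ContDiff ℝ ∞ f) (hf' : HasCompactSupport f) (k : Fin (n + 1)) :
    HasIntegralKernel (mMeas n lam) (besselComm n lam f k) fun x y =>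
      ((-rieszConst n lam * (kerWeight n lam x y * rieszSym n lam k x y) : ℝ) : ℂ) *
        (f y.1 - f x.1) := by
  obtain ⟨C, hC⟩ := exists_F_le hn hlam
  obtain ⟨Cf, hCf⟩ := hf'.exists_bound_of_continuous hf.continuous
  have hfm : Measurable fun x : halfSpace n => f x.1 :=
    (hf.continuous.comp continuous_subtype_val).measurable
  have hc0 := rieszConst_pos n hlam
  have hC0 : 0 ≤ C := (F_nonneg 2 0 le_rfl).trans (hC 0 le_rfl).1
  refine hasIntegralKernel_comm (f := fun x => f x.1) (w := fun x y => rieszConst n lam * (3 * C) * kerWeight n lam x y)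
    (kN := fun N x y => (rieszKerReg n lam k N x y : ℂ)) (reg := besselReg n lam)
    (S := range fun φ : 𝓓(halfSpace n, ℂ) => (memLp_test hlam φ).toLp _)
    hfm (fun x => hCf x.1)
    (measurable_kerWeight.const_mul _) ?_ ?_ ?_ ?_ ?_ ?_ tendsto_besselReg ?_ ?_ ?_
  · have h1 := ((l2Bounded_commMaj hf hf').mMeas lam).const_mul (c := ENNReal.ofReal
      (rieszConst n lam * (3 * C))) ENNReal.ofReal_ne_top
    refine h1.mono fun x y => le_of_eq ?_
    have hx := ht_pos x
    have hy := ht_pos y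
    rw [ENNReal.ofReal_mul (p := rieszConst n lam * (3 * C)) (by positivity), kerWeight,
      ENNReal.ofReal_mul (p := (ht x * ht y) ^ (-lam)) (by positivity), commMaj]
    ring
  · exact Complex.measurable_ofReal.comp
      ((measurable_kerWeight.mul (measurable_rieszSym k)).const_mul _)
  · intro x y
    rw [Complex.norm_real, Real.norm_eq_abs, abs_mul, abs_neg, abs_of_pos hc0, abs_mul,
      abs_of_nonneg (kerWeight_nonneg x y)]
    by_cases hxy : y = x
    · rw [hxy, kerWeight_self]; simp
    · have := abs_rieszSym_le k hxy hC
      have h2 := kerWeight_nonneg (lam := lam) x y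
      calc _ ≤ rieszConst n lam * (kerWeight n lam x y * (3 * C)) := by gcongr
        _ = _ := by ring
  · intro N x
    have := isFiniteMeasure_cutMeas hlam N
    have hm : Measurable fun q : halfSpace n × (ℝ × ℝ) => heatDensDeriv n lam k q.2 x.1 q.1.1 :=
      (measurable_heatDensDeriv (lam := lam) k).comp
        (g := fun q : (ℝ × ℝ) × Eu n × Eu n => heatDensDeriv n lam k q.1 q.2.1 q.2.2)
        (f := fun q : halfSpace n × (ℝ × ℝ) => (q.2, x.1, q.1.1)) (by fun_prop)
    exact Complex.measurable_ofReal.comp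
      (hm.stronglyMeasurable.integral_prod_right' (ν := cutMeas lam N)).measurable
  · refine fun N => Eventually.of_forall fun x => ?_
    filter_upwards [ae_mMeas_ne x] with y hxy
    rw [Complex.norm_real]
    refine (abs_rieszKerReg_le hlam k N hxy).trans ?_
    have h1 := sqrt_mul_F_le hxy hC
    have h2 := (hC _ (H_nonneg x y)).1
    have h3 := kerWeight_nonneg (lam := lam) x y
    calc _ ≤ rieszConst n lam * (kerWeight n lam x y * (3 * C)) := by
          gcongr
          linarith [h1.2]
      _ = _ := by ring
  · refine Eventually.of_forall fun x => ?_
    filter_upwards [ae_mMeas_ne x] with y hxy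
    exact (Complex.continuous_ofReal.tendsto _).comp (tendsto_rieszKerReg hlam k hxy)
  · intro A B h
    exact ext_of_eq_on_test hlam fun φ => h _ ⟨φ, rfl⟩
  · rintro _ ⟨φ, rfl⟩
    refine ⟨mulTest f hf.contDiffOn φ, Lp.ext ?_⟩
    filter_upwards [mulOp_apply_of_bounded (mMeas n lam) (fun x => f x.1)
        hfm.aestronglyMeasurable Cf
        (fun x => hCf x.1) ((memLp_test hlam φ).toLp _),
      (memLp_test hlam φ).coeFn_toLp,
      (memLp_test hlam (mulTest f hf.contDiffOn φ)).coeFn_toLp] with x h1 h2 h3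
    rw [h3, h1, h2, mulTest_apply]
  · rintro _ ⟨φ, rfl⟩ N
    have := isFiniteMeasure_cutMeas hlam N
    filter_upwards [besselRiesz_besselReg_ae_eq hlam k N φ] with x hx
    have h0 : (fun y => (rieszKerReg n lam k N x y : ℂ) * ((memLp_test hlam φ).toLp _) y)
        =ᵐ[mMeas n lam] fun y => (rieszKerReg n lam k N x y : ℂ) * φ y.1 := by
      filter_upwards [(memLp_test hlam φ).coeFn_toLp] with y hy
      rw [hy]
    have hφI := (integrable_mMeas_of_hasCompactSupport (n := n) hlam
      (f := fun y => (((1 + ‖y‖ : ℝ)) : ℂ) * φ y)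
        (by have := φ.continuous; fun_prop) φ.hasCompactSupport.mul_left).norm
    refine ⟨Integrable.congr ?_ h0.symm, ?_⟩
    · set C' := heatConst n lam * (N + 1 : ℝ) ^ (halfDim n lam + 1 / 2)
      refine (hφI.const_mul (3 * (N + 1) * C' * (1 + ‖x.1‖) * (cutMeas lam N).real univ)).mono' ?_
        (Eventually.of_forall fun y => ?_)
      · refine AEStronglyMeasurable.mul ?_ (φ.continuous.comp continuous_subtype_val).aestronglyMeasurable
        have hm : Measurable fun q : halfSpace n × (ℝ × ℝ) => heatDensDeriv n lam k q.2 x.1 q.1.1 :=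
          (measurable_heatDensDeriv (lam := lam) k).comp
            (g := fun q : (ℝ × ℝ) × Eu n × Eu n => heatDensDeriv n lam k q.1 q.2.1 q.2.2)
            (f := fun q : halfSpace n × (ℝ × ℝ) => (q.2, x.1, q.1.1)) (by fun_prop)
        exact (Complex.measurable_ofReal.comp
          (hm.stronglyMeasurable.integral_prod_right' (ν := cutMeas lam N)).measurable).aestronglyMeasurable
      · have h3 := norm_integral_le_of_norm_le_const (μ := cutMeas lam N)
          (f := fun p => heatDensDeriv n lam k p x.1 y.1)
          (C := 3 * (N + 1) * C' * ((1 + ‖x.1‖) * (1 + ‖y.1‖))) (by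
            filter_upwards [ae_mem_cutMeas hlam N] with p hp
            exact abs_heatDensDeriv_le hlam k hp.1 hp.2 x y)
        rw [norm_mul, norm_mul, Complex.norm_real, Complex.norm_real,
          Real.norm_of_nonneg (by positivity : 0 ≤ 1 + ‖y.1‖)]
        calc _ ≤ 3 * (N + 1) * C' * ((1 + ‖x.1‖) * (1 + ‖y.1‖)) * (cutMeas lam N).real univ * ‖φ y.1‖ :=
              mul_le_mul_of_nonneg_right h3 (norm_nonneg _)
          _ = _ := by ring
    · rw [hx, integral_congr_ae h0]
      refine integral_congr_ae (Eventually.of_forall fun y => ?_)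
      simp only
      rw [integral_mul_const, rieszKerReg, integral_complex_ofReal]

end BesselCommutator

/-! ### Fourier multipliers on `L²` and Gaussians -/

section ClassicalFourier

open Filter Topology
open scoped FourierTransform RealInnerProductSpace SchwartzMap

variable {n : ℕ}

/-- On `L¹ ∩ L²`, the inverse of the Fourier transform on `L²` is given by the Fourier integral. -/
theorem fourierL2_symm_ae_eq {h : Eu n → ℂ} (hI : Integrable h) (hL : MemLp h 2) :
    (fourierL2 n).symm (hL.toLp h) =ᵐ[volume] 𝓕⁻ h := by
  set u := (fourierL2 n).symm (hL.toLp h) with hu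
  have hc : Continuous (𝓕⁻ h) := by
    have h1 : Continuous (𝓕 h) := VectorFourier.fourierIntegral_continuous
      Real.continuous_fourierChar (L := innerₗ (Eu n)) (by exact continuous_inner) hI
    have h2 : 𝓕⁻ h = fun x => 𝓕 h (-x) := funext fun x => Real.fourierInv_eq_fourier_neg h x
    rw [h2]
    exact h1.comp continuous_neg
  refine ae_eq_of_integral_contDiff_smul_eq ((Lp.memLp u).locallyIntegrable (by norm_num))
    hc.locallyIntegrable fun g hg hgc => ?_
  have hgs : ContDiff ℝ ∞ fun x => (g x : ℂ) := Complex.ofRealCLM.contDiff.comp hg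
  have hgc' : HasCompactSupport fun x => (g x : ℂ) := hgc.comp_left Complex.ofReal_zero
  set ψ : 𝓢(Eu n, ℂ) := hgc'.toSchwartzMap hgs with hψ
  have hψa : ∀ x, ψ x = (g x : ℂ) := fun x => rfl
  have h1 := congrArg (fun T : 𝓢'(Eu n, ℂ) => T ψ)
    (Lp.fourierInv_toTemperedDistribution_eq (hL.toLp h))
  simp only [TemperedDistribution.fourierInv_apply, Lp.toTemperedDistribution_apply] at h1
  have h2 : ∫ x, (𝓕⁻ ψ : 𝓢(Eu n, ℂ)) x • (hL.toLp h) x = ∫ x, (𝓕⁻ (ψ : Eu n → ℂ)) x • h x := by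
    refine integral_congr_ae ?_
    filter_upwards [hL.coeFn_toLp] with x hx
    rw [hx, SchwartzMap.fourierInv_coe]
  have h3 : ∫ x, (𝓕⁻ (ψ : Eu n → ℂ)) x • h x = ∫ x, ψ x • (𝓕⁻ h) x :=
    VectorFourier.integral_fourierIntegral_smul_eq_flip (L := -innerₗ (Eu n))
      Real.continuous_fourierChar (by exact continuous_inner.neg) ψ.integrable hI |>.trans (by
        refine integral_congr_ae (Eventually.of_forall fun x => ?_)
        simp only
        congr 1
        simp only [Real.fourierInv_eq, VectorFourier.fourierIntegral, LinearMap.flip_apply,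
          LinearMap.neg_apply, neg_neg, innerₗ_apply_apply]
        refine integral_congr_ae (Eventually.of_forall fun y => ?_)
        simp only
        rw [real_inner_comm])
  rw [h2, h3] at h1
  have h4 : ∫ x, g x • u x = ∫ x, ψ x • u x := by simp [hψa]
  rw [h4]
  exact h1.symm.trans (by simp [hψa])

theorem integrable_norm_mul_exp {b : ℝ} (hb : 0 < b) :
    Integrable (fun v : Eu n => ‖v‖ * Real.exp (-b * ‖v‖ ^ 2)) := by
  have h0 := (GaussianFourier.integrable_cexp_neg_mul_sq_norm_add (V := Eu n) (b := ((b / 2 : ℝ) : ℂ))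
    (by simpa using hb) 0 0).norm
  refine (h0.const_mul (1 + 2 / b)).mono' (by fun_prop) (Eventually.of_forall fun v => ?_)
  rw [Complex.norm_exp, Real.norm_of_nonneg (by positivity)]
  have h1 : ‖v‖ ≤ (1 + 2 / b) * Real.exp (b / 2 * ‖v‖ ^ 2) := by
    have h2 := Real.add_one_le_exp (b / 2 * ‖v‖ ^ 2)
    have h3 : 1 ≤ Real.exp (b / 2 * ‖v‖ ^ 2) := Real.one_le_exp (by positivity)
    have h4 : ‖v‖ ^ 2 ≤ 2 / b * Real.exp (b / 2 * ‖v‖ ^ 2) := by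
      rw [div_mul_eq_mul_div, le_div_iff₀ hb]
      nlinarith
    nlinarith [sq_nonneg (‖v‖ - 1)]
  have h5 : (-((b / 2 : ℝ) : ℂ) * (‖v‖ : ℂ) ^ 2 + 0 * ((⟪(0 : Eu n), v⟫ : ℝ) : ℂ)).re =
      -(b / 2) * ‖v‖ ^ 2 := by
    rw [zero_mul, add_zero]
    norm_cast
  rw [h5]
  calc _ ≤ (1 + 2 / b) * Real.exp (b / 2 * ‖v‖ ^ 2) * Real.exp (-b * ‖v‖ ^ 2) := by gcongr
    _ = _ := by
      rw [mul_assoc, ← Real.exp_add]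
      ring_nf

/-- The Fourier transform of the derivative of a Gaussian. -/
theorem fourier_mul_gaussian (l : Fin (n + 1)) {t : ℝ} (ht : 0 < t) (z : Eu n) :
    𝓕 (fun ξ : Eu n => 2 * Real.pi * Complex.I * (ξ l : ℂ) *
      ((Real.exp (-t * (2 * Real.pi * ‖ξ‖) ^ 2) : ℝ) : ℂ)) z =
      ((z l / (2 * t) * ((4 * Real.pi * t) ^ (-((n + 1 : ℝ) / 2)) *
        Real.exp (-‖z‖ ^ 2 / (4 * t))) : ℝ) : ℂ) := by
  have hpi := Real.pi_pos
  set b : ℝ := 4 * Real.pi ^ 2 * t with hb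
  have hb0 : 0 < b := by positivity
  let g : Eu n → ℂ := fun v => Complex.exp (-(b : ℂ) * ‖v‖ ^ 2)
  have hgn : ∀ v, ‖g v‖ = Real.exp (-b * ‖v‖ ^ 2) := fun v => by
    simp only [g]
    rw [Complex.norm_exp]
    congr 1
    norm_cast
  have hgI : Integrable g := by
    have := GaussianFourier.integrable_cexp_neg_mul_sq_norm_add (V := Eu n) (b := (b : ℂ))
      (by simpa using hb0) 0 0
    simpa [g] using this
  have hgI' : Integrable fun v : Eu n => ‖v‖ * ‖g v‖ := by
    simp_rw [hgn]
    exact integrable_norm_mul_exp hb0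
  have hd := Real.hasFDerivAt_fourier hgI hgI' z
  have hdI : Integrable (VectorFourier.fourierSMulRight (innerSL ℝ) g) := by
    refine (hgI'.const_mul (2 * Real.pi * ‖innerSL ℝ (E := Eu n)‖)).mono' ?_
      (Eventually.of_forall fun v => (VectorFourier.norm_fourierSMulRight_le _ _ _).trans_eq (by ring))
    exact hgI.1.fourierSMulRight
  have h1 := hd.hasLineDerivAt (EuclideanSpace.single l (1 : ℝ))
  rw [Real.fourier_continuousLinearMap_apply hdI] at h1
  have h2 : (fun v => VectorFourier.fourierSMulRight (innerSL ℝ) g v (EuclideanSpace.single l (1 : ℝ))) =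
      fun ξ : Eu n => -(2 * Real.pi * Complex.I * (ξ l : ℂ) *
      ((Real.exp (-t * (2 * Real.pi * ‖ξ‖) ^ 2) : ℝ) : ℂ)) := by
    funext v
    rw [VectorFourier.fourierSMulRight_apply]
    have h3 : (innerSL ℝ) v (EuclideanSpace.single l (1 : ℝ)) = v l := by
      rw [innerSL_apply_apply, real_inner_comm]
      simp [EuclideanSpace.inner_single_left]
    rw [h3]
    simp only [g, hb, smul_eq_mul, Complex.real_smul]
    push_cast
    ring_nf
  rw [h2] at h1
  have h4 : 𝓕 g = fun z : Eu n => (((4 * Real.pi * t) ^ (-((n + 1 : ℝ) / 2)) *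
        Real.exp (-‖z‖ ^ 2 / (4 * t)) : ℝ) : ℂ) := by
    funext z
    have h5 := fourier_gaussian_innerProductSpace (V := Eu n) (b := (b : ℂ)) (by simpa using hb0) z
    simp only [g]
    rw [h5, finrank_euclideanSpace, Fintype.card_fin]
    have h6 : (Real.pi : ℂ) / b = ((4 * Real.pi * t : ℝ)⁻¹ : ℝ) := by
      rw [hb]
      push_cast
      field_simp
    have h7 : -(Real.pi : ℂ) ^ 2 * (‖z‖ : ℂ) ^ 2 / b = ((-‖z‖ ^ 2 / (4 * t) : ℝ) : ℂ) := by
      rw [hb]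
      push_cast
      field_simp
    rw [h6, h7, Complex.ofReal_mul, Complex.ofReal_exp, Real.rpow_neg (by positivity),
      ← Real.inv_rpow (by positivity), Complex.ofReal_cpow (by positivity)]
    push_cast
    rfl
  have h8 : HasLineDerivAt ℝ (𝓕 g) ((-(z l / (2 * t) * ((4 * Real.pi * t) ^ (-((n + 1 : ℝ) / 2)) *
        Real.exp (-‖z‖ ^ 2 / (4 * t)))) : ℝ) : ℂ) z (EuclideanSpace.single l (1 : ℝ)) := by
    rw [h4]
    have h9 : HasDerivAt (fun τ : ℝ => z + τ • (EuclideanSpace.single l 1 : Eu n))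
        (EuclideanSpace.single l 1 : Eu n) 0 := by
      simpa using ((hasDerivAt_id (0 : ℝ)).smul_const
        (EuclideanSpace.single l 1 : Eu n)).const_add z
    have h10 := ((h9.norm_sq.neg.div_const (4 * t)).exp.const_mul
      ((4 * Real.pi * t) ^ (-((n + 1 : ℝ) / 2))))
    refine HasDerivAt.ofReal_comp (f := fun τ : ℝ => (4 * Real.pi * t) ^ (-((n + 1 : ℝ) / 2)) *
      Real.exp (-‖z + τ • (EuclideanSpace.single l 1 : Eu n)‖ ^ 2 / (4 * t))) (h10.congr_deriv ?_)
    simp only [zero_smul, add_zero, Pi.neg_apply]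
    have h6 : inner ℝ z (EuclideanSpace.single l (1 : ℝ) : Eu n) = z l := by
      rw [real_inner_comm]
      simp [EuclideanSpace.inner_single_left]
    rw [h6]
    field_simp
    ring
  have h11 := h1.unique h8
  have h12 : 𝓕 (fun ξ : Eu n => -(2 * Real.pi * Complex.I * (ξ l : ℂ) *
      ((Real.exp (-t * (2 * Real.pi * ‖ξ‖) ^ 2) : ℝ) : ℂ))) z =
      -𝓕 (fun ξ : Eu n => 2 * Real.pi * Complex.I * (ξ l : ℂ) *
      ((Real.exp (-t * (2 * Real.pi * ‖ξ‖) ^ 2) : ℝ) : ℂ)) z := by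
    simp only [Real.fourier_eq, smul_neg, integral_neg]
  rw [h12, Complex.ofReal_neg] at h11
  exact neg_injective h11

end ClassicalFourier

/-! ### The kernels of the classical Riesz transforms -/

section ClassicalKernel

open Filter Topology
open scoped FourierTransform RealInnerProductSpace SchwartzMap

variable {n : ℕ}

/-- The symbol `2πi ξ_l (4π²|ξ|²)^{-1/2}` of the classical Riesz transform, with the power
`(4π²|ξ|²)^{-1/2}` replaced by its regularisation. -/
def rieszSymbolReg (n : ℕ) (l : Fin (n + 1)) (N : ℕ) (ξ : Eu n) : ℂ :=
  2 * Real.pi * Complex.I * (ξ l : ℂ) * (cutInv N (2 * Real.pi * ‖ξ‖) : ℂ)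

theorem measurable_rieszSymbolReg (l : Fin (n + 1)) (N : ℕ) : Measurable (rieszSymbolReg n l N) := by
  have := measurable_cutInv N
  unfold rieszSymbolReg
  fun_prop

theorem norm_mul_two_pi_I (l : Fin (n + 1)) (ξ : Eu n) :
    ‖2 * Real.pi * Complex.I * (ξ l : ℂ)‖ ≤ 2 * Real.pi * ‖ξ‖ := by
  rw [norm_mul, norm_mul, norm_mul, Complex.norm_I, Complex.norm_real, Complex.norm_real,
    Complex.norm_ofNat, mul_one, Real.norm_of_nonneg Real.pi_pos.le]
  have := abs_apply_le_norm ξ l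
  have := Real.pi_pos
  rw [Real.norm_eq_abs]
  gcongr

theorem norm_rieszSymbolReg_le (l : Fin (n + 1)) (N : ℕ) (ξ : Eu n) : ‖rieszSymbolReg n l N ξ‖ ≤ 1 := by
  have hpi := Real.pi_pos
  have h1 := norm_mul_two_pi_I l ξ
  rw [rieszSymbolReg, norm_mul, Complex.norm_real, Real.norm_of_nonneg (cutInv_nonneg _ _)]
  rcases eq_or_ne ξ 0 with rfl | h
  · simp
  · have h2 : 0 < 2 * Real.pi * ‖ξ‖ := by have := norm_pos_iff.2 h; positivity
    calc _ ≤ 2 * Real.pi * ‖ξ‖ * (2 * Real.pi * ‖ξ‖)⁻¹ := by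
          gcongr
          exacts [cutInv_nonneg _ _, cutInv_le N h2]
      _ = 1 := mul_inv_cancel₀ h2.ne'

/-- The derivative of the classical heat kernel, with the weight turning it into the density
with respect to time of the classical Riesz kernel. -/
def classicalDens (n : ℕ) (l : Fin (n + 1)) (t : ℝ) (z : Eu n) : ℝ :=
  Real.pi ^ (-(1 / 2) : ℝ) * t ^ (-(1 / 2) : ℝ) *
    (z l / (2 * t) * ((4 * Real.pi * t) ^ (-((n + 1 : ℝ) / 2)) * Real.exp (-‖z‖ ^ 2 / (4 * t))))

theorem integrable_rieszSymbolReg_integrand (l : Fin (n + 1)) (N : ℕ) :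
    Integrable (fun p : ℝ × Eu n => ((Real.pi ^ (-(1 / 2) : ℝ) * p.1 ^ (-(1 / 2) : ℝ) : ℝ) : ℂ) *
      (2 * Real.pi * Complex.I * (p.2 l : ℂ) *
        ((Real.exp (-p.1 * (2 * Real.pi * ‖p.2‖) ^ 2) : ℝ) : ℂ)))
      ((volume.restrict (Icc (1 / (N + 1 : ℝ)) (N + 1))).prod volume) := by
  have hpi := Real.pi_pos
  have hb : 0 < (2 * Real.pi) ^ 2 / (N + 1) := by positivity
  have h1 := (integrable_norm_mul_exp (n := n) hb).const_mul
    (Real.pi ^ (-(1 / 2) : ℝ) * (N + 1 : ℝ) ^ (1 / 2 : ℝ) * (2 * Real.pi))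
  have h2 := h1.comp_snd (volume.restrict (Icc (1 / (N + 1 : ℝ)) (N + 1)))
  refine h2.mono' ?_ ?_
  · refine Measurable.aestronglyMeasurable ?_
    fun_prop
  · have h3 : ∀ᵐ p ∂((volume.restrict (Icc (1 / (N + 1 : ℝ)) (N + 1))).prod (volume : Measure (Eu n))),
        p.1 ∈ Icc (1 / (N + 1 : ℝ)) (N + 1) :=
      Measure.quasiMeasurePreserving_fst.ae (ae_restrict_mem measurableSet_Icc)
    filter_upwards [h3] with p hp
    have ht := pos_of_mem_Icc hp
    have h4 := rpow_neg_le_of_mem_Icc hp (s := 1 / 2) (by norm_num)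
    rw [norm_mul, norm_mul, Complex.norm_real, Complex.norm_real, Real.norm_of_nonneg (by positivity),
      Real.norm_of_nonneg (by positivity)]
    have h5 := norm_mul_two_pi_I l p.2
    have h6 : Real.exp (-p.1 * (2 * Real.pi * ‖p.2‖) ^ 2) ≤
        Real.exp (-((2 * Real.pi) ^ 2 / (N + 1)) * ‖p.2‖ ^ 2) := by
      refine Real.exp_le_exp.2 ?_
      have h7 := mul_le_mul_of_nonneg_right hp.1 (by positivity : 0 ≤ (2 * Real.pi * ‖p.2‖) ^ 2)
      have h8 : 1 / (N + 1 : ℝ) * (2 * Real.pi * ‖p.2‖) ^ 2 = (2 * Real.pi) ^ 2 / (N + 1) * ‖p.2‖ ^ 2 := by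
        ring
      linarith
    calc _ ≤ Real.pi ^ (-(1 / 2) : ℝ) * (N + 1 : ℝ) ^ (1 / 2 : ℝ) * (2 * Real.pi * ‖p.2‖ *
          Real.exp (-((2 * Real.pi) ^ 2 / (N + 1)) * ‖p.2‖ ^ 2)) := by gcongr
      _ = _ := by ring

theorem rieszSymbolReg_eq (l : Fin (n + 1)) (N : ℕ) (ξ : Eu n) :
    rieszSymbolReg n l N ξ = ∫ t in Icc (1 / (N + 1 : ℝ)) (N + 1),
      ((Real.pi ^ (-(1 / 2) : ℝ) * t ^ (-(1 / 2) : ℝ) : ℝ) : ℂ) * (2 * Real.pi * Complex.I * (ξ l : ℂ) *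
        ((Real.exp (-t * (2 * Real.pi * ‖ξ‖) ^ 2) : ℝ) : ℂ)) := by
  rw [rieszSymbolReg, cutInv, ← integral_complex_ofReal, ← integral_const_mul]
  refine integral_congr_ae (Eventually.of_forall fun t => ?_)
  push_cast
  ring

theorem integrable_rieszSymbolReg (l : Fin (n + 1)) (N : ℕ) : Integrable (rieszSymbolReg n l N) := by
  refine (integrable_rieszSymbolReg_integrand l N).integral_prod_right.congr
    (Eventually.of_forall fun ξ => ?_)
  exact (rieszSymbolReg_eq l N ξ).symm

/-- The kernel of the regularised classical Riesz transform. -/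
theorem fourier_rieszSymbolReg (l : Fin (n + 1)) (N : ℕ) (z : Eu n) :
    𝓕 (rieszSymbolReg n l N) z =
      ((∫ t in Icc (1 / (N + 1 : ℝ)) (N + 1), classicalDens n l t z : ℝ) : ℂ) := by
  have hI := integrable_rieszSymbolReg_integrand l N
  set G : ℝ → Eu n → ℂ := fun t ξ => ((Real.pi ^ (-(1 / 2) : ℝ) * t ^ (-(1 / 2) : ℝ) : ℝ) : ℂ) *
      (2 * Real.pi * Complex.I * (ξ l : ℂ) *
        ((Real.exp (-t * (2 * Real.pi * ‖ξ‖) ^ 2) : ℝ) : ℂ)) with hG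
  have hI2 : Integrable (Function.uncurry fun (t : ℝ) (ξ : Eu n) => (Real.fourierChar (-⟪ξ, z⟫)) • G t ξ)
      ((volume.restrict (Icc (1 / (N + 1 : ℝ)) (N + 1))).prod volume) := by
    refine hI.norm.mono' ?_ (Eventually.of_forall fun p => ?_)
    · refine AEStronglyMeasurable.smul (𝕜 := Circle) ?_ hI.1
      refine Continuous.aestronglyMeasurable ?_
      exact Real.continuous_fourierChar.comp (by fun_prop)
    · simp only [Function.uncurry]
      rw [Circle.norm_smul]
  calc 𝓕 (rieszSymbolReg n l N) z
      = ∫ ξ, ∫ t in Icc (1 / (N + 1 : ℝ)) (N + 1), (Real.fourierChar (-⟪ξ, z⟫)) • G t ξ := by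
        rw [Real.fourier_eq]
        refine integral_congr_ae (Eventually.of_forall fun ξ => ?_)
        beta_reduce
        rw [rieszSymbolReg_eq]
        simp only [Circle.smul_def]
        rw [integral_smul]
    _ = ∫ t in Icc (1 / (N + 1 : ℝ)) (N + 1), ∫ ξ, (Real.fourierChar (-⟪ξ, z⟫)) • G t ξ :=
        (integral_integral_swap hI2).symm
    _ = _ := by
        rw [← integral_complex_ofReal]
        refine setIntegral_congr_fun measurableSet_Icc fun t ht => ?_
        beta_reduce
        rw [classicalDens, Complex.ofReal_mul, ← fourier_mul_gaussian l (pos_of_mem_Icc ht),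
          Real.fourier_eq, ← integral_const_mul]
        refine integral_congr_ae (Eventually.of_forall fun ξ => ?_)
        simp only [hG, Circle.smul_def, smul_eq_mul]
        ring

/-- The constant in the classical Riesz kernels. -/
def classicalConst (n : ℕ) : ℝ :=
  Real.pi ^ (-(1 / 2) : ℝ) / 2 * (4 * Real.pi) ^ (-((n + 1 : ℝ) / 2)) *
    (Real.Gamma ((n + 2 : ℝ) / 2) * 4 ^ ((n + 2 : ℝ) / 2))

theorem classicalConst_pos (n : ℕ) : 0 < classicalConst n := by
  have := Real.pi_pos
  have := Real.Gamma_pos_of_pos (s := (n + 2 : ℝ) / 2) (by positivity)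
  unfold classicalConst
  positivity

theorem classicalDens_eq (l : Fin (n + 1)) {t : ℝ} (ht : 0 < t) (z : Eu n) :
    classicalDens n l t z =
      (Real.pi ^ (-(1 / 2) : ℝ) / 2 * (4 * Real.pi) ^ (-((n + 1 : ℝ) / 2)) * z l) *
        (t ^ (-((n + 2 : ℝ) / 2 + 1)) * Real.exp (-‖z‖ ^ 2 / (4 * t))) := by
  have hpi := Real.pi_pos
  have h1 : t ^ (-((n + 2 : ℝ) / 2 + 1)) = t ^ (-(1 / 2) : ℝ) * t ^ (-((n + 1 : ℝ) / 2)) * t⁻¹ := by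
    rw [← Real.rpow_neg_one t, ← Real.rpow_add ht, ← Real.rpow_add ht]
    congr 1
    ring
  rw [classicalDens, Real.mul_rpow (by positivity) ht.le, h1]
  field_simp

/-- The classical Riesz kernel, as the integral of `classicalDens` over all times. -/
theorem integral_classicalDens (l : Fin (n + 1)) {z : Eu n} (hz : z ≠ 0) :
    IntegrableOn (fun t => classicalDens n l t z) (Ioi 0) ∧
    ∫ t in Ioi (0 : ℝ), classicalDens n l t z =
      classicalConst n * (z l / ‖z‖ * (‖z‖ ^ (n + 1))⁻¹) ∧
    ∫ t in Ioi (0 : ℝ), |classicalDens n l t z| =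
      classicalConst n * |z l / ‖z‖ * (‖z‖ ^ (n + 1))⁻¹| := by
  have hpi := Real.pi_pos
  have hr : 0 < ‖z‖ := norm_pos_iff.2 hz
  have hI := integral_rpow_mul_exp_neg_div (A := ‖z‖ ^ 2) (ρ := (n + 2 : ℝ) / 2) (by positivity)
    (by positivity)
  have h1 : ∀ t ∈ Ioi (0 : ℝ), classicalDens n l t z = _ := fun t ht => classicalDens_eq l ht z
  have h2 : ∀ t ∈ Ioi (0 : ℝ), |classicalDens n l t z| =
      (Real.pi ^ (-(1 / 2) : ℝ) / 2 * (4 * Real.pi) ^ (-((n + 1 : ℝ) / 2)) * |z l|) *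
        (t ^ (-((n + 2 : ℝ) / 2 + 1)) * Real.exp (-‖z‖ ^ 2 / (4 * t))) := fun t ht => by
    have ht' : (0 : ℝ) < t := ht
    rw [h1 t ht, abs_mul, abs_mul, abs_of_pos (by positivity : 0 < Real.pi ^ (-(1 / 2) : ℝ) / 2 *
      (4 * Real.pi) ^ (-((n + 1 : ℝ) / 2))), abs_of_nonneg (a := t ^ _ * _) (by positivity)]
  have h3 : (‖z‖ ^ 2) ^ (-((n + 2 : ℝ) / 2)) = ‖z‖⁻¹ * (‖z‖ ^ (n + 1))⁻¹ := by
    rw [← mul_inv, ← pow_succ', Real.rpow_neg (by positivity), ← Real.rpow_natCast ‖z‖ 2,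
      ← Real.rpow_mul hr.le, ← Real.rpow_natCast]
    congr 2
    push_cast
    ring
  refine ⟨IntegrableOn.congr_fun (Integrable.const_mul hI.1 _) (fun t ht => (h1 t ht).symm) measurableSet_Ioi, ?_, ?_⟩
  · rw [setIntegral_congr_fun measurableSet_Ioi h1, integral_const_mul, hI.2, h3, classicalConst]
    ring
  · rw [setIntegral_congr_fun measurableSet_Ioi h2, integral_const_mul, hI.2, h3, classicalConst,
      abs_mul, abs_div, abs_norm, abs_of_pos (by positivity : 0 < (‖z‖ ^ (n + 1))⁻¹)]
    ring

/-- The kernel of the regularised classical Riesz transform. -/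
def classicalKerReg (n : ℕ) (l : Fin (n + 1)) (N : ℕ) (x y : Eu n) : ℝ :=
  ∫ t in Icc (1 / (N + 1 : ℝ)) (N + 1), classicalDens n l t (y - x)

theorem tendsto_classicalKerReg (l : Fin (n + 1)) {x y : Eu n} (hxy : y ≠ x) :
    Tendsto (fun N => classicalKerReg n l N x y) atTop
      (𝓝 (-classicalConst n * ((x - y) l / ‖x - y‖ * (‖x - y‖ ^ (n + 1))⁻¹))) := by
  have h := integral_classicalDens l (sub_ne_zero.2 hxy)
  have h1 := tendsto_setIntegral_of_monotone (f := fun t => classicalDens n l t (y - x))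
    (fun N => measurableSet_Icc) monotone_Icc_inv (by rw [iUnion_Icc_inv]; exact h.1)
  rw [iUnion_Icc_inv, h.2.1] at h1
  have h2 : -classicalConst n * ((x - y) l / ‖x - y‖ * (‖x - y‖ ^ (n + 1))⁻¹) =
      classicalConst n * ((y - x) l / ‖y - x‖ * (‖y - x‖ ^ (n + 1))⁻¹) := by
    rw [norm_sub_rev y x, PiLp.sub_apply, PiLp.sub_apply]
    ring
  rw [h2]
  exact h1

theorem abs_classicalKerReg_le (l : Fin (n + 1)) (N : ℕ) {x y : Eu n} (hxy : y ≠ x) :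
    |classicalKerReg n l N x y| ≤ classicalConst n * (‖x - y‖ ^ (n + 1))⁻¹ := by
  have h := integral_classicalDens l (sub_ne_zero.2 hxy)
  have hc := classicalConst_pos n
  calc |classicalKerReg n l N x y|
      ≤ ∫ t in Icc (1 / (N + 1 : ℝ)) (N + 1), |classicalDens n l t (y - x)| :=
        abs_integral_le_integral_abs
    _ ≤ ∫ t in Ioi (0 : ℝ), |classicalDens n l t (y - x)| :=
        setIntegral_mono_set h.1.abs (Eventually.of_forall fun t => abs_nonneg _)
          (Icc_subset_Ioi N).eventuallyLE
    _ ≤ _ := by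
        rw [h.2.2, abs_mul, norm_sub_rev y x, abs_of_nonneg (a := (_ : ℝ)⁻¹) (by positivity)]
        have h1 : |(y - x) l / ‖x - y‖| ≤ 1 := by
          rw [abs_div, abs_norm, norm_sub_rev x y]
          exact div_le_one_of_le₀ (abs_apply_le_norm _ _) (norm_nonneg _)
        gcongr
        exact mul_le_of_le_one_left (by positivity) h1

/-- The regularised classical Riesz transform as a convolution operator. -/
theorem fourierInv_rieszSymbolReg_mul (l : Fin (n + 1)) (N : ℕ) (ψ : 𝓢(Eu n, ℂ)) (x : Eu n) :
    𝓕⁻ (fun ξ => rieszSymbolReg n l N ξ * (𝓕 (ψ : Eu n → ℂ)) ξ) x =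
      ∫ y, (classicalKerReg n l N x y : ℂ) * ψ y := by
  set g : Eu n → ℂ := fun ξ => Real.fourierChar ⟪ξ, x⟫ • rieszSymbolReg n l N ξ with hg
  have hgI : Integrable g := by
    refine (integrable_rieszSymbolReg l N).norm.mono' ?_ (Eventually.of_forall fun ξ => ?_)
    · refine AEStronglyMeasurable.smul (𝕜 := Circle) ?_ (integrable_rieszSymbolReg l N).1
      exact (Real.continuous_fourierChar.comp (by fun_prop)).aestronglyMeasurable
    · rw [hg, Circle.norm_smul]
  have h1 : ∫ ξ, (𝓕 (ψ : Eu n → ℂ)) ξ • g ξ = ∫ y, ψ y • (𝓕 g) y :=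
    (VectorFourier.integral_fourierIntegral_smul_eq_flip (L := innerₗ (Eu n))
      Real.continuous_fourierChar (by exact continuous_inner) ψ.integrable hgI).trans (by
        rw [flip_innerₗ]
        rfl)
  have h2 : ∀ y, (𝓕 g) y = (classicalKerReg n l N x y : ℂ) := fun y => by
    rw [classicalKerReg, ← fourier_rieszSymbolReg, Real.fourier_eq, Real.fourier_eq]
    refine integral_congr_ae (Eventually.of_forall fun ξ => ?_)
    simp only [hg]
    rw [smul_smul, ← AddChar.map_add_eq_mul, inner_sub_right]
    congr 2
    ring
  rw [Real.fourierInv_eq]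
  calc _ = ∫ ξ, (𝓕 (ψ : Eu n → ℂ)) ξ • g ξ := by
        refine integral_congr_ae (Eventually.of_forall fun ξ => ?_)
        simp only [hg, Circle.smul_def, smul_eq_mul]
        ring
    _ = _ := by
        rw [h1]
        refine integral_congr_ae (Eventually.of_forall fun y => ?_)
        simp only [h2, smul_eq_mul]
        ring

end ClassicalKernel

/-! ### The kernel of the classical Riesz commutator -/

section ClassicalCommutator

open Filter Topology ComplexConjugate
open scoped FourierTransform RealInnerProductSpace SchwartzMap

variable {n : ℕ} {lam : ℝ}

/-- The symbol of the regularisation `classicalReg`. The value at `0`, immaterial for the operator,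
makes it converge to `1` everywhere. -/
def classicalRegSymbol (n : ℕ) (N : ℕ) (ξ : Eu n) : ℝ :=
  if ξ = 0 then 1 else 2 * Real.pi * ‖ξ‖ * cutInv N (2 * Real.pi * ‖ξ‖)

theorem measurable_classicalRegSymbol (N : ℕ) : Measurable (classicalRegSymbol n N) := by
  have := measurable_cutInv N
  unfold classicalRegSymbol
  exact Measurable.ite (measurableSet_singleton 0) measurable_const (by fun_prop)

theorem norm_classicalRegSymbol_le (N : ℕ) (ξ : Eu n) : ‖(classicalRegSymbol n N ξ : ℂ)‖ ≤ 1 := by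
  have hpi := Real.pi_pos
  rw [Complex.norm_real, classicalRegSymbol]
  split_ifs with h
  · simp
  · have h2 : 0 < 2 * Real.pi * ‖ξ‖ := by have := norm_pos_iff.2 h; positivity
    rw [Real.norm_of_nonneg (mul_nonneg h2.le (cutInv_nonneg _ _))]
    calc _ ≤ 2 * Real.pi * ‖ξ‖ * (2 * Real.pi * ‖ξ‖)⁻¹ := by
          gcongr
          exact cutInv_le N h2
      _ = 1 := mul_inv_cancel₀ h2.ne'

theorem tendsto_classicalRegSymbol (ξ : Eu n) :
    Tendsto (fun N => (classicalRegSymbol n N ξ : ℂ)) atTop (𝓝 1) := by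
  have hpi := Real.pi_pos
  by_cases h : ξ = 0
  · simp [classicalRegSymbol, h]
  · have h2 : 0 < 2 * Real.pi * ‖ξ‖ := by have := norm_pos_iff.2 h; positivity
    have h3 := (tendsto_cutInv h2).const_mul (2 * Real.pi * ‖ξ‖)
    rw [mul_inv_cancel₀ h2.ne'] at h3
    have h4 := (Complex.continuous_ofReal.tendsto _).comp h3
    simpa [classicalRegSymbol, h, Function.comp_def] using h4

theorem rieszSymbol_mul_classicalRegSymbol (l : Fin (n + 1)) (N : ℕ) (ξ : Eu n) :
    rieszSymbol n l ξ * (classicalRegSymbol n N ξ : ℂ) = rieszSymbolReg n l N ξ := by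
  have hpi := Real.pi_pos
  by_cases h : ξ = 0
  · simp [rieszSymbol, rieszSymbolReg, h]
  · have h2 : 0 < 2 * Real.pi * ‖ξ‖ := by have := norm_pos_iff.2 h; positivity
    have h3 : (4 * Real.pi ^ 2 * ‖ξ‖ ^ 2) ^ (-(1 / 2) : ℝ) = (2 * Real.pi * ‖ξ‖)⁻¹ := by
      rw [show 4 * Real.pi ^ 2 * ‖ξ‖ ^ 2 = (2 * Real.pi * ‖ξ‖) ^ 2 by ring, ← Real.rpow_natCast,
        ← Real.rpow_mul h2.le]
      norm_num [Real.rpow_neg_one]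
    rw [rieszSymbol, rieszSymbolReg, classicalRegSymbol, if_neg h, h3, mul_assoc, ← Complex.ofReal_mul,
      inv_mul_cancel_left₀ h2.ne']

theorem norm_rieszSymbol_le (l : Fin (n + 1)) (ξ : Eu n) : ‖rieszSymbol n l ξ‖ ≤ 1 := by
  have h1 : Tendsto (fun N => rieszSymbol n l ξ * (classicalRegSymbol n N ξ : ℂ)) atTop
      (𝓝 (rieszSymbol n l ξ)) := by
    simpa using (tendsto_classicalRegSymbol ξ).const_mul (rieszSymbol n l ξ)
  refine le_of_tendsto h1.norm (Eventually.of_forall fun N => ?_)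
  rw [rieszSymbol_mul_classicalRegSymbol]
  exact norm_rieszSymbolReg_le l N ξ

theorem measurable_rieszSymbol (l : Fin (n + 1)) : Measurable (rieszSymbol n l) := by
  unfold rieszSymbol
  fun_prop

/-- A regularisation of the identity of `L²(ℝ^{n+1})`, making the Riesz transforms smoothing. -/
def classicalReg (n : ℕ) (N : ℕ) : L2Eu n →L[ℂ] L2Eu n :=
  (fourierL2 n).symm.toContinuousLinearEquiv.toContinuousLinearMap ∘L
    mulOp volume volume (fun ξ => (classicalRegSymbol n N ξ : ℂ)) ∘L
    (fourierL2 n).toContinuousLinearEquiv.toContinuousLinearMap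

theorem tendsto_classicalReg (g : L2Eu n) :
    Tendsto (fun N => classicalReg n N g) atTop (𝓝 g) := by
  have h1 := tendsto_mulOp (μ := (volume : Measure (Eu n)))
    (θ := fun N ξ => (classicalRegSymbol n N ξ : ℂ))
    (fun N => (Complex.measurable_ofReal.comp (measurable_classicalRegSymbol N)).aestronglyMeasurable)
    norm_classicalRegSymbol_le tendsto_classicalRegSymbol (fourierL2 n g)
  have h2 := ((fourierL2 n).symm.continuous.tendsto _).comp h1
  rw [LinearIsometryEquiv.symm_apply_apply] at h2
  exact h2

theorem memLp_rieszSymbolReg_mul (l : Fin (n + 1)) (N : ℕ) (ψ : 𝓢(Eu n, ℂ)) :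
    MemLp (fun ξ => rieszSymbolReg n l N ξ * (𝓕 (ψ : Eu n → ℂ)) ξ) 2 ∧
      Integrable (fun ξ => rieszSymbolReg n l N ξ * (𝓕 (ψ : Eu n → ℂ)) ξ) := by
  have hm := (measurable_rieszSymbolReg l N).aestronglyMeasurable (μ := (volume : Measure (Eu n)))
  have h1 : MemLp (𝓕 (ψ : Eu n → ℂ)) 2 volume := by
    rw [← SchwartzMap.fourier_coe]
    exact SchwartzMap.memLp _ 2 volume
  have h2 : Integrable (𝓕 (ψ : Eu n → ℂ)) := by
    rw [← SchwartzMap.fourier_coe]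
    exact SchwartzMap.integrable _
  have hb : ∀ ξ, ‖rieszSymbolReg n l N ξ * (𝓕 (ψ : Eu n → ℂ)) ξ‖ ≤ ‖(𝓕 (ψ : Eu n → ℂ)) ξ‖ :=
    fun ξ => by
      rw [norm_mul]
      exact mul_le_of_le_one_left (norm_nonneg _) (norm_rieszSymbolReg_le l N ξ)
  exact ⟨h1.mono (hm.mul h1.1) (Eventually.of_forall hb),
    h2.mono (hm.mul h2.1) (Eventually.of_forall hb)⟩

theorem fourierL2_toLp_ae_eq (ψ : 𝓢(Eu n, ℂ)) :
    fourierL2 n (ψ.toLp 2) =ᵐ[volume] 𝓕 (ψ : Eu n → ℂ) := by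
  have h : fourierL2 n (ψ.toLp 2) = (𝓕 ψ : 𝓢(Eu n, ℂ)).toLp 2 := SchwartzMap.toLp_fourier_eq ψ
  rw [h, ← SchwartzMap.fourier_coe]
  exact SchwartzMap.coeFn_toLp _ 2 volume

theorem fourierL2_riesz_classicalReg (l : Fin (n + 1)) (N : ℕ) (g : L2Eu n) :
    fourierL2 n (riesz n l (classicalReg n N g)) =ᵐ[volume]
      fun ξ => rieszSymbolReg n l N ξ * fourierL2 n g ξ := by
  have h2 : fourierL2 n (riesz n l (classicalReg n N g)) =
      mulOp volume volume (rieszSymbol n l)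
        (mulOp volume volume (fun ξ => (classicalRegSymbol n N ξ : ℂ)) (fourierL2 n g)) :=
    ((fourierL2 n).apply_symm_apply _).trans
      (congrArg (mulOp volume volume (rieszSymbol n l)) ((fourierL2 n).apply_symm_apply _))
  rw [h2]
  generalize fourierL2 n g = v
  filter_upwards [mulOp_apply_of_bounded volume (rieszSymbol n l)
      (measurable_rieszSymbol l).aestronglyMeasurable 1 (norm_rieszSymbol_le l)
      (mulOp volume volume (fun ξ => (classicalRegSymbol n N ξ : ℂ)) v),
    mulOp_apply_of_bounded volume (fun ξ => (classicalRegSymbol n N ξ : ℂ))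
      (Complex.measurable_ofReal.comp (measurable_classicalRegSymbol N)).aestronglyMeasurable 1
      (norm_classicalRegSymbol_le N) v] with ξ h4 h5
  rw [h4, h5, ← mul_assoc, rieszSymbol_mul_classicalRegSymbol]

/-- The regularised Riesz transform is an integral operator on Schwartz functions. -/
theorem riesz_classicalReg_ae_eq (l : Fin (n + 1)) (N : ℕ) (ψ : 𝓢(Eu n, ℂ)) :
    riesz n l (classicalReg n N (ψ.toLp 2)) =ᵐ[volume]
      fun x => ∫ y, (classicalKerReg n l N x y : ℂ) * ψ y := by
  have hψ := memLp_rieszSymbolReg_mul l N ψ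
  have h1 : riesz n l (classicalReg n N (ψ.toLp 2)) = (fourierL2 n).symm (hψ.1.toLp _) := by
    rw [LinearIsometryEquiv.eq_symm_apply]
    refine Lp.ext ?_
    filter_upwards [fourierL2_riesz_classicalReg l N (ψ.toLp 2), fourierL2_toLp_ae_eq ψ,
      hψ.1.coeFn_toLp] with ξ h4 h5 h6
    rw [h4, h5, h6]
  rw [h1]
  refine (fourierL2_symm_ae_eq hψ.2 hψ.1).trans (Eventually.of_forall fun x => ?_)
  exact fourierInv_rieszSymbolReg_mul l N ψ x

theorem continuous_classicalKerReg (l : Fin (n + 1)) (N : ℕ) (x : Eu n) :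
    Continuous fun y => (classicalKerReg n l N x y : ℂ) := by
  have h1 : Continuous (𝓕 (rieszSymbolReg n l N)) := VectorFourier.fourierIntegral_continuous
    Real.continuous_fourierChar (L := innerₗ (Eu n)) (by exact continuous_inner)
    (integrable_rieszSymbolReg l N)
  refine (h1.comp (continuous_id.sub continuous_const : Continuous fun y => y - x)).congr fun y => ?_
  exact fourier_rieszSymbolReg l N (y - x)

theorem norm_classicalKerReg_le (l : Fin (n + 1)) (N : ℕ) (x y : Eu n) :
    ‖(classicalKerReg n l N x y : ℂ)‖ ≤ ∫ ξ, ‖rieszSymbolReg n l N ξ‖ := by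
  rw [classicalKerReg, ← fourier_rieszSymbolReg]
  exact VectorFourier.norm_fourierIntegral_le_integral_norm _ _ _ _ _

/-- The singular integral kernel of the classical Riesz transform, in its commutator with a smooth
function. -/
theorem hasIntegralKernel_comm_riesz {f : Eu n → ℂ} (hf : ContDiff ℝ ∞ f) (hf' : HasCompactSupport f)
    (l : Fin (n + 1)) :
    HasIntegralKernel volume (comm (riesz n l) (mulOp volume volume f)) fun x y =>
      ((-classicalConst n * ((x - y) l / ‖x - y‖ * (‖x - y‖ ^ (n + 1))⁻¹) : ℝ) : ℂ) *
        (f y - f x) := by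
  obtain ⟨Cf, hCf⟩ := hf'.exists_bound_of_continuous hf.continuous
  have hc := classicalConst_pos n
  have hne : ∀ x : Eu n, ∀ᵐ y, y ≠ x := fun x =>
    compl_mem_ae_iff.2 (measure_singleton x)
  refine hasIntegralKernel_comm (w := fun x y => classicalConst n * (‖x - y‖ ^ (n + 1))⁻¹)
    (kN := fun N x y => (classicalKerReg n l N x y : ℂ)) (reg := classicalReg n)
    (S := range fun ψ : 𝓢(Eu n, ℂ) => ψ.toLp 2)
    hf.continuous.measurable hCf (by fun_prop) ?_ (by fun_prop) ?_
    (fun N x => (continuous_classicalKerReg l N x).measurable) ?_ ?_ tendsto_classicalReg ?_ ?_ ?_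
  · refine ((l2Bounded_commMaj hf hf').const_mul (c := ENNReal.ofReal
      (classicalConst n)) ENNReal.ofReal_ne_top).mono fun x y => le_of_eq ?_
    rw [ENNReal.ofReal_mul hc.le, commMaj]
    ring
  · intro x y
    rw [Complex.norm_real, Real.norm_eq_abs, abs_mul, abs_neg, abs_of_pos hc, abs_mul,
      abs_of_nonneg (a := (_ : ℝ)⁻¹) (by positivity)]
    have h1 : |(x - y) l / ‖x - y‖| ≤ 1 := by
      rw [abs_div, abs_norm]
      exact div_le_one_of_le₀ (abs_apply_le_norm _ _) (norm_nonneg _)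
    gcongr
    exact mul_le_of_le_one_left (by positivity) h1
  · refine fun N => Eventually.of_forall fun x => ?_
    filter_upwards [hne x] with y hxy
    rw [Complex.norm_real]
    exact abs_classicalKerReg_le l N hxy
  · refine Eventually.of_forall fun x => ?_
    filter_upwards [hne x] with y hxy
    exact (Complex.continuous_ofReal.tendsto _).comp (tendsto_classicalKerReg l hxy)
  · intro A B h
    have hd : DenseRange fun ψ : 𝓢(Eu n, ℂ) => ψ.toLp 2 (volume : Measure (Eu n)) :=
      SchwartzMap.denseRange_toLpCLM ENNReal.ofNat_ne_top
    exact DFunLike.coe_injective (hd.equalizer A.continuous B.continuous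
      (funext fun ψ => h _ ⟨ψ, rfl⟩))
  · rintro _ ⟨ψ, rfl⟩
    refine ⟨SchwartzMap.smulLeftCLM ℂ f ψ, Lp.ext ?_⟩
    filter_upwards [mulOp_apply_of_bounded volume f hf.continuous.aestronglyMeasurable Cf hCf
        (ψ.toLp 2), ψ.coeFn_toLp 2, (SchwartzMap.smulLeftCLM ℂ f ψ).coeFn_toLp 2] with x h1 h2 h3
    rw [h3, h1, h2, SchwartzMap.smulLeftCLM_apply_apply (hf'.hasTemperateGrowth hf), smul_eq_mul]
  · rintro _ ⟨ψ, rfl⟩ N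
    filter_upwards [riesz_classicalReg_ae_eq l N ψ] with x hx
    have h0 : (fun y => (classicalKerReg n l N x y : ℂ) * (ψ.toLp 2 (volume : Measure (Eu n))) y)
        =ᵐ[volume] fun y => (classicalKerReg n l N x y : ℂ) * ψ y := by
      filter_upwards [ψ.coeFn_toLp 2] with y hy
      rw [hy]
    refine ⟨Integrable.congr ?_ h0.symm, by rw [hx, integral_congr_ae h0]⟩
    exact ψ.integrable.bdd_mul (continuous_classicalKerReg l N x).aestronglyMeasurable
      (Eventually.of_forall fun y => norm_classicalKerReg_le l N x y)

theorem extOp_ae_eq (g : L2Half n) : extOp n g =ᵐ[volume] extendZero g :=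
  (memLp_extendZero (Lp.memLp g)).1.coeFn_toLp

theorem ae_leb_of_ae {p : Eu n → Prop} (h : ∀ᵐ x, p x) : ∀ᵐ x : halfSpace n ∂(leb n), p x.1 := by
  have hemb := MeasurableEmbedding.subtype_coe (measurableSet_halfSpace n)
  have h1 : Measure.map (Subtype.val : halfSpace n → Eu n) (leb n) =
      volume.restrict (halfSpace n : Set (Eu n)) := map_comap_subtype_coe (measurableSet_halfSpace n) _
  have h2 : ∀ᵐ x ∂(Measure.map (Subtype.val : halfSpace n → Eu n) (leb n)), p x := by
    rw [h1]
    exact ae_restrict_of_ae h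
  exact hemb.ae_map_iff.1 h2

theorem resOp_ae_eq (u : L2Eu n) : resOp n u =ᵐ[leb n] fun x => u x.1 := by
  have hemb := MeasurableEmbedding.subtype_coe (measurableSet_halfSpace n)
  have hm : MemLp (fun x : halfSpace n => u x.1) 2 (leb n) := by
    have h1 := ((Lp.memLp u).restrict (halfSpace n : Set (Eu n)))
    rw [← map_comap_subtype_coe (measurableSet_halfSpace n), hemb.memLp_map_measure_iff] at h1
    exact h1
  have h : resOp n u = hm.toLp _ := by
    refine ext_inner_left ℂ fun v => ?_
    rw [resOp, ContinuousLinearMap.adjoint_inner_right, inner_eq_integral, inner_eq_integral]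
    have h1 : ∫ x, conj (extOp n v x) * u x = ∫ x, conj (extendZero v x) * u x := by
      refine integral_congr_ae ?_
      filter_upwards [extOp_ae_eq v] with x hx
      rw [hx]
    rw [h1, ← setIntegral_eq_integral_of_forall_compl_eq_zero (s := (halfSpace n : Set (Eu n)))
      (fun x hx => by rw [extendZero_of_notMem _ hx, map_zero, zero_mul]),
      ← integral_leb fun x => conj (extendZero v x) * u x]
    refine integral_congr_ae ?_
    filter_upwards [hm.coeFn_toLp] with x hx
    rw [hx, extendZero_coe]
  rw [h]
  exact hm.coeFn_toLp

/-- The kernel of the conjugated and restricted classical commutator. -/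
theorem hasIntegralKernel_conjComm {f : Eu n → ℂ} (hf : ContDiff ℝ ∞ f) (hf' : HasCompactSupport f)
    (l : Fin (n + 1)) :
    HasIntegralKernel (mMeas n lam) (conjComm n lam f l) fun x y =>
      ((-classicalConst n * (kerWeight n lam x y * ((x.1 - y.1) l / ‖x.1 - y.1‖)) : ℝ) : ℂ) *
        (f y.1 - f x.1) := by
  have hK := hasIntegralKernel_comm_riesz hf hf' l
  have hmw := measurable_kerWeight (n := n) (lam := lam)
  have hmf := hf.continuous.measurable
  set K : Eu n → Eu n → ℂ := fun x y =>
    ((-classicalConst n * ((x - y) l / ‖x - y‖ * (‖x - y‖ ^ (n + 1))⁻¹) : ℝ) : ℂ) *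
        (f y - f x) with hKd
  refine ⟨Measurable.aestronglyMeasurable ?_, fun g => ?_⟩
  · unfold Function.uncurry
    fun_prop
  set v := weightOp n lam g with hv
  set u := comm (riesz n l) (mulOp volume volume f) (extOp n v) with hu
  have h1 : conjComm n lam f l g = invWeightOp n lam (resOp n u) := rfl
  rw [h1]
  have h2 : ∀ᵐ x : halfSpace n ∂(mMeas n lam), Integrable (fun y => K x.1 y * extendZero v y) volume ∧
      u x.1 = ∫ y, K x.1 y * extendZero v y := by
    refine (mMeas_ac_volume n lam).ae_le (ae_leb_of_ae (p := fun x =>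
      Integrable (fun y => K x y * extendZero v y) volume ∧ u x = ∫ y, K x y * extendZero v y) ?_)
    filter_upwards [hK.2 (extOp n v)] with x hx
    have h3 : (fun y => K x y * extOp n v y) =ᵐ[volume] fun y => K x y * extendZero v y := by
      filter_upwards [extOp_ae_eq v] with y hy
      rw [hy]
    exact ⟨hx.1.congr h3, hx.2.trans (integral_congr_ae h3)⟩
  filter_upwards [invWeightOp_apply n lam (resOp n u), (mMeas_ac_volume n lam).ae_le (resOp_ae_eq u),
    h2] with x h3 h4 h5
  have hx := ht_pos x
  have h6 : (fun y : halfSpace n => ((ht x ^ (-lam) : ℝ) : ℂ) * (K x.1 y.1 * extendZero v y.1))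
      =ᵐ[leb n] fun y => ((ht y ^ (2 * lam) : ℝ) : ℂ) *
        (((-classicalConst n * (kerWeight n lam x y * ((x.1 - y.1) l / ‖x.1 - y.1‖)) : ℝ) : ℂ) *
        (f y.1 - f x.1) * g y) := by
    filter_upwards [weightOp_apply n lam g] with y hy
    have hy0 := ht_pos y
    rw [extendZero_coe, hv, hy, hKd, kerWeight, Real.mul_rpow hx.le hy0.le]
    have h7 : ht y ^ lam = ht y ^ (2 * lam) * ht y ^ (-lam) := by
      rw [← Real.rpow_add hy0]
      congr 1
      ring
    rw [h7]
    push_cast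
    ring
  have h8 : Integrable (fun y : halfSpace n => K x.1 y.1 * extendZero v y.1) (leb n) :=
    (integrable_leb_iff fun y => K x.1 y * extendZero v y).2 h5.1.integrableOn
  refine ⟨(integrable_mMeas_iff _).2 ((h8.const_mul _).congr h6), ?_⟩
  rw [h3, h4, h5.2, integral_mMeas, ← integral_congr_ae h6, integral_const_mul,
    integral_leb fun y => K x.1 y * extendZero v y,
    setIntegral_eq_integral_of_forall_compl_eq_zero
      (fun y hy => by rw [extendZero_of_notMem _ hy, mul_zero])]

end ClassicalCommutator

/-! ### Schur multipliers of the commutator and the kernel identity -/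

section Symbols

variable {n : ℕ} {lam : ℝ}

/-- Bounded measurable symbols of Schur multipliers. -/
def BddSymbol (M : halfSpace n → halfSpace n → ℂ) : Prop :=
  (Measurable fun p : halfSpace n × halfSpace n => M p.1 p.2) ∧ ∃ C : ℝ, ∀ x y, ‖M x y‖ ≤ C

theorem BddSymbol.mul {M M' : halfSpace n → halfSpace n → ℂ} (h : BddSymbol M) (h' : BddSymbol M') :
    BddSymbol fun x y => M x y * M' x y := by
  obtain ⟨C, hC⟩ := h.2
  obtain ⟨C', hC'⟩ := h'.2
  refine ⟨h.1.mul h'.1, C * C', fun x y => ?_⟩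
  rw [norm_mul]
  have := (norm_nonneg _).trans (hC x y)
  gcongr
  exacts [hC x y, hC' x y]

theorem bddSymbol_symF (hn : 1 ≤ n) (hlam : 0 < lam) {k l : ℕ}
    (hkl : (k = 2 ∧ l = 0) ∨ (k = 1 ∧ l = 1) ∨ (k = 2 ∧ l = 1)) :
    BddSymbol (symF n lam k l) := by
  obtain ⟨C, hC⟩ := exists_F_le hn hlam
  refine ⟨Complex.measurable_ofReal.comp ((measurable_F k l).comp measurable_H), C, fun x y => ?_⟩
  rw [symF, Complex.norm_real, Real.norm_of_nonneg (F_nonneg k l (H_nonneg x y))]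
  have h := hC _ (H_nonneg x y)
  rcases hkl with ⟨rfl, rfl⟩ | ⟨rfl, rfl⟩ | ⟨rfl, rfl⟩
  exacts [h.1, h.2.1, h.2.2]

theorem bddSymbol_symh (k : Fin (n + 1)) : BddSymbol (symh (n := n) k) := by
  refine ⟨by unfold symh; fun_prop, 1, fun x y => ?_⟩
  rw [symh, Complex.norm_real]
  exact abs_sub_div_norm_le k x y

theorem bddSymbol_syma : BddSymbol (syma (n := n)) := by
  have := measurable_ht (n := n)
  refine ⟨by unfold syma; fun_prop, 1, fun x y => ?_⟩
  rw [syma, Complex.norm_real, Real.norm_of_nonneg (Real.sqrt_nonneg _)]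
  exact sqrt_min_div_max_le x y

theorem bddSymbol_symb : BddSymbol (symb (n := n)) := by
  have := measurable_ht (n := n)
  refine ⟨?_, 1, fun x y => ?_⟩
  · unfold symb
    exact Measurable.ite (measurableSet_lt (by fun_prop) (by fun_prop)) measurable_const
      measurable_const
  · unfold symb
    split_ifs <;> simp

/-- The kernel of `T_l`, with the symbol `h_l` as a separate factor. -/
def conjKer (n : ℕ) (lam : ℝ) (f : Eu n → ℂ) (l : Fin (n + 1)) (x y : halfSpace n) : ℂ :=
  symh l x y * (((-classicalConst n * kerWeight n lam x y : ℝ) : ℂ) * (f y.1 - f x.1))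

theorem hasIntegralKernel_conjKer {f : Eu n → ℂ} (hf : ContDiff ℝ ∞ f) (hf' : HasCompactSupport f)
    (l : Fin (n + 1)) :
    HasIntegralKernel (mMeas n lam) (conjComm n lam f l) (conjKer n lam f l) := by
  convert hasIntegralKernel_conjComm hf hf' l using 3 with x y
  rw [conjKer, symh]
  push_cast
  ring

/-- A bounded symbol times the kernel of the commutator is still dominated by an `L²`-bounded kernel, so
it is the kernel of a bounded operator. -/
theorem exists_hasIntegralKernel_mul_conjKer {f : Eu n → ℂ} (hf : ContDiff ℝ ∞ f)
    (hf' : HasCompactSupport f) (l : Fin (n + 1)) {M : halfSpace n → halfSpace n → ℂ}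
    (hM : BddSymbol M) :
    ∃ S, HasIntegralKernel (mMeas n lam) S fun x y => M x y * conjKer n lam f l x y := by
  obtain ⟨C, hC⟩ := hM.2
  have hc := classicalConst_pos n
  refine (((l2Bounded_commMaj hf hf').mMeas lam).const_mul (c := ENNReal.ofReal
    (C * classicalConst n)) ENNReal.ofReal_ne_top).exists_hasIntegralKernel ?_ fun x y => ?_
  · have h1 := measurable_kerWeight (n := n) (lam := lam)
    have h2 := hf.continuous.measurable
    refine (hM.1.mul ((bddSymbol_symh l).1.mul ?_)).aestronglyMeasurable
    fun_prop
  · have hx := ht_pos x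
    have hy := ht_pos y
    have hC0 := (norm_nonneg _).trans (hC x y)
    have h1 : ‖symh l x y‖ ≤ 1 := by
      rw [symh, Complex.norm_real]
      exact abs_sub_div_norm_le l x y
    have h2 : ‖M x y * conjKer n lam f l x y‖ ≤ (C * classicalConst n) * kerWeight n lam x y *
        ‖f y.1 - f x.1‖ := by
      rw [conjKer, norm_mul, norm_mul, norm_mul, Complex.norm_real, Real.norm_eq_abs, abs_mul, abs_neg,
        abs_of_pos hc, abs_of_nonneg (kerWeight_nonneg x y)]
      have h3 := kerWeight_nonneg (lam := lam) x y
      calc _ ≤ C * (1 * (classicalConst n * kerWeight n lam x y * ‖f y.1 - f x.1‖)) := by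
            gcongr
            exact hC x y
        _ = _ := by ring
    rw [← ofReal_norm]
    refine (ENNReal.ofReal_le_ofReal h2).trans_eq ?_
    rw [ENNReal.ofReal_mul' (norm_nonneg _), ENNReal.ofReal_mul (p := C * classicalConst n)
      (by positivity), kerWeight, ENNReal.ofReal_mul (p := (ht x * ht y) ^ (-lam)) (by positivity),
      commMaj, ofReal_norm, ← enorm_neg (f x.1 - f y.1), neg_sub]
    ring

/-- Applying a further Schur multiplier with bounded symbol. -/
theorem schur_conjKer {f : Eu n → ℂ} (hf : ContDiff ℝ ∞ f) (hf' : HasCompactSupport f)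
    {l : Fin (n + 1)} {M M' : halfSpace n → halfSpace n → ℂ} (hM : BddSymbol M) (hM' : BddSymbol M')
    {T : L2Bessel n lam →L[ℂ] L2Bessel n lam}
    (hT : HasIntegralKernel (mMeas n lam) T fun x y => M' x y * conjKer n lam f l x y) :
    InSchurDomain (mMeas n lam) M T ∧ HasIntegralKernel (mMeas n lam) (schur (mMeas n lam) M T)
      fun x y => M x y * M' x y * conjKer n lam f l x y := by
  obtain ⟨S, hS⟩ := exists_hasIntegralKernel_mul_conjKer (lam := lam) hf hf' l (hM.mul hM')
  simp_rw [mul_assoc] at hS ⊢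
  exact hT.schur hM.2 hS

/-- A Schur multiplier with bounded symbol applies to the classical commutator, and multiplies its
kernel. -/
theorem schur_conjComm {f : Eu n → ℂ} (hf : ContDiff ℝ ∞ f) (hf' : HasCompactSupport f)
    (l : Fin (n + 1)) {M : halfSpace n → halfSpace n → ℂ} (hM : BddSymbol M) :
    InSchurDomain (mMeas n lam) M (conjComm n lam f l) ∧
      HasIntegralKernel (mMeas n lam) (schur (mMeas n lam) M (conjComm n lam f l))
        fun x y => M x y * conjKer n lam f l x y := by
  obtain ⟨S, hS⟩ := exists_hasIntegralKernel_mul_conjKer (lam := lam) hf hf' l hM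
  exact (hasIntegralKernel_conjKer hf hf' l).schur hM.2 hS

theorem sum_symh_mul_symh {x y : halfSpace n} (hxy : y ≠ x) :
    ∑ l : Fin (n + 1), symh l x y * symh l x y = 1 := by
  have hr := norm_sub_pos hxy
  have h1 : ∑ l : Fin (n + 1), ((x.1 - y.1) l / ‖x.1 - y.1‖) * ((x.1 - y.1) l / ‖x.1 - y.1‖) = 1 := by
    have h2 := EuclideanSpace.real_norm_sq_eq (x.1 - y.1)
    simp_rw [div_mul_div_comm, ← Finset.sum_div, ← pow_two]
    rw [← h2, div_self (by positivity)]
  unfold symh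
  exact_mod_cast h1

/-- The kernel identity behind the commutator formula. -/
theorem besselKer_eq (f : Eu n → ℂ) (k : Fin (n + 1)) {x y : halfSpace n} (hxy : y ≠ x) :
    ((-rieszConst n lam * (kerWeight n lam x y * rieszSym n lam k x y) : ℝ) : ℂ) *
        (f y.1 - f x.1) =
      ((rieszConst n lam / classicalConst n : ℝ) : ℂ) *
          (symF n lam 2 0 x y * conjKer n lam f k x y) +
        (((rieszConst n lam / classicalConst n : ℝ) : ℂ) * if k = Fin.last n then 1 else 0) *
          ∑ l : Fin (n + 1), symh l x y * (syma x y * symF n lam 1 1 x y) * conjKer n lam f l x y -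
        (((rieszConst n lam / classicalConst n : ℝ) : ℂ) * if k = Fin.last n then 1 else 0) *
          ∑ l : Fin (n + 1), symh l x y * (symh (Fin.last n) x y * (symb x y * symF n lam 2 1 x y)) *
            conjKer n lam f l x y := by
  have hc := (classicalConst_pos n).ne'
  have hsum : ∀ X : ℂ, ∑ l : Fin (n + 1), symh l x y * X * conjKer n lam f l x y =
      X * (((-classicalConst n * kerWeight n lam x y : ℝ) : ℂ) * (f y.1 - f x.1)) := fun X => by
    calc _ = ∑ l : Fin (n + 1), symh l x y * symh l x y *
          (X * (((-classicalConst n * kerWeight n lam x y : ℝ) : ℂ) * (f y.1 - f x.1))) := by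
          refine Finset.sum_congr rfl fun l _ => ?_
          rw [conjKer]
          ring
      _ = _ := by rw [← Finset.sum_mul, sum_symh_mul_symh hxy, one_mul]
  have hsym : (rieszSym n lam k x y : ℂ) = symh k x y * symF n lam 2 0 x y +
      (if k = Fin.last n then 1 else 0) * (syma x y * symF n lam 1 1 x y -
        symh (Fin.last n) x y * (symb x y * symF n lam 2 1 x y)) := by
    rw [rieszSym, sqrt_mul_F hxy]
    unfold symh symF syma symb
    split_ifs <;> push_cast <;> ring
  have hκ : ((rieszConst n lam / classicalConst n : ℝ) : ℂ) *
      ((-classicalConst n * kerWeight n lam x y : ℝ) : ℂ) =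
        ((-rieszConst n lam * kerWeight n lam x y : ℝ) : ℂ) := by
    rw [← Complex.ofReal_mul]
    congr 1
    field_simp
  rw [hsum, hsum, conjKer, ← mul_assoc (-rieszConst n lam), Complex.ofReal_mul _ (rieszSym n lam k x y),
    hsym, ← hκ]
  ring

end Symbols

end BesselRiesz

end

open BesselRiesz in
/-- The representation of Bessel–Riesz commutators through Schur multipliers applied to classical
Riesz commutators. The first two conjuncts say that `𝓕 ⊗ U_λ` extends to a unitary operator and
that `∂_k Δ_λ^{-1/2}` extends to a bounded operator; the conjuncts on `InSchurDomain` say that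
every Schur multiplier in the formula is applied to an operator in its domain. -/
theorem proposition3p6 (n : ℕ) (hn : 1 ≤ n) (lam : ℝ) (hlam : 0 < lam) :
    IsBesselFourier n lam (besselFourier n lam) ∧
    (∀ k : Fin (n + 1), IsBesselRiesz n lam k (besselRiesz n lam k)) ∧
    ∃ κ : ℝ, ∀ f : Eu n → ℂ, ContDiff ℝ ∞ f → HasCompactSupport f →
      let m := mMeas n lam
      let T := conjComm n lam f
      let e := Fin.last n
      (∀ l : Fin (n + 1),
        InSchurDomain m (symF n lam 2 0) (T l) ∧
        InSchurDomain m (symF n lam 1 1) (T l) ∧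
        InSchurDomain m syma (schur m (symF n lam 1 1) (T l)) ∧
        InSchurDomain m (symh l) (schur m syma (schur m (symF n lam 1 1) (T l))) ∧
        InSchurDomain m (symF n lam 2 1) (T l) ∧
        InSchurDomain m symb (schur m (symF n lam 2 1) (T l)) ∧
        InSchurDomain m (symh e) (schur m symb (schur m (symF n lam 2 1) (T l))) ∧
        InSchurDomain m (symh l)
          (schur m (symh e) (schur m symb (schur m (symF n lam 2 1) (T l))))) ∧
      ∀ k : Fin (n + 1),
        besselComm n lam f k =
          (κ : ℂ) • schur m (symF n lam 2 0) (T k)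
          + ((κ : ℂ) * if k = e then 1 else 0) • ∑ l : Fin (n + 1),
              schur m (symh l) (schur m syma (schur m (symF n lam 1 1) (T l)))
          - ((κ : ℂ) * if k = e then 1 else 0) • ∑ l : Fin (n + 1),
              schur m (symh l) (schur m (symh e) (schur m symb
                (schur m (symF n lam 2 1) (T l)))) := by
  refine ⟨isBesselFourier_besselFourier n hlam, isBesselRiesz_besselRiesz hlam,
    rieszConst n lam / classicalConst n, fun f hf hf' => ?_⟩
  intro m T e
  have hF20 := bddSymbol_symF hn hlam (k := 2) (l := 0) (by simp)
  have hF11 := bddSymbol_symF hn hlam (k := 1) (l := 1) (by simp)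
  have hF21 := bddSymbol_symF hn hlam (k := 2) (l := 1) (by simp)
  have ha := bddSymbol_syma (n := n)
  have hb := bddSymbol_symb (n := n)
  have hh := bddSymbol_symh (n := n)
  have h1 := fun l => schur_conjComm (lam := lam) hf hf' l hF20
  have h2 := fun l => schur_conjComm (lam := lam) hf hf' l hF11
  have h3 := fun l => schur_conjKer hf hf' ha hF11 (h2 l).2
  have h4 := fun l => schur_conjKer hf hf' (hh l) (ha.mul hF11) (h3 l).2
  have h5 := fun l => schur_conjComm (lam := lam) hf hf' l hF21
  have h6 := fun l => schur_conjKer hf hf' hb hF21 (h5 l).2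
  have h7 := fun l => schur_conjKer hf hf' (hh e) (hb.mul hF21) (h6 l).2
  have h8 := fun l => schur_conjKer hf hf' (hh l) ((hh e).mul (hb.mul hF21)) (h7 l).2
  refine ⟨fun l => ⟨(h1 l).1, (h2 l).1, (h3 l).1, (h4 l).1, (h5 l).1, (h6 l).1, (h7 l).1, (h8 l).1⟩,
    fun k => ?_⟩
  refine (hasIntegralKernel_besselComm hn hlam hf hf' k).ext
    ((((h1 k).2.smul _).add ((HasIntegralKernel.sum Finset.univ fun l _ => (h4 l).2).smul _)).sub
      ((HasIntegralKernel.sum Finset.univ fun l _ => (h8 l).2).smul _))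
    (Filter.Eventually.of_forall fun x => ?_)
  filter_upwards [ae_mMeas_ne x] with y hxy using besselKer_eq f k hxy
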